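/- Let $G$ be a weighted undirected graph with $n \ge 2$ vertices and $m$ edges (real weights; parallel edges and loops allowed) and let $T$ be a spanning tree of $G$. A cut is a partition of the vertices into two non-empty sides, its value is the total weight of the edges with endpoints on different sides, and it $2$-respects $T$ if it cuts at most two (hence one or two) edges of $T$. Root $T$ at some vertex and choose for every vertex with children a heavy child, that is, a child with a largest subtree; this decomposes $T$ into heavy paths. A heavy-light order $e_1, \dots, e_{n-1}$ of the edges of $T$ lists the heavy paths one after another, in any order, each from top to bottom and preceded by the edge of $T$ (if any) that leads down to its top vertex. Consider the following algorithm. It uses a data structure that stores a weight for every edge of $T$ and supports $\mathtt{PathAdd}(u,v,x)$ (add $x$ to all edges on the $uv$-path in $T$), $\mathtt{NonPathAdd}(u,v,x)$ (add $x$ to all edges of $T$ not on the $uv$-path) and $\mathtt{QueryMinimum}()$ (return the minimum stored weight). 1. Arrange the edges of $T$ in a heavy-light order $e_1, \dots, e_{n-1}$. 2. For each edge $uv$ of $G$ not in $T$, mark the indices $i$ for which exactly one of $e_i, e_{i+1}$ is on the $uv$-path in $T$, and indicate whether $e_1$ is on this path. 3. Initialize the data structure with the weights of the edges of $T$. 4.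 Iterate $i$ from $1$ to $n-1$. Using the marks, maintain the invariant that the weight of each non-tree edge $uv$ has been added to all edges of $T$ off the $uv$-path if $e_i$ is on the $uv$-path, and to all edges on the $uv$-path if $e_i$ is off it. For each $i$, after this update, add $\infty$ to $e_i$, execute $\mathtt{QueryMinimum}()$, and subtract $\infty$ from $e_i$; the candidate value for $i$ is the result of the query plus the weight of $e_i$. 5. Update the data structure as if the current edge were off the $uv$-paths of all non-tree edges $uv$, and execute $\mathtt{QueryMinimum}()$. Return the minimum of the result and of all candidates of step 4. Then: (a) for every such $G$, $T$ and every heavy-light order of the edges of $T$, the algorithm returns the minimum value of a cut of $G$ that $2$-respects $T$; (b) the algorithm runs in $O(m \log^2 n)$ time. That is, there are a program for a unit-cost random access machine (whose words are bounded by a fixed power of $n+m$, and which can only add, subtract and compare real numbers) and a constant $C$ such that, for all $n \ge 2$, $m$, $G$ and $T$ as above, given as a list of weighted edges with the members of $T$ flagged, the program carries out the algorithm for some heavy-light order within $C\, m \log_2^2 n$ steps: it outputs the order, all the calls to the data structure (non-tree edges being treated by increasing index in each iteration) with the results of all queries, and finally the returned minimum value. -/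

import Mathlib

namespace TwoRespect

/-! ## Weighted graphs, spanning trees and cuts -/

/-- A weighted undirected graph with vertices `0, …, n - 1` and `m` edges, presented as a list of
edges. Parallel edges and loops are allowed. The order of the two endpoints is irrelevant. -/
structure WGraph (n m : ℕ) where
  /-- one endpoint of an edge -/
  src : Fin m → Fin n
  /-- the other endpoint of an edge -/
  dst : Fin m → Fin n
  /-- the weight of an edge -/
  weight : Fin m → ℝ

variable {n m : ℕ}

/-- The unordered pair of endpoints of an edge. -/
def WGraph.ends (G : WGraph n m) (k : Fin m) : Sym2 (Fin n) := s(G.src k, G.dst k)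

/-- The graph on the vertices of `G` whose edges are the members of `T`. -/
def WGraph.treeGraph (G : WGraph n m) (T : Finset (Fin m)) : SimpleGraph (Fin n) :=
  SimpleGraph.fromEdgeSet {z | ∃ k ∈ T, G.ends k = z}

/-- The set `T` of edges of `G` is the edge set of a spanning tree of `G`. The first two conditions
say that `T` has no loops and no parallel edges (which `treeGraph` alone cannot see). -/
def WGraph.IsSpanningTree (G : WGraph n m) (T : Finset (Fin m)) : Prop :=
  (∀ k ∈ T, G.src k ≠ G.dst k) ∧ Set.InjOn G.ends (T : Set (Fin m)) ∧ (G.treeGraph T).IsTree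

/-- The edge `k` crosses the cut with sides `S` and `Sᶜ`. -/
def WGraph.Crosses (G : WGraph n m) (S : Finset (Fin n)) (k : Fin m) : Prop :=
  ¬ (G.src k ∈ S ↔ G.dst k ∈ S)

open Classical in
/-- The value of a cut: the total weight of the edges that cross it. -/
noncomputable def WGraph.cutValue (G : WGraph n m) (S : Finset (Fin n)) : ℝ :=
  ∑ k with G.Crosses S k, G.weight k

open Classical in
/-- The cut with sides `S`, `Sᶜ` `j`-respects `T`: it cuts at most `j` edges of `T`. -/
def WGraph.Respects (G : WGraph n m) (T : Finset (Fin m)) (j : ℕ) (S : Finset (Fin n)) : Prop :=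
  (T.filter (G.Crosses S)).card ≤ j

/-- The values of all cuts of `G` (both sides are non-empty) that 2-respect `T`. -/
def WGraph.twoRespectingValues (G : WGraph n m) (T : Finset (Fin m)) : Set ℝ :=
  {x | ∃ S : Finset (Fin n), S.Nonempty ∧ S ≠ Finset.univ ∧ G.Respects T 2 S ∧ G.cutValue S = x}

/-- The tree edge `e` is on the path of the tree `T` between `u` and `v`. -/
def WGraph.OnPath (G : WGraph n m) (T : Finset (Fin m)) (e : Fin m) (u v : Fin n) : Prop :=
  ∃ p : (G.treeGraph T).Walk u v, p.IsPath ∧ G.ends e ∈ p.edges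

/-! ## The heavy-light order of the tree edges -/

/-- In the tree `T` rooted at `r`, the vertex `u` is the parent of `v`. -/
def WGraph.IsParent (G : WGraph n m) (T : Finset (Fin m)) (r u v : Fin n) : Prop :=
  (G.treeGraph T).Adj u v ∧ (G.treeGraph T).dist r v = (G.treeGraph T).dist r u + 1

/-- The number of vertices in the subtree of `u` in the tree `T` rooted at `r`. -/
noncomputable def WGraph.subtreeSize (G : WGraph n m) (T : Finset (Fin m)) (r u : Fin n) : ℕ :=
  (Finset.univ.filter fun x =>
    (G.treeGraph T).dist r x = (G.treeGraph T).dist r u + (G.treeGraph T).dist u x).card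

/-- The list `es` is a heavy-light order of the edges of `T`. For some root `r`, every vertex `u`
that has children gets as heavy child `h u` a child with a largest subtree, and the tree falls into
heavy paths `u, h u, h (h u), …`. The edges above the vertices of a heavy path (the light
edge that leads down to its top vertex, unless that is the root, followed by the edges of the path)
are consecutive in `es`, from top to bottom; these blocks are concatenated in any order. -/
def WGraph.IsHeavyLightOrder (G : WGraph n m) (T : Finset (Fin m)) (es : List (Fin m)) : Prop :=
  es.Nodup ∧ (∀ k, k ∈ es ↔ k ∈ T) ∧
  ∃ (r : Fin n) (h : Fin n → Fin n),
    (∀ u v, G.IsParent T r u v →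
      G.IsParent T r u (h u) ∧ G.subtreeSize T r v ≤ G.subtreeSize T r (h u)) ∧
    (∀ p u, G.IsParent T r p u → G.IsParent T r u (h u) →
      ∀ f ∈ T, ∀ g ∈ T, G.ends f = s(p, u) → G.ends g = s(u, h u) → [f, g] <:+: es)

/-! ## The path-add / global-minimum data structure (its specification) -/

/-- Weights `a + z * ∞`, with `z` an integer and `a` real, in the obvious (lexicographic) order:
adding `∞` and subtracting it again restores a weight. -/
abbrev Ext : Type := ℤ ×ₗ ℝ

/-- The finite weight `a`. -/
noncomputable def Ext.fin (a : ℝ) : Ext := toLex (0, a)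

/-- The weight `∞`. -/
noncomputable def Ext.inf : Ext := toLex (1, 0)

/-- The calls to the data structure. -/
inductive Cmd (n : ℕ) : Type
  /-- add `x` to all tree edges on the path from `u` to `v` -/
  | pathAdd (u v : Fin n) (x : Ext) : Cmd n
  /-- add `x` to all tree edges that are not on the path from `u` to `v` -/
  | nonPathAdd (u v : Fin n) (x : Ext) : Cmd n
  /-- ask for the minimum weight of a tree edge -/
  | queryMin : Cmd n

open Classical in
/-- The effect of a call on the stored weights `D` of the tree edges. -/
noncomputable def WGraph.update (G : WGraph n m) (T : Finset (Fin m)) (D : Fin m → Ext) :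
    Cmd n → (Fin m → Ext)
  | .pathAdd u v x => fun e => if G.OnPath T e u v then D e + x else D e
  | .nonPathAdd u v x => fun e => if G.OnPath T e u v then D e else D e + x
  | .queryMin => D

open Classical in
/-- The minimum stored weight of a tree edge (`T` is never empty where this is used). -/
noncomputable def minWeight (T : Finset (Fin m)) (D : Fin m → Ext) : Ext :=
  if hT : T.Nonempty then T.inf' hT D else 0

/-- The results of the successive queries in a sequence of calls, from stored weights `D` on. -/
noncomputable def WGraph.answers (G : WGraph n m) (T : Finset (Fin m)) :
    (Fin m → Ext) → List (Cmd n) → List Ext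
  | _, [] => []
  | D, .queryMin :: cs => minWeight T D :: G.answers T D cs
  | D, c :: cs => G.answers T (G.update T D c) cs

/-! ## The algorithm -/

/-- The non-tree edges. -/
def nonTree (T : Finset (Fin m)) : List (Fin m) := (List.finRange m).filter (· ∉ T)

/-- Add the weight of the non-tree edge `k = uv` off the `uv`-path (when the current tree edge
is on that path). -/
noncomputable def WGraph.addOff (G : WGraph n m) (k : Fin m) : Cmd n :=
  .nonPathAdd (G.src k) (G.dst k) (Ext.fin (G.weight k))

/-- Add the weight of the non-tree edge `k = uv` on the `uv`-path (when the current tree edge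
is off that path). -/
noncomputable def WGraph.addOn (G : WGraph n m) (k : Fin m) : Cmd n :=
  .pathAdd (G.src k) (G.dst k) (Ext.fin (G.weight k))

/-- Undo `addOff`. -/
noncomputable def WGraph.undoOff (G : WGraph n m) (k : Fin m) : Cmd n :=
  .nonPathAdd (G.src k) (G.dst k) (Ext.fin (- G.weight k))

/-- Undo `addOn`. -/
noncomputable def WGraph.undoOn (G : WGraph n m) (k : Fin m) : Cmd n :=
  .pathAdd (G.src k) (G.dst k) (Ext.fin (- G.weight k))

/-- The current tree edge `e` is on the path of the non-tree edge `k`. -/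
def WGraph.On (G : WGraph n m) (T : Finset (Fin m)) (e k : Fin m) : Prop :=
  G.OnPath T e (G.src k) (G.dst k)

open Classical in
/-- Establish the invariants for the first tree edge `e`. -/
noncomputable def WGraph.start (G : WGraph n m) (T : Finset (Fin m)) (e : Fin m) : List (Cmd n) :=
  (nonTree T).map fun k => if G.On T e k then G.addOff k else G.addOn k

open Classical in
/-- Restore the invariants when the current tree edge changes from `e` to `e'`: only the
non-tree edges for which one of `e` and `e'` is on the path and the other is not (the marked
transitions) are touched. -/
noncomputable def WGraph.advance (G : WGraph n m) (T : Finset (Fin m)) (e e' : Fin m) :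
    List (Cmd n) :=
  (nonTree T).flatMap fun k =>
    if G.On T e k ∧ ¬ G.On T e' k then [G.undoOff k, G.addOn k]
    else if ¬ G.On T e k ∧ G.On T e' k then [G.undoOn k, G.addOff k]
    else []

/-- Add `∞` to the tree edge `e`, query, and subtract `∞` from `e`. -/
noncomputable def WGraph.probe (G : WGraph n m) (e : Fin m) : List (Cmd n) :=
  [.pathAdd (G.src e) (G.dst e) Ext.inf, .queryMin, .pathAdd (G.src e) (G.dst e) (- Ext.inf)]

open Classical in
/-- The last step: the current tree edge, which was `e`, is now considered to be off the paths of
all non-tree edges, and there is one more query. -/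
noncomputable def WGraph.finish (G : WGraph n m) (T : Finset (Fin m)) (e : Fin m) : List (Cmd n) :=
  ((nonTree T).flatMap fun k => if G.On T e k then [G.undoOff k, G.addOn k] else []) ++ [.queryMin]

/-- The calls from the query for the tree edge `e` on; the tree edges `es` are still to come. -/
noncomputable def WGraph.iterate (G : WGraph n m) (T : Finset (Fin m)) :
    Fin m → List (Fin m) → List (Cmd n)
  | e, [] => G.probe e ++ G.finish T e
  | e, e' :: es => G.probe e ++ G.advance T e e' ++ G.iterate T e' es

/-- All calls to the data structure that the algorithm makes, for the order `es` of the tree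
edges. -/
noncomputable def WGraph.calls (G : WGraph n m) (T : Finset (Fin m)) :
    List (Fin m) → List (Cmd n)
  | [] => []
  | e :: es => G.start T e ++ G.iterate T e es

/-- Initially every edge has its own weight. -/
noncomputable def WGraph.initialWeights (G : WGraph n m) (e : Fin m) : Ext := Ext.fin (G.weight e)

/-- The candidate values: the result of the query for the `i`-th tree edge plus the
weight of this edge, for all `i`, and the result of the last query. -/
noncomputable def WGraph.candidates (G : WGraph n m) (T : Finset (Fin m)) (es : List (Fin m)) :
    List Ext :=
  List.zipWith (· + ·) (G.answers T G.initialWeights (G.calls T es))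
    (es.map (fun e => Ext.fin (G.weight e)) ++ [0])

/-- The algorithm, run with the order `es` of the tree edges, returns the value `x`, the minimum of
the candidates. -/
def WGraph.Returns (G : WGraph n m) (T : Finset (Fin m)) (es : List (Fin m)) (x : ℝ) : Prop :=
  (G.candidates T es).minimum = ((Ext.fin x : Ext) : WithTop Ext)

/-- A symbol on the output tape of the machine below. -/
abbrev Symbol : Type := ℕ ⊕ ℝ

/-- How a weight is written on the output tape. -/
noncomputable def encode (x : Ext) : List Symbol :=
  [.inr (((ofLex x).1 : ℤ) : ℝ), .inr (ofLex x).2]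

/-- The record of a sequence of calls to the data structure, together with the results of the
queries. -/
noncomputable def WGraph.record (G : WGraph n m) (T : Finset (Fin m)) :
    (Fin m → Ext) → List (Cmd n) → List Symbol
  | _, [] => []
  | D, .pathAdd u v x :: cs =>
      [.inl 0, .inl u, .inl v] ++ encode x ++ G.record T (G.update T D (.pathAdd u v x)) cs
  | D, .nonPathAdd u v x :: cs =>
      [.inl 1, .inl u, .inl v] ++ encode x ++ G.record T (G.update T D (.nonPathAdd u v x)) cs
  | D, .queryMin :: cs => [.inl 2] ++ encode (minWeight T D) ++ G.record T D cs

/-- The transcript of the run of the algorithm with the order `es` and the return value `x`: the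
tree edges in the order `es`, all calls to the data structure in order with the results of the
queries, and the returned value. -/
noncomputable def WGraph.transcript (G : WGraph n m) (T : Finset (Fin m)) (es : List (Fin m))
    (x : ℝ) : List Symbol :=
  es.map (fun e => .inl e) ++ G.record T G.initialWeights (G.calls T es) ++ [.inr x]

/-! ## The machine: a unit-cost random access machine

It computes with words (natural numbers bounded by a number `B`; a computation with an overflow
gets stuck) and with real numbers, which can only be added, subtracted and compared. Programs are
structured; a program uses finitely many variables and arrays, which are numbered. -/

/-- The contents of the memory and of the write-only output tape. -/
structure State : Type where
  /-- word variables -/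
  wvar : ℕ → ℕ
  /-- word arrays -/
  warr : ℕ → ℕ → ℕ
  /-- real variables -/
  rvar : ℕ → ℝ
  /-- real arrays -/
  rarr : ℕ → ℕ → ℝ
  /-- the output so far -/
  out : List Symbol

/-- Word expressions: literals, variables, array access, arithmetic operations. -/
inductive WExpr : Type
  | lit (c : ℕ) : WExpr
  | var (i : ℕ) : WExpr
  | get (a : ℕ) (i : WExpr) : WExpr
  | add (x y : WExpr) : WExpr
  | sub (x y : WExpr) : WExpr
  | mul (x y : WExpr) : WExpr
  | div (x y : WExpr) : WExpr

/-- Real expressions: the constants 0 and 1, variables, array access, addition, subtraction. -/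
inductive RExpr : Type
  | zero : RExpr
  | one : RExpr
  | var (i : ℕ) : RExpr
  | get (a : ℕ) (i : WExpr) : RExpr
  | add (x y : RExpr) : RExpr
  | sub (x y : RExpr) : RExpr

/-- Conditions: comparisons and Boolean combinations. -/
inductive Cond : Type
  | wlt (x y : WExpr) : Cond
  | weq (x y : WExpr) : Cond
  | rlt (x y : RExpr) : Cond
  | not (b : Cond) : Cond
  | and (b c : Cond) : Cond

/-- The value of a word expression (truncated subtraction, division rounded down). -/
def WExpr.eval (s : State) : WExpr → ℕ
  | lit c => c
  | var i => s.wvar i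
  | get a i => s.warr a (i.eval s)
  | add x y => x.eval s + y.eval s
  | sub x y => x.eval s - y.eval s
  | mul x y => x.eval s * y.eval s
  | div x y => x.eval s / y.eval s

/-- No value that occurs in the evaluation of a word expression exceeds the bound `B`. -/
def WExpr.Fits (B : ℕ) (s : State) : WExpr → Prop
  | lit c => c ≤ B
  | var i => s.wvar i ≤ B
  | get a i => i.Fits B s ∧ s.warr a (i.eval s) ≤ B
  | add x y => x.Fits B s ∧ y.Fits B s ∧ x.eval s + y.eval s ≤ B
  | sub x y => x.Fits B s ∧ y.Fits B s
  | mul x y => x.Fits B s ∧ y.Fits B s ∧ x.eval s * y.eval s ≤ B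
  | div x y => x.Fits B s ∧ y.Fits B s

/-- The cost of a word expression: one unit for every literal, access and operation. -/
def WExpr.cost : WExpr → ℕ
  | lit _ => 1
  | var _ => 1
  | get _ i => i.cost + 1
  | add x y => x.cost + y.cost + 1
  | sub x y => x.cost + y.cost + 1
  | mul x y => x.cost + y.cost + 1
  | div x y => x.cost + y.cost + 1

/-- The value of a real expression. -/
noncomputable def RExpr.eval (s : State) : RExpr → ℝ
  | zero => 0
  | one => 1
  | var i => s.rvar i
  | get a i => s.rarr a (i.eval s)
  | add x y => x.eval s + y.eval s
  | sub x y => x.eval s - y.eval s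

/-- No word that occurs in the evaluation of a real expression exceeds the bound `B`. -/
def RExpr.Fits (B : ℕ) (s : State) : RExpr → Prop
  | zero => True
  | one => True
  | var _ => True
  | get _ i => i.Fits B s
  | add x y => x.Fits B s ∧ y.Fits B s
  | sub x y => x.Fits B s ∧ y.Fits B s

/-- The cost of a real expression. -/
def RExpr.cost : RExpr → ℕ
  | zero => 1
  | one => 1
  | var _ => 1
  | get _ i => i.cost + 1
  | add x y => x.cost + y.cost + 1
  | sub x y => x.cost + y.cost + 1

/-- The truth of a condition. -/
def Cond.Holds (s : State) : Cond → Prop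
  | wlt x y => x.eval s < y.eval s
  | weq x y => x.eval s = y.eval s
  | rlt x y => x.eval s < y.eval s
  | not b => ¬ b.Holds s
  | and b c => b.Holds s ∧ c.Holds s

/-- No word that occurs in the evaluation of a condition exceeds the bound `B`. -/
def Cond.Fits (B : ℕ) (s : State) : Cond → Prop
  | wlt x y => x.Fits B s ∧ y.Fits B s
  | weq x y => x.Fits B s ∧ y.Fits B s
  | rlt x y => x.Fits B s ∧ y.Fits B s
  | not b => b.Fits B s
  | and b c => b.Fits B s ∧ c.Fits B s

/-- The cost of a condition. -/
def Cond.cost : Cond → ℕ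
  | wlt x y => x.cost + y.cost + 1
  | weq x y => x.cost + y.cost + 1
  | rlt x y => x.cost + y.cost + 1
  | not b => b.cost + 1
  | and b c => b.cost + c.cost + 1

/-- Programs. -/
inductive Prog : Type
  | skip : Prog
  /-- assign to a word variable -/
  | setW (i : ℕ) (x : WExpr) : Prog
  /-- assign to a cell of the word array `a` -/
  | storeW (a : ℕ) (i x : WExpr) : Prog
  /-- assign to a real variable -/
  | setR (i : ℕ) (x : RExpr) : Prog
  /-- assign to a cell of the real array `a` -/
  | storeR (a : ℕ) (i : WExpr) (x : RExpr) : Prog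
  /-- append a word to the output -/
  | emitW (x : WExpr) : Prog
  /-- append a real number to the output -/
  | emitR (x : RExpr) : Prog
  | seq (p q : Prog) : Prog
  | ite (b : Cond) (p q : Prog) : Prog
  | loop (b : Cond) (p : Prog) : Prog

/-- `Exec B p s t s'`: started in the state `s`, the program `p` halts in the state `s'` after
exactly `t` steps, and no word ever exceeds `B`. -/
inductive Exec (B : ℕ) : Prog → State → ℕ → State → Prop
  | skip (s : State) : Exec B .skip s 1 s
  | setW (s : State) (i : ℕ) (x : WExpr) : x.Fits B s →
      Exec B (.setW i x) s (x.cost + 1)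
        { s with wvar := Function.update s.wvar i (x.eval s) }
  | storeW (s : State) (a : ℕ) (i x : WExpr) : i.Fits B s → x.Fits B s →
      Exec B (.storeW a i x) s (i.cost + x.cost + 1)
        { s with warr :=
            Function.update s.warr a (Function.update (s.warr a) (i.eval s) (x.eval s)) }
  | setR (s : State) (i : ℕ) (x : RExpr) : x.Fits B s →
      Exec B (.setR i x) s (x.cost + 1)
        { s with rvar := Function.update s.rvar i (x.eval s) }
  | storeR (s : State) (a : ℕ) (i : WExpr) (x : RExpr) : i.Fits B s → x.Fits B s →
      Exec B (.storeR a i x) s (i.cost + x.cost + 1)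
        { s with rarr :=
            Function.update s.rarr a (Function.update (s.rarr a) (i.eval s) (x.eval s)) }
  | emitW (s : State) (x : WExpr) : x.Fits B s →
      Exec B (.emitW x) s (x.cost + 1) { s with out := s.out ++ [.inl (x.eval s)] }
  | emitR (s : State) (x : RExpr) : x.Fits B s →
      Exec B (.emitR x) s (x.cost + 1) { s with out := s.out ++ [.inr (x.eval s)] }
  | seq {p q : Prog} {s s₁ s₂ : State} {t₁ t₂ : ℕ} :
      Exec B p s t₁ s₁ → Exec B q s₁ t₂ s₂ → Exec B (.seq p q) s (t₁ + t₂) s₂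
  | iteTrue {b : Cond} {p q : Prog} {s s₁ : State} {t : ℕ} :
      b.Fits B s → b.Holds s → Exec B p s t s₁ → Exec B (.ite b p q) s (b.cost + t + 1) s₁
  | iteFalse {b : Cond} {p q : Prog} {s s₁ : State} {t : ℕ} :
      b.Fits B s → ¬ b.Holds s → Exec B q s t s₁ → Exec B (.ite b p q) s (b.cost + t + 1) s₁
  | loopTrue {b : Cond} {p : Prog} {s s₁ s₂ : State} {t₁ t₂ : ℕ} :
      b.Fits B s → b.Holds s → Exec B p s t₁ s₁ → Exec B (.loop b p) s₁ t₂ s₂ →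
      Exec B (.loop b p) s (b.cost + t₁ + t₂ + 1) s₂
  | loopFalse {b : Cond} {p : Prog} {s : State} :
      b.Fits B s → ¬ b.Holds s → Exec B (.loop b p) s (b.cost + 1) s

/-- The initial state: the word variables 0 and 1 hold `n` and `m`, the word arrays 0, 1, 2 hold the
two endpoints of every edge and whether it belongs to `T`, the real array 0 holds the edge weights,
and everything else is zero or empty. -/
def WGraph.input (G : WGraph n m) (T : Finset (Fin m)) : State where
  wvar i := if i = 0 then n else if i = 1 then m else 0
  warr a k := if hk : k < m then
      (if a = 0 then (G.src ⟨k, hk⟩ : ℕ) else if a = 1 then (G.dst ⟨k, hk⟩ : ℕ)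
        else if a = 2 then (if (⟨k, hk⟩ : Fin m) ∈ T then 1 else 0) else 0)
    else 0
  rvar _ := 0
  rarr a k := if hk : k < m then (if a = 0 then G.weight ⟨k, hk⟩ else 0) else 0
  out := []

end TwoRespect

open TwoRespect

/-! Correctness rests on linear algebra modulo 2. Going from one end of an edge `k` to the other
along the tree, one changes sides exactly at the tree edges that are cut, so `k` crosses a cut if
and only if an odd number of cut tree edges lie on its tree path (`IsRooting.ind_crosses`). Hence
the value of a cut depends only on the set `F` of tree edges that it cuts, and every `F` occurs
(`IsRooting.exists_cut`). Non-empty proper sides correspond to non-empty `F`, so the 2-respecting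
values are the numbers `treeCutValue` for `F` with one or two elements (`IsRooting.mem_values_iff`).
For `F = {e, e'}` a non-tree edge counts if exactly one of `e`, `e'` is on its path. This is what
the invariant of the algorithm adds to the stored weight of `e'` while `e` is current
(`IsRooting.treeCutValue_pair`); the infinite weight excludes `e' = e`. Treating the current edge as
off all paths gives the sets with one element. None of this depends on the order of the tree edges:
the heavy-light order matters for the running time only.

For the running time, identify a tree edge with its lower vertex. The order is a preorder `pos` in
which the heavy child comes first, so the vertices of a heavy path have consecutive numbers. The way
from a vertex to the root meets O(log n) heavy paths, because the subtree size at least doubles when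
a light edge is climbed, and on each of them the ancestors form an interval of numbers
(`HLD.switch`). Therefore a non-tree edge changes between on and off O(log n) times, and there are
O(m log n) calls in total. The program stores a superset of these places as marks, possibly with
repetitions, and tests each mark before it acts.

It remains to execute a call in O(log n) steps. The weight of the edge above `v` is represented as a
base value, plus the sum of values `y` over the subtree of `v`, plus a global offset. Then `PathAdd`
consists of three point updates of `y`, at the two ends and at their lowest common ancestor, and
`NonPathAdd` is a change of the offset together with a `PathAdd` of the negative number
(`run_apply`). Adding infinity to an edge is done by deactivating its lower vertex
(`run_probeEdge`).

For point updates with a global minimum, the vertices are numbered by a second preorder `tin` in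
which the heavy child comes last. Then the subtrees of all vertices of a heavy path end at the same
number, and their sums are suffix sums. A binary-tree-like hierarchy of segments of this numbering
is built: a segment is split at the item (a path vertex or a light subtree) that contains its
middle, and light subtrees are split in turn along their own heavy paths. Every segment keeps its
sum and two minima, which can be computed from its parts (`SegOK.pull`). The depth is O(log n),
because `segWeight` at least doubles from a node to its parent (`HLD.segWeight_half`,
`HLD.segWeight_light`); there are O(n) nodes because of the potential `nodeWeight`.

The programs are verified with the total-correctness triples `Run`, which carry a time bound, a
frame (`Agree`) and a bound `K` for all words in memory. Overflow inside expressions is excluded by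
the syntactic check `Prog.ok`, so that only stored values have to be estimated. -/

namespace TwoRespect

/-! ## Program logic for the random access machine -/

/-- Assignment to a word variable. -/
def State.setW (s : State) (i v : ℕ) : State := { s with wvar := Function.update s.wvar i v }

/-- Assignment to a cell of a word array. -/
def State.storeW (s : State) (a i v : ℕ) : State :=
  { s with warr := Function.update s.warr a (Function.update (s.warr a) i v) }

/-- Assignment to a real variable. -/
noncomputable def State.setR (s : State) (i : ℕ) (v : ℝ) : State :=
  { s with rvar := Function.update s.rvar i v }

/-- Assignment to a cell of a real array. -/
noncomputable def State.storeR (s : State) (a i : ℕ) (v : ℝ) : State :=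
  { s with rarr := Function.update s.rarr a (Function.update (s.rarr a) i v) }

/-- Output of a symbol. -/
def State.emit (s : State) (x : Symbol) : State := { s with out := s.out ++ [x] }

/-! ### Reading the memory after an assignment. -/

section proj
variable (s : State) (a i j v : ℕ) (x : ℝ) (y : Symbol)

@[simp] theorem State.setW_wvar :
    (s.setW i v).wvar j = if j = i then v else s.wvar j := Function.update_apply ..
@[simp] theorem State.setW_warr : (s.setW i v).warr = s.warr := rfl
@[simp] theorem State.setW_rvar : (s.setW i v).rvar = s.rvar := rfl
@[simp] theorem State.setW_rarr : (s.setW i v).rarr = s.rarr := rfl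
@[simp] theorem State.setW_out : (s.setW i v).out = s.out := rfl
@[simp] theorem State.storeW_wvar : (s.storeW a i v).wvar = s.wvar := rfl
@[simp] theorem State.storeW_warr :
    (s.storeW a i v).warr j = if j = a then Function.update (s.warr a) i v else s.warr j :=
  Function.update_apply ..
@[simp] theorem State.storeW_rvar : (s.storeW a i v).rvar = s.rvar := rfl
@[simp] theorem State.storeW_rarr : (s.storeW a i v).rarr = s.rarr := rfl
@[simp] theorem State.storeW_out : (s.storeW a i v).out = s.out := rfl
@[simp] theorem State.setR_wvar : (s.setR i x).wvar = s.wvar := rfl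
@[simp] theorem State.setR_warr : (s.setR i x).warr = s.warr := rfl
@[simp] theorem State.setR_rvar :
    (s.setR i x).rvar j = if j = i then x else s.rvar j := Function.update_apply ..
@[simp] theorem State.setR_rarr : (s.setR i x).rarr = s.rarr := rfl
@[simp] theorem State.setR_out : (s.setR i x).out = s.out := rfl
@[simp] theorem State.storeR_wvar : (s.storeR a i x).wvar = s.wvar := rfl
@[simp] theorem State.storeR_warr : (s.storeR a i x).warr = s.warr := rfl
@[simp] theorem State.storeR_rvar : (s.storeR a i x).rvar = s.rvar := rfl
@[simp] theorem State.storeR_rarr :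
    (s.storeR a i x).rarr j = if j = a then Function.update (s.rarr a) i x else s.rarr j :=
  Function.update_apply ..
@[simp] theorem State.storeR_out : (s.storeR a i x).out = s.out := rfl
@[simp] theorem State.emit_wvar : (s.emit y).wvar = s.wvar := rfl
@[simp] theorem State.emit_warr : (s.emit y).warr = s.warr := rfl
@[simp] theorem State.emit_rvar : (s.emit y).rvar = s.rvar := rfl
@[simp] theorem State.emit_rarr : (s.emit y).rarr = s.rarr := rfl
@[simp] theorem State.emit_out : (s.emit y).out = s.out ++ [y] := rfl

end proj

/-- All words in the memory are at most `K`. -/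
def State.Bd (s : State) (K : ℕ) : Prop := (∀ i, s.wvar i ≤ K) ∧ ∀ a i, s.warr a i ≤ K

/-- Expressions without multiplication and with small literals. -/
def WExpr.plain : WExpr → Bool
  | lit c => decide (c ≤ 64)
  | var _ => true
  | get _ i => i.plain
  | add x y => x.plain && y.plain
  | sub x y => x.plain && y.plain
  | mul _ _ => false
  | div x y => x.plain && y.plain

/-- Without products, values grow at most additively: every literal or access contributes at most
`K`, and truncated subtraction and division do not increase a value. The same estimate holds for all
subexpressions, so none of them overflows. -/
theorem WExpr.plain_bound {K : ℕ} (hK : 64 ≤ K) {s : State} (hs : s.Bd K) :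
    ∀ x : WExpr, x.plain → x.eval s ≤ x.cost * K ∧ ∀ B, x.cost * K ≤ B → x.Fits B s := by
  intro x
  induction x with
  | lit c =>
    intro h
    have h : c ≤ 64 := by simpa [plain] using h
    simp only [eval, cost, Fits]
    exact ⟨by lia, fun B hB => by lia⟩
  | var i =>
    intro h
    have := hs.1 i
    simp only [eval, cost, Fits]
    exact ⟨by lia, fun B hB => by lia⟩
  | get a i ih =>
    intro h
    obtain ⟨h1, h2⟩ := ih h
    have := hs.2 a (i.eval s)
    simp only [eval, cost, Fits, add_mul, one_mul]
    exact ⟨by lia, fun B hB => ⟨h2 B (by lia), by lia⟩⟩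
  | add x y ihx ihy =>
    intro h
    simp only [plain, Bool.and_eq_true] at h
    obtain ⟨h1, h2⟩ := ihx h.1
    obtain ⟨h3, h4⟩ := ihy h.2
    simp only [eval, cost, Fits, add_mul, one_mul]
    exact ⟨by lia, fun B hB => ⟨h2 B (by lia), h4 B (by lia), by lia⟩⟩
  | sub x y ihx ihy =>
    intro h
    simp only [plain, Bool.and_eq_true] at h
    obtain ⟨h1, h2⟩ := ihx h.1
    obtain ⟨h3, h4⟩ := ihy h.2
    simp only [eval, cost, Fits, add_mul, one_mul]
    exact ⟨by lia, fun B hB => ⟨h2 B (by lia), h4 B (by lia)⟩⟩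
  | mul x y => simp [plain]
  | div x y ihx ihy =>
    intro h
    simp only [plain, Bool.and_eq_true] at h
    obtain ⟨h1, h2⟩ := ihx h.1
    obtain ⟨h3, h4⟩ := ihy h.2
    simp only [eval, cost, Fits, add_mul, one_mul]
    have := Nat.div_le_self (x.eval s) (y.eval s)
    exact ⟨by lia, fun B hB => ⟨h2 B (by lia), h4 B (by lia)⟩⟩

/-- Plain word expressions of small cost. -/
def WExpr.ok (x : WExpr) : Bool := x.plain && decide (x.cost ≤ 64)

/-- Real expressions all of whose indices are small plain word expressions. -/
def RExpr.ok : RExpr → Bool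
  | zero => true
  | one => true
  | var _ => true
  | get _ i => i.ok
  | add x y => x.ok && y.ok
  | sub x y => x.ok && y.ok

/-- Conditions all of whose word expressions are small and plain. -/
def Cond.ok : Cond → Bool
  | wlt x y => x.ok && y.ok
  | weq x y => x.ok && y.ok
  | rlt x y => x.ok && y.ok
  | not b => b.ok
  | and b c => b.ok && c.ok

/-- Programs all of whose word expressions are small and plain. -/
def Prog.ok : Prog → Bool
  | skip => true
  | setW _ x => x.ok
  | storeW _ i x => i.ok && x.ok
  | setR _ x => x.ok
  | storeR _ i x => i.ok && x.ok
  | emitW x => x.ok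
  | emitR x => x.ok
  | seq p q => p.ok && q.ok
  | ite b p q => b.ok && (p.ok && q.ok)
  | loop b p => b.ok && p.ok

/-- This disposes of overflow inside expressions once and for all. In the program proofs it only
remains to see that stored values are at most `K`. -/
theorem WExpr.ok.fits {x : WExpr} (hx : x.ok) {B K : ℕ} (hK : 64 ≤ K) (hB : 64 * K ≤ B) {s : State}
    (hs : s.Bd K) : x.Fits B s := by
  simp only [ok, Bool.and_eq_true, decide_eq_true_eq] at hx
  exact (x.plain_bound hK hs hx.1).2 B ((Nat.mul_le_mul_right K hx.2).trans hB)

theorem RExpr.ok.fits {x : RExpr} (hx : x.ok) {B K : ℕ} (hK : 64 ≤ K) (hB : 64 * K ≤ B) {s : State}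
    (hs : s.Bd K) : x.Fits B s := by
  induction x with
  | zero => trivial
  | one => trivial
  | var => trivial
  | get a i => exact WExpr.ok.fits hx hK hB hs
  | add x y ihx ihy =>
    simp only [ok, Bool.and_eq_true] at hx
    exact ⟨ihx hx.1, ihy hx.2⟩
  | sub x y ihx ihy =>
    simp only [ok, Bool.and_eq_true] at hx
    exact ⟨ihx hx.1, ihy hx.2⟩

theorem Cond.ok.fits {b : Cond} (hb : b.ok) {B K : ℕ} (hK : 64 ≤ K) (hB : 64 * K ≤ B) {s : State}
    (hs : s.Bd K) : b.Fits B s := by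
  induction b with
  | wlt x y =>
    simp only [ok, Bool.and_eq_true] at hb
    exact ⟨WExpr.ok.fits hb.1 hK hB hs, WExpr.ok.fits hb.2 hK hB hs⟩
  | weq x y =>
    simp only [ok, Bool.and_eq_true] at hb
    exact ⟨WExpr.ok.fits hb.1 hK hB hs, WExpr.ok.fits hb.2 hK hB hs⟩
  | rlt x y =>
    simp only [ok, Bool.and_eq_true] at hb
    exact ⟨RExpr.ok.fits hb.1 hK hB hs, RExpr.ok.fits hb.2 hK hB hs⟩
  | not b ih => exact ih hb
  | and b c ihb ihc =>
    simp only [ok, Bool.and_eq_true] at hb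
    exact ⟨ihb hb.1, ihc hb.2⟩

/-- The word variables that a program may change. -/
def Prog.modW : Prog → ℕ → Bool
  | setW i _, j => j == i
  | seq p q, j => p.modW j || q.modW j
  | ite _ p q, j => p.modW j || q.modW j
  | loop _ p, j => p.modW j
  | _, _ => false

/-- The word arrays that a program may change. -/
def Prog.modWA : Prog → ℕ → Bool
  | storeW a _ _, j => j == a
  | seq p q, j => p.modWA j || q.modWA j
  | ite _ p q, j => p.modWA j || q.modWA j
  | loop _ p, j => p.modWA j
  | _, _ => false

/-- The real variables that a program may change. -/
def Prog.modR : Prog → ℕ → Bool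
  | setR i _, j => j == i
  | seq p q, j => p.modR j || q.modR j
  | ite _ p q, j => p.modR j || q.modR j
  | loop _ p, j => p.modR j
  | _, _ => false

/-- The real arrays that a program may change. -/
def Prog.modRA : Prog → ℕ → Bool
  | storeR a _ _, j => j == a
  | seq p q, j => p.modRA j || q.modRA j
  | ite _ p q, j => p.modRA j || q.modRA j
  | loop _ p, j => p.modRA j
  | _, _ => false

/-- The program may write to the output tape. -/
def Prog.emits : Prog → Bool
  | emitW _ => true
  | emitR _ => true
  | seq p q => p.emits || q.emits
  | ite _ p q => p.emits || q.emits
  | loop _ p => p.emits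
  | _ => false

/-- Two states agree on everything that the program `p` cannot change. -/
structure Agree (p : Prog) (s s' : State) : Prop where
  w : ∀ i, p.modW i = false → s'.wvar i = s.wvar i
  wa : ∀ a, p.modWA a = false → s'.warr a = s.warr a
  r : ∀ i, p.modR i = false → s'.rvar i = s.rvar i
  ra : ∀ a, p.modRA a = false → s'.rarr a = s.rarr a
  o : p.emits = false → s'.out = s.out

theorem Agree.refl (p : Prog) (s : State) : Agree p s s :=
  ⟨fun _ _ => rfl, fun _ _ => rfl, fun _ _ => rfl, fun _ _ => rfl, fun _ => rfl⟩

theorem Agree.trans {p : Prog} {s s' s'' : State} (h : Agree p s s') (h' : Agree p s' s'') :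
    Agree p s s'' :=
  ⟨fun i hi => (h'.w i hi).trans (h.w i hi), fun i hi => (h'.wa i hi).trans (h.wa i hi),
    fun i hi => (h'.r i hi).trans (h.r i hi), fun i hi => (h'.ra i hi).trans (h.ra i hi),
    fun hi => (h'.o hi).trans (h.o hi)⟩

theorem Agree.seq_left {p q : Prog} {s s' : State} (h : Agree p s s') : Agree (.seq p q) s s' :=
  ⟨fun i hi => h.w i (by simp [Prog.modW] at hi; exact hi.1),
    fun i hi => h.wa i (by simp [Prog.modWA] at hi; exact hi.1),
    fun i hi => h.r i (by simp [Prog.modR] at hi; exact hi.1),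
    fun i hi => h.ra i (by simp [Prog.modRA] at hi; exact hi.1),
    fun hi => h.o (by simp [Prog.emits] at hi; exact hi.1)⟩

theorem Agree.seq_right {p q : Prog} {s s' : State} (h : Agree q s s') : Agree (.seq p q) s s' :=
  ⟨fun i hi => h.w i (by simp [Prog.modW] at hi; exact hi.2),
    fun i hi => h.wa i (by simp [Prog.modWA] at hi; exact hi.2),
    fun i hi => h.r i (by simp [Prog.modR] at hi; exact hi.2),
    fun i hi => h.ra i (by simp [Prog.modRA] at hi; exact hi.2),
    fun hi => h.o (by simp [Prog.emits] at hi; exact hi.2)⟩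

/-- The cells that `seq p q` and `ite b p q` may change are given by the same formulas, so all
fields carry over definitionally. Thus both branches are covered by the lemmas for `seq`. -/
theorem Agree.ite_of_seq {b : Cond} {p q : Prog} {s s' : State} (h : Agree (.seq p q) s s') :
    Agree (.ite b p q) s s' := ⟨h.w, h.wa, h.r, h.ra, h.o⟩

theorem Agree.loop {b : Cond} {p : Prog} {s s' : State} (h : Agree p s s') :
    Agree (.loop b p) s s' := ⟨h.w, h.wa, h.r, h.ra, h.o⟩

/-- Started in `s`, the program `p` halts within `T` steps in a state that satisfies `Q`. -/
def Run (B K : ℕ) (p : Prog) (s : State) (T : ℕ) (Q : State → Prop) : Prop :=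
  p.ok → 64 ≤ K → 64 * K ≤ B → s.Bd K →
    ∃ t s', t ≤ T ∧ Exec B p s t s' ∧ s'.Bd K ∧ Agree p s s' ∧ Q s'

/-! ### Rules for total correctness with time bounds. -/

section rules
variable {B K : ℕ} {p q : Prog} {b : Cond} {s : State} {T T₁ T₂ : ℕ} {Q R : State → Prop}

/-- The memory bound is a hypothesis inside `Run`, so it is available for proving the triple itself.
-/
theorem Run.bd (h : s.Bd K → Run B K p s T Q) : Run B K p s T Q :=
  fun h1 h2 h3 h4 => h h4 h1 h2 h3 h4

theorem Run.mono (h : Run B K p s T₁ R) (hT : T₁ ≤ T₂)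
    (hQ : ∀ s', s'.Bd K → Agree p s s' → R s' → Q s') : Run B K p s T₂ Q := by
  intro h1 h2 h3 h4
  obtain ⟨t, s', ht, he, hb, ha, hR⟩ := h h1 h2 h3 h4
  exact ⟨t, s', ht.trans hT, he, hb, ha, hQ s' hb ha hR⟩

theorem Run.time_mono (h : Run B K p s T₁ Q) (hT : T₁ ≤ T₂) : Run B K p s T₂ Q :=
  h.mono hT fun _ _ _ h => h

theorem Run.imp (h : Run B K p s T R)
    (hQ : ∀ s', s'.Bd K → Agree p s s' → R s' → Q s') : Run B K p s T Q := h.mono le_rfl hQ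

theorem State.Bd.setW (hs : s.Bd K) {i v : ℕ} (hv : v ≤ K) : (s.setW i v).Bd K := by
  refine ⟨fun j => ?_, hs.2⟩
  rw [State.setW_wvar]
  split_ifs
  · exact hv
  · exact hs.1 j

theorem State.Bd.storeW (hs : s.Bd K) {a i v : ℕ} (hv : v ≤ K) : (s.storeW a i v).Bd K := by
  refine ⟨hs.1, fun j l => ?_⟩
  rw [State.storeW_warr]
  split_ifs with h
  · rw [Function.update_apply]
    split_ifs
    · exact hv
    · exact hs.2 _ _
  · exact hs.2 _ _

theorem Run.skip (h : Q s) : Run B K .skip s 1 Q :=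
  fun _ _ _ h4 => ⟨1, s, le_rfl, .skip s, h4, .refl _ _, h⟩

theorem Run.setW {i : ℕ} {x : WExpr} (hv : x.eval s ≤ K) (h : Q (s.setW i (x.eval s))) :
    Run B K (.setW i x) s (x.cost + 1) Q := fun h1 h2 h3 h4 =>
  ⟨_, _, le_rfl, .setW s i x (WExpr.ok.fits h1 h2 h3 h4), h4.setW hv,
    ⟨fun j hj => by simp only [Prog.modW, beq_eq_false_iff_ne] at hj; simp [hj],
      fun _ _ => rfl, fun _ _ => rfl, fun _ _ => rfl, fun _ => rfl⟩, h⟩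

theorem Run.storeW {a : ℕ} {i x : WExpr} (hv : x.eval s ≤ K)
    (h : Q (s.storeW a (i.eval s) (x.eval s))) :
    Run B K (.storeW a i x) s (i.cost + x.cost + 1) Q := fun h1 h2 h3 h4 => by
  simp only [Prog.ok, Bool.and_eq_true] at h1
  exact ⟨_, _, le_rfl, .storeW s a i x (WExpr.ok.fits h1.1 h2 h3 h4) (WExpr.ok.fits h1.2 h2 h3 h4),
    h4.storeW hv, ⟨fun _ _ => rfl,
      fun j hj => by
        simp only [Prog.modWA, beq_eq_false_iff_ne] at hj
        simp [hj],
      fun _ _ => rfl, fun _ _ => rfl, fun _ => rfl⟩, h⟩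

theorem Run.setR {i : ℕ} {x : RExpr} (h : Q (s.setR i (x.eval s))) :
    Run B K (.setR i x) s (x.cost + 1) Q := fun h1 h2 h3 h4 =>
  ⟨_, _, le_rfl, .setR s i x (RExpr.ok.fits h1 h2 h3 h4), h4,
    ⟨fun _ _ => rfl, fun _ _ => rfl,
      fun j hj => by simp only [Prog.modR, beq_eq_false_iff_ne] at hj; simp [hj],
      fun _ _ => rfl, fun _ => rfl⟩, h⟩

theorem Run.storeR {a : ℕ} {i : WExpr} {x : RExpr} (h : Q (s.storeR a (i.eval s) (x.eval s))) :
    Run B K (.storeR a i x) s (i.cost + x.cost + 1) Q := fun h1 h2 h3 h4 => by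
  simp only [Prog.ok, Bool.and_eq_true] at h1
  exact ⟨_, _, le_rfl, .storeR s a i x (WExpr.ok.fits h1.1 h2 h3 h4) (RExpr.ok.fits h1.2 h2 h3 h4),
    h4, ⟨fun _ _ => rfl, fun _ _ => rfl, fun _ _ => rfl,
      fun j hj => by
        simp only [Prog.modRA, beq_eq_false_iff_ne] at hj
        simp [hj],
      fun _ => rfl⟩, h⟩

theorem Run.emitW {x : WExpr} (h : Q (s.emit (.inl (x.eval s)))) :
    Run B K (.emitW x) s (x.cost + 1) Q := fun h1 h2 h3 h4 =>
  ⟨_, _, le_rfl, .emitW s x (WExpr.ok.fits h1 h2 h3 h4), h4,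
    ⟨fun _ _ => rfl, fun _ _ => rfl, fun _ _ => rfl, fun _ _ => rfl,
      fun h => by simp [Prog.emits] at h⟩, h⟩

theorem Run.emitR {x : RExpr} (h : Q (s.emit (.inr (x.eval s)))) :
    Run B K (.emitR x) s (x.cost + 1) Q := fun h1 h2 h3 h4 =>
  ⟨_, _, le_rfl, .emitR s x (RExpr.ok.fits h1 h2 h3 h4), h4,
    ⟨fun _ _ => rfl, fun _ _ => rfl, fun _ _ => rfl, fun _ _ => rfl,
      fun h => by simp [Prog.emits] at h⟩, h⟩

theorem Run.seq (h : Run B K p s T₁ fun s' => Run B K q s' T₂ Q) :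
    Run B K (.seq p q) s (T₁ + T₂) Q := by
  intro h1 h2 h3 h4
  simp only [Prog.ok, Bool.and_eq_true] at h1
  obtain ⟨t₁, s₁, ht₁, he₁, hb₁, ha₁, hq₁⟩ := h h1.1 h2 h3 h4
  obtain ⟨t₂, s₂, ht₂, he₂, hb₂, ha₂, hq₂⟩ := hq₁ h1.2 h2 h3 hb₁
  exact ⟨_, s₂, Nat.add_le_add ht₁ ht₂, .seq he₁ he₂, hb₂, ha₁.seq_left.trans ha₂.seq_right, hq₂⟩

/-- Sequential composition; the frame of the first program is available for the second one. -/
theorem Run.seq' (h : Run B K p s T₁ R)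
    (h' : ∀ s', s'.Bd K → Agree p s s' → R s' → Run B K q s' T₂ Q) :
    Run B K (.seq p q) s (T₁ + T₂) Q := .seq (h.imp h')

theorem Run.ite (h : b.Holds s → Run B K p s T₁ Q) (h' : ¬ b.Holds s → Run B K q s T₂ Q) :
    Run B K (.ite b p q) s (b.cost + max T₁ T₂ + 1) Q := by
  intro h1 h2 h3 h4
  simp only [Prog.ok, Bool.and_eq_true] at h1
  by_cases hb : b.Holds s
  · obtain ⟨t, s', ht, he, hb', ha, hq⟩ := h hb h1.2.1 h2 h3 h4
    exact ⟨_, s', by have := le_max_left T₁ T₂; lia, .iteTrue (Cond.ok.fits h1.1 h2 h3 h4) hb he, hb',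
      ha.seq_left.ite_of_seq, hq⟩
  · obtain ⟨t, s', ht, he, hb', ha, hq⟩ := h' hb h1.2.2 h2 h3 h4
    exact ⟨_, s', by have := le_max_right T₁ T₂; lia, .iteFalse (Cond.ok.fits h1.1 h2 h3 h4) hb he, hb',
      ha.seq_right.ite_of_seq, hq⟩

/-- The general rule for loops: `Φ` bounds the remaining time. -/
theorem Run.loop_time (I : State → Prop) (Φ : State → ℕ) (h0 : I s)
    (hstep : ∀ s', s'.Bd K → Agree (.loop b p) s s' → I s' → b.Holds s' →
      ∃ T, Run B K p s' T fun s'' => I s'' ∧ T + b.cost + 1 + Φ s'' ≤ Φ s')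
    (hend : ∀ s', s'.Bd K → Agree (.loop b p) s s' → I s' → ¬ b.Holds s' → Q s') :
    Run B K (.loop b p) s (Φ s + b.cost + 1) Q := by
  intro h1 h2 h3 h4
  have h1' := h1
  simp only [Prog.ok, Bool.and_eq_true] at h1'
  suffices H : ∀ N s', Φ s' ≤ N → s'.Bd K → Agree (.loop b p) s s' → I s' →
      ∃ t s'', t ≤ Φ s' + b.cost + 1 ∧ Exec B (.loop b p) s' t s'' ∧ s''.Bd K ∧
        Agree (.loop b p) s s'' ∧ Q s'' from H _ s le_rfl h4 (.refl _ _) h0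
  intro N
  induction N with
  | zero =>
    intro s' hN hbd ha hI
    by_cases hb : b.Holds s'
    -- An iteration uses up at least one unit of potential, so there is none left to start with
    -- potential zero.
    · obtain ⟨T, hT⟩ := hstep s' hbd ha hI hb
      obtain ⟨t, s'', -, -, -, -, -, h⟩ := hT h1'.2 h2 h3 hbd
      lia
    · exact ⟨_, s', by lia, .loopFalse (Cond.ok.fits h1'.1 h2 h3 hbd) hb, hbd, ha,
        hend s' hbd ha hI hb⟩
  | succ N ih =>
    intro s' hN hbd ha hI
    by_cases hb : b.Holds s'
    · obtain ⟨T, hT⟩ := hstep s' hbd ha hI hb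
      obtain ⟨t, s'', ht, he, hbd', ha', hI', h⟩ := hT h1'.2 h2 h3 hbd
      obtain ⟨t', s₃, ht', he', hbd'', ha'', hQ⟩ :=
        ih s'' (by lia) hbd' (ha.trans ha'.loop) hI'
      exact ⟨_, s₃, by lia, .loopTrue (Cond.ok.fits h1'.1 h2 h3 hbd) hb he he', hbd'', ha'', hQ⟩
    · exact ⟨_, s', by lia, .loopFalse (Cond.ok.fits h1'.1 h2 h3 hbd) hb, hbd, ha,
        hend s' hbd ha hI hb⟩

/-- Loops with at most `Φ` iterations, each of which takes time at most `T`. -/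
theorem Run.loop_pot (I : State → Prop) (Φ : State → ℕ) (T : ℕ) (h0 : I s)
    (hstep : ∀ s', s'.Bd K → Agree (.loop b p) s s' → I s' → b.Holds s' →
      Run B K p s' T fun s'' => I s'' ∧ Φ s'' < Φ s')
    (hend : ∀ s', s'.Bd K → Agree (.loop b p) s s' → I s' → ¬ b.Holds s' → Q s') :
    Run B K (.loop b p) s (Φ s * (T + b.cost + 1) + b.cost + 1) Q := by
  refine Run.loop_time I (fun s => Φ s * (T + b.cost + 1)) h0 (fun s' h1 h2 h3 h4 => ⟨T, ?_⟩) hend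
  refine (hstep s' h1 h2 h3 h4).imp fun s'' _ _ h => ⟨h.1, ?_⟩
  calc T + b.cost + 1 + Φ s'' * (T + b.cost + 1) = (Φ s'' + 1) * (T + b.cost + 1) := by ring
    _ ≤ _ := Nat.mul_le_mul_right _ h.2

/-- Loops with exactly `N` iterations. -/
theorem Run.loop_sum (I : ℕ → State → Prop) (N : ℕ) (T : ℕ → ℕ) (h0 : I 0 s)
    (hstep : ∀ j < N, ∀ s', s'.Bd K → Agree (.loop b p) s s' → I j s' →
      b.Holds s' ∧ Run B K p s' (T j) (I (j + 1)))
    (hend : ∀ s', s'.Bd K → Agree (.loop b p) s s' → I N s' → ¬ b.Holds s' ∧ Q s') :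
    Run B K (.loop b p) s (∑ j ∈ Finset.range N, (T j + b.cost + 1) + b.cost + 1) Q := by
  intro h1 h2 h3 h4
  have h1' := h1
  simp only [Prog.ok, Bool.and_eq_true] at h1'
  -- Induction on the number `l` of iterations that are left, for an arbitrary index `j` of the
  -- current one.
  suffices H : ∀ l j, j + l = N → ∀ s', s'.Bd K → Agree (.loop b p) s s' → I j s' →
      ∃ t s'', t ≤ ∑ i ∈ Finset.range l, (T (j + i) + b.cost + 1) + b.cost + 1 ∧
        Exec B (.loop b p) s' t s'' ∧ s''.Bd K ∧ Agree (.loop b p) s s'' ∧ Q s'' by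
    simpa using H N 0 (by simp) s h4 (.refl _ _) h0
  intro l
  induction l with
  | zero =>
    rintro j rfl s' hbd ha hI
    obtain ⟨hb, hQ⟩ := hend s' hbd ha hI
    exact ⟨_, s', by simp, .loopFalse (Cond.ok.fits h1'.1 h2 h3 hbd) hb, hbd, ha, hQ⟩
  | succ l ih =>
    intro j hj s' hbd ha hI
    obtain ⟨hb, hR⟩ := hstep j (by lia) s' hbd ha hI
    obtain ⟨t, s'', ht, he, hbd', ha', hI'⟩ := hR h1'.2 h2 h3 hbd
    obtain ⟨t', s₃, ht', he', hbd'', ha'', hQ⟩ := ih (j + 1) (by lia) s'' hbd' (ha.trans ha'.loop) hI'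
    refine ⟨_, s₃, ?_, .loopTrue (Cond.ok.fits h1'.1 h2 h3 hbd) hb he he', hbd'', ha'', hQ⟩
    rw [Finset.sum_range_succ']
    simp only [add_zero]
    have : ∀ i, j + 1 + i = j + (i + 1) := fun i => by ring
    simp only [this] at ht'
    lia

/-- Loops with exactly `N` iterations, each of which takes time at most `T`. -/
theorem Run.loop_count (I : ℕ → State → Prop) (N : ℕ) (T : ℕ) (h0 : I 0 s)
    (hstep : ∀ j < N, ∀ s', s'.Bd K → Agree (.loop b p) s s' → I j s' →
      b.Holds s' ∧ Run B K p s' T (I (j + 1)))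
    (hend : ∀ s', s'.Bd K → Agree (.loop b p) s s' → I N s' → ¬ b.Holds s' ∧ Q s') :
    Run B K (.loop b p) s (N * (T + b.cost + 1) + b.cost + 1) Q := by
  refine (Run.loop_sum I N (fun _ => T) h0 hstep hend).time_mono ?_
  simp

end rules

/-! ### Weakest preconditions of programs without loops. -/

/-- The cost of a program without loops. -/
def Prog.tm : Prog → ℕ
  | skip => 1
  | setW _ x => x.cost + 1
  | storeW _ i x => i.cost + x.cost + 1
  | setR _ x => x.cost + 1
  | storeR _ i x => i.cost + x.cost + 1
  | emitW x => x.cost + 1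
  | emitR x => x.cost + 1
  | seq p q => p.tm + q.tm
  | ite b p q => b.cost + max p.tm q.tm + 1
  | loop _ _ => 0

/-- The weakest precondition of a program without loops. -/
def Prog.wp (K : ℕ) : Prog → (State → Prop) → State → Prop
  | skip, Q, s => Q s
  | setW i x, Q, s => x.eval s ≤ K ∧ Q (s.setW i (x.eval s))
  | storeW a i x, Q, s => x.eval s ≤ K ∧ Q (s.storeW a (i.eval s) (x.eval s))
  | setR i x, Q, s => Q (s.setR i (x.eval s))
  | storeR a i x, Q, s => Q (s.storeR a (i.eval s) (x.eval s))
  | emitW x, Q, s => Q (s.emit (.inl (x.eval s)))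
  | emitR x, Q, s => Q (s.emit (.inr (x.eval s)))
  | seq p q, Q, s => p.wp K (q.wp K Q) s
  | ite b p q, Q, s => (b.Holds s → p.wp K Q s) ∧ (¬ b.Holds s → q.wp K Q s)
  | loop _ _, _, _ => False

/-- The precondition of a loop is `False`, so the dummy cost 0 that `Prog.tm` gives to loops is
never used. -/
theorem Run.of_wp {B K : ℕ} {p : Prog} {s : State} {Q : State → Prop} (h : p.wp K Q s) :
    Run B K p s p.tm Q := by
  induction p generalizing s Q with
  | skip => exact .skip h
  | setW i x => exact .setW h.1 h.2
  | storeW a i x => exact .storeW h.1 h.2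
  | setR i x => exact .setR h
  | storeR a i x => exact .storeR h
  | emitW x => exact .emitW h
  | emitR x => exact .emitR h
  | seq p q ihp ihq => exact .seq ((ihp h).imp fun s' _ _ h => ihq h)
  | ite b p q ihp ihq => exact .ite (fun hb => ihp (h.1 hb)) fun hb => ihq (h.2 hb)
  | loop b p => exact h.elim

theorem Run.of_wp' {B K T : ℕ} {p : Prog} {s : State} {Q : State → Prop} (hT : p.tm ≤ T)
    (h : p.wp K Q s) : Run B K p s T Q := (Run.of_wp h).time_mono hT

infixr:60 " ;; " => Prog.seq

end TwoRespect

namespace TwoRespect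

/-! ## Rooted trees given by parent functions -/

/-- `w` is an ancestor of `u` (possibly `u` itself). -/
def Anc (par : ℕ → ℕ) (w u : ℕ) : Prop := ∃ i, par^[i] u = w

/-- `par` is the parent function of a tree with vertices `0, …, n - 1` and root `0`, and `dep` is
the depth of its vertices. -/
structure RTree (n : ℕ) (par dep : ℕ → ℕ) : Prop where
  n_pos : 0 < n
  root : par 0 = 0
  out : ∀ v, n ≤ v → par v = 0
  lt : ∀ v, par v < n
  step : ∀ v, 0 < v → v < n → dep v = dep (par v) + 1

namespace RTree
variable {n : ℕ} {par dep : ℕ → ℕ}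

theorem _root_.TwoRespect.Anc.refl (w : ℕ) : Anc par w w := ⟨0, rfl⟩

theorem _root_.TwoRespect.Anc.trans {a b c : ℕ} (h : Anc par a b) (h' : Anc par b c) :
    Anc par a c := by
  obtain ⟨i, rfl⟩ := h
  obtain ⟨j, rfl⟩ := h'
  exact ⟨i + j, Function.iterate_add_apply ..⟩

theorem _root_.TwoRespect.Anc.parent (v : ℕ) : Anc par (par v) v := ⟨1, rfl⟩

theorem _root_.TwoRespect.Anc.iff_par {w u : ℕ} : Anc par w u ↔ w = u ∨ Anc par w (par u) := by
  constructor
  · rintro ⟨i, rfl⟩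
    cases i with
    | zero => exact .inl rfl
    | succ i => exact .inr ⟨i, (Function.iterate_succ_apply ..).symm⟩
  · rintro (rfl | h)
    · exact .refl _
    · exact h.trans (.parent u)

/-- Induction from the root downwards. -/
theorem induction (h : RTree n par dep) {P : ℕ → Prop} (h0 : P 0)
    (hs : ∀ v, 0 < v → v < n → P (par v) → P v) : ∀ v, v < n → P v := by
  have : ∀ d v, v < n → dep v ≤ d → P v := by
    intro d
    induction d with
    | zero =>
      intro v hv hd
      rcases Nat.eq_zero_or_pos v with rfl | hv0
      · exact h0
      · have := h.step v hv0 hv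
        lia
    | succ d ih =>
      intro v hv hd
      rcases Nat.eq_zero_or_pos v with rfl | hv0
      · exact h0
      · have := h.step v hv0 hv
        exact hs v hv0 hv (ih _ (h.lt v) (by lia))
  exact fun v hv => this _ v hv le_rfl

theorem anc_root (h : RTree n par dep) {v : ℕ} (hv : v < n) : Anc par 0 v :=
  h.induction (.refl 0) (fun v _ _ ih => ih.trans (.parent v)) v hv

theorem anc_zero (h : RTree n par dep) {w : ℕ} : Anc par w 0 ↔ w = 0 := by
  constructor
  · rintro ⟨i, rfl⟩
    exact Function.iterate_fixed h.root i
  · rintro rfl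
    exact .refl 0

theorem anc_lt (h : RTree n par dep) {w u : ℕ} (hu : u < n) (ha : Anc par w u) : w < n := by
  revert ha
  refine h.induction (P := fun u => Anc par w u → w < n) ?_ ?_ u hu
  · rw [h.anc_zero]
    rintro rfl
    exact h.n_pos
  · intro v _ hv ih ha
    rcases Anc.iff_par.1 ha with rfl | ha
    · exact hv
    · exact ih ha

/-- The depth drops at every step towards the root. Antisymmetry of the ancestor relation and the
absence of cycles come from this. -/
theorem anc_dep (h : RTree n par dep) {w u : ℕ} (hu : u < n) (ha : Anc par w u) :
    w = u ∨ dep w < dep u := by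
  revert ha
  refine h.induction (P := fun u => Anc par w u → w = u ∨ dep w < dep u) ?_ ?_ u hu
  · rw [h.anc_zero]
    exact .inl
  · intro v hv0 hv ih ha
    rcases Anc.iff_par.1 ha with rfl | ha
    · exact .inl rfl
    · have := h.step v hv0 hv
      rcases ih ha with rfl | h'
      · right; lia
      · right; lia

theorem anc_antisymm (h : RTree n par dep) {w u : ℕ} (hu : u < n) (ha : Anc par w u)
    (ha' : Anc par u w) : w = u := by
  rcases h.anc_dep hu ha with h1 | h1
  · exact h1
  · rcases h.anc_dep (h.anc_lt hu ha) ha' with h2 | h2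
    · exact h2.symm
    · lia

theorem not_anc_par (h : RTree n par dep) {v : ℕ} (h0 : 0 < v) (hv : v < n) :
    ¬ Anc par v (par v) := fun ha => by
  have := h.anc_dep (h.lt v) ha
  have := h.step v h0 hv
  rcases h.anc_dep (h.lt v) ha with h1 | h1
  · rw [← h1] at this
    lia
  · lia

theorem par_ne (h : RTree n par dep) {v : ℕ} (h0 : 0 < v) (hv : v < n) : par v ≠ v := fun e => by
  have := h.not_anc_par h0 hv
  rw [e] at this
  exact this (.refl v)

/-- Every vertex has only one parent, so its ancestors form a chain. -/
theorem anc_total (h : RTree n par dep) {a b v : ℕ} (hv : v < n) (ha : Anc par a v)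
    (hb : Anc par b v) : Anc par a b ∨ Anc par b a := by
  revert ha hb
  refine h.induction (P := fun v => Anc par a v → Anc par b v → Anc par a b ∨ Anc par b a)
    ?_ ?_ v hv
  · rw [h.anc_zero, h.anc_zero]
    rintro rfl rfl
    exact .inl (.refl 0)
  · intro v _ _ ih ha hb
    rcases Anc.iff_par.1 ha with rfl | ha'
    · exact .inr hb
    · rcases Anc.iff_par.1 hb with rfl | hb'
      · exact .inl ha
      · exact ih ha' hb'

/-- Siblings with a common descendant are equal. -/
theorem sibling_eq (h : RTree n par dep) {c d v : ℕ} (hc0 : 0 < c) (hd0 : 0 < d) (hv : v < n)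
    (hp : par c = par d) (hc : Anc par c v) (hd : Anc par d v) : c = d := by
  have hcn := h.anc_lt hv hc
  have hdn := h.anc_lt hv hd
  rcases h.anc_total hv hc hd with h1 | h1
  · rcases Anc.iff_par.1 h1 with h2 | h2
    · exact h2
    · exact (h.not_anc_par hc0 hcn (hp ▸ h2)).elim
  · rcases Anc.iff_par.1 h1 with h2 | h2
    · exact h2.symm
    · exact (h.not_anc_par hd0 hdn (hp ▸ h2)).elim

/-- A proper descendant lies below a child. -/
theorem exists_child (h : RTree n par dep) {w u : ℕ} (hu : u < n) (ha : Anc par w u) (hne : w ≠ u) :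
    ∃ c, 0 < c ∧ c < n ∧ par c = w ∧ Anc par c u := by
  revert ha hne
  refine h.induction (P := fun u => Anc par w u → w ≠ u → ∃ c, 0 < c ∧ c < n ∧ par c = w ∧ Anc par c u)
    ?_ ?_ u hu
  · rw [h.anc_zero]
    intro h1 h2
    exact (h2 h1).elim
  · intro v h0 hv ih ha hne
    rcases Anc.iff_par.1 ha with h1 | h1
    · exact (hne h1).elim
    · by_cases hw : w = par v
      · exact ⟨v, h0, hv, hw.symm, .refl v⟩
      · obtain ⟨c, hc, hcn, hcp, hca⟩ := ih h1 hw
        exact ⟨c, hc, hcn, hcp, hca.trans (.parent v)⟩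

end RTree

/-! ## The rooted tree of a spanning tree -/

/-- The truth value of `f` flips exactly when the walk traverses `e`. -/
theorem _root_.SimpleGraph.Walk.even_count_edges {V : Type*} [DecidableEq V] {H : SimpleGraph V}
    {f : V → Prop} {e : Sym2 V} (hf : ∀ a b, H.Adj a b → ((f a ↔ f b) ↔ s(a, b) ≠ e)) {u v : V}
    (p : H.Walk u v) : (f u ↔ f v) ↔ Even (p.edges.count e) := by
  induction p with
  | nil => simp
  | @cons a b c hab p ih =>
    have := hf a b hab
    rw [SimpleGraph.Walk.edges_cons, List.count_cons]
    by_cases he : s(a, b) = e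
    · simp only [he, beq_self_eq_true, if_true, Nat.even_add_one]
      rw [← ih]
      simp only [he, ne_eq, not_true_eq_false, iff_false] at this
      tauto
    · simp only [beq_iff_eq, he, if_false, add_zero]
      rw [← ih]
      simp only [ne_eq, he, not_false_eq_true, iff_true] at this
      tauto

/-- `par`, `pe` and `dep` describe the spanning tree `T` of `G`, rooted at the vertex `0`: the
vertex `v ≠ 0` is connected with its parent `par v` by the edge `pe v`. -/
structure IsRooting {n m : ℕ} (G : WGraph n m) (T : Finset (Fin m)) (par pe dep : ℕ → ℕ) : Prop
    extends RTree n par dep where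
  adj : ∀ u v : Fin n, (G.treeGraph T).Adj u v ↔
    (0 < (v : ℕ) ∧ par v = u) ∨ (0 < (u : ℕ) ∧ par u = v)
  dist : ∀ v : Fin n, (G.treeGraph T).dist ⟨0, n_pos⟩ v = dep v
  dep0 : dep 0 = 0
  pe_out : ∀ v, n ≤ v ∨ v = 0 → pe v = 0
  pe_spec : ∀ v, 0 < v → v < n → ∃ k : Fin m, k ∈ T ∧ (k : ℕ) = pe v ∧
    (((G.src k : ℕ) = v ∧ (G.dst k : ℕ) = par v) ∨ ((G.src k : ℕ) = par v ∧ (G.dst k : ℕ) = v))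
  pe_surj : ∀ k ∈ T, ∃ v, 0 < v ∧ v < n ∧ pe v = k
  pe_inj : ∀ v w, 0 < v → v < n → 0 < w → w < n → pe v = pe w → v = w

/-! ### Existence of a rooting; tree paths and subtrees in terms of ancestors. -/

section rooting
variable {n m : ℕ} {G : WGraph n m} {T : Finset (Fin m)}

/-- The parent is the second vertex of a shortest path from `v` to the root. Another neighbour
closer to the root would give a second path from `v` to `r`, contrary to acyclicity. -/
theorem exists_unique_parent {V : Type*} {H : SimpleGraph V} (hH : H.IsTree) {r v : V}
    (hv : v ≠ r) : ∃ p, H.Adj v p ∧ H.dist r v = H.dist r p + 1 ∧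
      ∀ q, H.Adj v q → H.dist r v = H.dist r q + 1 → q = p := by
  obtain ⟨w, hw, hwl⟩ := hH.connected.exists_path_of_dist v r
  have hnil : ¬ w.Nil := fun h => hv h.eq
  have hlen : w.tail.length + 1 = w.length := w.length_tail_add_one hnil
  have hadj : H.Adj v w.snd := w.adj_snd hnil
  have hd : H.dist r v = H.dist r w.snd + 1 := by
    rcases hH.dist_eq_dist_add_one_of_adj r hadj with h | h
    · exact h
    · have := SimpleGraph.dist_le w.tail
      rw [SimpleGraph.dist_comm] at this
      rw [SimpleGraph.dist_comm] at hwl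
      lia
  refine ⟨w.snd, hadj, hd, fun q hq hqd => ?_⟩
  obtain ⟨x, hx, hxl⟩ := hH.connected.exists_path_of_dist q r
  have hpath : (SimpleGraph.Walk.cons hq x).IsPath := by
    apply SimpleGraph.Walk.isPath_of_length_eq_dist
    rw [SimpleGraph.Walk.length_cons, hxl, SimpleGraph.dist_comm, SimpleGraph.dist_comm (u := v)]
    exact hqd.symm
  have := (hH.isAcyclic.subsingleton_path v r).elim ⟨_, hpath⟩ ⟨w, hw⟩
  have := congrArg (fun p => p.1.snd) this
  simpa using this

theorem adj_treeGraph {u v : Fin n} :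
    (G.treeGraph T).Adj u v ↔ (∃ k ∈ T, G.ends k = s(u, v)) ∧ u ≠ v := by
  simp [WGraph.treeGraph]

/-- All three functions are read off from the distances to the vertex `0`. They are extended by 0
outside of their domains, in agreement with the arrays of the machine, so that later the arrays can
be equated with them as functions. -/
theorem exists_isRooting (hn : 0 < n) (hT : G.IsSpanningTree T) :
    ∃ par pe dep, IsRooting G T par pe dep := by
  classical
  obtain ⟨hloop, hinj, htree⟩ := hT
  set r : Fin n := ⟨0, hn⟩ with hr
  set H := G.treeGraph T with hH
  have hex : ∀ v : Fin n, ∃ p : Fin n, (v = r → p = r) ∧ (v ≠ r → H.Adj v p ∧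
      H.dist r v = H.dist r p + 1 ∧ ∀ q, H.Adj v q → H.dist r v = H.dist r q + 1 → q = p) := by
    intro v
    by_cases hv : v = r
    · exact ⟨r, fun _ => rfl, fun h => (h hv).elim⟩
    · obtain ⟨p, hp⟩ := exists_unique_parent htree hv
      exact ⟨p, fun h => (hv h).elim, fun _ => hp⟩
  choose P hP0 hP using hex
  have hkex : ∀ v : Fin n, v ≠ r → ∃ k ∈ T, G.ends k = s(v, P v) := fun v hv =>
    (adj_treeGraph.1 (hP v hv).1).1
  choose E hE using hkex
  have hr0 : ∀ v : Fin n, v ≠ r ↔ 0 < (v : ℕ) := fun v => by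
    rw [hr, Ne, Fin.ext_iff, Nat.pos_iff_ne_zero]
  let par : ℕ → ℕ := fun v => if h : v < n then (P ⟨v, h⟩ : ℕ) else 0
  let pe : ℕ → ℕ := fun v => 
    if h : v < n ∧ 0 < v then (E ⟨v, h.1⟩ ((hr0 _).2 h.2) : ℕ) else 0
  let dep : ℕ → ℕ := fun v => if h : v < n then H.dist r ⟨v, h⟩ else 0
  have hpar : ∀ v : Fin n, par v = P v := fun v => by simp [par]
  have hpe : ∀ (v : Fin n) (hv : v ≠ r), pe v = E v hv := fun v hv => by
    have := (hr0 v).1 hv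
    simp [pe, this]
  have hdep : ∀ v : Fin n, dep v = H.dist r v := fun v => by simp [dep]
  have hlt : ∀ v, par v < n := fun v => by
    simp only [par]
    split_ifs
    · exact Fin.is_lt _
    · exact hn
  have hspec : ∀ v, 0 < v → ∀ hv : v < n, ∃ k : Fin m, k ∈ T ∧ (k : ℕ) = pe v ∧
      G.ends k = s(⟨v, hv⟩, ⟨par v, hlt v⟩) := by
    intro v h0 hv
    have hvr := (hr0 ⟨v, hv⟩).2 h0
    refine ⟨E ⟨v, hv⟩ hvr, (hE _ hvr).1, (hpe _ hvr).symm, ?_⟩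
    rw [(hE _ hvr).2]
    congr
    ext
    exact (hpar ⟨v, hv⟩).symm
  have hadj : ∀ u v : Fin n, H.Adj u v ↔ (0 < (v : ℕ) ∧ par v = u) ∨ (0 < (u : ℕ) ∧ par u = v) := by
    intro u v
    rw [← hr0, ← hr0, hpar, hpar, ← Fin.ext_iff, ← Fin.ext_iff]
    constructor
    · intro h
      rcases htree.dist_eq_dist_add_one_of_adj r h with h1 | h1
      · right
        have : u ≠ r := by
          rintro rfl
          simp at h1
        exact ⟨this, ((hP u this).2.2 v h h1).symm⟩
      · left
        have : v ≠ r := by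
          rintro rfl
          simp at h1
        exact ⟨this, ((hP v this).2.2 u h.symm h1).symm⟩
    · rintro (⟨h1, rfl⟩ | ⟨h1, rfl⟩)
      · exact (hP v h1).1.symm
      · exact (hP u h1).1
  have hstep : ∀ v, 0 < v → v < n → dep v = dep (par v) + 1 := by
    intro v h0 hv
    have := (hP ⟨v, hv⟩ ((hr0 _).2 h0)).2.1
    rw [← hdep, ← hdep, ← hpar] at this
    exact this
  refine ⟨par, pe, dep, ⟨hn, ?_, ?_, hlt, hstep⟩, hadj, fun v => (hdep v).symm, ?_, ?_, ?_, ?_, ?_⟩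
  · have := hpar r
    rw [hP0 r rfl] at this
    exact this
  · intro v hv
    simp [par, hv]
  · have := hdep r
    simpa using this
  · rintro v (hv | rfl)
    · simp [pe, hv.not_gt]
    · simp [pe]
  · intro v h0 hv
    obtain ⟨k, hk, hkv, hke⟩ := hspec v h0 hv
    refine ⟨k, hk, hkv, ?_⟩
    rw [WGraph.ends, Sym2.eq_iff] at hke
    rcases hke with ⟨h1, h2⟩ | ⟨h1, h2⟩
    · left; rw [h1, h2]; exact ⟨rfl, rfl⟩
    · right; rw [h1, h2]; exact ⟨rfl, rfl⟩
  -- The edge chosen above the lower end of `k` has the same ends as `k`; it is `k` since `T` has no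
  -- parallel edges.
  · intro k hk
    have hne := hloop k hk
    have h1 : H.Adj (G.src k) (G.dst k) := adj_treeGraph.2 ⟨⟨k, hk, rfl⟩, hne⟩
    rcases (hadj _ _).1 h1 with ⟨h2, h3⟩ | ⟨h2, h3⟩
    · obtain ⟨k', hk', hkv, hke⟩ := hspec _ h2 (Fin.is_lt _)
      refine ⟨_, h2, Fin.is_lt _, ?_⟩
      rw [← hkv]
      congr 1
      apply hinj hk' hk
      rw [hke, WGraph.ends, Sym2.eq_swap]
      congr
    · obtain ⟨k', hk', hkv, hke⟩ := hspec _ h2 (Fin.is_lt _)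
      refine ⟨_, h2, Fin.is_lt _, ?_⟩
      rw [← hkv]
      congr 1
      apply hinj hk' hk
      rw [hke, WGraph.ends]
      congr
  · intro v w h0 hv h0' hw he
    obtain ⟨k, hk, hkv, hke⟩ := hspec v h0 hv
    obtain ⟨k', hk', hkv', hke'⟩ := hspec w h0' hw
    have : k = k' := Fin.ext (by rw [hkv, hkv', he])
    subst this
    rw [hke, Sym2.eq_iff] at hke'
    simp only [Fin.mk.injEq] at hke'
    rcases hke' with ⟨h1, h2⟩ | ⟨h1, h2⟩
    · exact h1
    -- With the ends interchanged, `v` and `w` would be parents of each other.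
    · have h3 := hstep v h0 hv
      have h4 := hstep w h0' hw
      rw [h2] at h3
      rw [← h1] at h4
      lia

namespace IsRooting
variable {par pe dep : ℕ → ℕ}

/-- The tree edge above `w` is on the path between `u` and `v` if and only if exactly one of `u`
and `v` is a descendant of `w`. -/
theorem onPath_iff (h : IsRooting G T par pe dep) (hT : G.IsSpanningTree T) {w : ℕ} (h0 : 0 < w)
    (hw : w < n) {e : Fin m} (he : (e : ℕ) = pe w) (u v : Fin n) :
    G.OnPath T e u v ↔ ¬ (Anc par w u ↔ Anc par w v) := by
  classical
  have hends : G.ends e = s((⟨w, hw⟩ : Fin n), ⟨par w, h.lt w⟩) := by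
    obtain ⟨k, hk, hkw, hke⟩ := h.pe_spec w h0 hw
    have : k = e := Fin.ext (hkw.trans he.symm)
    subst this
    rw [WGraph.ends, Sym2.eq_iff]
    rcases hke with ⟨h1, h2⟩ | ⟨h1, h2⟩
    · exact .inl ⟨Fin.ext h1, Fin.ext h2⟩
    · exact .inr ⟨Fin.ext h1, Fin.ext h2⟩
  -- The subtree of `w` is left, going from a vertex to its parent, only at `w` itself. Hence
  -- membership in it changes along a tree edge exactly if this edge is `e`.
  have key : ∀ a : Fin n, 0 < (a : ℕ) → ((Anc par w (par a) ↔ Anc par w a) ↔ (a : ℕ) ≠ w) := by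
    intro a ha
    rw [Anc.iff_par (u := a)]
    by_cases haw : (a : ℕ) = w
    · have h1 := h.not_anc_par h0 hw
      simp [haw, h1]
    · simp [Ne.symm haw, haw]
  have hf : ∀ a b : Fin n, (G.treeGraph T).Adj a b →
      ((Anc par w a ↔ Anc par w b) ↔ s(a, b) ≠ G.ends e) := by
    intro a b hab
    have hdep := fun v : Fin n => h.step v
    rw [hends, Ne, Sym2.eq_iff]
    simp only [Fin.ext_iff]
    rcases (h.adj a b).1 hab with ⟨h1, h2⟩ | ⟨h1, h2⟩
    · rw [← h2, key b h1]
      have h3 := hdep b h1 b.2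
      have h4 := h.step w h0 hw
      rw [not_iff_not]
      constructor
      · intro hb
        right
        rw [hb]
        exact ⟨rfl, rfl⟩
      · rintro (⟨h5, h6⟩ | h5)
        · rw [← h6] at h4; rw [h5] at h3; lia
        · exact h5.2
    · rw [← h2, iff_comm (a := Anc par w a), key a h1]
      have h3 := hdep a h1 a.2
      have h4 := h.step w h0 hw
      rw [not_iff_not]
      constructor
      · intro hb
        left
        rw [hb]
        exact ⟨rfl, rfl⟩
      · rintro (h5 | ⟨h5, h6⟩)
        · exact h5.1
        · rw [← h5] at h4; rw [h6] at h3; lia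
  constructor
  · rintro ⟨p, hp, hep⟩
    -- A path has no repeated edge, so `e` is used once, an odd number of times; below, an unused
    -- edge is used zero times, an even number.
    rw [p.even_count_edges hf, List.count_eq_one_of_mem hp.isTrail.edges_nodup hep]
    simp
  · intro hne
    obtain ⟨p, hp, -⟩ := hT.2.2.existsUnique_path u v
    refine ⟨p, hp, ?_⟩
    by_contra hep
    rw [p.even_count_edges hf, List.count_eq_zero_of_not_mem hep] at hne
    simp at hne

theorem isParent_iff (h : IsRooting G T par pe dep) (u v : Fin n) :
    G.IsParent T ⟨0, h.n_pos⟩ u v ↔ 0 < (v : ℕ) ∧ par v = u := by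
  rw [WGraph.IsParent, h.dist, h.dist, h.adj]
  constructor
  · rintro ⟨h1 | ⟨h1, h2⟩, h3⟩
    · exact h1
    · have := h.step u h1 u.2
      rw [h2] at this
      lia
  · rintro ⟨h1, h2⟩
    refine ⟨.inl ⟨h1, h2⟩, ?_⟩
    rw [h.step v h1 v.2, h2]

/-- `subtreeSize` describes subtrees by distances, and this connects it with ancestors. If a
shortest path from the root to `x` can be led through `u`, the first step from `x` towards `u` also
approaches the root, so it leads to the parent, and one proceeds by induction. Conversely,
descending from `u` increases both distances by one per step. -/
theorem dist_eq_iff (h : IsRooting G T par pe dep) (hT : G.IsSpanningTree T) (u x : Fin n) :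
    (G.treeGraph T).dist ⟨0, h.n_pos⟩ x =
      (G.treeGraph T).dist ⟨0, h.n_pos⟩ u + (G.treeGraph T).dist u x ↔ Anc par u x := by
  set H := G.treeGraph T
  have htree : H.IsTree := hT.2.2
  constructor
  · suffices ∀ d, ∀ x : Fin n, H.dist u x = d → H.dist ⟨0, h.n_pos⟩ x = H.dist ⟨0, h.n_pos⟩ u + d →
      Anc par u x from fun hx => this _ x rfl hx
    intro d
    induction d with
    | zero =>
      intro x hx _
      rw [htree.connected.dist_eq_zero_iff] at hx
      rw [hx]
      exact .refl _
    | succ d ih =>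
      intro x hx hd
      obtain ⟨p, hp, hpl⟩ := htree.connected.exists_path_of_dist x u
      have hnil : ¬ p.Nil := fun hn => by
        have := hn.eq
        subst this
        simp at hx
      have hlen : p.tail.length + 1 = p.length := p.length_tail_add_one hnil
      have hadj := p.adj_snd hnil
      set y := p.snd
      have h1 : H.dist u y ≤ d := by
        rw [SimpleGraph.dist_comm]
        refine (SimpleGraph.dist_le p.tail).trans ?_
        rw [SimpleGraph.dist_comm] at hpl
        lia
      have h2 := htree.connected.dist_triangle (u := ⟨0, h.n_pos⟩) (v := u) (w := y)
      have h3 : H.dist ⟨0, h.n_pos⟩ x = H.dist ⟨0, h.n_pos⟩ y + 1 := by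
        rcases htree.dist_eq_dist_add_one_of_adj ⟨0, h.n_pos⟩ hadj with h3 | h3
        · exact h3
        · lia
      have h4 : H.dist u y = d := by lia
      have := ih y h4 (by lia)
      have h5 := (h.isParent_iff y x).1 ⟨hadj.symm, h3⟩
      rw [← h5.2] at this
      exact this.trans (.parent _)
  · suffices ∀ x, x < n → ∀ hx : x < n, Anc par u x → H.dist u ⟨x, hx⟩ + dep u ≤ dep x by
      intro ha
      have h1 := this x x.2 x.2 ha
      have h2 := htree.connected.dist_triangle (u := ⟨0, h.n_pos⟩) (v := u) (w := x)
      simp only [H, h.dist, Fin.eta] at h1 h2 ⊢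
      lia
    refine h.induction ?_ ?_
    · intro hx h1
      have h1 := h.anc_zero.1 h1
      have : u = ⟨0, hx⟩ := Fin.ext h1
      subst this
      simp
    · intro v h0 hv ih hx h1
      rcases Anc.iff_par.1 h1 with h2 | h2
      · have : u = ⟨v, hx⟩ := Fin.ext h2
        subst this
        simp
      · have h3 := ih (h.lt v) h2
        have h4 := htree.connected.dist_triangle (u := u) (v := ⟨par v, h.lt v⟩) (w := ⟨v, hx⟩)
        have h5 : H.dist ⟨par v, h.lt v⟩ ⟨v, hx⟩ = 1 :=
          SimpleGraph.dist_eq_one_iff_adj.2 ((h.adj _ _).2 (.inl ⟨h0, rfl⟩))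
        have h6 := h.step v h0 hv
        lia

end IsRooting

end rooting
end TwoRespect

namespace TwoRespect
variable {n m : ℕ}

/-! ## Correctness of the algorithm -/

/-! ### Weights with infinity. -/

section ext

theorem Ext.fin_add (a b : ℝ) : Ext.fin (a + b) = Ext.fin a + Ext.fin b := by
  simp only [Ext.fin, ← toLex_add, Prod.mk_add_mk, add_zero]

theorem Ext.fin_zero : Ext.fin 0 = 0 := rfl

theorem Ext.fin_le_fin {a b : ℝ} : Ext.fin a ≤ Ext.fin b ↔ a ≤ b := by
  simp [Ext.fin, Prod.Lex.toLex_le_toLex]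

theorem Ext.fin_le_fin_add_inf (a b : ℝ) : Ext.fin a ≤ Ext.fin b + Ext.inf := by
  simp [Ext.fin, Ext.inf, ← toLex_add, Prod.Lex.toLex_le_toLex]

end ext

open Classical in
/-- The amount that a call adds to the weight of the tree edge `e`. -/
noncomputable def WGraph.amount (G : WGraph n m) (T : Finset (Fin m)) (e : Fin m) : Cmd n → Ext
  | .pathAdd u v x => if G.OnPath T e u v then x else 0
  | .nonPathAdd u v x => if G.OnPath T e u v then 0 else x
  | .queryMin => 0

/-- The stored weights after a sequence of calls. -/
noncomputable def WGraph.updates (G : WGraph n m) (T : Finset (Fin m)) (D : Fin m → Ext)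
    (cs : List (Cmd n)) : Fin m → Ext := fun e => D e + (cs.map (G.amount T e)).sum

/-! ### The effect of the calls on the stored weights. -/

section answers
variable (G : WGraph n m) (T : Finset (Fin m))

/-- What a call adds to an edge does not depend on the stored weights. Hence the effect of a
sequence of calls is a sum, and queries can be evaluated without following the intermediate states.
-/
theorem WGraph.update_eq (D : Fin m → Ext) (c : Cmd n) :
    G.update T D c = fun e => D e + G.amount T e c := by
  cases c <;> funext e <;> simp only [update, amount] <;> (try split_ifs) <;> simp

theorem WGraph.updates_nil (D : Fin m → Ext) : G.updates T D [] = D := by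
  funext e
  simp [updates]

theorem WGraph.updates_cons (D : Fin m → Ext) (c : Cmd n) (cs : List (Cmd n)) :
    G.updates T D (c :: cs) = G.updates T (G.update T D c) cs := by
  funext e
  simp [updates, update_eq, add_assoc]

theorem WGraph.answers_append (D : Fin m → Ext) (cs cs' : List (Cmd n)) :
    G.answers T D (cs ++ cs') = G.answers T D cs ++ G.answers T (G.updates T D cs) cs' := by
  induction cs generalizing D with
  | nil => simp [answers, updates_nil]
  | cons c cs ih =>
    rw [updates_cons]
    cases c <;> simp [answers, ih, update]

theorem WGraph.answers_eq_nil (D : Fin m → Ext) {cs : List (Cmd n)} (h : Cmd.queryMin ∉ cs) :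
    G.answers T D cs = [] := by
  induction cs generalizing D with
  | nil => simp [answers]
  | cons c cs ih =>
    simp only [List.mem_cons, not_or] at h
    cases c
    · simp [answers, ih _ h.2]
    · simp [answers, ih _ h.2]
    · exact (h.1 rfl).elim

open Classical in
/-- The contribution of the non-tree edge `k` to the stored weight of `e`, if it is treated as on
its path according to `on`. -/
noncomputable def WGraph.share (on : Fin m → Prop) (e k : Fin m) : ℝ :=
  if on k ↔ G.On T e k then 0 else G.weight k

/-- The stored weight of `e` while the non-tree edges are treated according to `on`. -/
noncomputable def WGraph.stored (on : Fin m → Prop) (e : Fin m) : ℝ :=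
  G.weight e + ((nonTree T).map (G.share T on e)).sum

variable {G T}

theorem sum_map_fin {ι : Type*} (l : List ι) (f : ι → ℝ) :
    (l.map fun k => Ext.fin (f k)).sum = Ext.fin (l.map f).sum := by
  induction l with
  | nil => rfl
  | cons a l ih => rw [List.map_cons, List.sum_cons, ih, List.map_cons, List.sum_cons, Ext.fin_add]

theorem sum_flatMap_amount (e : Fin m) (l : List (Fin m)) (f : Fin m → List (Cmd n)) :
    ((l.flatMap f).map (G.amount T e)).sum = (l.map fun k => ((f k).map (G.amount T e)).sum).sum := by
  induction l with
  | nil => rfl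
  | cons a l ih => simp [ih]

/-- A change of the non-tree edge `k` from `on` to `on'`. -/
theorem sum_amount_undoOff_addOn (e k : Fin m) :
    (([G.undoOff k, G.addOn k] : List (Cmd n)).map (G.amount T e)).sum =
      Ext.fin (G.share T (fun _ => False) e k - G.share T (fun _ => True) e k) := by
  by_cases h : G.On T e k
  · have h' : G.OnPath T e (G.src k) (G.dst k) := h
    simp [WGraph.undoOff, WGraph.addOn, WGraph.amount, WGraph.share, h, h']
  · have h' : ¬ G.OnPath T e (G.src k) (G.dst k) := h
    simp [WGraph.undoOff, WGraph.addOn, WGraph.amount, WGraph.share, h, h']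

theorem sum_amount_undoOn_addOff (e k : Fin m) :
    (([G.undoOn k, G.addOff k] : List (Cmd n)).map (G.amount T e)).sum =
      Ext.fin (G.share T (fun _ => True) e k - G.share T (fun _ => False) e k) := by
  by_cases h : G.On T e k
  · have h' : G.OnPath T e (G.src k) (G.dst k) := h
    simp [WGraph.undoOn, WGraph.addOff, WGraph.amount, WGraph.share, h, h']
  · have h' : ¬ G.OnPath T e (G.src k) (G.dst k) := h
    simp [WGraph.undoOn, WGraph.addOff, WGraph.amount, WGraph.share, h, h']

theorem share_congr {on on' : Fin m → Prop} {e k : Fin m} (h : on k ↔ on' k) :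
    G.share T on e k = G.share T on' e k := by
  simp only [WGraph.share]
  split_ifs <;> first | rfl | (exfalso; tauto)

theorem updates_start (e : Fin m) :
    G.updates T G.initialWeights (G.start T e) = fun e' => Ext.fin (G.stored T (G.On T e) e') := by
  funext e'
  simp only [WGraph.updates, WGraph.initialWeights, WGraph.stored, Ext.fin_add, WGraph.start,
    List.map_map, ← sum_map_fin]
  congr 3
  funext k
  simp only [Function.comp, WGraph.share]
  split_ifs <;> simp_all [WGraph.addOff, WGraph.addOn, WGraph.amount, Ext.fin_zero, WGraph.On]

/-- The contributions of different non-tree edges are added up independently, so a change of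
treatment can be verified for one edge `k` at a time. -/
theorem updates_switch {on on' : Fin m → Prop} {f : Fin m → List (Cmd n)}
    (hf : ∀ e k, ((f k).map (G.amount T e)).sum =
      Ext.fin (G.share T on' e k - G.share T on e k)) :
    G.updates T (fun e => Ext.fin (G.stored T on e)) ((nonTree T).flatMap f) =
      fun e => Ext.fin (G.stored T on' e) := by
  funext e
  simp only [WGraph.updates, sum_flatMap_amount, hf, sum_map_fin, ← Ext.fin_add, WGraph.stored]
  congr 1
  rw [add_assoc, add_right_inj]
  induction nonTree T with
  | nil => simp
  | cons a l ih => simp only [List.map_cons, List.sum_cons]; linarith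

/-- Untouched edges have the same status for `e` and `e'`, and `share` depends on the treatment only
through this status. -/
theorem updates_advance (e e' : Fin m) :
    G.updates T (fun e'' => Ext.fin (G.stored T (G.On T e) e'')) (G.advance T e e') =
      fun e'' => Ext.fin (G.stored T (G.On T e') e'') := by
  refine updates_switch fun e'' k => ?_
  split_ifs with h1 h2
  · rw [sum_amount_undoOff_addOn]
    congr 2 <;> exact share_congr (by simp [h1])
  · rw [sum_amount_undoOn_addOff]
    congr 2 <;> exact share_congr (by simp [h2])
  · rw [share_congr (on := G.On T e') (on' := G.On T e) (by tauto)]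
    simp [Ext.fin_zero]

theorem updates_finish (e : Fin m) :
    G.updates T (fun e'' => Ext.fin (G.stored T (G.On T e) e'')) (G.finish T e) =
      fun e'' => Ext.fin (G.stored T (fun _ => False) e'') := by
  have : ∀ D, G.updates T D (G.finish T e) = G.updates T D ((nonTree T).flatMap fun k =>
      open Classical in if G.On T e k then [G.undoOff k, G.addOn k] else []) := by
    intro D
    funext e'
    simp [WGraph.updates, WGraph.finish, WGraph.amount]
  rw [this]
  refine updates_switch fun e'' k => ?_
  split_ifs with h1
  · rw [sum_amount_undoOff_addOn]
    congr 2; exact share_congr (by simp [h1])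
  · rw [share_congr (on := fun _ => False) (on' := G.On T e) (by tauto)]
    simp [Ext.fin_zero]

open Classical in
/-- The answer to the query for the tree edge `e`. -/
noncomputable def WGraph.probeAnswer (G : WGraph n m) (T : Finset (Fin m)) (e : Fin m) : Ext :=
  minWeight T fun e' => Ext.fin (G.stored T (G.On T e) e') + if G.On T e' e then Ext.inf else 0

/-- The answer to the last query. -/
noncomputable def WGraph.lastAnswer (G : WGraph n m) (T : Finset (Fin m)) : Ext :=
  minWeight T fun e' => Ext.fin (G.stored T (fun _ => False) e')

/-- Infinity is an element of a group, so the two infinite amounts cancel exactly. -/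
theorem updates_probe (D : Fin m → Ext) (e : Fin m) : G.updates T D (G.probe e) = D := by
  funext e'
  simp only [WGraph.updates, WGraph.probe, WGraph.amount, List.map_cons, List.map_nil,
    List.sum_cons, List.sum_nil]
  split_ifs <;> simp

theorem answers_probe (e : Fin m) :
    G.answers T (fun e' => Ext.fin (G.stored T (G.On T e) e')) (G.probe e) =
      [G.probeAnswer T e] := by
  simp only [WGraph.probe, WGraph.answers, WGraph.probeAnswer]
  congr 2
  funext e'
  rw [WGraph.update_eq]
  rfl

theorem queryMin_notMem_start (e : Fin m) : Cmd.queryMin ∉ G.start T e := by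
  simp only [WGraph.start, List.mem_map, not_exists, not_and]
  intro k _
  split_ifs <;> simp [WGraph.addOff, WGraph.addOn]

theorem queryMin_notMem_advance (e e' : Fin m) : Cmd.queryMin ∉ G.advance T e e' := by
  simp only [WGraph.advance, List.mem_flatMap, not_exists, not_and]
  intro k _
  split_ifs <;> simp [WGraph.addOff, WGraph.addOn, WGraph.undoOff, WGraph.undoOn]

theorem answers_iterate (e : Fin m) (es : List (Fin m)) :
    G.answers T (fun e' => Ext.fin (G.stored T (G.On T e) e')) (G.iterate T e es) =
      (e :: es).map (G.probeAnswer T) ++ [G.lastAnswer T] := by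
  induction es generalizing e with
  | nil =>
    rw [WGraph.iterate, WGraph.answers_append, answers_probe, updates_probe]
    have := updates_finish (G := G) (T := T) e
    rw [WGraph.finish] at this ⊢
    rw [WGraph.answers_append, WGraph.answers_eq_nil]
    · have h2 : ∀ D (l : List (Cmd n)), G.updates T D (l ++ [.queryMin]) = G.updates T D l := by
        intro D l
        funext e'
        simp [WGraph.updates, WGraph.amount]
      rw [h2] at this
      rw [this]
      simp [WGraph.answers, WGraph.lastAnswer]
    · simp only [List.mem_flatMap, not_exists, not_and]
      intro k _
      split_ifs <;> simp [WGraph.addOn, WGraph.undoOff]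
  | cons e' es ih =>
    rw [WGraph.iterate, List.append_assoc, WGraph.answers_append, answers_probe, updates_probe,
      WGraph.answers_append, WGraph.answers_eq_nil _ _ _ (queryMin_notMem_advance e e'),
      updates_advance, ih]
    simp

theorem answers_calls {es : List (Fin m)} (hes : es ≠ []) :
    G.answers T G.initialWeights (G.calls T es) =
      es.map (G.probeAnswer T) ++ [G.lastAnswer T] := by
  cases es with
  | nil => exact (hes rfl).elim
  | cons e es =>
    rw [WGraph.calls, WGraph.answers_append, WGraph.answers_eq_nil _ _ _ (queryMin_notMem_start e),
      updates_start, answers_iterate, List.nil_append]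

theorem candidates_eq {es : List (Fin m)} (hes : es ≠ []) :
    G.candidates T es =
      es.map (fun e => G.probeAnswer T e + Ext.fin (G.weight e)) ++ [G.lastAnswer T] := by
  rw [WGraph.candidates, answers_calls hes, List.zipWith_append (by simp)]
  simp [List.zipWith_map, List.zipWith_self]

end answers

theorem minWeight_spec {T : Finset (Fin m)} (hT : T.Nonempty) (D : Fin m → Ext) :
    (∃ e ∈ T, minWeight T D = D e) ∧ ∀ e ∈ T, minWeight T D ≤ D e := by
  rw [minWeight, dif_pos hT]
  exact ⟨by simpa using Finset.exists_mem_eq_inf' hT D, fun e he => Finset.inf'_le _ he⟩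

/-! ### Cuts and the tree edges that they cut -/

open Classical in
/-- The indicator of a proposition, modulo 2. -/
noncomputable def ind (p : Prop) : ZMod 2 := if p then 1 else 0

theorem ind_eq_one {p : Prop} : ind p = 1 ↔ p := by
  by_cases h : p <;> simp [ind, h]

theorem ind_pos {p : Prop} (h : p) : ind p = 1 := if_pos h

theorem ind_neg {p : Prop} (h : ¬ p) : ind p = 0 := if_neg h

theorem ind_congr {p q : Prop} (h : p ↔ q) : ind p = ind q := by rw [propext h]

theorem ind_eq_self (x : ZMod 2) : ind (x = 1) = x := by
  rcases (by decide : ∀ x : ZMod 2, x = 0 ∨ x = 1) x with rfl | rfl <;> simp [ind]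

theorem ind_not_iff {p q : Prop} : ind (¬ (p ↔ q)) = ind p + ind q := by
  by_cases h : p <;> by_cases h' : q <;> simp [ind, h, h']
  decide

theorem ind_and {p q : Prop} : ind (p ∧ q) = ind p * ind q := by
  by_cases h : p <;> by_cases h' : q <;> simp [ind, h, h']

theorem ind_add_self (x : ZMod 2) : x + x = 0 := CharTwo.add_self_eq_zero x

/-- The value of the cut that cuts exactly the tree edges in `F`. -/
noncomputable def WGraph.treeCutValue (G : WGraph n m) (T F : Finset (Fin m)) : ℝ :=
  open Classical in ∑ k with ∑ e ∈ F, ind (G.On T e k) = 1, G.weight k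

section cuts
variable {G : WGraph n m} {T : Finset (Fin m)} {par pe dep : ℕ → ℕ}

/-- The vertex below the tree edge `e` is an ancestor of `u`. -/
def AncEdge (n : ℕ) (par pe : ℕ → ℕ) (e : Fin m) (u : ℕ) : Prop :=
  ∃ w, 0 < w ∧ w < n ∧ pe w = e ∧ Anc par w u

theorem IsRooting.ancEdge_iff (h : IsRooting G T par pe dep) {w : ℕ} (h0 : 0 < w) (hw : w < n)
    {e : Fin m} (he : pe w = e) (u : ℕ) : AncEdge n par pe e u ↔ Anc par w u := by
  constructor
  · rintro ⟨w', h0', hw', he', ha⟩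
    rwa [h.pe_inj w w' h0 hw h0' hw' (he.trans he'.symm)]
  · exact fun ha => ⟨w, h0, hw, he, ha⟩

/-- Modulo 2 the condition "exactly one end is below `e`" becomes a sum over the two ends. This
makes the parity of path edges a difference of values at the ends. -/
theorem IsRooting.ind_on (h : IsRooting G T par pe dep) (hT : G.IsSpanningTree T) {e : Fin m}
    (he : e ∈ T) (k : Fin m) :
    ind (G.On T e k) = ind (AncEdge n par pe e (G.src k)) + ind (AncEdge n par pe e (G.dst k)) := by
  obtain ⟨w, h0, hw, hwe⟩ := h.pe_surj e he
  rw [← ind_not_iff, WGraph.On, h.onPath_iff hT h0 hw hwe.symm, h.ancEdge_iff h0 hw hwe,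
    h.ancEdge_iff h0 hw hwe]

/-- The only subtree that contains a vertex `v` but not its parent is the one with root `v`. -/
theorem IsRooting.on_tree_iff (h : IsRooting G T par pe dep) (hT : G.IsSpanningTree T) {e k : Fin m}
    (he : e ∈ T) (hk : k ∈ T) : G.On T e k ↔ e = k := by
  obtain ⟨w, h0, hw, hwe⟩ := h.pe_surj e he
  obtain ⟨v, hv0, hv, hvk⟩ := h.pe_surj k hk
  obtain ⟨k', -, hk', hends⟩ := h.pe_spec v hv0 hv
  have : k = k' := Fin.ext (hvk.symm.trans hk'.symm)
  subst this
  have h1 : G.On T e k ↔ ¬ (Anc par w v ↔ Anc par w (par v)) := by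
    rw [WGraph.On, h.onPath_iff hT h0 hw hwe.symm]
    rcases hends with ⟨h1, h2⟩ | ⟨h1, h2⟩
    · rw [h1, h2]
    · rw [h1, h2, not_iff_not]
      exact iff_comm
  rw [h1, Anc.iff_par (u := v)]
  constructor
  · intro h2
    have : w = v := by tauto
    subst this
    exact Fin.ext (hwe.symm.trans hvk)
  · rintro rfl
    have := h.pe_inj w v h0 hw hv0 hv (hwe.trans hvk.symm)
    subst this
    have := h.not_anc_par h0 hw
    tauto

/-- The number, modulo 2, of edges in `T` above `u`, weighted with `f`. -/
noncomputable def aboveSum (n : ℕ) (par pe : ℕ → ℕ) (T : Finset (Fin m)) (f : Fin m → ZMod 2)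
    (u : ℕ) : ZMod 2 := ∑ e ∈ T, f e * ind (AncEdge n par pe e u)

theorem IsRooting.aboveSum_root (h : IsRooting G T par pe dep) (f : Fin m → ZMod 2) :
    aboveSum n par pe T f 0 = 0 := by
  refine Finset.sum_eq_zero fun e _ => ?_
  have : ¬ AncEdge n par pe e 0 := by
    rintro ⟨w, h0, -, -, ha⟩
    rw [h.anc_zero] at ha
    lia
  simp [ind, this]

/-- The edge `e` is the only tree edge that is above `v` but not above its parent. -/
theorem IsRooting.aboveSum_step (h : IsRooting G T par pe dep) (f : Fin m → ZMod 2) {v : ℕ}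
    (h0 : 0 < v) (hv : v < n) {e : Fin m} (he : e ∈ T) (hve : pe v = e) :
    aboveSum n par pe T f v = aboveSum n par pe T f (par v) + f e := by
  have h1 : ¬ AncEdge n par pe e (par v) := by
    rw [h.ancEdge_iff h0 hv hve]
    exact h.not_anc_par h0 hv
  have h2 : AncEdge n par pe e v := (h.ancEdge_iff h0 hv hve v).2 (.refl v)
  rw [aboveSum, aboveSum, ← Finset.add_sum_erase _ _ he, ← Finset.add_sum_erase _ _ he]
  have : ∀ e' ∈ T.erase e, f e' * ind (AncEdge n par pe e' v) =
      f e' * ind (AncEdge n par pe e' (par v)) := by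
    intro e' he'
    obtain ⟨w, hw0, hw, hwe⟩ := h.pe_surj e' (Finset.mem_of_mem_erase he')
    rw [ind_congr]
    rw [h.ancEdge_iff hw0 hw hwe, h.ancEdge_iff hw0 hw hwe, Anc.iff_par (u := v)]
    have : w ≠ v := by
      rintro rfl
      exact Finset.ne_of_mem_erase he' (Fin.ext (hwe.symm.trans hve))
    tauto
  rw [Finset.sum_congr rfl this]
  simp [ind, h1, h2]
  ring

theorem IsRooting.aboveSum_on (h : IsRooting G T par pe dep) (hT : G.IsSpanningTree T)
    (f : Fin m → ZMod 2) (k : Fin m) :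
    aboveSum n par pe T f (G.src k) + aboveSum n par pe T f (G.dst k) =
      ∑ e ∈ T, f e * ind (G.On T e k) := by
  rw [aboveSum, aboveSum, ← Finset.sum_add_distrib]
  refine Finset.sum_congr rfl fun e he => ?_
  rw [h.ind_on hT he, mul_add]

/-- Membership in `S` acts as a potential: on the way from the root down to `u` it changes at the
cut tree edges, so modulo 2 it is a constant plus the number of cut edges above `u`. In the
difference for the two ends of `k` the constant and the common edges disappear, and the edges on the
path remain. -/
theorem IsRooting.ind_crosses (h : IsRooting G T par pe dep) (hT : G.IsSpanningTree T)
    (S : Finset (Fin n)) (k : Fin m) :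
    ind (G.Crosses S k) = ∑ e ∈ T, ind (G.Crosses S e) * ind (G.On T e k) := by
  set f : Fin m → ZMod 2 := fun e => ind (G.Crosses S e)
  have key : ∀ u, u < n → ∀ hu : u < n, ind ((⟨u, hu⟩ : Fin n) ∈ S) =
      ind ((⟨0, h.n_pos⟩ : Fin n) ∈ S) + aboveSum n par pe T f u := by
    refine h.toRTree.induction ?_ ?_
    · intro hu
      rw [h.aboveSum_root, add_zero]
    · intro v h0 hv ih hu
      obtain ⟨e, he, hev, hends⟩ := h.pe_spec v h0 hv
      rw [h.aboveSum_step f h0 hv he hev.symm, ← add_assoc, ← ih (h.lt v)]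
      have : f e = ind ((⟨v, hv⟩ : Fin n) ∈ S) + ind ((⟨par v, h.lt v⟩ : Fin n) ∈ S) := by
        rw [← ind_not_iff]
        refine ind_congr ?_
        rw [WGraph.Crosses]
        rcases hends with ⟨h1, h2⟩ | ⟨h1, h2⟩
        · rw [show G.src e = ⟨v, hv⟩ from Fin.ext h1, show G.dst e = ⟨par v, h.lt v⟩ from Fin.ext h2]
        · rw [show G.dst e = ⟨v, hv⟩ from Fin.ext h2, show G.src e = ⟨par v, h.lt v⟩ from Fin.ext h1]
          tauto
      rw [this, add_comm (ind ((⟨v, hv⟩ : Fin n) ∈ S)), ← add_assoc, ind_add_self, zero_add]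
  rw [← h.aboveSum_on hT, WGraph.Crosses, ind_not_iff, key _ (G.src k).2 (G.src k).2,
    key _ (G.dst k).2 (G.dst k).2]
  linear_combination ind_add_self (ind ((⟨0, h.n_pos⟩ : Fin n) ∈ S))

open Classical in
/-- The value of a cut depends only on the tree edges that it cuts. -/
theorem IsRooting.cutValue_eq (h : IsRooting G T par pe dep) (hT : G.IsSpanningTree T)
    (S : Finset (Fin n)) : G.cutValue S = G.treeCutValue T (T.filter (G.Crosses S)) := by
  rw [WGraph.cutValue, WGraph.treeCutValue]
  refine Finset.sum_congr ?_ fun _ _ => rfl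
  refine Finset.filter_congr fun k _ => ?_
  rw [← ind_eq_one (p := G.Crosses S k), h.ind_crosses hT, Finset.sum_filter]
  have : ∀ e ∈ T, ind (G.Crosses S e) * ind (G.On T e k) =
      if G.Crosses S e then ind (G.On T e k) else 0 := by
    intro e _
    split_ifs with h1 <;> simp [ind, h1]
  rw [Finset.sum_congr rfl this]

open Classical in
/-- Every set of tree edges is the set of tree edges that some cut cuts. -/
theorem IsRooting.exists_cut (h : IsRooting G T par pe dep) (hT : G.IsSpanningTree T)
    {F : Finset (Fin m)} (hF : F ⊆ T) : ∃ S : Finset (Fin n), T.filter (G.Crosses S) = F := by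
  set f : Fin m → ZMod 2 := fun e => ind (e ∈ F)
  -- One side consists of the vertices that have an odd number of edges of `F` above them.
  refine ⟨Finset.univ.filter fun u => aboveSum n par pe T f u = 1, ?_⟩
  ext k
  rw [Finset.mem_filter]
  constructor
  · rintro ⟨hk, hc⟩
    rw [WGraph.Crosses, ← ind_eq_one (p := ¬ _), ind_not_iff] at hc
    simp only [Finset.mem_filter, Finset.mem_univ, true_and, ind_eq_self] at hc
    rw [h.aboveSum_on hT, ← Finset.add_sum_erase _ _ hk, Finset.sum_eq_zero, add_zero,
      ← ind_and (p := k ∈ F), ind_eq_one] at hc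
    · exact hc.1
    · intro e he
      have := (h.on_tree_iff hT (Finset.mem_of_mem_erase he) hk).not.2 (Finset.ne_of_mem_erase he)
      simp [ind, this]
  · intro hk
    refine ⟨hF hk, ?_⟩
    rw [WGraph.Crosses, ← ind_eq_one (p := ¬ _), ind_not_iff]
    simp only [Finset.mem_filter, Finset.mem_univ, true_and, ind_eq_self]
    rw [h.aboveSum_on hT, ← Finset.add_sum_erase _ _ (hF hk), Finset.sum_eq_zero, add_zero,
      ← ind_and (p := k ∈ F), ind_eq_one]
    · exact ⟨hk, (h.on_tree_iff hT (hF hk) (hF hk)).2 rfl⟩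
    · intro e he
      have := (h.on_tree_iff hT (Finset.mem_of_mem_erase he) (hF hk)).not.2 (Finset.ne_of_mem_erase he)
      simp [ind, this]

open Classical in
-- Cuts are exchanged for the sets of tree edges that they cut, by `IsRooting.cutValue_eq` and
-- `IsRooting.exists_cut`. Properness of the two sides becomes non-emptiness of `F`, because the
-- tree is connected.
theorem IsRooting.mem_values_iff (h : IsRooting G T par pe dep) (hT : G.IsSpanningTree T) (x : ℝ) :
    x ∈ G.twoRespectingValues T ↔
      ∃ F ⊆ T, F.Nonempty ∧ F.card ≤ 2 ∧ G.treeCutValue T F = x := by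
  constructor
  · rintro ⟨S, ⟨a, ha⟩, hS, hR, rfl⟩
    refine ⟨T.filter (G.Crosses S), Finset.filter_subset _ _, ?_, hR, (h.cutValue_eq hT S).symm⟩
    by_contra hne
    rw [Finset.not_nonempty_iff_eq_empty, Finset.filter_eq_empty_iff] at hne
    -- If no tree edge is cut, every vertex is on the side of the root.
    have key : ∀ u, u < n → ∀ hu : u < n, ((⟨u, hu⟩ : Fin n) ∈ S ↔ (⟨0, h.n_pos⟩ : Fin n) ∈ S) := by
      refine h.toRTree.induction (fun _ => Iff.rfl) ?_
      intro v h0 hv ih hu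
      rw [← ih (h.lt v)]
      obtain ⟨e, he, hev, hends⟩ := h.pe_spec v h0 hv
      have h3 := hne he
      rw [WGraph.Crosses, not_not] at h3
      rcases hends with ⟨h1, h2⟩ | ⟨h1, h2⟩
      · rwa [show G.src e = ⟨v, hv⟩ from Fin.ext h1, show G.dst e = ⟨par v, h.lt v⟩ from Fin.ext h2] at h3
      · rw [show G.dst e = ⟨v, hv⟩ from Fin.ext h2, show G.src e = ⟨par v, h.lt v⟩ from Fin.ext h1] at h3
        exact h3.symm
    apply hS
    ext b
    have h1 := (key b b.2 b.2).trans (key a a.2 a.2).symm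
    simp only [Fin.eta] at h1
    simp [h1, ha]
  · rintro ⟨F, hF, ⟨e, he⟩, hc, rfl⟩
    obtain ⟨S, hS⟩ := h.exists_cut hT hF
    have hcr : G.Crosses S e := by
      rw [← hS] at he
      exact (Finset.mem_filter.1 he).2
    refine ⟨S, ?_, ?_, ?_, ?_⟩
    · by_contra hne
      rw [Finset.not_nonempty_iff_eq_empty] at hne
      simp [WGraph.Crosses, hne] at hcr
    · rintro rfl
      simp [WGraph.Crosses] at hcr
    · rw [WGraph.Respects, hS]
      exact hc
    · rw [h.cutValue_eq hT, hS]

theorem sum_nonTree (f : Fin m → ℝ) :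
    ((nonTree T).map f).sum = ∑ k with k ∉ T, f k := by
  classical
  rw [nonTree, ← List.sum_toFinset _ ((List.nodup_finRange m).filter _)]
  refine Finset.sum_congr ?_ fun _ _ => rfl
  ext k
  simp

theorem treeCutValue_split (F : Finset (Fin m)) : G.treeCutValue T F =
    (open Classical in ∑ k with k ∈ T, if ∑ e ∈ F, ind (G.On T e k) = 1 then G.weight k else 0) +
    ((nonTree T).map fun k =>
      open Classical in if ∑ e ∈ F, ind (G.On T e k) = 1 then G.weight k else 0).sum := by
  classical
  rw [sum_nonTree, Finset.sum_filter_add_sum_filter_not, WGraph.treeCutValue, Finset.sum_filter]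

/-- A non-tree edge crosses this cut if `e` is on its path, and such weights are added to `e` when
the current edge is treated as off all paths. -/
theorem IsRooting.treeCutValue_singleton (h : IsRooting G T par pe dep) (hT : G.IsSpanningTree T)
    {e : Fin m} (he : e ∈ T) : G.treeCutValue T {e} = G.stored T (fun _ => False) e := by
  classical
  rw [treeCutValue_split, WGraph.stored]
  congr 1
  · rw [Finset.sum_eq_single_of_mem e (by simpa using he)]
    · simp [ind_pos ((h.on_tree_iff hT he he).2 rfl)]
    · intro k hk hne
      have hk : k ∈ T := by simpa using hk
      simp [ind_neg ((h.on_tree_iff hT he hk).not.2 (Ne.symm hne))]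
  · congr 2
    funext k
    simp only [Finset.sum_singleton, ind_eq_one, WGraph.share]
    by_cases hon : G.On T e k <;> simp [hon]

/-- A non-tree edge crosses this cut if exactly one of `e` and `e'` is on its path, that is, if its
status differs for the current edge `e` and for `e'`; this is when `share` contributes. The weight
of `e'` is part of its stored weight, whereas that of `e` has to be added. -/
theorem IsRooting.treeCutValue_pair (h : IsRooting G T par pe dep) (hT : G.IsSpanningTree T)
    {e e' : Fin m} (he : e ∈ T) (he' : e' ∈ T) (hne : e' ≠ e) :
    G.treeCutValue T {e, e'} = G.stored T (G.On T e) e' + G.weight e := by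
  classical
  rw [treeCutValue_split, WGraph.stored]
  have h1 : (∑ k with k ∈ T, if ∑ f ∈ {e, e'}, ind (G.On T f k) = 1 then G.weight k else 0) =
      G.weight e' + G.weight e := by
    rw [← Finset.sum_subset (s₁ := {e', e})]
    · rw [Finset.sum_pair hne, Finset.sum_pair hne.symm, Finset.sum_pair hne.symm]
      simp [ind, h.on_tree_iff hT he he, h.on_tree_iff hT he he', h.on_tree_iff hT he' he,
        h.on_tree_iff hT he' he', hne, hne.symm]
    · intro k hk
      simp only [Finset.mem_insert, Finset.mem_singleton] at hk
      rcases hk with rfl | rfl <;> simpa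
    · intro k hk hk'
      have hk : k ∈ T := by simpa using hk
      simp only [Finset.mem_insert, Finset.mem_singleton, not_or] at hk'
      rw [Finset.sum_pair hne.symm]
      simp [ind, (h.on_tree_iff hT he hk), (h.on_tree_iff hT he' hk), Ne.symm hk'.1, Ne.symm hk'.2]
  rw [h1, add_right_comm]
  congr 2
  congr 1
  congr 1
  funext k
  rw [Finset.sum_pair hne.symm, ← ind_not_iff, WGraph.share]
  simp only [ind_eq_one]
  split_ifs <;> rfl

/-- The algorithm is correct for every order of the tree edges. -/
theorem exists_returns_isLeast (hn : 2 ≤ n) (hT : G.IsSpanningTree T) {es : List (Fin m)}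
    (hmem : ∀ k, k ∈ es ↔ k ∈ T) :
    ∃ x : ℝ, G.Returns T es x ∧ IsLeast (G.twoRespectingValues T) x := by
  classical
  obtain ⟨par, pe, dep, h⟩ := exists_isRooting (by lia) hT
  have hTne : T.Nonempty := by
    obtain ⟨k, hk, -⟩ := h.pe_spec 1 one_pos (by lia)
    exact ⟨k, hk⟩
  have hes : es ≠ [] := by
    rintro rfl
    obtain ⟨k, hk⟩ := hTne
    simpa using (hmem k).2 hk
  have hcand := candidates_eq (G := G) (T := T) hes
  have hlast : ∃ v ∈ G.twoRespectingValues T, G.lastAnswer T = Ext.fin v := by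
    obtain ⟨e, he, heq⟩ := (minWeight_spec hTne fun e' => Ext.fin (G.stored T (fun _ => False) e')).1
    refine ⟨_, ?_, heq⟩
    rw [h.mem_values_iff hT]
    exact ⟨{e}, by simpa, by simp, by simp, h.treeCutValue_singleton hT he⟩
  have hprobe : ∀ e ∈ T, (∃ v ∈ G.twoRespectingValues T,
      G.probeAnswer T e + Ext.fin (G.weight e) = Ext.fin v) ∨
      -- The answer is infinite if `e` is the only tree edge. Such a candidate exceeds all real
      -- numbers and does no harm.
      ∀ v, Ext.fin v ≤ G.probeAnswer T e + Ext.fin (G.weight e) := by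
    intro e he
    obtain ⟨e', he', heq⟩ := (minWeight_spec hTne fun e' =>
      Ext.fin (G.stored T (G.On T e) e') + if G.On T e' e then Ext.inf else 0).1
    rw [WGraph.probeAnswer, heq]
    by_cases hee : e' = e
    · right
      intro v
      rw [if_pos ((h.on_tree_iff hT he' he).2 hee), add_right_comm, ← Ext.fin_add]
      exact Ext.fin_le_fin_add_inf _ _
    · left
      refine ⟨G.stored T (G.On T e) e' + G.weight e, ?_, ?_⟩
      swap
      · rw [if_neg ((h.on_tree_iff hT he' he).not.2 hee), add_zero, ← Ext.fin_add]
      · rw [h.mem_values_iff hT]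
        refine ⟨{e, e'}, ?_, by simp, Finset.card_le_two, h.treeCutValue_pair hT he he' hee⟩
        intro k hk
        simp only [Finset.mem_insert, Finset.mem_singleton] at hk
        rcases hk with rfl | rfl <;> assumption
  have hlower : ∀ v ∈ G.twoRespectingValues T, ∃ c ∈ G.candidates T es, c ≤ Ext.fin v := by
    intro v hv
    rw [h.mem_values_iff hT] at hv
    obtain ⟨F, hF, hFne, hc, rfl⟩ := hv
    have hc' : F.card = 1 ∨ F.card = 2 := by
      have := hFne.card_pos
      lia
    rcases hc' with hc' | hc'
    · obtain ⟨e, rfl⟩ := Finset.card_eq_one.1 hc'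
      have he : e ∈ T := hF (by simp)
      refine ⟨G.lastAnswer T, by rw [hcand]; simp, ?_⟩
      rw [h.treeCutValue_singleton hT he]
      exact (minWeight_spec hTne fun e' => Ext.fin (G.stored T (fun _ => False) e')).2 e he
    · obtain ⟨e, e', hne, rfl⟩ := Finset.card_eq_two.1 hc'
      have he : e ∈ T := hF (by simp)
      have he' : e' ∈ T := hF (by simp)
      refine ⟨G.probeAnswer T e + Ext.fin (G.weight e), ?_, ?_⟩
      · rw [hcand]
        exact List.mem_append_left _ (List.mem_map.2 ⟨e, (hmem e).2 he, rfl⟩)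
      · rw [h.treeCutValue_pair hT he he' hne.symm, Ext.fin_add]
        have := (minWeight_spec hTne fun e' =>
          Ext.fin (G.stored T (G.On T e) e') + if G.On T e' e then Ext.inf else 0).2 e' he'
        rw [if_neg ((h.on_tree_iff hT he' he).not.2 hne.symm), add_zero] at this
        exact add_le_add_left this _
  obtain ⟨v₀, hv₀, hlv⟩ := hlast
  have hlastmem : Ext.fin v₀ ∈ G.candidates T es := by rw [hcand, hlv]; simp
  have hpos : 0 < (G.candidates T es).length := List.length_pos_of_mem hlastmem
  obtain ⟨hμ1, hμ2⟩ := List.minimum_eq_coe_iff.1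
    (List.coe_minimum_of_length_pos hpos).symm
  set μ := List.minimum_of_length_pos hpos
  have hμ : ∃ x ∈ G.twoRespectingValues T, μ = Ext.fin x := by
    have h1 := hμ1
    rw [hcand, List.mem_append, List.mem_map, List.mem_singleton] at h1
    rcases h1 with ⟨e, he, heq⟩ | heq
    · rcases hprobe e ((hmem e).1 he) with ⟨v, hv, hev⟩ | hbig
      · exact ⟨v, hv, heq.symm.trans hev⟩
      -- An infinite candidate could be the minimum only by being equal to the last candidate, which
      -- is finite.
      · exact ⟨v₀, hv₀, le_antisymm (hμ2 _ hlastmem) (heq ▸ hbig v₀)⟩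
    · exact ⟨v₀, hv₀, heq.trans hlv⟩
  obtain ⟨x, hx, hμx⟩ := hμ
  refine ⟨x, ?_, hx, fun v hv => ?_⟩
  · rw [WGraph.Returns, ← hμx]
    exact (List.coe_minimum_of_length_pos hpos).symm
  · obtain ⟨c, hc, hcv⟩ := hlower v hv
    have := (hμ2 c hc).trans hcv
    rwa [hμx, Ext.fin_le_fin] at this

end cuts

end TwoRespect

namespace TwoRespect

/-! ## Subtree sizes, heavy paths and preorder numbers -/

/-- The children of `v`. -/
def children (n : ℕ) (par : ℕ → ℕ) (v : ℕ) : Finset ℕ :=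
  (Finset.range n).filter fun c => 0 < c ∧ par c = v

theorem mem_children {n : ℕ} {par : ℕ → ℕ} {v c : ℕ} :
    c ∈ children n par v ↔ c < n ∧ 0 < c ∧ par c = v := by simp [children]

open Classical in
/-- The descendants of `v`. -/
noncomputable def subtree (n : ℕ) (par : ℕ → ℕ) (v : ℕ) : Finset ℕ :=
  (Finset.range n).filter fun u => Anc par v u

theorem mem_subtree {n : ℕ} {par : ℕ → ℕ} {v u : ℕ} :
    u ∈ subtree n par v ↔ u < n ∧ Anc par v u := by simp [subtree]

/-- The number of descendants of `v`. -/
noncomputable def size (n : ℕ) (par : ℕ → ℕ) (v : ℕ) : ℕ := (subtree n par v).card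

namespace RTree
variable {n : ℕ} {par dep : ℕ → ℕ}

theorem size_pos {v : ℕ} (hv : v < n) : 0 < size n par v :=
  Finset.card_pos.2 ⟨v, mem_subtree.2 ⟨hv, .refl v⟩⟩

theorem size_le (v : ℕ) : size n par v ≤ n := by
  classical
  exact (Finset.card_filter_le _ _).trans (Finset.card_range n).le

theorem subtree_eq (h : RTree n par dep) {v : ℕ} (hv : v < n) :
    subtree n par v = insert v ((children n par v).biUnion (subtree n par)) := by
  ext u
  simp only [mem_subtree, Finset.mem_insert, Finset.mem_biUnion, mem_children]
  constructor
  · rintro ⟨hu, ha⟩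
    by_cases hvu : v = u
    · exact .inl hvu.symm
    · obtain ⟨c, h0, hc, hp, ha'⟩ := h.exists_child hu ha hvu
      exact .inr ⟨c, ⟨hc, h0, hp⟩, hu, ha'⟩
  · rintro (rfl | ⟨c, ⟨hc, h0, rfl⟩, hu, ha⟩)
    · exact ⟨hv, .refl _⟩
    · exact ⟨hu, (Anc.parent c).trans ha⟩

theorem disjoint_children (h : RTree n par dep) (v : ℕ) :
    ((children n par v : Finset ℕ) : Set ℕ).PairwiseDisjoint (subtree n par) := by
  intro c hc d hd hne
  rw [Function.onFun, Finset.disjoint_left]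
  intro u hu hu'
  rw [Finset.mem_coe, mem_children] at hc hd
  rw [mem_subtree] at hu hu'
  exact hne (h.sibling_eq hc.2.1 hd.2.1 hu.1 (hc.2.2.trans hd.2.2.symm) hu.2 hu'.2)

theorem notMem_biUnion_children (h : RTree n par dep) (v : ℕ) :
    v ∉ (children n par v).biUnion (subtree n par) := by
  simp only [Finset.mem_biUnion, mem_children, mem_subtree, not_exists, not_and]
  rintro c ⟨hc, h0, rfl⟩ - ha
  exact h.not_anc_par h0 hc ha

theorem size_eq (h : RTree n par dep) {v : ℕ} (hv : v < n) :
    size n par v = ∑ c ∈ children n par v, size n par c + 1 := by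
  rw [size, h.subtree_eq hv, Finset.card_insert_of_notMem (h.notMem_biUnion_children v),
    Finset.card_biUnion (h.disjoint_children v)]
  rfl

theorem size_root (h : RTree n par dep) : size n par 0 = n := by
  classical
  rw [size, subtree, Finset.filter_true_of_mem, Finset.card_range]
  intro v hv
  exact h.anc_root (Finset.mem_range.1 hv)

theorem children_out (h : RTree n par dep) {v : ℕ} (hv : n ≤ v) : children n par v = ∅ := by
  ext c
  simp only [mem_children, Finset.notMem_empty, iff_false, not_and]
  rintro - - rfl
  exact absurd (h.lt c) hv.not_gt

theorem size_le_of_anc {w u : ℕ} (ha : Anc par w u) : size n par u ≤ size n par w :=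
  Finset.card_le_card fun x hx => by
    rw [mem_subtree] at hx ⊢
    exact ⟨hx.1, ha.trans hx.2⟩

end RTree

/-- `f` numbers the vertices in such a way that the descendants of a vertex are numbered
consecutively, starting with the vertex itself. -/
structure Numbering (n : ℕ) (par f : ℕ → ℕ) : Prop where
  zero : f 0 = 0
  lo : ∀ v, 0 < v → v < n → f (par v) + 1 ≤ f v
  hi : ∀ v, 0 < v → v < n → f v + size n par v ≤ f (par v) + size n par (par v)
  sib : ∀ v w, 0 < v → v < n → 0 < w → w < n → par v = par w → v ≠ w →
    f v + size n par v ≤ f w ∨ f w + size n par w ≤ f v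

namespace Numbering
variable {n : ℕ} {par dep f : ℕ → ℕ}

/-- The intervals from `f v` to `f v + size n par v` shrink on the way down. -/
theorem of_anc (hf : Numbering n par f) (h : RTree n par dep) {w u : ℕ} (hu : u < n)
    (ha : Anc par w u) : f w ≤ f u ∧ f u + size n par u ≤ f w + size n par w := by
  revert ha
  refine h.induction (P := fun u => Anc par w u → f w ≤ f u ∧
    f u + size n par u ≤ f w + size n par w) ?_ ?_ u hu
  · rw [h.anc_zero]
    rintro rfl
    exact ⟨le_rfl, le_rfl⟩
  · intro v h0 hv ih ha
    rcases Anc.iff_par.1 ha with rfl | ha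
    · exact ⟨le_rfl, le_rfl⟩
    · have := ih ha
      have := hf.lo v h0 hv
      have := hf.hi v h0 hv
      lia

/-- Where the ways from the root to two incomparable vertices part, they continue into different
siblings, whose intervals are disjoint. -/
theorem disjoint (hf : Numbering n par f) (h : RTree n par dep) {w u : ℕ} (hw : w < n) (hu : u < n)
    (ha : ¬ Anc par w u) (ha' : ¬ Anc par u w) :
    f w + size n par w ≤ f u ∨ f u + size n par u ≤ f w := by
  revert ha ha'
  refine h.induction (P := fun u => ¬ Anc par w u → ¬ Anc par u w →
    f w + size n par w ≤ f u ∨ f u + size n par u ≤ f w) ?_ ?_ u hu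
  · intro _ h2
    exact (h2 (h.anc_root hw)).elim
  · intro v h0 hv ih h1 h2
    have h3 : ¬ Anc par w (par v) := fun h3 => h1 (h3.trans (.parent v))
    by_cases h4 : Anc par (par v) w
    · have h5 : par v ≠ w := fun h5 => h3 (h5 ▸ .refl _)
      obtain ⟨c, hc0, hc, hp, hcw⟩ := h.exists_child hw h4 h5
      have h6 : c ≠ v := fun h6 => h2 (h6 ▸ hcw)
      have := hf.sib c v hc0 hc h0 hv hp h6
      have := hf.of_anc h hw hcw
      lia
    · have := ih h3 h4
      have := hf.lo v h0 hv
      have := hf.hi v h0 hv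
      lia

/-- The intervals of two vertices are nested or disjoint according to the ancestor relation, so an
ancestor query becomes two comparisons. -/
theorem anc_iff (hf : Numbering n par f) (h : RTree n par dep) {w u : ℕ} (hw : w < n) (hu : u < n) :
    Anc par w u ↔ f w ≤ f u ∧ f u < f w + size n par w := by
  have hpos : 0 < size n par u := RTree.size_pos hu
  have hpos' : 0 < size n par w := RTree.size_pos hw
  constructor
  · intro ha
    have := hf.of_anc h hu ha
    lia
  · intro h1
    by_contra ha
    by_cases ha' : Anc par u w
    · rcases Anc.iff_par.1 ha' with rfl | h2
      · exact ha (.refl _)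
      · have h0 : 0 < w := by
          rcases Nat.eq_zero_or_pos w with rfl | h0
          · exact (ha (h.anc_root hu)).elim
          · exact h0
        have := hf.of_anc h (h.lt w) h2
        have := hf.lo w h0 hw
        lia
    · have := hf.disjoint h hw hu ha ha'
      lia

theorem inj (hf : Numbering n par f) (h : RTree n par dep) {w u : ℕ} (hw : w < n) (hu : u < n)
    (he : f w = f u) : w = u := by
  have h1 : 0 < size n par w := RTree.size_pos hw
  have h2 : 0 < size n par u := RTree.size_pos hu
  exact h.anc_antisymm hu ((hf.anc_iff h hw hu).2 (by lia)) ((hf.anc_iff h hu hw).2 (by lia))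

theorem add_size_le (hf : Numbering n par f) (h : RTree n par dep) {v : ℕ} (hv : v < n) :
    f v + size n par v ≤ n := by
  have := hf.of_anc h hv (h.anc_root hv)
  rw [hf.zero, h.size_root] at this
  lia

theorem lt (hf : Numbering n par f) (h : RTree n par dep) {v : ℕ} (hv : v < n) : f v < n := by
  have := hf.add_size_le h hv
  have : 0 < size n par v := RTree.size_pos hv
  lia

theorem surj (hf : Numbering n par f) (h : RTree n par dep) {i : ℕ} (hi : i < n) :
    ∃ v, v < n ∧ f v = i := by
  have := Finset.surj_on_of_inj_on_of_card_le (s := Finset.range n) (t := Finset.range n)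
    (fun v _ => f v) (fun v hv => Finset.mem_range.2 (hf.lt h (Finset.mem_range.1 hv)))
    (fun a b ha hb he => hf.inj h (Finset.mem_range.1 ha) (Finset.mem_range.1 hb) he) le_rfl i
    (Finset.mem_range.2 hi)
  obtain ⟨v, hv, he⟩ := this
  exact ⟨v, Finset.mem_range.1 hv, he.symm⟩

end Numbering

/-- The heavy path decomposition: `hv` chooses heavy children (with value `0` if there are none),
`top` gives the top vertices of the heavy paths, `tin` is the preorder number when heavy children
come last, `pos` the preorder number when they come first, and `acc` is the total size of the light
siblings that come before a light vertex. -/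
structure HeavyPaths (n : ℕ) (par dep hv top tin pos acc : ℕ → ℕ) : Prop
    extends RTree n par dep where
  heavy : ∀ v, v < n → (hv v = 0 ∧ children n par v = ∅) ∨
    (hv v ∈ children n par v ∧ ∀ c ∈ children n par v, size n par c ≤ size n par (hv v))
  top_zero : top 0 = 0
  tin_zero : tin 0 = 0
  pos_zero : pos 0 = 0
  top_heavy : ∀ v, 0 < v → v < n → hv (par v) = v → top v = top (par v)
  tin_heavy : ∀ v, 0 < v → v < n → hv (par v) = v →
    tin v + size n par v = tin (par v) + size n par (par v)
  pos_heavy : ∀ v, 0 < v → v < n → hv (par v) = v → pos v = pos (par v) + 1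
  top_light : ∀ v, 0 < v → v < n → hv (par v) ≠ v → top v = v
  tin_light : ∀ v, 0 < v → v < n → hv (par v) ≠ v → tin v = tin (par v) + 1 + acc v
  pos_light : ∀ v, 0 < v → v < n → hv (par v) ≠ v →
    pos v = pos (par v) + 1 + size n par (hv (par v)) + acc v
  acc_le : ∀ v, 0 < v → v < n → hv (par v) ≠ v →
    acc v + size n par v + size n par (hv (par v)) + 1 ≤ size n par (par v)
  acc_sib : ∀ v w, 0 < v → v < n → 0 < w → w < n → hv (par v) ≠ v → hv (par w) ≠ w →
    par v = par w → v ≠ w → acc v + size n par v ≤ acc w ∨ acc w + size n par w ≤ acc v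

namespace HeavyPaths
variable {n : ℕ} {par dep hv top tin pos acc : ℕ → ℕ}

section
variable (h : HeavyPaths n par dep hv top tin pos acc)
include h

theorem hv_mem {v : ℕ} (h0 : 0 < v) (hvn : v < n) : hv (par v) ∈ children n par (par v) ∧
    size n par v ≤ size n par (hv (par v)) := by
  have hm : v ∈ children n par (par v) := mem_children.2 ⟨hvn, h0, rfl⟩
  rcases h.heavy _ (h.lt v) with h1 | h1
  · rw [h1.2] at hm
    simp at hm
  · exact ⟨h1.1, h1.2 v hm⟩

theorem size_par {v : ℕ} (h0 : 0 < v) (hvn : v < n) : size n par v + 1 ≤ size n par (par v) := by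
  rw [h.size_eq (h.lt v)]
  exact Nat.succ_le_succ (Finset.single_le_sum (f := size n par) (fun _ _ => Nat.zero_le _)
    (mem_children.2 ⟨hvn, h0, rfl⟩))

/-- The heavy sibling is at least as large, and both siblings are counted in the subtree of the
parent, together with the parent itself. -/
theorem two_mul_size {v : ℕ} (h0 : 0 < v) (hvn : v < n) (hl : hv (par v) ≠ v) :
    2 * size n par v + 1 ≤ size n par (par v) := by
  have h1 := h.hv_mem h0 hvn
  have h2 := Finset.sum_le_sum_of_subset (f := size n par) (s := {v, hv (par v)})
    (t := children n par (par v)) (by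
      intro c hc
      simp only [Finset.mem_insert, Finset.mem_singleton] at hc
      rcases hc with rfl | rfl
      · exact mem_children.2 ⟨hvn, h0, rfl⟩
      · exact h1.1)
  rw [Finset.sum_pair hl.symm] at h2
  rw [h.size_eq (h.lt v)]
  lia

/-- The light children fill the interval of the parent from the front, one block after another
according to `acc`, and the heavy child takes the rear end. -/
theorem numbering_tin : Numbering n par tin where
  zero := h.tin_zero
  lo v h0 hvn := by
    by_cases hl : hv (par v) = v
    · have := h.tin_heavy v h0 hvn hl
      have := h.size_par h0 hvn
      lia
    · have := h.tin_light v h0 hvn hl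
      lia
  hi v h0 hvn := by
    by_cases hl : hv (par v) = v
    · exact (h.tin_heavy v h0 hvn hl).le
    · have := h.tin_light v h0 hvn hl
      have := h.acc_le v h0 hvn hl
      lia
  sib v w h0 hvn h0' hwn hp hne := by
    by_cases hl : hv (par v) = v
    · have hl' : hv (par w) ≠ w := by rw [← hp, hl]; exact hne
      have := h.tin_heavy v h0 hvn hl
      have := h.tin_light w h0' hwn hl'
      have := h.acc_le w h0' hwn hl'
      rw [← hp, hl] at this
      rw [← hp] at *
      lia
    · by_cases hl' : hv (par w) = w
      · have := h.tin_heavy w h0' hwn hl'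
        have := h.tin_light v h0 hvn hl
        have := h.acc_le v h0 hvn hl
        rw [hp, hl'] at this
        rw [hp] at *
        lia
      · have h1 := h.tin_light v h0 hvn hl
        have h2 := h.tin_light w h0' hwn hl'
        have := h.acc_sib v w h0 hvn h0' hwn hl hl' hp hne
        rw [← hp] at h2
        lia

/-- The heavy child takes the numbers right after its parent, and the light children follow, one
block after another according to `acc`. -/
theorem numbering_pos : Numbering n par pos where
  zero := h.pos_zero
  lo v h0 hvn := by
    by_cases hl : hv (par v) = v
    · exact (h.pos_heavy v h0 hvn hl).ge
    · have := h.pos_light v h0 hvn hl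
      lia
  hi v h0 hvn := by
    by_cases hl : hv (par v) = v
    · have := h.pos_heavy v h0 hvn hl
      have := h.size_par h0 hvn
      lia
    · have := h.pos_light v h0 hvn hl
      have := h.acc_le v h0 hvn hl
      lia
  sib v w h0 hvn h0' hwn hp hne := by
    by_cases hl : hv (par v) = v
    · have hl' : hv (par w) ≠ w := by rw [← hp, hl]; exact hne
      have h1 := h.pos_heavy v h0 hvn hl
      have h2 := h.pos_light w h0' hwn hl'
      rw [← hp, hl] at h2
      lia
    · by_cases hl' : hv (par w) = w
      · have h1 := h.pos_heavy w h0' hwn hl'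
        have h2 := h.pos_light v h0 hvn hl
        rw [hp, hl'] at h2
        lia
      · have h1 := h.pos_light v h0 hvn hl
        have h2 := h.pos_light w h0' hwn hl'
        have := h.acc_sib v w h0 hvn h0' hwn hl hl' hp hne
        rw [← hp] at h2
        lia

theorem tin_lt {v : ℕ} (hvn : v < n) : tin v < n := h.numbering_tin.lt h.toRTree hvn

theorem pos_lt {v : ℕ} (hvn : v < n) : pos v < n := h.numbering_pos.lt h.toRTree hvn

end

end HeavyPaths

/-- The heavy path decomposition, with the inverse functions `vat` and `ev` of `tin` and `pos`. -/
structure HLD (n : ℕ) (par dep hv top tin pos vat ev acc : ℕ → ℕ) : Prop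
    extends HeavyPaths n par dep hv top tin pos acc where
  vat_tin : ∀ v, v < n → vat (tin v) = v
  ev_pos : ∀ v, v < n → ev (pos v) = v

namespace HLD
variable {n : ℕ} {par dep hv top tin pos vat ev acc : ℕ → ℕ}

section
variable (h : HLD n par dep hv top tin pos vat ev acc)
include h

theorem vat_spec {i : ℕ} (hi : i < n) : vat i < n ∧ tin (vat i) = i := by
  obtain ⟨v, hvn, rfl⟩ := h.numbering_tin.surj h.toRTree hi
  rw [h.vat_tin v hvn]
  exact ⟨hvn, rfl⟩

theorem ev_spec {i : ℕ} (hi : i < n) : ev i < n ∧ pos (ev i) = i := by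
  obtain ⟨v, hvn, rfl⟩ := h.numbering_pos.surj h.toRTree hi
  rw [h.ev_pos v hvn]
  exact ⟨hvn, rfl⟩

theorem ev_ne_zero {i : ℕ} (hi : i < n) (h0 : 0 < i) : 0 < ev i := by
  have := (h.ev_spec hi).2
  rcases Nat.eq_zero_or_pos (ev i) with h1 | h1
  · rw [h1, h.pos_zero] at this
    lia
  · exact h1

/-- The claims pass from the parent to a heavy child and start anew at a light one. The one about
`tin v + size n par v` is the reason for numbering heavy children last: the intervals of all
vertices of a heavy path have the same end, so subtree sums are suffix sums. -/
theorem top_spec : ∀ v, v < n → top v < n ∧ Anc par (top v) v ∧ top (top v) = top v ∧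
    (0 < top v → hv (par (top v)) ≠ top v) ∧
    tin v + size n par v = tin (top v) + size n par (top v) ∧
    ∀ x, Anc par (top v) x → Anc par x v → top x = top v := by
  refine h.toRTree.induction ?_ ?_
  · rw [h.top_zero]
    refine ⟨h.n_pos, .refl 0, h.top_zero, by simp, rfl, fun x hx hx' => ?_⟩
    rw [h.anc_zero.1 hx', h.top_zero]
  · intro v h0 hvn ih
    by_cases hl : hv (par v) = v
    · rw [h.top_heavy v h0 hvn hl, h.tin_heavy v h0 hvn hl]
      obtain ⟨h1, h2, h3, h4, h5, h6⟩ := ih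
      refine ⟨h1, h2.trans (.parent v), h3, h4, h5, fun x hx hx' => ?_⟩
      rcases Anc.iff_par.1 hx' with rfl | hx'
      · exact h.top_heavy x h0 hvn hl
      · exact h6 x hx hx'
    · rw [h.top_light v h0 hvn hl]
      refine ⟨hvn, .refl v, h.top_light v h0 hvn hl, fun _ => hl, rfl, fun x hx hx' => ?_⟩
      rw [h.anc_antisymm hvn hx' hx]
      exact h.top_light v h0 hvn hl

theorem top_lt {v : ℕ} (hvn : v < n) : top v < n := (h.top_spec v hvn).1
theorem anc_top {v : ℕ} (hvn : v < n) : Anc par (top v) v := (h.top_spec v hvn).2.1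
theorem top_top {v : ℕ} (hvn : v < n) : top (top v) = top v := (h.top_spec v hvn).2.2.1
theorem light_top {v : ℕ} (hvn : v < n) (h0 : 0 < top v) : hv (par (top v)) ≠ top v :=
  (h.top_spec v hvn).2.2.2.1 h0
theorem tout_top {v : ℕ} (hvn : v < n) :
    tin v + size n par v = tin (top v) + size n par (top v) := (h.top_spec v hvn).2.2.2.2.1
theorem top_between {v x : ℕ} (hvn : v < n) (hx : Anc par (top v) x) (hx' : Anc par x v) :
    top x = top v := (h.top_spec v hvn).2.2.2.2.2 x hx hx'

theorem tin_anc {w u : ℕ} (hw : w < n) (hu : u < n) :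
    Anc par w u ↔ tin w ≤ tin u ∧ tin u < tin w + size n par w :=
  h.numbering_tin.anc_iff h.toRTree hw hu

/-- The vertices between `c` and the top of its heavy path. -/
theorem pos_between {c w : ℕ} (hc : c < n) (hw : w < n) :
    (Anc par (top c) w ∧ Anc par w c) ↔ pos (top c) ≤ pos w ∧ pos w ≤ pos c := by
  constructor
  · rintro ⟨h1, h2⟩
    exact ⟨(h.numbering_pos.of_anc h.toRTree hw h1).1, (h.numbering_pos.of_anc h.toRTree hc h2).1⟩
  · rintro ⟨h1, h2⟩
    refine ⟨?_, ?_⟩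
    · rw [h.numbering_pos.anc_iff h.toRTree (h.top_lt hc) hw]
      have := h.numbering_pos.of_anc h.toRTree hc (h.anc_top hc)
      have : 0 < size n par c := RTree.size_pos hc
      lia
    · revert h1 h2
      refine h.toRTree.induction (P := fun c => pos (top c) ≤ pos w → pos w ≤ pos c → Anc par w c)
        ?_ ?_ c hc
      · intro _ h2
        have : w = 0 := h.numbering_pos.inj h.toRTree hw h.n_pos
          (by rw [h.pos_zero] at h2 ⊢; lia)
        rw [this]
        exact .refl 0
      · intro v h0 hvn ih h1 h2
        by_cases he : pos w = pos v
        · rw [h.numbering_pos.inj h.toRTree hw hvn he]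
          exact .refl v
        · by_cases hl : hv (par v) = v
          · have := h.pos_heavy v h0 hvn hl
            rw [h.top_heavy v h0 hvn hl] at h1
            exact (ih h1 (by lia)).trans (.parent v)
          · rw [h.top_light v h0 hvn hl] at h1
            lia

/-- The way from `c` to the root first follows the heavy path of `c` up to its top and then
continues from the parent of the top. -/
theorem anc_iff_top {c w : ℕ} (hc : c < n) :
    Anc par w c ↔ (Anc par (top c) w ∧ Anc par w c) ∨ (0 < top c ∧ Anc par w (par (top c))) := by
  constructor
  · intro ha
    rcases h.anc_total hc (h.anc_top hc) ha with h1 | h1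
    · exact .inl ⟨h1, ha⟩
    · rcases Anc.iff_par.1 h1 with rfl | h2
      · exact .inl ⟨.refl _, ha⟩
      · by_cases h0 : 0 < top c
        · exact .inr ⟨h0, h2⟩
        · have : top c = 0 := by lia
          rw [this, h.anc_zero] at h1
          rw [this, h1]
          exact .inl ⟨.refl _, h.anc_root hc⟩
  · rintro (h1 | h1)
    · exact h1.2
    · exact h1.2.trans ((Anc.parent _).trans (h.anc_top hc))

/-- When two consecutive edges of the heavy-light order are not both ancestors of `c`. -/
theorem switch {c i : ℕ} (hc : c < n) (hi : i + 1 < n)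
    (hs : ¬ (Anc par (ev i) c ↔ Anc par (ev (i + 1)) c)) :
    i = pos c ∨ i = pos (top c) - 1 ∨
      (0 < top c ∧ ¬ (Anc par (ev i) (par (top c)) ↔ Anc par (ev (i + 1)) (par (top c)))) := by
  have h1 := h.ev_spec (i := i) (by lia)
  have h2 := h.ev_spec hi
  rw [h.anc_iff_top hc, h.anc_iff_top (w := ev (i + 1)) hc, h.pos_between hc h1.1,
    h.pos_between hc h2.1, h1.2, h2.2] at hs
  by_cases h3 : i = pos c
  · exact .inl h3
  · by_cases h4 : i + 1 = pos (top c)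
    · right; left; lia
    · right; right
      -- Away from the two ends of the interval of positions, `i` and `i + 1` are both inside it or
      -- both outside.
      have : (pos (top c) ≤ i ∧ i ≤ pos c) ↔ (pos (top c) ≤ i + 1 ∧ i + 1 ≤ pos c) := by lia
      rw [this] at hs
      tauto

/-- The step of the computation of lowest common ancestors. -/
theorem lca_step {a b : ℕ} (ha : a < n) (hb : b < n) (ht : tin (top b) < tin (top a)) :
    0 < top a ∧ ∀ w, (Anc par w (par (top a)) ∧ Anc par w b) ↔ (Anc par w a ∧ Anc par w b) := by
  have h0 : 0 < top a := by
    rcases Nat.eq_zero_or_pos (top a) with h0 | h0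
    · rw [h0, h.tin_zero] at ht
      lia
    · exact h0
  -- Otherwise the later top `top a` would lie between `top b` and `b`, hence on the heavy path of
  -- `b`, and the two tops would coincide.
  have key : ¬ Anc par (top a) b := by
    intro h1
    have h2 : Anc par (top b) (top a) := by
      rcases h.anc_total hb (h.anc_top hb) h1 with h2 | h2
      · exact h2
      · have := (h.numbering_tin.of_anc h.toRTree (h.top_lt hb) h2).1
        lia
    have := h.top_between hb h2 h1
    rw [h.top_top ha] at this
    rw [this] at ht
    exact lt_irrefl _ ht
  refine ⟨h0, fun w => ⟨fun h1 => ⟨h1.1.trans ((Anc.parent _).trans (h.anc_top ha)), h1.2⟩,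
    fun h1 => ⟨?_, h1.2⟩⟩⟩
  rcases (h.anc_iff_top ha).1 h1.1 with h2 | h2
  · exact (key (h2.1.trans h1.2)).elim
  · exact h2.2

/-- The end of the computation of lowest common ancestors. -/
theorem lca_end {a b : ℕ} (ha : a < n) (hb : b < n) (ht : top a = top b) (hle : tin a ≤ tin b) :
    Anc par a b := by
  rw [h.tin_anc ha hb]
  refine ⟨hle, ?_⟩
  rw [h.tout_top ha, ht, ← h.tout_top hb]
  have : 0 < size n par b := RTree.size_pos hb
  lia

/-- Each step upwards from the top of a heavy path doubles the size of the subtree. -/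
theorem log_size_climb {v : ℕ} (hvn : v < n) (h0 : 0 < top v) :
    Nat.log 2 (size n par v) + 1 ≤ Nat.log 2 (size n par (par (top v))) := by
  have h1 := h.two_mul_size h0 (h.top_lt hvn) (h.light_top hvn h0)
  have h2 : size n par v ≤ size n par (top v) := RTree.size_le_of_anc (h.anc_top hvn)
  have h3 : 0 < size n par v := RTree.size_pos hvn
  rw [← Nat.log_mul_base (by lia) (by lia)]
  exact Nat.log_mono_right (by lia)

end

end HLD

end TwoRespect

namespace TwoRespect

/-! ## The program: rooting the tree -/

-- Names of the memory cells: word variables `v…` and arrays `a…`.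

notation "vN" => (0 : ℕ)
notation "vM" => (1 : ℕ)
notation "vI" => (2 : ℕ)
notation "vX" => (3 : ℕ)
notation "vP" => (4 : ℕ)
notation "vE" => (5 : ℕ)
notation "vQ" => (6 : ℕ)
notation "aSRC" => (0 : ℕ)
notation "aDST" => (1 : ℕ)
notation "aFLAG" => (2 : ℕ)
notation "aDEG" => (3 : ℕ)
notation "aSUM" => (4 : ℕ)
notation "aPAR" => (5 : ℕ)
notation "aPE" => (6 : ℕ)
notation "aSZ" => (7 : ℕ)
notation "aHV" => (8 : ℕ)
notation "aQ" => (9 : ℕ)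
notation "aTIN" => (10 : ℕ)
notation "aPOS" => (11 : ℕ)
notation "aTOP" => (12 : ℕ)
notation "aACC" => (13 : ℕ)
notation "aVAT" => (14 : ℕ)
notation "aEV" => (15 : ℕ)
notation "aAV" => (16 : ℕ)

/-- The instruction `a[i] := a[i] + x`. -/
def addTo (a : ℕ) (i x : WExpr) : Prog := .storeW a i (.add (.get a i) x)

/-- The instruction `a[i] := a[i] - x`. -/
def subFrom (a : ℕ) (i x : WExpr) : Prog := .storeW a i (.sub (.get a i) x)

/-- The instruction `i := i + 1`. -/
def incr (i : ℕ) : Prog := .setW i (.add (.var i) (.lit 1))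

/-- The instruction `i := i - 1`. -/
def decr (i : ℕ) : Prog := .setW i (.sub (.var i) (.lit 1))

/-- The facts about the arrays of the input that are used to root the tree. -/
structure TreeInput (n m : ℕ) (src dst flag par pe dep : ℕ → ℕ) : Prop extends RTree n par dep where
  pe_out : ∀ v, n ≤ v ∨ v = 0 → pe v = 0
  pe_lt : ∀ v, 0 < v → v < n → pe v < m
  flag_pe : ∀ v, 0 < v → v < n → flag (pe v) = 1
  ends : ∀ v, 0 < v → v < n → (src (pe v) = v ∧ dst (pe v) = par v) ∨
    (src (pe v) = par v ∧ dst (pe v) = v)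
  surj : ∀ k, k < m → flag k = 1 → ∃ v, 0 < v ∧ v < n ∧ pe v = k
  inj : ∀ v w, 0 < v → v < n → 0 < w → w < n → pe v = pe w → v = w

/-- Sums over the tree edges as sums over the vertices other than the root. -/
theorem TreeInput.sum_flag {n m : ℕ} {src dst flag par pe dep : ℕ → ℕ}
    (h : TreeInput n m src dst flag par pe dep) (g : ℕ → ℕ) :
    ∑ k ∈ Finset.range m, (if flag k = 1 then g k else 0) = ∑ c ∈ Finset.Ioo 0 n, g (pe c) := by
  rw [← Finset.sum_filter]
  symm
  refine Finset.sum_nbij pe ?_ ?_ ?_ fun _ _ => rfl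
  · intro v hv
    rw [Finset.mem_Ioo] at hv
    simp [h.pe_lt v hv.1 hv.2, h.flag_pe v hv.1 hv.2]
  · intro v hv w hw he
    simp only [Finset.coe_Ioo, Set.mem_Ioo] at hv hw
    exact h.inj v w hv.1 hv.2 hw.1 hw.2 he
  · intro k hk
    simp only [Finset.coe_filter, Finset.mem_range, Set.mem_ofPred_eq] at hk
    obtain ⟨v, h0, hv, he⟩ := h.surj k hk.1 hk.2
    exact ⟨v, by simp [h0, hv], he⟩

/-- Every tree edge is `pe c` for one vertex `c`, and its ends are `c` and `par c`. At `v` this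
leaves the edge to the parent and the edges to the children. -/
theorem TreeInput.sum_incident {n m : ℕ} {src dst flag par pe dep : ℕ → ℕ}
    (h : TreeInput n m src dst flag par pe dep) (g : ℕ → ℕ) {v : ℕ} (hv : v < n) :
    ∑ k ∈ Finset.range m, (if flag k = 1 then
      (if src k = v then g (k + 1) else 0) + (if dst k = v then g (k + 1) else 0) else 0) =
    (if 0 < v then g (pe v + 1) else 0) + ∑ c ∈ children n par v, g (pe c + 1) := by
  rw [h.sum_flag fun k => (if src k = v then g (k + 1) else 0) + (if dst k = v then g (k + 1) else 0)]
  have h1 : ∀ c ∈ Finset.Ioo 0 n,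
      ((if src (pe c) = v then g (pe c + 1) else 0) + if dst (pe c) = v then g (pe c + 1) else 0) =
      (if c = v then g (pe c + 1) else 0) + if par c = v then g (pe c + 1) else 0 := by
    intro c hc
    rw [Finset.mem_Ioo] at hc
    rcases h.ends c hc.1 hc.2 with ⟨h1, h2⟩ | ⟨h1, h2⟩
    · rw [h1, h2]
    · rw [h1, h2, add_comm]
  rw [Finset.sum_congr rfl h1, Finset.sum_add_distrib, Finset.sum_ite_eq']
  congr 1
  · simp [hv]
  · rw [← Finset.sum_filter]
    refine Finset.sum_congr ?_ fun _ _ => rfl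
    ext c
    simp only [Finset.mem_filter, Finset.mem_Ioo, mem_children]
    tauto

/-- Computes the degrees in the tree and the sums of the incident tree edges. -/
def initDegrees : Prog :=
  .setW vI (.lit 0) ;;
  .loop (.wlt (.var vI) (.var vM))
    (.ite (.weq (.get aFLAG (.var vI)) (.lit 1))
      (addTo aDEG (.get aSRC (.var vI)) (.lit 1) ;;
       addTo aSUM (.get aSRC (.var vI)) (.var vI) ;;
       addTo aDEG (.get aDST (.var vI)) (.lit 1) ;;
       addTo aSUM (.get aDST (.var vI)) (.var vI)) .skip ;;
     incr vI)

variable {B K n m : ℕ}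

theorem run_initDegrees {s : State} (hm : s.wvar vM = m)
    (hK : 2 * (m + 1) * (m + 1) ≤ K) (h3 : s.warr aDEG = fun _ => 0)
    (h4 : s.warr aSUM = fun _ => 0) :
    Run B K initDegrees s (60 * m + 60) fun s' =>
      (∀ v, s'.warr aDEG v = ∑ k ∈ Finset.range m, (if s.warr aFLAG k = 1 then
        (if s.warr aSRC k = v then 1 else 0) + (if s.warr aDST k = v then 1 else 0) else 0)) ∧
      (∀ v, s'.warr aSUM v = ∑ k ∈ Finset.range m, (if s.warr aFLAG k = 1 then
        (if s.warr aSRC k = v then k else 0) + (if s.warr aDST k = v then k else 0) else 0)) := by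
  set src := s.warr aSRC
  set dst := s.warr aDST
  set flag := s.warr aFLAG
  -- A sum of edge indices has at most `m` terms, each at most `2 * m`; these sums are the reason
  -- for a bound `K` that is quadratic in `m`.
  have hb : ∀ j ≤ m, ∀ v, (∑ k ∈ Finset.range j, (if flag k = 1 then
      (if src k = v then 1 else 0) + (if dst k = v then 1 else 0) else 0)) ≤ 2 * m ∧
      (∑ k ∈ Finset.range j, (if flag k = 1 then
        (if src k = v then k else 0) + (if dst k = v then k else 0) else 0)) ≤ 2 * m * m := by
    intro j hj v
    constructor
    · refine (Finset.sum_le_card_nsmul _ _ 2 fun k _ => ?_).trans ?_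
      · split_ifs <;> lia
      · simp only [Finset.card_range, smul_eq_mul]; lia
    · refine (Finset.sum_le_card_nsmul _ _ (2 * m) fun k hk => ?_).trans ?_
      · rw [Finset.mem_range] at hk
        split_ifs <;> lia
      · simp only [Finset.card_range, smul_eq_mul]
        nlinarith
  refine (Run.seq' (R := fun s' => s' = s.setW vI 0) (.of_wp ?_) ?_).time_mono
    (T₁ := 2 + (m * (56 + 3 + 1) + 3 + 1)) (by lia)
  · simp [Prog.wp, WExpr.eval]
  rintro s1 - - rfl
  refine Run.loop_count (fun j s' => s'.wvar vI = j ∧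
      (∀ v, s'.warr aDEG v = ∑ k ∈ Finset.range j, (if flag k = 1 then
        (if src k = v then 1 else 0) + (if dst k = v then 1 else 0) else 0)) ∧
      (∀ v, s'.warr aSUM v = ∑ k ∈ Finset.range j, (if flag k = 1 then
        (if src k = v then k else 0) + (if dst k = v then k else 0) else 0))) m 56 ?_ ?_ ?_
  · simp [h3, h4]
  · rintro j hj s' - ha ⟨h1, h2, h5⟩
    have e0 : s'.warr aSRC = src := ha.wa _ rfl
    have e1 : s'.warr aDST = dst := ha.wa _ rfl
    have e2 : s'.warr aFLAG = flag := ha.wa _ rfl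
    have em : s'.wvar vM = m := (ha.w _ rfl).trans (by simpa using hm)
    refine ⟨by simpa [Cond.Holds, WExpr.eval, h1, em] using hj, Run.of_wp' (by decide) ?_⟩
    have hbj := fun v => hb j hj.le v
    simp only [← h2, ← h5] at hbj
    have b1 := hbj (src j)
    have b2 := hbj (dst j)
    have hK1 : 2 * m + 2 ≤ K := by nlinarith
    have hK2 : 2 * m * m + 2 * m ≤ K := by nlinarith
    simp [Prog.wp, addTo, incr, Cond.Holds, WExpr.eval, h1, e0, e1, e2, Finset.sum_range_succ,
      ← h2, ← h5]
    constructor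
    · intro hf
      simp only [hf, if_true]
      refine ⟨by lia, by lia, ?_, ?_, by lia, fun v => ?_, fun v => ?_⟩
      · rw [Function.update_apply]
        split_ifs <;> lia
      · rw [Function.update_apply]
        split_ifs <;> lia
      · simp only [Function.update_apply]
        split_ifs <;> subst_vars <;> lia
      · simp only [Function.update_apply]
        split_ifs <;> subst_vars <;> lia
    · intro hf
      simp [hf]
      lia
  · rintro s' - ha ⟨h1, h2, h5⟩
    have em : s'.wvar vM = m := (ha.w _ rfl).trans (by simpa using hm)
    exact ⟨by simp [Cond.Holds, WExpr.eval, h1, em], h2, h5⟩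

/-- Collects the leaves other than the root in a queue. -/
def initQueue : Prog :=
  .setW vI (.lit 1) ;; .setW vQ (.lit 0) ;;
  .loop (.wlt (.var vI) (.var vN))
    (.ite (.weq (.get aDEG (.var vI)) (.lit 1))
      (.storeW aQ (.var vQ) (.var vI) ;; incr vQ) .skip ;;
     incr vI)

/-- The first `qn` entries of `q` are distinct non-root vertices. -/
structure IsQueue (n : ℕ) (q : ℕ → ℕ) (qn : ℕ) : Prop where
  mem : ∀ l, l < qn → 0 < q l ∧ q l < n
  inj : ∀ l l', l < qn → l' < qn → q l = q l' → l = l'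

theorem IsQueue.le {n : ℕ} {q : ℕ → ℕ} {qn : ℕ} (h : IsQueue n q qn) : qn ≤ n - 1 := by
  have := Finset.card_le_card_of_injOn (s := Finset.range qn) (t := Finset.Ioo 0 n) q
    (fun l hl => by
      have := h.mem l (by simpa using hl)
      simpa using this)
    (fun l hl l' hl' => h.inj l l' (by simpa using hl) (by simpa using hl'))
  simpa using this

theorem IsQueue.push {n : ℕ} {q : ℕ → ℕ} {qn v : ℕ} (h : IsQueue n q qn) (h0 : 0 < v) (hv : v < n)
    (hnew : ∀ l, l < qn → q l ≠ v) : IsQueue n (Function.update q qn v) (qn + 1) where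
  mem l hl := by
    rw [Function.update_apply]
    split_ifs with h1
    · exact ⟨h0, hv⟩
    · exact h.mem l (by lia)
  inj l l' hl hl' := by
    simp only [Function.update_apply]
    split_ifs with h1 h2 h2
    · lia
    · intro he
      exact (hnew l' (by lia) he.symm).elim
    · intro he
      exact (hnew l (by lia) he).elim
    · exact h.inj l l' (by lia) (by lia)

theorem exists_push {q : ℕ → ℕ} {qn v w : ℕ} :
    (∃ l ≤ qn, Function.update q qn v l = w) ↔ (∃ l < qn, q l = w) ∨ v = w := by
  constructor
  · rintro ⟨l, hl, he⟩
    rw [Function.update_apply] at he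
    split_ifs at he with h1
    · exact .inr he
    · exact .inl ⟨l, by lia, he⟩
  · rintro (⟨l, hl, he⟩ | rfl)
    · exact ⟨l, by lia, by rw [Function.update_of_ne (by lia), he]⟩
    · exact ⟨qn, by lia, by simp⟩

/-- The scan starts with the vertex 1, so the root is not queued even if its degree is one. -/
theorem run_initQueue {s : State} (hn : s.wvar vN = n) (hn0 : 0 < n) (hK : n ≤ K) :
    Run B K initQueue s (60 * n + 60) fun s' => IsQueue n (s'.warr aQ) (s'.wvar vQ) ∧
      ∀ v, 0 < v → v < n → ((∃ l < s'.wvar vQ, s'.warr aQ l = v) ↔ s.warr aDEG v = 1) := by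
  have h64 : 1 ≤ K := by lia
  refine (Run.seq' (R := fun s' => s' = s.setW vI 1) (.of_wp ?_) ?_).time_mono
    (T₁ := 2 + (2 + ((n - 1) * (26 + 3 + 1) + 3 + 1))) (by lia)
  · simp [Prog.wp, WExpr.eval, h64]
  rintro s1 - - rfl
  refine Run.seq' (R := fun s' => s' = (s.setW vI 1).setW vQ 0) (.of_wp ?_) ?_
  · simp [Prog.wp, WExpr.eval]
  rintro s1 - - rfl
  refine Run.loop_count (fun j s' => s'.wvar vI = j + 1 ∧ IsQueue n (s'.warr aQ) (s'.wvar vQ) ∧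
      ∀ v, (∃ l < s'.wvar vQ, s'.warr aQ l = v) ↔ 0 < v ∧ v < j + 1 ∧ s.warr aDEG v = 1)
      (n - 1) 26 ?_ ?_ ?_
  · exact ⟨by simp, ⟨by simp, by simp⟩, by simp; lia⟩
  · rintro j hj s' - ha ⟨h1, h2, h3⟩
    have e3 : s'.warr aDEG = s.warr aDEG := ha.wa _ rfl
    have en : s'.wvar vN = n := (ha.w _ rfl).trans (by simpa using hn)
    refine ⟨by simp [Cond.Holds, WExpr.eval, h1, en]; lia, Run.of_wp' (by decide) ?_⟩
    have hqn := h2.le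
    simp [Prog.wp, incr, Cond.Holds, WExpr.eval, h1, e3]
    constructor
    · intro hd
      refine ⟨by lia, by lia, by lia, ?_, fun v => ?_⟩
      · refine h2.push (by lia) (by lia) fun l hl he => ?_
        have := (h3 (j + 1)).1 ⟨l, hl, he⟩
        lia
      · rw [exists_push, h3]
        constructor
        · rintro (h4 | rfl)
          · exact ⟨h4.1, by lia, h4.2.2⟩
          · exact ⟨by lia, by lia, hd⟩
        · rintro ⟨h4, h5, h6⟩
          by_cases h7 : j + 1 = v
          · exact .inr h7
          · exact .inl ⟨h4, by lia, h6⟩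
    · intro hd
      refine ⟨by lia, h2, fun v => ?_⟩
      rw [h3]
      constructor
      · rintro ⟨h4, h5, h6⟩
        exact ⟨h4, by lia, h6⟩
      · rintro ⟨h4, h5, h6⟩
        refine ⟨h4, ?_, h6⟩
        by_contra h7
        have : v = j + 1 := by lia
        exact hd (this ▸ h6)
  · rintro s' - ha ⟨h1, h2, h3⟩
    have en : s'.wvar vN = n := (ha.w _ rfl).trans (by simpa using hn)
    refine ⟨by simp [Cond.Holds, WExpr.eval, h1, en]; lia, h2, fun v h0 hv => ?_⟩
    rw [h3]
    constructor
    · exact fun h => h.2.2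
    · exact fun h => ⟨h0, by lia, h⟩

/-- Removes leaves one after another. For every removed vertex, its parent and the edge to its
parent become known, and the subtree sizes (minus one) and the heavy children are updated. -/
def peelBody : Prog :=
  .setW vX (.get aQ (.var vI)) ;;
  .setW vE (.get aSUM (.var vX)) ;;
  .setW vP (.sub (.add (.get aSRC (.var vE)) (.get aDST (.var vE))) (.var vX)) ;;
  .storeW aPAR (.var vX) (.var vP) ;;
  .storeW aPE (.var vX) (.var vE) ;;
  .ite (.and (.not (.weq (.get aHV (.var vP)) (.lit 0)))
      (.not (.wlt (.get aSZ (.get aHV (.var vP))) (.get aSZ (.var vX)))))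
    .skip (.storeW aHV (.var vP) (.var vX)) ;;
  addTo aSZ (.var vP) (.add (.get aSZ (.var vX)) (.lit 1)) ;;
  subFrom aDEG (.var vP) (.lit 1) ;;
  subFrom aSUM (.var vP) (.var vE) ;;
  .ite (.and (.weq (.get aDEG (.var vP)) (.lit 1)) (.not (.weq (.var vP) (.lit 0))))
    (.storeW aQ (.var vQ) (.var vP) ;; incr vQ) .skip ;;
  incr vI

def peel : Prog :=
  .setW vI (.lit 0) ;; .loop (.wlt (.var vI) (.var vQ)) peelBody

/-- The vertices that have been removed. -/
def removed (q : ℕ → ℕ) (i : ℕ) : Finset ℕ := (Finset.range i).image q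

theorem mem_removed {q : ℕ → ℕ} {i v : ℕ} : v ∈ removed q i ↔ ∃ l < i, q l = v := by
  simp [removed]

/-- The invariant of the loop that removes leaves. -/
structure Peel (n : ℕ) (par pe : ℕ → ℕ) (i qn : ℕ) (q deg sum par' pe' sz hv : ℕ → ℕ) : Prop where
  queue : IsQueue n q qn
  le : i ≤ qn
  ready : ∀ v, 0 < v → v < n → ((∃ l < qn, q l = v) ↔ children n par v ⊆ removed q i)
  order : ∀ l < qn, ∀ c ∈ children n par (q l), ∃ l' < l, q l' = c
  deg_eq : ∀ v < n, deg v + (children n par v ∩ removed q i).card =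
    (if 0 < v then 1 else 0) + (children n par v).card
  sum_eq : ∀ v < n, sum v + ∑ c ∈ children n par v ∩ removed q i, pe c =
    pe v + ∑ c ∈ children n par v, pe c
  par_eq : ∀ v, par' v = if v ∈ removed q i then par v else 0
  pe_eq : ∀ v, pe' v = if v ∈ removed q i then pe v else 0
  sz_eq : ∀ v, sz v = ∑ c ∈ children n par v ∩ removed q i, size n par c
  hv_eq : ∀ v, (hv v = 0 ∧ children n par v ∩ removed q i = ∅) ∨
    (hv v ∈ children n par v ∩ removed q i ∧
      ∀ c ∈ children n par v ∩ removed q i, size n par c ≤ size n par (hv v))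

namespace Peel
variable {par pe dep : ℕ → ℕ} {i qn : ℕ} {q deg sum par' pe' sz hv : ℕ → ℕ}

theorem sz_le (h : Peel n par pe i qn q deg sum par' pe' sz hv) (ht : RTree n par dep) (v : ℕ) :
    sz v ≤ n := by
  rw [h.sz_eq]
  by_cases hv : v < n
  · have h1 := Finset.sum_le_sum_of_subset (f := size n par)
      (Finset.inter_subset_left (s₁ := children n par v) (s₂ := removed q i))
    have h2 := ht.size_eq hv
    have h3 : size n par v ≤ n := RTree.size_le v
    lia
  · rw [ht.children_out (by lia)]
    simp

/-- The next vertex to be removed. -/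
theorem next (h : Peel n par pe i qn q deg sum par' pe' sz hv) (hi : i < qn) :
    0 < q i ∧ q i < n ∧ q i ∉ removed q i ∧ children n par (q i) ⊆ removed q i := by
  have h1 := h.queue.mem i hi
  refine ⟨h1.1, h1.2, ?_, (h.ready _ h1.1 h1.2).1 ⟨i, hi, rfl⟩⟩
  rw [mem_removed]
  rintro ⟨l, hl, he⟩
  have := h.queue.inj l i (by lia) hi he
  lia

/-- The edges to all children have been subtracted, and only the edge to the parent is left: no
adjacency lists are needed to find it. -/
theorem sum_next (h : Peel n par pe i qn q deg sum par' pe' sz hv) (hi : i < qn) :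
    sum (q i) = pe (q i) := by
  have h1 := h.next hi
  have h2 := h.sum_eq _ h1.2.1
  rw [Finset.inter_eq_left.2 h1.2.2.2] at h2
  lia

/-- By now all children have reported their sizes; `sz` does not count the vertex itself. -/
theorem sz_next (h : Peel n par pe i qn q deg sum par' pe' sz hv) (ht : RTree n par dep)
    (hi : i < qn) : sz (q i) + 1 = size n par (q i) := by
  have h1 := h.next hi
  rw [h.sz_eq, Finset.inter_eq_left.2 h1.2.2.2, ht.size_eq h1.2.1]

theorem children_inter_insert {v x : ℕ} {R : Finset ℕ} (h0 : 0 < x) (hx : x < n) :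
    children n par v ∩ insert x R =
      if v = par x then insert x (children n par v ∩ R) else children n par v ∩ R := by
  split_ifs with h
  · rw [Finset.inter_insert_of_mem (mem_children.2 ⟨hx, h0, h.symm⟩)]
  · rw [Finset.inter_insert_of_notMem]
    rw [mem_children]
    exact fun h' => h h'.2.2.symm

theorem removed_succ (q : ℕ → ℕ) (i : ℕ) : removed q (i + 1) = insert (q i) (removed q i) := by
  rw [removed, Finset.range_add_one, Finset.image_insert, removed]

theorem removed_update {q : ℕ → ℕ} {i qn v : ℕ} (hi : i ≤ qn) :
    removed (Function.update q qn v) i = removed q i := by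
  refine Finset.image_congr fun l hl => ?_
  have : l < i := by simpa using hl
  exact Function.update_of_ne (by lia) _ _

/-- The hypotheses `hq` and `hhv` list the outcomes of the two tests in `peelBody`. The removal of
`x` affects only its parent `p`: it gains one removed child, and it becomes ready if this child was
the last one. -/
theorem step (h : Peel n par pe i qn q deg sum par' pe' sz hv) (ht : RTree n par dep)
    (hi : i < qn) {q' hv' : ℕ → ℕ} {qn' : ℕ}
    (hq : ((deg (par (q i)) - 1 = 1 ∧ par (q i) ≠ 0) ∧ q' = Function.update q qn (par (q i)) ∧
        qn' = qn + 1) ∨ (¬ (deg (par (q i)) - 1 = 1 ∧ par (q i) ≠ 0) ∧ q' = q ∧ qn' = qn))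
    (hhv : ((hv (par (q i)) ≠ 0 ∧ ¬ sz (hv (par (q i))) < sz (q i)) ∧ hv' = hv) ∨
      (¬ (hv (par (q i)) ≠ 0 ∧ ¬ sz (hv (par (q i))) < sz (q i)) ∧
        hv' = Function.update hv (par (q i)) (q i))) :
    Peel n par pe (i + 1) qn' q'
      (Function.update deg (par (q i)) (deg (par (q i)) - 1))
      (Function.update sum (par (q i)) (sum (par (q i)) - pe (q i)))
      (Function.update par' (q i) (par (q i))) (Function.update pe' (q i) (pe (q i)))
      (Function.update sz (par (q i)) (sz (par (q i)) + (sz (q i) + 1))) hv' := by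
  obtain ⟨h0, hx, hxR, hch⟩ := h.next hi
  have hsz := h.sz_next ht hi
  set x := q i with hxdef
  set p := par x with hp
  have hpn : p < n := ht.lt x
  have hxp : x ∈ children n par p := mem_children.2 ⟨hx, h0, rfl⟩
  set R := removed q i with hR
  have hR' : removed q' (i + 1) = insert x R := by
    rcases hq with ⟨-, rfl, -⟩ | ⟨-, rfl, -⟩
    · rw [removed_update (by lia), removed_succ]
    · rw [removed_succ]
  have hxI : x ∉ children n par p ∩ R := fun h' => hxR (Finset.mem_inter.1 h').2
  have hinter : ∀ v, children n par v ∩ insert x R =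
      if v = p then insert x (children n par v ∩ R) else children n par v ∩ R :=
    fun v => children_inter_insert h0 hx
  have hcard : (children n par p ∩ insert x R).card = (children n par p ∩ R).card + 1 := by
    rw [hinter, if_pos rfl, Finset.card_insert_of_notMem hxI]
  have hdeg := h.deg_eq p hpn
  have hcardle := Finset.card_le_card
    (Finset.inter_subset_left (s₁ := children n par p) (s₂ := insert x R))
  have hsumle := Finset.sum_le_sum_of_subset (f := pe)
    (Finset.inter_subset_left (s₁ := children n par p) (s₂ := insert x R))
  have hsump := h.sum_eq p hpn
  have hsum' : ∑ c ∈ children n par p ∩ insert x R, pe c =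
      pe x + ∑ c ∈ children n par p ∩ R, pe c := by
    rw [hinter, if_pos rfl, Finset.sum_insert hxI]
  -- By `deg_eq` a non-root vertex has degree one exactly if only the edge to its parent is left.
  have hready : deg p - 1 = 1 ∧ p ≠ 0 ↔ 0 < p ∧ children n par p ⊆ insert x R := by
    rw [← Finset.inter_eq_left]
    constructor
    · rintro ⟨h1, h2⟩
      refine ⟨by lia, Finset.eq_of_subset_of_card_le Finset.inter_subset_left ?_⟩
      rw [if_pos (by lia)] at hdeg
      lia
    · rintro ⟨h1, h2⟩
      rw [h2] at hcard
      rw [if_pos h1] at hdeg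
      lia
  -- Queued vertices have only removed children, but `x` is a child of `p` and has not been removed.
  have hpq : ∀ l, l < qn → q l ≠ p := by
    intro l hl he
    by_cases hp0 : 0 < p
    · exact hxR ((h.ready p hp0 hpn).1 ⟨l, hl, he⟩ hxp)
    · have := h.queue.mem l hl
      lia
  refine ⟨?_, ?_, ?_, ?_, ?_, ?_, ?_, ?_, ?_, ?_⟩
  · rcases hq with ⟨h1, rfl, rfl⟩ | ⟨-, rfl, rfl⟩
    · exact h.queue.push (by lia) hpn hpq
    · exact h.queue
  · lia
  · intro v hv0 hvn
    rw [hR']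
    have hother : v ≠ p → (children n par v ⊆ insert x R ↔ children n par v ⊆ R) := by
      intro hvp
      rw [Finset.subset_insert_iff_of_notMem]
      rw [mem_children]
      exact fun h' => hvp h'.2.2.symm
    have hold := h.ready v hv0 hvn
    rcases hq with ⟨h1, rfl, rfl⟩ | ⟨h1, rfl, rfl⟩
    · simp only [Nat.lt_add_one_iff]
      rw [exists_push, hold]
      by_cases hvp : v = p
      · subst hvp
        simp only [or_true, true_iff]
        exact (hready.1 h1).2
      · rw [hother hvp]
        exact ⟨fun h' => h'.resolve_right (Ne.symm hvp), .inl⟩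
    · rw [hold]
      by_cases hvp : v = p
      · subst hvp
        constructor
        · exact fun h' => h'.trans (Finset.subset_insert _ _)
        · exact fun h' => (h1 (hready.2 ⟨hv0, h'⟩)).elim
      · rw [hother hvp]
  · rcases hq with ⟨h1, rfl, rfl⟩ | ⟨h1, rfl, rfl⟩
    · intro l hl c hc
      by_cases hlq : l = qn
      · subst hlq
        rw [Function.update_self] at hc
        have := (hready.1 h1).2 hc
        rw [hR, ← removed_succ, mem_removed] at this
        obtain ⟨l', hl', he⟩ := this
        exact ⟨l', by lia, by rw [Function.update_of_ne (by lia), he]⟩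
      · rw [Function.update_of_ne hlq] at hc
        obtain ⟨l', hl', he⟩ := h.order l (by lia) c hc
        exact ⟨l', hl', by rw [Function.update_of_ne (by lia), he]⟩
    · exact h.order
  · intro v hvn
    rw [hR']
    by_cases hvp : v = p
    · rw [hvp, Function.update_self]
      lia
    · rw [Function.update_of_ne hvp, hinter, if_neg hvp]
      exact h.deg_eq v hvn
  · intro v hvn
    rw [hR', Function.update_apply]
    split_ifs with h1
    · subst h1; lia
    · have := h.sum_eq v hvn
      rw [hinter, if_neg h1]
      exact this
  · intro v
    rw [hR', Function.update_apply, h.par_eq, ← hR]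
    simp only [Finset.mem_insert]
    by_cases h1 : v = x
    · simp [h1, hp]
    · simp [h1]
  · intro v
    rw [hR', Function.update_apply, h.pe_eq, ← hR]
    simp only [Finset.mem_insert]
    by_cases h1 : v = x
    · simp [h1]
    · simp [h1]
  · intro v
    rw [hR', hinter, Function.update_apply]
    split_ifs with h1
    · subst h1
      rw [Finset.sum_insert hxI, h.sz_eq, hsz]
      ring
    · exact h.sz_eq v
  · intro v
    rw [hR', hinter]
    have hold := h.hv_eq v
    by_cases hvp : v = p
    · subst hvp
      rw [if_pos rfl]
      right
      -- The current heavy child has been removed, so its entry in `sz` is final and the comparison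
      -- with `x` is one of true sizes.
      have hszmax : hv p ≠ 0 → sz (hv p) + 1 = size n par (hv p) := by
        intro h1
        rcases hold with h2 | h2
        · exact (h1 h2.1).elim
        · have h3 := (Finset.mem_inter.1 h2.1).2
          obtain ⟨l, hl, he⟩ := mem_removed.1 h3
          have h4 := h.queue.mem l (by lia)
          rw [he] at h4
          have h5 := (h.ready _ h4.1 h4.2).1 ⟨l, by lia, he⟩
          rw [h.sz_eq, Finset.inter_eq_left.2 h5, ht.size_eq h4.2]
      rcases hhv with ⟨h1, rfl⟩ | ⟨h1, rfl⟩
      · rcases hold with h2 | h2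
        · exact (h1.1 h2.1).elim
        · refine ⟨Finset.mem_insert_of_mem h2.1, fun c hc => ?_⟩
          rcases Finset.mem_insert.1 hc with rfl | hc
          · have := hszmax h1.1
            lia
          · exact h2.2 c hc
      · rw [Function.update_self]
        refine ⟨Finset.mem_insert_self _ _, fun c hc => ?_⟩
        rcases Finset.mem_insert.1 hc with rfl | hc
        · exact le_rfl
        · rcases hold with h2 | h2
          · rw [h2.2] at hc
            simp at hc
          · have h3 : hv p ≠ 0 := by
              have := mem_children.1 (Finset.mem_inter.1 h2.1).1
              lia
            have := hszmax h3
            have := h2.2 c hc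
            have : sz (hv p) < sz x := by tauto
            lia
    · rw [if_neg hvp]
      have : hv' v = hv v := by
        rcases hhv with ⟨-, rfl⟩ | ⟨-, rfl⟩
        · rfl
        · exact Function.update_of_ne hvp _ _
      rw [this]
      exact hold

/-- As long as there are vertices other than the root, there are leaves. -/
theorem progress (h : Peel n par pe i qn q deg sum par' pe' sz hv) (ht : RTree n par dep)
    (hi : i < n - 1) : i < qn := by
  by_contra hiq
  have hiq : i = qn := le_antisymm h.le (by lia)
  -- A deepest vertex among those that are left has only removed children, hence it is in the queue.
  obtain ⟨v, hv, hmax⟩ := Finset.exists_max_image (Finset.Ioo 0 n \ removed q i) dep (by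
    rw [← Finset.card_pos]
    have h1 := Finset.le_card_sdiff (removed q i) (Finset.Ioo 0 n)
    have h2 : (removed q i).card ≤ i := by
      rw [removed]
      simpa using Finset.card_image_le (s := Finset.range i) (f := q)
    simp only [Nat.card_Ioo] at h1
    lia)
  rw [Finset.mem_sdiff, Finset.mem_Ioo] at hv
  apply hv.2
  rw [mem_removed, hiq, h.ready v hv.1.1 hv.1.2]
  intro c hc
  by_contra hcR
  have hc' := mem_children.1 hc
  have := hmax c (Finset.mem_sdiff.2 ⟨Finset.mem_Ioo.2 ⟨hc'.2.1, hc'.1⟩, hcR⟩)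
  have := ht.step c hc'.2.1 hc'.1
  rw [hc'.2.2] at this
  lia

end Peel

theorem run_peel {par pe dep : ℕ → ℕ} {s : State}
    (ht : TreeInput n m (s.warr aSRC) (s.warr aDST) (s.warr aFLAG) par pe dep)
    (hnK : 2 * n ≤ K) (hmK : m ≤ K)
    (h : Peel n par pe 0 (s.wvar vQ) (s.warr aQ) (s.warr aDEG) (s.warr aSUM) (s.warr aPAR)
      (s.warr aPE) (s.warr aSZ) (s.warr aHV)) :
    Run B K peel s (200 * n + 200) fun s' => s'.wvar vQ = n - 1 ∧
      Peel n par pe (n - 1) (n - 1) (s'.warr aQ) (s'.warr aDEG) (s'.warr aSUM) (s'.warr aPAR)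
      (s'.warr aPE) (s'.warr aSZ) (s'.warr aHV) := by
  refine (Run.seq' (R := fun s' => s' = s.setW vI 0) (.of_wp ?_) ?_).time_mono
    (T₁ := 2 + ((n - 1) * (100 + 3 + 1) + 3 + 1)) (by lia)
  · simp [Prog.wp, WExpr.eval]
  rintro s1 - - rfl
  refine Run.loop_count (fun j s' => s'.wvar vI = j ∧
      Peel n par pe j (s'.wvar vQ) (s'.warr aQ) (s'.warr aDEG) (s'.warr aSUM) (s'.warr aPAR)
      (s'.warr aPE) (s'.warr aSZ) (s'.warr aHV)) (n - 1) 100 ?_ ?_ ?_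
  · simpa using h
  · rintro j hj s' hbd ha ⟨h1, h2⟩
    have e0 : s'.warr aSRC = s.warr aSRC := ha.wa _ rfl
    have e1 : s'.warr aDST = s.warr aDST := ha.wa _ rfl
    have hjq := h2.progress ht.toRTree hj
    refine ⟨by simpa [Cond.Holds, WExpr.eval, h1] using hjq, Run.of_wp' (by decide) ?_⟩
    obtain ⟨h0, hx, hxR, hch⟩ := h2.next hjq
    have hsum := h2.sum_next hjq
    have hqn := h2.queue.le
    have hstep := @h2.step _ _ _ _ _ _ _ _ _ _ _ _ _ ht.toRTree hjq
    obtain ⟨x, hxq⟩ : ∃ x, s'.warr aQ j = x := ⟨_, rfl⟩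
    rw [hxq] at h0 hx hxR hch hsum hstep
    -- The other end of the edge is found by subtracting `x` from the sum of both ends, whatever
    -- their order.
    have hp : (s.warr aSRC (pe x) + s.warr aDST (pe x)) - x = par x := by
      rcases ht.ends x h0 hx with ⟨h3, h4⟩ | ⟨h3, h4⟩ <;> rw [h3, h4] <;> lia
    have hpn := ht.lt x
    have hpe := ht.pe_lt x h0 hx
    have hsz := h2.sz_le ht.toRTree
    have hszx := h2.sz_next ht.toRTree hjq
    have hszp : s'.warr aSZ (par x) + (s'.warr aSZ x + 1) ≤ 2 * n := by
      have h3 : size n par x ≤ n := RTree.size_le x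
      have h4 := hsz (par x)
      rw [hxq] at hszx
      lia
    generalize par x = p at *
    have hbd3 := hbd.2 aDEG p
    have hbd4 := hbd.2 aSUM p
    simp [peelBody, Prog.wp, incr, addTo, subFrom, Cond.Holds, WExpr.eval, h1, e0, e1, hxq, hsum, hp]
    have hdeg : ∀ d : ℕ, d - 1 = 1 ↔ d = 2 := fun d => by lia
    simp only [hdeg, not_and, not_not] at hstep
    refine ⟨by lia, by lia, by lia, by lia, fun h3 h4 => ⟨by lia, by lia, by lia, fun h5 h6 =>
      ⟨by lia, by lia, by lia, ?_⟩, fun h5 => ⟨by lia, ?_⟩⟩, fun h3 => ⟨by lia, by lia, by lia,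
      by lia, fun h5 h6 => ⟨by lia, by lia, by lia, ?_⟩, fun h5 => ⟨by lia, ?_⟩⟩⟩
    · exact hstep (.inl ⟨⟨h5, h6⟩, rfl, rfl⟩) (.inl ⟨⟨h3, by lia⟩, rfl⟩)
    · exact hstep (.inr ⟨h5, rfl, rfl⟩) (.inl ⟨⟨h3, by lia⟩, rfl⟩)
    · exact hstep (.inl ⟨⟨h5, h6⟩, rfl, rfl⟩) (.inr ⟨h3, rfl⟩)
    · exact hstep (.inr ⟨h5, rfl, rfl⟩) (.inr ⟨h3, rfl⟩)
  · rintro s' - ha ⟨h1, h2⟩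
    have := h2.queue.le
    have := h2.le
    have e : s'.wvar vQ = n - 1 := by lia
    rw [e] at h2
    exact ⟨by simp [Cond.Holds, WExpr.eval, h1, e], e, h2⟩

end TwoRespect

/-! ### The program: heavy paths and the two preorder numberings. -/

namespace TwoRespect

variable {B K n m : ℕ} {par pe dep q sz hv : ℕ → ℕ}

/-- The result of rooting the tree: `q` lists the vertices other than the root, children before
their parents, `sz` holds the sizes of the subtrees minus one and `hv` the heavy children. -/
structure Rooted (n : ℕ) (par dep q sz hv : ℕ → ℕ) : Prop extends RTree n par dep where
  queue : IsQueue n q (n - 1)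
  order : ∀ l < n - 1, ∀ c ∈ children n par (q l), ∃ l' < l, q l' = c
  sz_eq : ∀ v < n, sz v + 1 = size n par v
  heavy : ∀ v, v < n → (hv v = 0 ∧ children n par v = ∅) ∨
    (hv v ∈ children n par v ∧ ∀ c ∈ children n par v, size n par c ≤ size n par (hv v))

theorem IsQueue.mem_image (h : IsQueue n q (n - 1)) {v : ℕ} :
    v ∈ (Finset.range (n - 1)).image q ↔ 0 < v ∧ v < n := by
  have h1 : (Finset.range (n - 1)).image q = Finset.Ioo 0 n := by
    refine Finset.eq_of_subset_of_card_le (fun v hv => ?_) ?_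
    · rw [Finset.mem_image] at hv
      obtain ⟨l, hl, rfl⟩ := hv
      exact Finset.mem_Ioo.2 (h.mem l (Finset.mem_range.1 hl))
    · rw [Finset.card_image_of_injOn, Nat.card_Ioo, Finset.card_range]
      · lia
      · intro l hl l' hl' he
        exact h.inj l l' (by simpa using hl) (by simpa using hl') he
  rw [h1, Finset.mem_Ioo]

theorem IsQueue.surj (h : IsQueue n q (n - 1)) {v : ℕ} (h0 : 0 < v) (hv : v < n) :
    ∃ l < n - 1, q l = v := by
  have := h.mem_image.2 ⟨h0, hv⟩
  simpa using this

/-- All vertices but the root have been removed, so intersecting with the removed vertices no longer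
has an effect. -/
theorem Peel.rooted {deg sum par' pe' : ℕ → ℕ} (ht : RTree n par dep)
    (hpe : ∀ v, n ≤ v ∨ v = 0 → pe v = 0)
    (h : Peel n par pe (n - 1) (n - 1) q deg sum par' pe' sz hv) :
    Rooted n par dep q sz hv ∧ par' = par ∧ pe' = pe := by
  have hmem : ∀ v, v ∈ removed q (n - 1) ↔ 0 < v ∧ v < n := fun v => h.queue.mem_image
  have hch : ∀ v, children n par v ∩ removed q (n - 1) = children n par v := by
    intro v
    rw [Finset.inter_eq_left]
    intro c hc
    rw [hmem]
    rw [mem_children] at hc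
    exact ⟨hc.2.1, hc.1⟩
  refine ⟨⟨ht, h.queue, h.order, fun v hv => ?_, fun v hv => ?_⟩, funext fun v => ?_,
    funext fun v => ?_⟩
  · rw [h.sz_eq, hch, ht.size_eq hv]
  · have := h.hv_eq v
    rwa [hch] at this
  · rw [h.par_eq]
    split_ifs with h1
    · rfl
    · rw [hmem] at h1
      rcases Nat.eq_zero_or_pos v with rfl | h0
      · exact ht.root.symm
      · exact (ht.out v (by lia)).symm
  · rw [h.pe_eq]
    split_ifs with h1
    · rfl
    · rw [hmem] at h1
      exact (hpe v (by lia)).symm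

/-- Computes parents, subtree sizes and heavy children. -/
def rootTree : Prog := initDegrees ;; initQueue ;; peel

theorem run_rootTree {s : State}
    (ht : TreeInput n m (s.warr aSRC) (s.warr aDST) (s.warr aFLAG) par pe dep)
    (hn : s.wvar vN = n) (hm : s.wvar vM = m) (hK : 2 * (m + 1) * (m + 1) ≤ K) (hnK : 2 * n ≤ K)
    (h0 : ∀ a, 3 ≤ a → s.warr a = fun _ => 0) :
    Run B K rootTree s (60 * m + 260 * n + 320) fun s' => s'.warr aPAR = par ∧ s'.warr aPE = pe ∧
      Rooted n par dep (s'.warr aQ) (s'.warr aSZ) (s'.warr aHV) := by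
  have hmK : m ≤ K := by nlinarith
  refine (Run.seq' (run_initDegrees hm hK (h0 _ (by lia)) (h0 _ (by lia))) ?_).time_mono
    (T₁ := 60 * m + 60 + (60 * n + 60 + (200 * n + 200))) (by lia)
  rintro s1 - ha1 ⟨hdeg, hsum⟩
  refine Run.seq' (run_initQueue ((ha1.w _ rfl).trans hn) ht.n_pos (by lia)) ?_
  rintro s2 - ha2 ⟨hq, hleaf⟩
  have hd : ∀ v < n, s1.warr aDEG v = (if 0 < v then 1 else 0) + (children n par v).card := by
    intro v hv
    rw [hdeg, ht.sum_incident (fun _ => 1) hv, Finset.card_eq_sum_ones]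
  have hs : ∀ v < n, s1.warr aSUM v = pe v + ∑ c ∈ children n par v, pe c := by
    intro v hv
    -- The subtraction undoes the shift of the argument in `sum_incident`.
    have := ht.sum_incident (fun k => k - 1) hv
    simp only [Nat.add_sub_cancel] at this
    rw [hsum, this]
    split_ifs with h1
    · rfl
    · rw [ht.pe_out v (by lia)]
  have e : ∀ a, a ≤ 2 ∨ (5 ≤ a ∧ a ≤ 8) → s2.warr a = s.warr a := by
    intro a haa
    have : a = 0 ∨ a = 1 ∨ a = 2 ∨ a = 5 ∨ a = 6 ∨ a = 7 ∨ a = 8 := by lia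
    rcases this with rfl | rfl | rfl | rfl | rfl | rfl | rfl <;>
      exact (ha2.wa _ rfl).trans (ha1.wa _ rfl)
  have e3 : s2.warr aDEG = s1.warr aDEG := ha2.wa _ rfl
  have e4 : s2.warr aSUM = s1.warr aSUM := ha2.wa _ rfl
  refine (run_peel (n := n) (m := m) (par := par) (pe := pe) (dep := dep) ?_ hnK hmK ?_).imp ?_
  · rw [e _ (by lia), e _ (by lia), e _ (by lia)]
    exact ht
  · rw [e3, e4, e 5 (by lia), e 6 (by lia), e 7 (by lia), e 8 (by lia), h0 5 (by lia),
      h0 6 (by lia), h0 7 (by lia), h0 8 (by lia)]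
    have hr : removed (s2.warr aQ) 0 = ∅ := by simp [removed]
    refine ⟨hq, Nat.zero_le _, fun v hv0 hv => ?_, fun l hl c hc => ?_, fun v hv => ?_,
      fun v hv => ?_, ?_, ?_, ?_, ?_⟩
    · rw [hleaf v hv0 hv, hd v hv, if_pos hv0, hr, Finset.subset_empty, ← Finset.card_eq_zero]
      lia
    · have h1 := hq.mem l hl
      have h2 := (hleaf _ h1.1 h1.2).1 ⟨l, hl, rfl⟩
      rw [hd _ h1.2, if_pos h1.1] at h2
      have : children n par (s2.warr aQ l) = ∅ := Finset.card_eq_zero.1 (by lia)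
      rw [this] at hc
      simp at hc
    · rw [hr, hd v hv]
      simp
    · rw [hr, hs v hv]
      simp
    all_goals simp [hr]
  · rintro s3 - - ⟨-, hp⟩
    obtain ⟨h1, h2, h3⟩ := hp.rooted ht.toRTree ht.pe_out
    exact ⟨h2, h3, h1⟩

/-- One step of the computation of the numberings, for the vertex in position `vI` of the queue. -/
def layoutBody : Prog :=
  decr vI ;;
  .setW vX (.get aQ (.var vI)) ;;
  .setW vP (.get aPAR (.var vX)) ;;
  .ite (.weq (.get aHV (.var vP)) (.var vX))
    (.storeW aTIN (.var vX) (.sub (.add (.get aTIN (.var vP)) (.get aSZ (.var vP)))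
        (.get aSZ (.var vX))) ;;
     .storeW aPOS (.var vX) (.add (.get aPOS (.var vP)) (.lit 1)) ;;
     .storeW aTOP (.var vX) (.get aTOP (.var vP)))
    (.storeW aAV (.var vX) (.get aACC (.var vP)) ;;
     .storeW aTIN (.var vX) (.add (.add (.get aTIN (.var vP)) (.lit 1)) (.get aACC (.var vP))) ;;
     .storeW aPOS (.var vX) (.add (.add (.add (.get aPOS (.var vP)) (.lit 1))
        (.add (.get aSZ (.get aHV (.var vP))) (.lit 1))) (.get aACC (.var vP))) ;;
     .storeW aTOP (.var vX) (.var vX) ;;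
     addTo aACC (.var vP) (.add (.get aSZ (.var vX)) (.lit 1)))

/-- Computes the two numberings of the vertices and the tops of the heavy paths. -/
def layout : Prog :=
  .setW vI (.sub (.var vN) (.lit 1)) ;; .loop (.wlt (.lit 0) (.var vI)) layoutBody

/-- The vertices at the positions `i, …, n - 2` of the queue. -/
def late (n : ℕ) (q : ℕ → ℕ) (i : ℕ) : Finset ℕ := (Finset.Ico i (n - 1)).image q

theorem mem_late {i v : ℕ} : v ∈ late n q i ↔ ∃ l, i ≤ l ∧ l < n - 1 ∧ q l = v := by
  simp [late, and_assoc]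

/-- The invariant of the loop that computes the numberings. -/
structure Layout (n : ℕ) (par q hv : ℕ → ℕ) (i : ℕ) (top tin pos acc av : ℕ → ℕ) : Prop where
  top_zero : top 0 = 0
  tin_zero : tin 0 = 0
  pos_zero : pos 0 = 0
  top_heavy : ∀ v ∈ late n q i, hv (par v) = v → top v = top (par v)
  tin_heavy : ∀ v ∈ late n q i, hv (par v) = v →
    tin v + size n par v = tin (par v) + size n par (par v)
  pos_heavy : ∀ v ∈ late n q i, hv (par v) = v → pos v = pos (par v) + 1
  top_light : ∀ v ∈ late n q i, hv (par v) ≠ v → top v = v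
  tin_light : ∀ v ∈ late n q i, hv (par v) ≠ v → tin v = tin (par v) + 1 + av v
  pos_light : ∀ v ∈ late n q i, hv (par v) ≠ v →
    pos v = pos (par v) + 1 + size n par (hv (par v)) + av v
  tin_le : ∀ v, v = 0 ∨ v ∈ late n q i → tin v + size n par v ≤ n
  pos_le : ∀ v, v = 0 ∨ v ∈ late n q i → pos v + size n par v ≤ n
  acc_eq : ∀ v < n, acc v = ∑ c ∈ (children n par v ∩ late n q i).erase (hv v), size n par c
  av_le : ∀ v ∈ late n q i, hv (par v) ≠ v → av v + size n par v ≤ acc (par v)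
  av_sib : ∀ v ∈ late n q i, ∀ w ∈ late n q i, hv (par v) ≠ v → hv (par w) ≠ w →
    par v = par w → v ≠ w → av v + size n par v ≤ av w ∨ av w + size n par w ≤ av v

namespace Layout
variable {i : ℕ} {top tin pos acc av : ℕ → ℕ}

theorem late_succ (hi : i < n - 1) : late n q i = insert (q i) (late n q (i + 1)) := by
  rw [late, ← Finset.insert_Ico_add_one_left_eq_Ico hi, Finset.image_insert, late]

/-- `acc` sums the sizes of light children only, so there is room for the heavy child and for `v`
itself. -/
theorem acc_add_le (h : Layout n par q hv i top tin pos acc av) (hr : Rooted n par dep q sz hv)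
    {v : ℕ} (hc : (children n par v).Nonempty) :
    acc v + size n par (hv v) + 1 ≤ size n par v := by
  have hvn : v < n := by
    by_contra h1
    rw [hr.children_out (by lia)] at hc
    simp at hc
  rcases hr.heavy v hvn with h1 | h1
  · rw [h1.2] at hc
    simp at hc
  · rw [hr.size_eq hvn, h.acc_eq v hvn, ← Finset.sum_erase_add _ _ h1.1]
    have := Finset.sum_le_sum_of_subset (f := size n par)
      (Finset.erase_subset_erase (hv v) (Finset.inter_subset_left
        (s₁ := children n par v) (s₂ := late n q i)))
    lia

end Layout

/-- Children precede their parents in the queue. Reading it from the rear, one meets the parent of a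
vertex before it and its children after it. -/
theorem Rooted.fresh {i : ℕ} (hr : Rooted n par dep q sz hv) (hi : i < n - 1) :
    q i ∉ late n q (i + 1) ∧ (par (q i) = 0 ∨ par (q i) ∈ late n q (i + 1)) ∧
    ∀ v ∈ late n q (i + 1), par v ≠ q i := by
  have hx := hr.queue.mem i hi
  refine ⟨fun h => ?_, ?_, fun v hv he => ?_⟩
  · obtain ⟨l, hl, hl', he⟩ := mem_late.1 h
    have := hr.queue.inj l i hl' hi he
    lia
  · rcases Nat.eq_zero_or_pos (par (q i)) with h0 | h0
    · exact .inl h0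
    · obtain ⟨l, hl, he⟩ := hr.queue.surj h0 (hr.lt _)
      obtain ⟨l', hl', he'⟩ := hr.order l hl (q i) (mem_children.2 ⟨hx.2, hx.1, he.symm⟩)
      have := hr.queue.inj l' i (by lia) hi he'
      exact .inr (mem_late.2 ⟨l, by lia, hl, he⟩)
  · obtain ⟨l, hl, hl', rfl⟩ := mem_late.1 hv
    have hm := hr.queue.mem l hl'
    obtain ⟨l', hl2, he'⟩ := hr.order i hi (q l) (mem_children.2 ⟨hm.2, hm.1, he⟩)
    have := hr.queue.inj l' l (by lia) hl' he'
    lia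

/-- No vertex that was treated earlier is `x` or a child of `x`, so overwriting the entries at `x`
does not disturb the earlier claims. As `sz` is the size minus one at both vertices, the difference
`sz (par x) - sz x` is that of the sizes. -/
theorem Layout.step_heavy {i : ℕ} {top tin pos acc av : ℕ → ℕ} {x : ℕ}
    (h : Layout n par q hv (i + 1) top tin pos acc av) (hr : Rooted n par dep q sz hv)
    (hi : i < n - 1) (hqx : q i = x) (hx : hv (par x) = x) :
    Layout n par q hv i (Function.update top x (top (par x)))
      (Function.update tin x (tin (par x) + sz (par x) - sz x))
      (Function.update pos x (pos (par x) + 1)) acc av := by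
  obtain ⟨f1, f2, f3⟩ := hr.fresh hi
  have hxm := hr.queue.mem i hi
  rw [hqx] at f1 f2 f3 hxm
  have hxp : x ≠ par x := (hr.par_ne hxm.1 hxm.2).symm
  have hs1 := hr.sz_eq x hxm.2
  have hs2 := hr.sz_eq (par x) (hr.lt x)
  have hs3 : size n par x ≤ size n par (par x) := RTree.size_le_of_anc (.parent x)
  have hs4 := h.tin_le _ f2
  have hs5 := h.pos_le _ f2
  have hs6 : size n par x + 1 ≤ size n par (par x) := by
    rw [hr.size_eq (hr.lt x)]
    exact Nat.succ_le_succ (Finset.single_le_sum (f := size n par) (fun _ _ => Nat.zero_le _)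
      (mem_children.2 ⟨hxm.2, hxm.1, rfl⟩))
  have hl : late n q i = insert x (late n q (i + 1)) := by rw [late_succ hi, hqx]
  have hne : ∀ v ∈ late n q (i + 1), v ≠ x := fun v hv he => f1 (he ▸ hv)
  have hx0 : (0 : ℕ) ≠ x := by lia
  constructor <;> (try rw [hl]) <;> (try simp only [Finset.forall_mem_insert])
  · rw [Function.update_of_ne hx0, h.top_zero]
  · rw [Function.update_of_ne hx0, h.tin_zero]
  · rw [Function.update_of_ne hx0, h.pos_zero]
  · refine ⟨fun _ => by simp [Function.update_of_ne hxp.symm], fun v hv hh => ?_⟩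
    rw [Function.update_of_ne (hne v hv), Function.update_of_ne (f3 v hv), h.top_heavy v hv hh]
  · refine ⟨fun _ => ?_, fun v hv hh => ?_⟩
    · rw [Function.update_self, Function.update_of_ne hxp.symm]
      lia
    · rw [Function.update_of_ne (hne v hv), Function.update_of_ne (f3 v hv), h.tin_heavy v hv hh]
  · refine ⟨fun _ => by simp [Function.update_of_ne hxp.symm], fun v hv hh => ?_⟩
    rw [Function.update_of_ne (hne v hv), Function.update_of_ne (f3 v hv), h.pos_heavy v hv hh]
  · refine ⟨fun hh => (hh hx).elim, fun v hv hh => ?_⟩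
    rw [Function.update_of_ne (hne v hv), h.top_light v hv hh]
  · refine ⟨fun hh => (hh hx).elim, fun v hv hh => ?_⟩
    rw [Function.update_of_ne (hne v hv), Function.update_of_ne (f3 v hv), h.tin_light v hv hh]
  · refine ⟨fun hh => (hh hx).elim, fun v hv hh => ?_⟩
    rw [Function.update_of_ne (hne v hv), Function.update_of_ne (f3 v hv), h.pos_light v hv hh]
  · intro v hv
    rw [Function.update_apply]
    split_ifs with h1
    · subst h1; lia
    · exact h.tin_le v (hv.imp_right fun h2 => (Finset.mem_insert.1 h2).resolve_left h1)
  · intro v hv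
    rw [Function.update_apply]
    split_ifs with h1
    · subst h1; lia
    · exact h.pos_le v (hv.imp_right fun h2 => (Finset.mem_insert.1 h2).resolve_left h1)
  · intro v hv
    rw [h.acc_eq v hv, Peel.children_inter_insert hxm.1 hxm.2]
    split_ifs with h1
    · rw [h1, hx, Finset.erase_insert_eq_erase]
    · rfl
  · exact ⟨fun hh => (hh hx).elim, h.av_le⟩
  · exact ⟨⟨fun hh => (hh hx).elim, fun v hv hh => (hh hx).elim⟩,
      fun v hv => ⟨fun _ hh => (hh hx).elim, h.av_sib v hv⟩⟩

/-- The block of `x` starts where the blocks of the earlier light siblings end, and `acc` at the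
parent is advanced past it. This gives the disjointness of sibling blocks. -/
theorem Layout.step_light {i : ℕ} {top tin pos acc av : ℕ → ℕ} {x : ℕ}
    (h : Layout n par q hv (i + 1) top tin pos acc av) (hr : Rooted n par dep q sz hv)
    (hi : i < n - 1) (hqx : q i = x) (hx : hv (par x) ≠ x) :
    Layout n par q hv i (Function.update top x x)
      (Function.update tin x (tin (par x) + 1 + acc (par x)))
      (Function.update pos x (pos (par x) + 1 + (sz (hv (par x)) + 1) + acc (par x)))
      (Function.update acc (par x) (acc (par x) + (sz x + 1)))
      (Function.update av x (acc (par x))) := by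
  obtain ⟨f1, f2, f3⟩ := hr.fresh hi
  have hxm := hr.queue.mem i hi
  rw [hqx] at f1 f2 f3 hxm
  have hxp : x ≠ par x := (hr.par_ne hxm.1 hxm.2).symm
  have hxc : x ∈ children n par (par x) := mem_children.2 ⟨hxm.2, hxm.1, rfl⟩
  have hhv : hv (par x) < n := by
    rcases hr.heavy _ (hr.lt x) with h1 | h1
    · rw [h1.1]; exact hr.n_pos
    · exact (mem_children.1 h1.1).1
  have hs1 := hr.sz_eq x hxm.2
  have hs2 := hr.sz_eq _ hhv
  have hs4 := h.tin_le _ f2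
  have hs5 := h.pos_le _ f2
  have hl : late n q i = insert x (late n q (i + 1)) := by rw [late_succ hi, hqx]
  have hne : ∀ v ∈ late n q (i + 1), v ≠ x := fun v hv he => f1 (he ▸ hv)
  have hx0 : (0 : ℕ) ≠ x := by lia
  have hacc : ∀ v < n, Function.update acc (par x) (acc (par x) + (sz x + 1)) v =
      ∑ c ∈ (children n par v ∩ late n q i).erase (hv v), size n par c := by
    intro v hv
    rw [hl, Peel.children_inter_insert hxm.1 hxm.2]
    split_ifs with h1
    · rw [h1, Function.update_self, h.acc_eq _ (hr.lt x), Finset.erase_insert_of_ne hx.symm,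
        Finset.sum_insert, hs1, add_comm]
      exact fun hm => f1 (Finset.mem_inter.1 (Finset.mem_of_mem_erase hm)).2
    · rw [Function.update_of_ne h1, h.acc_eq v hv]
  -- The light siblings so far, `x` and the heavy child are different children, and the parent
  -- itself counts one.
  have hsize : acc (par x) + size n par x + size n par (hv (par x)) + 1 ≤ size n par (par x) := by
    rcases hr.heavy _ (hr.lt x) with h1 | h1
    · rw [h1.2] at hxc
      simp at hxc
    · have h2 := hacc (par x) (hr.lt x)
      rw [Function.update_self] at h2
      rw [hr.size_eq (hr.lt x), ← Finset.sum_erase_add _ _ h1.1]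
      have := Finset.sum_le_sum_of_subset (f := size n par)
        (Finset.erase_subset_erase (hv (par x)) (Finset.inter_subset_left
          (s₁ := children n par (par x)) (s₂ := late n q i)))
      lia
  have hle : ∀ v ∈ late n q (i + 1), hv (par v) ≠ v → av v + size n par v ≤
      Function.update acc (par x) (acc (par x) + (sz x + 1)) (par v) := by
    intro v hv hh
    have := h.av_le v hv hh
    rw [Function.update_apply]
    split_ifs with h1
    · rw [h1] at this; lia
    · exact this
  constructor <;> (try rw [hl]) <;> (try simp only [Finset.forall_mem_insert])
  · rw [Function.update_of_ne hx0, h.top_zero]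
  · rw [Function.update_of_ne hx0, h.tin_zero]
  · rw [Function.update_of_ne hx0, h.pos_zero]
  · refine ⟨fun hh => (hx hh).elim, fun v hv hh => ?_⟩
    rw [Function.update_of_ne (hne v hv), Function.update_of_ne (f3 v hv), h.top_heavy v hv hh]
  · refine ⟨fun hh => (hx hh).elim, fun v hv hh => ?_⟩
    rw [Function.update_of_ne (hne v hv), Function.update_of_ne (f3 v hv), h.tin_heavy v hv hh]
  · refine ⟨fun hh => (hx hh).elim, fun v hv hh => ?_⟩
    rw [Function.update_of_ne (hne v hv), Function.update_of_ne (f3 v hv), h.pos_heavy v hv hh]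
  · refine ⟨fun _ => by simp, fun v hv hh => ?_⟩
    rw [Function.update_of_ne (hne v hv), h.top_light v hv hh]
  · refine ⟨fun _ => by simp [Function.update_of_ne hxp.symm], fun v hv hh => ?_⟩
    rw [Function.update_of_ne (hne v hv), Function.update_of_ne (f3 v hv),
      Function.update_of_ne (hne v hv), h.tin_light v hv hh]
  · refine ⟨fun _ => ?_, fun v hv hh => ?_⟩
    · rw [Function.update_self, Function.update_of_ne hxp.symm, Function.update_self, hs2]
    · rw [Function.update_of_ne (hne v hv), Function.update_of_ne (f3 v hv),
        Function.update_of_ne (hne v hv), h.pos_light v hv hh]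
  · intro v hv
    rw [Function.update_apply]
    split_ifs with h1
    · subst h1; lia
    · exact h.tin_le v (hv.imp_right fun h2 => (Finset.mem_insert.1 h2).resolve_left h1)
  · intro v hv
    rw [Function.update_apply]
    split_ifs with h1
    · subst h1; lia
    · exact h.pos_le v (hv.imp_right fun h2 => (Finset.mem_insert.1 h2).resolve_left h1)
  · rw [← hl]
    exact hacc
  · refine ⟨fun _ => ?_, fun v hv hh => ?_⟩
    · rw [Function.update_self, Function.update_self, hs1]
    · rw [Function.update_of_ne (hne v hv)]
      exact hle v hv hh
  · refine ⟨⟨fun _ _ _ hh => (hh rfl).elim, fun w hw h1 h2 h3 h4 => ?_⟩,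
      fun v hv => ⟨fun h1 h2 h3 h4 => ?_, fun w hw h1 h2 h3 h4 => ?_⟩⟩
    · rw [Function.update_self, Function.update_of_ne (hne w hw)]
      right
      rw [h3]
      exact h.av_le w hw h2
    · rw [Function.update_self, Function.update_of_ne (hne v hv)]
      left
      rw [← h3]
      exact h.av_le v hv h1
    · rw [Function.update_of_ne (hne v hv), Function.update_of_ne (hne w hw)]
      exact h.av_sib v hv w hw h1 h2 h3 h4

theorem Layout.heavyPaths {top tin pos acc av : ℕ → ℕ}
    (h : Layout n par q hv 0 top tin pos acc av) (hr : Rooted n par dep q sz hv) :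
    HeavyPaths n par dep hv top tin pos av := by
  have hm : ∀ v, 0 < v → v < n → v ∈ late n q 0 := by
    intro v h0 hv
    obtain ⟨l, hl, he⟩ := hr.queue.surj h0 hv
    exact mem_late.2 ⟨l, by lia, hl, he⟩
  exact
    { hr.toRTree with
      heavy := hr.heavy
      top_zero := h.top_zero
      tin_zero := h.tin_zero
      pos_zero := h.pos_zero
      top_heavy := fun v h0 hv => h.top_heavy v (hm v h0 hv)
      tin_heavy := fun v h0 hv => h.tin_heavy v (hm v h0 hv)
      pos_heavy := fun v h0 hv => h.pos_heavy v (hm v h0 hv)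
      top_light := fun v h0 hv => h.top_light v (hm v h0 hv)
      tin_light := fun v h0 hv => h.tin_light v (hm v h0 hv)
      pos_light := fun v h0 hv => h.pos_light v (hm v h0 hv)
      acc_le := fun v h0 hv hl => by
        have h1 := h.acc_add_le hr (v := par v) ⟨v, mem_children.2 ⟨hv, h0, rfl⟩⟩
        have h2 := h.av_le v (hm v h0 hv) hl
        lia
      acc_sib := fun v w h0 hv h0' hw => h.av_sib v (hm v h0 hv) w (hm w h0' hw) }

theorem run_layout {s : State} (hr : Rooted n par dep (s.warr aQ) (s.warr aSZ) (s.warr aHV))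
    (hp : s.warr aPAR = par) (hn : s.wvar vN = n) (hnK : 2 * n ≤ K)
    (h0 : ∀ a, 10 ≤ a → s.warr a = fun _ => 0) :
    Run B K layout s (100 * n + 100) fun s' => HeavyPaths n par dep (s.warr aHV) (s'.warr aTOP)
      (s'.warr aTIN) (s'.warr aPOS) (s'.warr aAV) := by
  have hn0 := hr.n_pos
  refine (Run.seq' (R := fun s' => s' = s.setW vI (n - 1)) (.of_wp ?_) ?_).time_mono
    (T₁ := 4 + ((n - 1) * (90 + 3 + 1) + 3 + 1)) (by lia)
  · simp [Prog.wp, WExpr.eval, hn]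
    lia
  rintro s1 - - rfl
  refine Run.loop_count (fun j s' => s'.wvar vI = n - 1 - j ∧
      Layout n par (s.warr aQ) (s.warr aHV) (n - 1 - j) (s'.warr aTOP)
      (s'.warr aTIN) (s'.warr aPOS) (s'.warr aACC) (s'.warr aAV)) (n - 1) 90 ?_ ?_ ?_
  · have hl : late n (s.warr aQ) (n - 1) = ∅ := by simp [late]
    refine ⟨by simp, ?_⟩
    simp only [State.setW_warr, Nat.sub_zero]
    rw [h0 10 (by lia), h0 11 (by lia), h0 12 (by lia), h0 13 (by lia), h0 16 (by lia)]
    constructor <;> simp [hl, hr.size_root]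
  · rintro j hj s' hbd ha ⟨h1, h2⟩
    have e5 : s'.warr aPAR = par := (ha.wa _ rfl).trans hp
    have e7 : s'.warr aSZ = s.warr aSZ := ha.wa _ rfl
    have e8 : s'.warr aHV = s.warr aHV := ha.wa _ rfl
    have e9 : s'.warr aQ = s.warr aQ := ha.wa _ rfl
    refine ⟨by simp [Cond.Holds, WExpr.eval, h1]; lia, Run.of_wp' (by decide) ?_⟩
    obtain ⟨i, hi⟩ : ∃ i, n - 1 - j = i + 1 := ⟨n - 2 - j, by lia⟩
    have hi' : n - 1 - (j + 1) = i := by lia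
    have hin : i < n - 1 := by lia
    rw [hi] at h1 h2
    rw [hi']
    have hlh := h2.step_heavy hr hin rfl
    have hll := h2.step_light hr hin rfl
    have hsz := hr.sz_eq
    obtain ⟨x, hx⟩ : ∃ x, s.warr aQ i = x := ⟨_, rfl⟩
    have hxm := hr.queue.mem i hin
    have hf := (hr.fresh hin).2.1
    rw [hx] at hlh hll hxm hf
    have b1 := h2.tin_le _ hf
    have b2 := h2.pos_le _ hf
    have b3 := hsz (par x) (hr.lt x)
    have b4 := hsz x hxm.2
    have b5 := h2.acc_add_le hr (v := par x) ⟨x, mem_children.2 ⟨hxm.2, hxm.1, rfl⟩⟩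
    have hhv : s.warr aHV (par x) < n := by
      rcases hr.heavy _ (hr.lt x) with h1 | h1
      · rw [h1.1]; exact hr.n_pos
      · exact (mem_children.1 h1.1).1
    have b6 := hsz _ hhv
    have hpn := hr.lt x
    have b7 : size n par x ≤ n := RTree.size_le x
    have b8 : size n par (par x) ≤ n := RTree.size_le _
    have htop : s'.warr aTOP (par x) ≤ K := hbd.2 _ _
    simp [layoutBody, Prog.wp, decr, addTo, Cond.Holds, WExpr.eval, h1, e5, e7, e8, e9, hx]
    exact ⟨by lia, by lia, by lia, fun h3 => ⟨by lia, by lia, htop, hlh h3⟩,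
      fun h3 => ⟨by lia, by lia, by lia, by lia, by lia, hll h3⟩⟩
  · rintro s' - ha ⟨h1, h2⟩
    rw [Nat.sub_self] at h1 h2
    exact ⟨by simp [Cond.Holds, WExpr.eval, h1], h2.heavyPaths hr⟩

end TwoRespect

/-! ### The program: inverse numberings, and the decomposition in memory. -/

namespace TwoRespect

variable {B K n m : ℕ}

/-- Inverts the two numberings. -/
def invert : Prog :=
  .setW vI (.lit 0) ;;
  .loop (.wlt (.var vI) (.var vN))
    (.storeW aVAT (.get aTIN (.var vI)) (.var vI) ;;
     .storeW aEV (.get aPOS (.var vI)) (.var vI) ;;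
     incr vI)

theorem run_invert {par dep hv top tin pos acc : ℕ → ℕ} {s : State}
    (h : HeavyPaths n par dep hv top tin pos acc)
    (htin : s.warr aTIN = tin) (hpos : s.warr aPOS = pos) (hn : s.wvar vN = n) (hnK : 2 * n ≤ K) :
    Run B K invert s (20 * n + 20) fun s' =>
      HLD n par dep hv top tin pos (s'.warr aVAT) (s'.warr aEV) acc := by
  have hn0 := h.n_pos
  refine (Run.seq' (R := fun s' => s' = s.setW vI 0) (.of_wp ?_) ?_).time_mono
    (T₁ := 2 + (n * (12 + 3 + 1) + 3 + 1)) (by lia)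
  · simp [Prog.wp, WExpr.eval]
  rintro s1 - - rfl
  refine Run.loop_count (fun j s' => s'.wvar vI = j ∧ (∀ v, v < j → s'.warr aVAT (tin v) = v) ∧
      ∀ v, v < j → s'.warr aEV (pos v) = v) n 12 ?_ ?_ ?_
  · simp
  · rintro j hj s' - ha ⟨h1, h2, h3⟩
    have e1 : s'.warr aTIN = tin := (ha.wa _ rfl).trans htin
    have e2 : s'.warr aPOS = pos := (ha.wa _ rfl).trans hpos
    have en : s'.wvar vN = n := (ha.w _ rfl).trans (by simpa using hn)
    refine ⟨by simpa [Cond.Holds, WExpr.eval, h1, en] using hj, Run.of_wp' (by decide) ?_⟩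
    simp [Prog.wp, incr, WExpr.eval, h1, e1, e2]
    refine ⟨by lia, by lia, fun v hv => ?_, fun v hv => ?_⟩
    · rw [Function.update_apply]
      split_ifs with h4
      · exact (h.numbering_tin.inj h.toRTree (by lia) hj h4).symm
      · exact h2 v (lt_of_le_of_ne hv fun h5 => h4 (h5 ▸ rfl))
    · rw [Function.update_apply]
      split_ifs with h4
      · exact (h.numbering_pos.inj h.toRTree (by lia) hj h4).symm
      · exact h3 v (lt_of_le_of_ne hv fun h5 => h4 (h5 ▸ rfl))
  · rintro s' - ha ⟨h1, h2, h3⟩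
    have en : s'.wvar vN = n := (ha.w _ rfl).trans (by simpa using hn)
    exact ⟨by simp [Cond.Holds, WExpr.eval, h1, en], { h with vat_tin := h2, ev_pos := h3 }⟩

/-- The endpoints and weights of the edges as functions on the natural numbers. -/
def WGraph.srcN (G : WGraph n m) (k : ℕ) : ℕ := if hk : k < m then G.src ⟨k, hk⟩ else 0
def WGraph.dstN (G : WGraph n m) (k : ℕ) : ℕ := if hk : k < m then G.dst ⟨k, hk⟩ else 0
noncomputable def WGraph.weightN (G : WGraph n m) (k : ℕ) : ℝ :=
  if hk : k < m then G.weight ⟨k, hk⟩ else 0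
/-- The indicator function of the tree edges. -/
def flagN (T : Finset (Fin m)) (k : ℕ) : ℕ :=
  if hk : k < m then (if (⟨k, hk⟩ : Fin m) ∈ T then 1 else 0) else 0

section input
variable {G : WGraph n m} {T : Finset (Fin m)}

theorem WGraph.srcN_fin (k : Fin m) : G.srcN k = G.src k := by simp [WGraph.srcN]
theorem WGraph.dstN_fin (k : Fin m) : G.dstN k = G.dst k := by simp [WGraph.dstN]
theorem WGraph.weightN_fin (k : Fin m) : G.weightN k = G.weight k := by simp [WGraph.weightN]
theorem flagN_fin (k : Fin m) : flagN T k = if k ∈ T then 1 else 0 := by simp [flagN]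

theorem WGraph.srcN_lt {k : ℕ} (hk : k < m) : G.srcN k < n := by simp [WGraph.srcN, hk]
theorem WGraph.dstN_lt {k : ℕ} (hk : k < m) : G.dstN k < n := by simp [WGraph.dstN, hk]

theorem IsRooting.treeInput {par pe dep : ℕ → ℕ} (h : IsRooting G T par pe dep) :
    TreeInput n m G.srcN G.dstN (flagN T) par pe dep where
  toRTree := h.toRTree
  pe_out := h.pe_out
  pe_lt v h0 hv := by
    obtain ⟨k, -, hk, -⟩ := h.pe_spec v h0 hv
    rw [← hk]
    exact k.2
  flag_pe v h0 hv := by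
    obtain ⟨k, hkT, hk, -⟩ := h.pe_spec v h0 hv
    rw [← hk, flagN_fin, if_pos hkT]
  ends v h0 hv := by
    obtain ⟨k, hkT, hk, he⟩ := h.pe_spec v h0 hv
    rw [← hk, WGraph.srcN_fin, WGraph.dstN_fin]
    exact he
  surj k hk hf := by
    rw [flagN, dif_pos hk] at hf
    exact h.pe_surj ⟨k, hk⟩ (by by_contra h1; simp [h1] at hf)
  inj := h.pe_inj

end input

/-- A rooting of the tree together with its heavy path decomposition. -/
structure Decomp (G : WGraph n m) (T : Finset (Fin m)) : Type where
  par : ℕ → ℕ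
  pe : ℕ → ℕ
  dep : ℕ → ℕ
  hv : ℕ → ℕ
  top : ℕ → ℕ
  tin : ℕ → ℕ
  pos : ℕ → ℕ
  vat : ℕ → ℕ
  ev : ℕ → ℕ
  acc : ℕ → ℕ
  rooting : IsRooting G T par pe dep
  hld : HLD n par dep hv top tin pos vat ev acc

variable {G : WGraph n m} {T : Finset (Fin m)}

/-- The memory holds the graph and the heavy path decomposition. -/
structure Mem (D : Decomp G T) (s : State) : Prop where
  vn : s.wvar vN = n
  vm : s.wvar vM = m
  src : s.warr aSRC = G.srcN
  dst : s.warr aDST = G.dstN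
  flag : s.warr aFLAG = flagN T
  par : s.warr aPAR = D.par
  pe : s.warr aPE = D.pe
  sz : ∀ v < n, s.warr aSZ v + 1 = size n D.par v
  top : s.warr aTOP = D.top
  tin : s.warr aTIN = D.tin
  pos : s.warr aPOS = D.pos
  vat : s.warr aVAT = D.vat
  ev : s.warr aEV = D.ev
  weight : s.rarr 0 = G.weightN

/-- The program does not change the memory cells that hold the heavy path decomposition. -/
def Prog.keeps (p : Prog) : Bool :=
  [0, 1].all (fun i => !p.modW i) &&
    [0, 1, 2, 5, 6, 7, 12, 10, 11, 14, 15].all (fun a => !p.modWA a) && !p.modRA 0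

theorem Mem.agree {D : Decomp G T} {s s' : State} {p : Prog} (h : Mem D s) (ha : Agree p s s')
    (hp : p.keeps) : Mem D s' := by
  simp only [Prog.keeps, List.all_cons, List.all_nil, Bool.and_eq_true, Bool.not_eq_true',
    Bool.and_true] at hp
  obtain ⟨⟨⟨w0, w1⟩, a0, a1, a2, a5, a6, a7, a12, a10, a11, a14, a15⟩, r0⟩ := hp
  exact ⟨(ha.w _ w0).trans h.vn, (ha.w _ w1).trans h.vm, (ha.wa _ a0).trans h.src,
    (ha.wa _ a1).trans h.dst, (ha.wa _ a2).trans h.flag, (ha.wa _ a5).trans h.par,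
    (ha.wa _ a6).trans h.pe, by rw [ha.wa _ a7]; exact h.sz, (ha.wa _ a12).trans h.top,
    (ha.wa _ a10).trans h.tin, (ha.wa _ a11).trans h.pos, (ha.wa _ a14).trans h.vat,
    (ha.wa _ a15).trans h.ev, (ha.ra _ r0).trans h.weight⟩

/-- Computes the heavy path decomposition. -/
def decompose : Prog := rootTree ;; layout ;; invert

theorem rootTree_modWA {a : ℕ} (ha : 10 ≤ a) : rootTree.modWA a = false := by
  simp [rootTree, initDegrees, initQueue, peel, peelBody, addTo, subFrom, incr, Prog.modWA]
  omega

theorem layout_modWA {a : ℕ} (ha : 17 ≤ a) : layout.modWA a = false := by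
  simp [layout, layoutBody, addTo, decr, Prog.modWA]
  omega

theorem invert_modWA {a : ℕ} (ha : 17 ≤ a) : invert.modWA a = false := by
  simp [invert, incr, Prog.modWA]
  omega

theorem run_decompose (hn : 0 < n) (hT : G.IsSpanningTree T)
    (hK : 2 * (m + 1) * (m + 1) ≤ K) (hnK : 2 * n ≤ K) :
    Run B K decompose (G.input T) (60 * m + 380 * n + 440) fun s' =>
      (∃ D : Decomp G T, Mem D s') ∧ (∀ a, 17 ≤ a → s'.warr a = fun _ => 0) ∧
        (∀ a, 1 ≤ a → s'.rarr a = fun _ => 0) ∧ s'.out = [] := by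
  obtain ⟨par, pe, dep, hroot⟩ := exists_isRooting hn hT
  have i0 : (G.input T).warr aSRC = G.srcN := by
    funext k; simp [WGraph.input, WGraph.srcN]
  have i1 : (G.input T).warr aDST = G.dstN := by
    funext k; simp [WGraph.input, WGraph.dstN]
  have i2 : (G.input T).warr aFLAG = flagN T := by
    funext k; simp [WGraph.input, flagN]
  have i3 : ∀ a, 3 ≤ a → (G.input T).warr a = fun _ => 0 := by
    intro a ha
    funext k
    simp [WGraph.input, show a ≠ 0 by lia, show a ≠ 1 by lia, show a ≠ 2 by lia]
  have i4 : (G.input T).rarr 0 = G.weightN := by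
    funext k; simp [WGraph.input, WGraph.weightN]
  have i5 : ∀ a, 1 ≤ a → (G.input T).rarr a = fun _ => 0 := by
    intro a ha
    funext k
    simp [WGraph.input, show a ≠ 0 by lia]
  have i6 : (G.input T).wvar vN = n := rfl
  have i7 : (G.input T).wvar vM = m := rfl
  have i8 : (G.input T).out = [] := rfl
  -- Only the facts `i0`, …, `i8` about the input are used from here on.
  generalize G.input T = s at *
  refine (Run.seq' (run_rootTree (by rw [i0, i1, i2]; exact hroot.treeInput) i6 i7 hK hnK i3)
    ?_).time_mono (T₁ := 60 * m + 260 * n + 320 + (100 * n + 100 + (20 * n + 20))) (by lia)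
  rintro s1 - ha1 ⟨p1, p2, p3⟩
  refine Run.seq' (run_layout p3 p1 ((ha1.w _ rfl).trans i6) hnK ?_) ?_
  · intro a haa
    rw [ha1.wa a (rootTree_modWA haa)]
    exact i3 a (by lia)
  rintro s2 - ha2 h2
  refine (run_invert h2 rfl rfl ((ha2.w _ rfl).trans ((ha1.w _ rfl).trans i6)) hnK).imp ?_
  rintro s3 - ha3 h3
  refine ⟨⟨⟨par, pe, dep, _, _, _, _, _, _, _, hroot, h3⟩, ?_⟩, ?_, ?_, ?_⟩
  · exact
      { vn := (ha3.w _ rfl).trans ((ha2.w _ rfl).trans ((ha1.w _ rfl).trans i6))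
        vm := (ha3.w _ rfl).trans ((ha2.w _ rfl).trans ((ha1.w _ rfl).trans i7))
        src := (ha3.wa _ rfl).trans ((ha2.wa _ rfl).trans ((ha1.wa _ rfl).trans i0))
        dst := (ha3.wa _ rfl).trans ((ha2.wa _ rfl).trans ((ha1.wa _ rfl).trans i1))
        flag := (ha3.wa _ rfl).trans ((ha2.wa _ rfl).trans ((ha1.wa _ rfl).trans i2))
        par := (ha3.wa _ rfl).trans ((ha2.wa _ rfl).trans p1)
        pe := (ha3.wa _ rfl).trans ((ha2.wa _ rfl).trans p2)
        sz := by
          have e : s3.warr aSZ = s1.warr aSZ := (ha3.wa _ rfl).trans (ha2.wa _ rfl)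
          rw [e]
          exact p3.sz_eq
        top := ha3.wa _ rfl
        tin := ha3.wa _ rfl
        pos := ha3.wa _ rfl
        vat := rfl
        ev := rfl
        weight := (ha3.ra _ rfl).trans ((ha2.ra _ rfl).trans ((ha1.ra _ rfl).trans i4)) }
  · intro a haa
    rw [ha3.wa a (invert_modWA haa), ha2.wa a (layout_modWA haa), ha1.wa a (rootTree_modWA (by lia))]
    exact i3 a (by lia)
  · exact fun a ha => (ha3.ra _ rfl).trans ((ha2.ra _ rfl).trans ((ha1.ra _ rfl).trans (i5 a ha)))
  · exact (ha3.o rfl).trans ((ha2.o rfl).trans ((ha1.o rfl).trans i8))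

end TwoRespect

namespace TwoRespect

variable {B K n m : ℕ}

/-! ## The program: marks and lowest common ancestors -/

notation "aHEAD" => (17 : ℕ)
notation "aNX" => (18 : ℕ)
notation "aMK" => (19 : ℕ)
notation "aLCA" => (20 : ℕ)

/-- The list `l` is stored as a linked list that starts in the cell `h`; the cells in use are
`1, …, N - 1`. -/
def IsLinked (nx mk : ℕ → ℕ) (N : ℕ) : ℕ → List ℕ → Prop
  | h, [] => h = 0
  | h, k :: l => 0 < h ∧ h < N ∧ mk h = k ∧ IsLinked nx mk N (nx h) l

/-- Existing lists use only cells below `N`, so writing the new cell `N` leaves them intact. -/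
theorem IsLinked.update {nx mk : ℕ → ℕ} {N x y : ℕ} : ∀ {h : ℕ} {l : List ℕ},
    IsLinked nx mk N h l → IsLinked (Function.update nx N x) (Function.update mk N y) (N + 1) h l
  | _, [], hl => hl
  | h, k :: l, ⟨h1, h2, h3, h4⟩ => by
    refine ⟨h1, by lia, ?_, ?_⟩
    · rw [Function.update_of_ne (by lia), h3]
    · rw [Function.update_of_ne (by lia)]
      exact h4.update

theorem IsLinked.zero {nx mk : ℕ → ℕ} {N : ℕ} {l : List ℕ} (h : IsLinked nx mk N 0 l) : l = [] := by
  cases l with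
  | nil => rfl
  | cons k l => exact absurd h.1 (lt_irrefl 0)

theorem IsLinked.pos {nx mk : ℕ → ℕ} {N h : ℕ} {l : List ℕ} (hl : IsLinked nx mk N h l)
    (h0 : h ≠ 0) : ∃ l', l = mk h :: l' ∧ h < N ∧ IsLinked nx mk N (nx h) l' := by
  cases l with
  | nil => exact (h0 hl).elim
  | cons k l => exact ⟨l, by rw [hl.2.2.1], hl.2.1, hl.2.2.2⟩

/-- The marks are kept in `n` sorted linked lists, all of whose members are non-tree edges with
index at least `k`. -/
structure Marks (n m : ℕ) (flag : ℕ → ℕ) (k N : ℕ) (head nx mk : ℕ → ℕ) (l : ℕ → List ℕ) : Prop where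
  linked : ∀ b, IsLinked nx mk N (head b) (l b)
  count : ∑ b ∈ Finset.range n, (l b).length + 1 = N
  sorted : ∀ b, (l b).Pairwise (· ≤ ·)
  mem : ∀ b, ∀ e ∈ l b, k ≤ e ∧ e < m ∧ flag e ≠ 1

section marks
variable {flag head nx mk : ℕ → ℕ} {k N : ℕ} {l : ℕ → List ℕ}

/-- The edges are treated by decreasing index, so putting each mark in front keeps the lists sorted.
An edge may be marked twice in the same list. -/
theorem Marks.push (h : Marks n m flag k N head nx mk l) {b : ℕ} (hb : b < n) (hk : k < m)
    (hf : flag k ≠ 1) : Marks n m flag k (N + 1) (Function.update head b N)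
      (Function.update nx N (head b)) (Function.update mk N k)
      (Function.update l b (k :: l b)) where
  linked c := by
    by_cases hc : c = b
    · subst hc
      rw [Function.update_self, Function.update_self]
      refine ⟨by have := h.count; lia, by lia, by simp, ?_⟩
      rw [Function.update_self]
      exact (h.linked c).update
    · rw [Function.update_of_ne hc, Function.update_of_ne hc]
      exact (h.linked c).update
  count := by
    rw [← h.count, ← Finset.sum_erase_add _ _ (Finset.mem_range.2 hb),
      ← Finset.sum_erase_add (a := b) _ _ (Finset.mem_range.2 hb), Function.update_self,
      List.length_cons]
    have : ∑ x ∈ (Finset.range n).erase b, (Function.update l b (k :: l b) x).length =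
        ∑ x ∈ (Finset.range n).erase b, (l x).length := by
      refine Finset.sum_congr rfl fun x hx => ?_
      rw [Function.update_of_ne (Finset.ne_of_mem_erase hx)]
    lia
  sorted c := by
    by_cases hc : c = b
    · subst hc
      rw [Function.update_self]
      exact List.pairwise_cons.2 ⟨fun e he => (h.mem c e he).1, h.sorted c⟩
    · rw [Function.update_of_ne hc]
      exact h.sorted c
  mem c := by
    by_cases hc : c = b
    · subst hc
      rw [Function.update_self]
      rintro e (_ | ⟨_, he⟩)
      · exact ⟨le_rfl, hk, hf⟩
      · exact h.mem c e he
    · rw [Function.update_of_ne hc]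
      exact h.mem c

theorem Marks.mono {k' : ℕ} (h : Marks n m flag k N head nx mk l) (hk : k' ≤ k) :
    Marks n m flag k' N head nx mk l :=
  { h with mem := fun b e he => ⟨hk.trans (h.mem b e he).1, (h.mem b e he).2⟩ }

end marks

/-- Appends a mark for the edge `vI` to the list with number `b`. -/
def pushMark (b : WExpr) : Prog :=
  .storeW aMK (.var vQ) (.var vI) ;;
  .storeW aNX (.var vQ) (.get aHEAD b) ;;
  .storeW aHEAD b (.var vQ) ;;
  incr vQ

/-- Marks all places where the path from the vertex `vX - 1` to the root is entered or left. -/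
def markPath : Prog :=
  .loop (.wlt (.lit 0) (.var vX))
    (decr vX ;;
     pushMark (.get aPOS (.var vX)) ;;
     pushMark (.sub (.get aPOS (.get aTOP (.var vX))) (.lit 1)) ;;
     .ite (.weq (.get aTOP (.var vX)) (.lit 0)) (.setW vX (.lit 0))
       (.setW vX (.add (.get aPAR (.get aTOP (.var vX))) (.lit 1))))

/-- The `i`-th edge of the order (if it exists) is above `c`. -/
def AboveAt (n : ℕ) (par ev : ℕ → ℕ) (i c : ℕ) : Prop := i < n ∧ Anc par (ev i) c

/-- The number `n` belongs to a fictitious last edge that is above nothing. If the edge with number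
`n - 1` is above `c`, then `c` has this number itself, so the place is also marked. -/
theorem HLD.switch' {par dep hv top tin pos vat ev acc : ℕ → ℕ}
    (h : HLD n par dep hv top tin pos vat ev acc) {c i : ℕ} (hc : c < n) (hi : i < n)
    (hs : ¬ (AboveAt n par ev i c ↔ AboveAt n par ev (i + 1) c)) :
    i = pos c ∨ i = pos (top c) - 1 ∨ (0 < top c ∧
      ¬ (AboveAt n par ev i (par (top c)) ↔ AboveAt n par ev (i + 1) (par (top c)))) := by
  by_cases hi' : i + 1 < n
  · simp only [AboveAt, hi, hi', true_and] at hs ⊢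
    exact h.switch hc hi' hs
  · simp only [AboveAt, hi, hi', true_and, false_and, iff_false, not_not] at hs
    left
    have h1 := (h.numbering_pos.of_anc h.toRTree hc hs).1
    rw [(h.ev_spec hi).2] at h1
    have := h.pos_lt hc
    lia

variable {G : WGraph n m} {T : Finset (Fin m)}

/-- Each iteration treats one heavy path and makes two marks; the logarithm of the subtree size
grows by at least one per iteration, which bounds both the time and the number of marks. The
variable `vX` holds the current vertex plus one, and 0 at the end. For the path of the root, `pos
(top c) - 1` is truncated to 0; the main loop does not read the list with this number. -/
theorem run_markPath {D : Decomp G T} {s : State} (hmem : Mem D s) {k N u : ℕ} {l : ℕ → List ℕ}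
    (hI : s.wvar vI = k) (hX : s.wvar vX = u + 1) (hQ : s.wvar vQ = N) (hu : u < n)
    (hk : k < m) (hf : flagN T k ≠ 1) (hnK : 2 * n ≤ K) (hNK : N + 2 * (Nat.log 2 n + 1) + 2 ≤ K)
    (hmK : m ≤ K)
    (h : Marks n m (flagN T) k N (s.warr aHEAD) (s.warr aNX) (s.warr aMK) l) :
    Run B K markPath s (80 * (Nat.log 2 n + 2)) fun s' => ∃ N' l', s'.wvar vQ = N' ∧
      N' ≤ N + 2 * (Nat.log 2 n + 1) ∧
      Marks n m (flagN T) k N' (s'.warr aHEAD) (s'.warr aNX) (s'.warr aMK) l' ∧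
      (∀ b, ∀ e ∈ l b, e ∈ l' b) ∧
      ∀ i < n, ¬ (AboveAt n D.par D.ev i u ↔ AboveAt n D.par D.ev (i + 1) u) → k ∈ l' i := by
  have hd := D.hld
  refine (Run.loop_pot (fun s' => ∃ N' l', s'.wvar vQ = N' ∧
      Marks n m (flagN T) k N' (s'.warr aHEAD) (s'.warr aNX) (s'.warr aMK) l' ∧
      s'.wvar vX ≤ n ∧ (∀ b, ∀ e ∈ l b, e ∈ l' b) ∧
      N' + 2 * (if s'.wvar vX = 0 then 0 else
        Nat.log 2 n + 1 - Nat.log 2 (size n D.par (s'.wvar vX - 1))) ≤ N + 2 * (Nat.log 2 n + 1) ∧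
      ∀ i < n, ¬ (AboveAt n D.par D.ev i u ↔ AboveAt n D.par D.ev (i + 1) u) → k ∈ l' i ∨
        (0 < s'.wvar vX ∧ ¬ (AboveAt n D.par D.ev i (s'.wvar vX - 1) ↔
          AboveAt n D.par D.ev (i + 1) (s'.wvar vX - 1))))
    (fun s' => if s'.wvar vX = 0 then 0 else
        Nat.log 2 n + 1 - Nat.log 2 (size n D.par (s'.wvar vX - 1))) 66 ?_ ?_ ?_).time_mono ?_
  · refine ⟨N, l, hQ, h, by lia, fun _ _ h => h, ?_, fun i _ hs => .inr ?_⟩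
    · rw [hX, if_neg (by lia)]
      lia
    · rw [hX]
      exact ⟨by lia, hs⟩
  · rintro s' hbd ha ⟨N', l', h1, h2, h3, h4, h5, h6⟩ hb
    have hmem' := hmem.agree ha rfl
    have eI : s'.wvar vI = k := (ha.w _ rfl).trans hI
    have h7 : 0 < s'.wvar vX := hb
    obtain ⟨c, hc⟩ : ∃ c, s'.wvar vX = c + 1 := ⟨s'.wvar vX - 1, by lia⟩
    simp only [hc, Nat.add_one_ne_zero, if_false, Nat.add_sub_cancel] at h3 h5 h6 ⊢
    have hcn : c < n := by lia
    have hlc : Nat.log 2 (size n D.par c) ≤ Nat.log 2 n := Nat.log_mono_right (RTree.size_le c)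
    have hp1 := hd.pos_lt hcn
    have hp2 := hd.pos_lt (hd.top_lt hcn)
    have hq := (h2.push hp1 hk hf).push (show D.pos (D.top c) - 1 < n by lia) hk hf
    have hmono : ∀ b, ∀ e ∈ l b, e ∈ Function.update (Function.update l' (D.pos c)
        (k :: l' (D.pos c))) (D.pos (D.top c) - 1) (k :: Function.update l' (D.pos c)
        (k :: l' (D.pos c)) (D.pos (D.top c) - 1)) b := by
      intro b e he
      have := h4 b e he
      simp only [Function.update_apply]
      split_ifs <;> simp_all
    have hcov : ∀ i < n, ¬ (AboveAt n D.par D.ev i u ↔ AboveAt n D.par D.ev (i + 1) u) →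
        k ∈ Function.update (Function.update l' (D.pos c)
        (k :: l' (D.pos c))) (D.pos (D.top c) - 1) (k :: Function.update l' (D.pos c)
        (k :: l' (D.pos c)) (D.pos (D.top c) - 1)) i ∨ (0 < D.top c ∧
      ¬ (AboveAt n D.par D.ev i (D.par (D.top c)) ↔ AboveAt n D.par D.ev (i + 1) (D.par (D.top c)))) := by
      intro i hi hs
      simp only [Function.update_apply]
      rcases h6 i hi hs with h8 | ⟨-, h8⟩
      · left
        split_ifs <;> simp_all
      · rcases hd.switch' hcn hi h8 with h9 | h9 | h9
        · left
          split_ifs <;> simp_all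
        · left
          split_ifs <;> simp_all
        · exact .inr h9
    have hlog := hd.log_size_climb hcn
    have hpl := hd.lt (D.top c)
    have hlp : Nat.log 2 (size n D.par (D.par (D.top c))) ≤ Nat.log 2 n :=
      Nat.log_mono_right (RTree.size_le _)
    refine Run.of_wp' (by decide) ?_
    simp [Prog.wp, pushMark, incr, decr, Cond.Holds, WExpr.eval, hc, h1, eI, hmem'.pos, hmem'.top, hmem'.par]
    have hb17 : s'.warr aHEAD (D.pos c) ≤ K := hbd.2 _ _
    have hb17' : Function.update (s'.warr aHEAD) (D.pos c) N' (D.pos (D.top c) - 1) ≤ K := by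
      rw [Function.update_apply]
      split_ifs
      · lia
      · exact hbd.2 _ _
    refine ⟨by lia, by lia, hb17, by lia, by lia, by lia, hb17', by lia, by lia, fun h8 =>
      ⟨⟨_, hq, hmono, by lia, fun i hi hs => (hcov i hi hs).resolve_right fun h9 => by lia⟩, hlc⟩,
      fun h8 => ⟨by lia, ⟨_, hq, hpl, hmono, ?_, fun i hi hs => (hcov i hi hs).imp_right
        fun h9 => h9.2⟩, ?_⟩⟩
    · have := hlog (by lia)
      lia
    · have := hlog (by lia)
      lia
  · rintro s' - - ⟨N', l', h1, h2, h3, h4, h5, h6⟩ hb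
    have h7 : s'.wvar vX = 0 := by simpa [Cond.Holds, WExpr.eval] using hb
    simp only [h7, if_true] at h5
    refine ⟨N', l', h1, by lia, h2, h4, fun i hi hs => ?_⟩
    rcases h6 i hi hs with h8 | h8
    · exact h8
    · lia
  · simp only [hX, Nat.add_one_ne_zero, if_false]
    have : (Nat.log 2 n + 1 - Nat.log 2 (size n D.par (u + 1 - 1))) *
      (66 + (Cond.wlt (WExpr.lit 0) (WExpr.var vX)).cost + 1) ≤ (Nat.log 2 n + 1) * 70 :=
        Nat.mul_le_mul (by lia) (by decide)
    have : (Cond.wlt (WExpr.lit 0) (WExpr.var vX)).cost = 3 := rfl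
    lia

/-- Replaces `vX` and `vP` by higher vertices until they are on the same heavy path. -/
def climbBoth : Prog :=
  .loop (.not (.weq (.get aTOP (.var vX)) (.get aTOP (.var vP))))
    (.ite (.wlt (.get aTIN (.get aTOP (.var vP))) (.get aTIN (.get aTOP (.var vX))))
      (.setW vX (.get aPAR (.get aTOP (.var vX))))
      (.setW vP (.get aPAR (.get aTOP (.var vP)))))

/-- The vertex whose heavy path has the later top moves to the parent of that top, which by
`HLD.lca_step` preserves the common ancestors. The potential adds up what the logarithms of both
subtree sizes can still grow by. -/
theorem run_climbBoth {D : Decomp G T} {s : State} (hmem : Mem D s) {u v : ℕ}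
    (hX : s.wvar vX = u) (hP : s.wvar vP = v) (hu : u < n) (hv : v < n) (hnK : 2 * n ≤ K) :
    Run B K climbBoth s (60 * (Nat.log 2 n + 1)) fun s' => s'.wvar vX < n ∧ s'.wvar vP < n ∧
      D.top (s'.wvar vX) = D.top (s'.wvar vP) ∧ ∀ w, (Anc D.par w (s'.wvar vX) ∧
        Anc D.par w (s'.wvar vP)) ↔ (Anc D.par w u ∧ Anc D.par w v) := by
  have hd := D.hld
  have hlog : ∀ c, Nat.log 2 (size n D.par c) ≤ Nat.log 2 n :=
    fun c => Nat.log_mono_right (RTree.size_le c)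
  refine (Run.loop_pot (fun s' => s'.wvar vX < n ∧ s'.wvar vP < n ∧
      ∀ w, (Anc D.par w (s'.wvar vX) ∧
        Anc D.par w (s'.wvar vP)) ↔ (Anc D.par w u ∧ Anc D.par w v))
    (fun s' => (Nat.log 2 n - Nat.log 2 (size n D.par (s'.wvar vX))) +
      (Nat.log 2 n - Nat.log 2 (size n D.par (s'.wvar vP)))) 20 ?_ ?_ ?_).time_mono ?_
  · rw [hX, hP]
    exact ⟨hu, hv, fun w => Iff.rfl⟩
  · rintro s' - ha ⟨h1, h2, h3⟩ hb
    have hmem' := hmem.agree ha rfl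
    obtain ⟨a, ha⟩ : ∃ a, s'.wvar vX = a := ⟨_, rfl⟩
    obtain ⟨b, hb'⟩ : ∃ b, s'.wvar vP = b := ⟨_, rfl⟩
    simp only [Cond.Holds, WExpr.eval, hmem'.top, ha, hb'] at hb
    rw [ha] at h1
    rw [hb'] at h2
    simp only [ha, hb'] at h3
    have hla := hlog (D.par (D.top a))
    have hlb := hlog (D.par (D.top b))
    have hpa := hd.lt (D.top a)
    have hpb := hd.lt (D.top b)
    refine Run.of_wp' (by decide) ?_
    simp [Prog.wp, Cond.Holds, WExpr.eval, ha, hb', hmem'.tin, hmem'.top, hmem'.par, h1, h2, hpa, hpb]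
    constructor
    · intro h4
      obtain ⟨h5, h6⟩ := hd.lca_step h1 h2 h4
      have := hd.log_size_climb h1 h5
      exact ⟨by lia, fun w => (h6 w).trans (h3 w), by lia⟩
    · intro h4
      -- Equal numbers would mean equal tops, and then the loop would have ended.
      have h4' : D.tin (D.top a) < D.tin (D.top b) := lt_of_le_of_ne h4 fun h5 =>
        hb (hd.numbering_tin.inj hd.toRTree (hd.top_lt h1) (hd.top_lt h2) h5)
      obtain ⟨h5, h6⟩ := hd.lca_step h2 h1 h4'
      have := hd.log_size_climb h2 h5
      exact ⟨by lia, fun w => by rw [and_comm, h6 w, and_comm]; exact h3 w, by lia⟩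
  · rintro s' - ha ⟨h1, h2, h3⟩ hb
    have hmem' := hmem.agree ha rfl
    simp only [Cond.Holds, WExpr.eval, hmem'.top, not_not] at hb
    exact ⟨h1, h2, hb, h3⟩
  · have hc : (Cond.not (.weq (.get aTOP (.var vX)) (.get aTOP (.var vP)))).cost = 6 := rfl
    rw [hc]
    lia

/-- The vertex `l` is the lowest common ancestor of `u` and `v`. -/
def IsLca (n : ℕ) (par : ℕ → ℕ) (l u v : ℕ) : Prop :=
  l < n ∧ ∀ w, Anc par w l ↔ Anc par w u ∧ Anc par w v

/-- Marks all non-tree edges and computes the lowest common ancestors of their endpoints. -/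
def markAll : Prog :=
  .setW vQ (.lit 1) ;;
  .setW vI (.var vM) ;;
  .loop (.wlt (.lit 0) (.var vI))
    (decr vI ;;
     .ite (.weq (.get aFLAG (.var vI)) (.lit 1)) .skip
      (.setW vX (.add (.get aSRC (.var vI)) (.lit 1)) ;; markPath ;;
       .setW vX (.add (.get aDST (.var vI)) (.lit 1)) ;; markPath ;;
       .setW vX (.get aSRC (.var vI)) ;; .setW vP (.get aDST (.var vI)) ;; climbBoth ;;
       .ite (.wlt (.get aTIN (.var vX)) (.get aTIN (.var vP)))
        (.storeW aLCA (.var vI) (.var vX)) (.storeW aLCA (.var vI) (.var vP))))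

/-- The lists of marks of all non-tree edges from index `k` on. -/
structure Marked (D : Decomp G T) (k : ℕ) (s : State) (l : ℕ → List ℕ) : Prop where
  marks : Marks n m (flagN T) k (s.wvar vQ) (s.warr aHEAD) (s.warr aNX) (s.warr aMK) l
  cover : ∀ e, k ≤ e → e < m → flagN T e ≠ 1 → ∀ i < n,
    ¬ (AboveAt n D.par D.ev i (G.srcN e) ↔ AboveAt n D.par D.ev (i + 1) (G.srcN e)) ∨
    ¬ (AboveAt n D.par D.ev i (G.dstN e) ↔ AboveAt n D.par D.ev (i + 1) (G.dstN e)) → e ∈ l i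
  lca : ∀ e, k ≤ e → e < m → flagN T e ≠ 1 →
    IsLca n D.par (s.warr aLCA e) (G.srcN e) (G.dstN e)

/-- A non-tree edge gets at most `2 * (Nat.log 2 n + 1)` marks for each of its two ends. -/
theorem run_markAll {D : Decomp G T} {s : State} (hmem : Mem D s) (hnK : 2 * n ≤ K)
    (hmK : (4 * m + 4) * (Nat.log 2 n + 2) ≤ K)
    (h0 : ∀ a, 17 ≤ a → s.warr a = fun _ => 0) :
    Run B K markAll s (10 + 400 * (m * (Nat.log 2 n + 2))) fun s' => ∃ l, Marked D 0 s' l ∧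
      s'.wvar vQ ≤ 1 + 4 * (Nat.log 2 n + 1) * m := by
  have hd := D.hld
  have hn0 := hd.n_pos
  set L := Nat.log 2 n with hL
  have hmK' : 4 * (L + 1) * m + 4 * L + 8 ≤ K := by nlinarith
  refine (Run.seq' (R := fun s' => s' = s.setW vQ 1) (.of_wp ?_) ?_).time_mono
    (T₁ := 2 + (2 + (m * (300 * (L + 2) + 3 + 1) + 3 + 1))) (by nlinarith)
  · simp [Prog.wp, WExpr.eval]
    lia
  rintro s1 - - rfl
  refine Run.seq' (R := fun s' => s' = (s.setW vQ 1).setW vI m) (.of_wp ?_) ?_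
  · simp [Prog.wp, WExpr.eval, hmem.vm]
    nlinarith
  rintro s1 - ha1 rfl
  have hmem1 : Mem D ((s.setW vQ 1).setW vI m) := by
    have h1 : Agree markAll s ((s.setW vQ 1).setW vI m) := by
      refine ⟨fun i hi => ?_, fun _ _ => rfl, fun _ _ => rfl, fun _ _ => rfl, fun _ => rfl⟩
      have : i ≠ 6 ∧ i ≠ 2 := by
        constructor <;> rintro rfl <;> exact absurd hi (by decide)
      simp [this.1, this.2]
    exact hmem.agree h1 rfl
  refine Run.loop_count (fun j s' => s'.wvar vI = m - j ∧ ∃ l, Marked D (m - j) s' l ∧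
      s'.wvar vQ ≤ 1 + 4 * (L + 1) * j) m (300 * (L + 2)) ?_ ?_ ?_
  · refine ⟨by simp, fun _ => [], ⟨⟨?_, ?_, ?_, ?_⟩, ?_, ?_⟩, by simp⟩
    · intro b
      simp [IsLinked, h0]
    · simp
    · simp
    · simp
    · intro e he he'
      lia
    · intro e he he'
      lia
  · rintro j hj s' - ha ⟨h1, l, h2, h3⟩
    have hmem' := hmem1.agree ha rfl
    obtain ⟨k, hk⟩ : ∃ k, m - j = k + 1 := ⟨m - j - 1, by lia⟩
    have hk' : m - (j + 1) = k := by lia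
    have hkm : k < m := by lia
    rw [hk] at h1 h2
    rw [hk']
    have hj4 : 4 * (L + 1) * (j + 1) ≤ 4 * (L + 1) * m := Nat.mul_le_mul_left _ hj
    have hj5 : 4 * (L + 1) * (j + 1) = 4 * (L + 1) * j + 4 * (L + 1) := by ring
    have hmm : m ≤ K := by nlinarith
    refine ⟨by simp [Cond.Holds, WExpr.eval, h1], ?_⟩
    refine (Run.seq' (R := fun s'' => s'' = s'.setW vI k) (.of_wp ?_) ?_).time_mono
      (T₁ := 4 + (4 + max 1 (5 + (80 * (L + 2) + (5 + (80 * (L + 2) + (3 + (3 + (60 * (L + 1)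
        + 20)))))))+ 1)) ?_
    · simp [Prog.wp, decr, WExpr.eval, h1]
      lia
    · rintro s2 - ha2 rfl
      have hmem2 := hmem'.agree ha2 rfl
      have eI : (s'.setW vI k).wvar vI = k := by simp
      refine Run.ite ?_ ?_
      · intro hb
        simp only [Cond.Holds, WExpr.eval, eI, hmem2.flag] at hb
        refine Run.skip ⟨eI, l, ⟨h2.marks.mono (by lia), fun e he he' hf => ?_,
          fun e he he' hf => ?_⟩, ?_⟩
        · exact h2.cover e (Nat.lt_of_le_of_ne he fun h => hf (h ▸ hb)) he' hf
        · exact h2.lca e (Nat.lt_of_le_of_ne he fun h => hf (h ▸ hb)) he' hf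
        · simp only [State.setW_wvar]
          simp
          lia
      · intro hb
        simp only [Cond.Holds, WExpr.eval, eI, hmem2.flag] at hb
        have hu := G.srcN_lt hkm
        have hv := G.dstN_lt hkm
        refine Run.seq' (R := fun s'' => s'' = (s'.setW vI k).setW vX (G.srcN k + 1)) (.of_wp ?_) ?_
        · simp [Prog.wp, WExpr.eval, hmem'.src]
          lia
        rintro s3 - ha3 rfl
        have hmem3 := hmem2.agree ha3 rfl
        refine Run.seq' (run_markPath hmem3 (k := k) (by simp) (by simp) rfl hu hkm hb hnK ?_ hmm
          (h2.marks.mono (by lia))) ?_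
        · simp; lia
        rintro s4 - ha4 ⟨N4, l4, q4, b4, m4, i4, c4⟩
        have hmem4 := hmem3.agree ha4 rfl
        have e4 : s4.wvar vI = k := (ha4.w _ rfl).trans (by simp)
        refine Run.seq' (R := fun s'' => s'' = s4.setW vX (G.dstN k + 1)) (.of_wp ?_) ?_
        · simp [Prog.wp, WExpr.eval, hmem4.dst, e4]
          lia
        rintro s5 - ha5 rfl
        have hmem5 := hmem4.agree ha5 rfl
        simp at b4
        refine Run.seq' (run_markPath hmem5 (k := k) (by simpa using e4) (by simp)
          (by simpa using q4) hv hkm hb hnK (by lia) hmm m4) ?_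
        rintro s6 - ha6 ⟨N6, l6, q6, b6, m6, i6, c6⟩
        have hmem6 := hmem5.agree ha6 rfl
        have e6 : s6.wvar vI = k := (ha6.w _ rfl).trans (by simpa using e4)
        refine Run.seq' (R := fun s'' => s'' = s6.setW vX (G.srcN k)) (.of_wp ?_) ?_
        · simp [Prog.wp, WExpr.eval, hmem6.src, e6]
          lia
        rintro s7 - ha7 rfl
        have hmem7 := hmem6.agree ha7 rfl
        refine Run.seq' (R := fun s'' => s'' = (s6.setW vX (G.srcN k)).setW vP (G.dstN k))
          (.of_wp ?_) ?_
        · simp [Prog.wp, WExpr.eval, hmem6.dst, e6]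
          lia
        rintro s8 - ha8 rfl
        have hmem8 := hmem7.agree ha8 rfl
        refine Run.seq' (run_climbBoth hmem8 (by simp) (by simp) hu hv hnK) ?_
        rintro s9 - ha9 ⟨c1, c2, c3, c5⟩
        have hmem9 := hmem8.agree ha9 rfl
        have e9 : s9.wvar vI = k := (ha9.w _ rfl).trans (by simpa using e6)
        have q9 : s9.wvar vQ = N6 := (ha9.w _ rfl).trans (by simpa using q6)
        have m17 : s9.warr aHEAD = s6.warr aHEAD := ha9.wa _ rfl
        have m18 : s9.warr aNX = s6.warr aNX := ha9.wa _ rfl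
        have m19 : s9.warr aMK = s6.warr aMK := ha9.wa _ rfl
        have m20 : s9.warr aLCA = s'.warr aLCA := (ha9.wa _ rfl).trans ((ha6.wa _ rfl).trans
          (ha4.wa _ rfl))
        have key : ∀ x, IsLca n D.par x (G.srcN k) (G.dstN k) →
            Marked D k (s9.storeW aLCA k x) l6 := by
          intro x hx
          refine ⟨?_, fun e he he' hf i hi hs => ?_, fun e he he' hf => ?_⟩
          · simpa [q9, m17, m18, m19] using m6
          · rcases Nat.eq_or_lt_of_le he with rfl | hlt
            · rcases hs with hs | hs
              · exact i6 _ _ (c4 i hi hs)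
              · exact c6 i hi hs
            · exact i6 _ _ (i4 _ _ (h2.cover e hlt he' hf i hi hs))
          · simp only [State.storeW_warr, if_true, m20]
            rcases Nat.eq_or_lt_of_le he with rfl | hlt
            · rw [Function.update_self]
              exact hx
            · rw [Function.update_of_ne (by lia)]
              exact h2.lca e hlt he' hf
        refine Run.of_wp' (by decide) ?_
        simp only [Prog.wp, Cond.Holds, WExpr.eval, hmem9.tin, e9]
        -- Of two vertices on the same heavy path, the one with the smaller number is an ancestor of
        -- the other, hence their lowest common ancestor.
        refine ⟨fun hlt => ⟨by lia, by simpa using e9, l6, key _ ⟨c1, fun w => ?_⟩, ?_⟩,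
          fun hlt => ⟨by lia, by simpa using e9, l6, key _ ⟨c2, fun w => ?_⟩, ?_⟩⟩
        · rw [← c5]
          exact ⟨fun h => ⟨h, h.trans (hd.lca_end c1 c2 c3 hlt.le)⟩, fun h => h.1⟩
        · simp [q9]
          lia
        · rw [← c5]
          exact ⟨fun h => ⟨h.trans (hd.lca_end c2 c1 c3.symm (by lia)), h⟩, fun h => h.2⟩
        · simp [q9]
          lia
    · have : max 1 (5 + (80 * (L + 2) + (5 + (80 * (L + 2) + (3 + (3 + (60 * (L + 1)
        + 20))))))) ≤ 240 * (L + 2) := by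
        rw [max_le_iff]
        constructor <;> lia
      lia
  · rintro s' - ha ⟨h1, l, h2, h3⟩
    rw [Nat.sub_self] at h1 h2
    exact ⟨by simp [Cond.Holds, WExpr.eval, h1], l, h2, h3⟩

end TwoRespect

namespace TwoRespect

/-! ## The balanced hierarchy of segments -/

/-- The segment from `a` to `b` of the preorder numbers is a non-empty union of vertices of the heavy
path with top `t` and of subtrees of their light children. -/
structure Good (n : ℕ) (par top tin : ℕ → ℕ) (a b t : ℕ) : Prop where
  lt : t < n
  top_eq : top t = t
  lo : tin t ≤ a
  ne : a < b
  hi : b ≤ tin t + size n par t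
  lam : ∀ c < n, Anc par t c → top c ≠ t →
    tin c + size n par c ≤ a ∨ b ≤ tin c ∨ (a ≤ tin c ∧ tin c + size n par c ≤ b)

/-- The segment from `p` to `e` consists of a single vertex `x` of the heavy path with top `t`. -/
structure PathItem (n : ℕ) (top tin : ℕ → ℕ) (t p e x : ℕ) : Prop where
  lt : x < n
  top_eq : top x = t
  tin_eq : tin x = p
  end_eq : e = p + 1

/-- The segment from `p` to `e` is the subtree of a light child `c` of a vertex of the heavy path
with top `t`. -/
structure LightItem (n : ℕ) (par top tin : ℕ → ℕ) (t p e c : ℕ) : Prop where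
  pos : 0 < c
  lt : c < n
  top_eq : top c = c
  top_par : top (par c) = t
  tin_eq : tin c = p
  end_eq : e = p + size n par c
  anc : Anc par t (par c)

/-- An upper bound for the number of nodes in the hierarchy below a segment. -/
def nodeWeight (n : ℕ) (top tin : ℕ → ℕ) (a b t : ℕ) : ℕ :=
  (b - a) + ∑ v ∈ Finset.range n, if a ≤ tin v ∧ tin v < b ∧ top v = v ∧ v ≠ t then 1 else 0

/-- A quantity that at least doubles from a segment to the next larger one. -/
noncomputable def segWeight (n : ℕ) (par tin : ℕ → ℕ) (a b t : ℕ) : ℕ :=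
  if a = tin t ∧ b = tin t + size n par t then (b - a) * (b - a) else 2 * ((b - a) * (b - a))

namespace HLD
variable {n : ℕ} {par dep hv top tin pos vat ev acc : ℕ → ℕ} {a b t p e c x : ℕ}

section
variable (h : HLD n par dep hv top tin pos vat ev acc)
include h

theorem good_root : Good n par top tin 0 n 0 where
  lt := h.n_pos
  top_eq := h.top_zero
  lo := h.tin_zero.le
  ne := h.n_pos
  hi := by rw [h.tin_zero, h.size_root]; lia
  lam c hc _ _ := .inr (.inr ⟨Nat.zero_le _, h.numbering_tin.add_size_le h.toRTree hc⟩)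

theorem good_full (hc : c < n) (ht : top c = c) :
    Good n par top tin (tin c) (tin c + size n par c) c where
  lt := hc
  top_eq := ht
  lo := le_rfl
  ne := by have : 0 < size n par c := RTree.size_pos hc; lia
  hi := le_rfl
  lam _ hv ha _ := .inr (.inr (h.numbering_tin.of_anc h.toRTree hv ha))

theorem good_anc (hg : Good n par top tin a b t) {v : ℕ} (hv : v < n) (h1 : a ≤ tin v)
    (h2 : tin v < b) : Anc par t v :=
  (h.tin_anc hg.lt hv).2 ⟨hg.lo.trans h1, h2.trans_le hg.hi⟩

theorem good_contains (hg : Good n par top tin a b t) {v : ℕ} (hv : v < n) (h1 : a ≤ tin v)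
    (h2 : tin v < b) (ht : top v ≠ t) : tin v + size n par v ≤ b := by
  have : 0 < size n par v := RTree.size_pos hv
  have := hg.lam v hv (h.good_anc hg hv h1 h2) ht
  lia

/-- An ancestor of `x` below `t` is on the heavy path. So a vertex `c` off this path is not above
`x`, and its interval does not contain the one number of the item. -/
theorem pathItem_lam (hi : PathItem n top tin t p e x) (hv : c < n) (ha : Anc par t c)
    (hc : top c ≠ t) :
    tin c + size n par c ≤ p ∨ e ≤ tin c ∨ (p ≤ tin c ∧ tin c + size n par c ≤ e) := by
  have h1 : ¬ Anc par c x := fun h1 => hc <| by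
    rw [h.top_between (v := x) hi.lt (by rw [hi.top_eq]; exact ha) h1, hi.top_eq]
  rw [h.tin_anc hv hi.lt, hi.tin_eq] at h1
  have := hi.end_eq
  have h3 : tin c ≠ p := fun h3 => by
    have : 0 < size n par c := RTree.size_pos hv
    lia
  lia

/-- A path vertex below `c` would put `c` on the path as well, whereas `c` is the top of its own
path, strictly below `t`. -/
theorem lightItem_off (hi : LightItem n par top tin t p e c) {v : ℕ} (hv : v < n)
    (ha : Anc par c v) : top v ≠ t := by
  intro h1
  have h2 : top c = top v := h.top_between hv
    (by rw [h1]; exact hi.anc.trans (.parent c)) ha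
  rw [hi.top_eq, h1] at h2
  have h3 := hi.anc
  rw [← h2] at h3
  exact h.not_anc_par hi.pos hi.lt h3

/-- A vertex strictly above `c` and below `t` is on the path. All other vertices have their subtree
inside that of `c` or disjoint from it. -/
theorem lightItem_lam (hi : LightItem n par top tin t p e c) {v : ℕ} (hv : v < n)
    (ha : Anc par t v) (hc : top v ≠ t) :
    tin v + size n par v ≤ p ∨ e ≤ tin v ∨ (p ≤ tin v ∧ tin v + size n par v ≤ e) := by
  have h0 := hi.tin_eq
  have h1 := hi.end_eq
  by_cases h2 : Anc par v c
  · rcases Anc.iff_par.1 h2 with rfl | h3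
    · lia
    · refine (hc ?_).elim
      rw [h.top_between (v := par c) (h.lt c) (by rw [hi.top_par]; exact ha) h3, hi.top_par]
  · by_cases h3 : Anc par c v
    · have := h.numbering_tin.of_anc h.toRTree hv h3
      lia
    · have := h.numbering_tin.disjoint h.toRTree hv hi.lt h2 h3
      lia

theorem lightItem_subset (hi : LightItem n par top tin t p e c) (hg : Good n par top tin a b t)
    {v : ℕ} (hv : v < n) (ha : Anc par c v) (h1 : a ≤ tin v) (h2 : tin v < b) : a ≤ p ∧ e ≤ b := by
  have h3 := (h.tin_anc hi.lt hv).1 ha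
  have h4 := hg.lam c hi.lt (hi.anc.trans (.parent c)) (h.lightItem_off hi hi.lt (.refl c))
  have h5 := hi.tin_eq
  have h6 := hi.end_eq
  lia

omit h in
theorem lightItem_lt (hi : LightItem n par top tin t p e c) : p < e := by
  have h1 := hi.end_eq
  have : 0 < size n par c := RTree.size_pos hi.lt
  lia

omit h in
theorem _root_.TwoRespect.Good.left (hg : Good n par top tin a b t)
    (hl : ∀ c < n, Anc par t c → top c ≠ t →
      tin c + size n par c ≤ p ∨ e ≤ tin c ∨ (p ≤ tin c ∧ tin c + size n par c ≤ e))
    (hpe : p < e) (heb : e ≤ b) (hap : a < p) : Good n par top tin a p t where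
  lt := hg.lt
  top_eq := hg.top_eq
  lo := hg.lo
  ne := hap
  hi := by have := hg.hi; lia
  lam c hc ha ht := by
    have := hg.lam c hc ha ht
    have := hl c hc ha ht
    lia

omit h in
theorem _root_.TwoRespect.Good.right (hg : Good n par top tin a b t)
    (hl : ∀ c < n, Anc par t c → top c ≠ t →
      tin c + size n par c ≤ p ∨ e ≤ tin c ∨ (p ≤ tin c ∧ tin c + size n par c ≤ e))
    (hpe : p < e) (hap : a ≤ p) (heb : e < b) : Good n par top tin e b t where
  lt := hg.lt
  top_eq := hg.top_eq
  lo := by have := hg.lo; lia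
  ne := heb
  hi := hg.hi
  lam c hc ha ht := by
    have := hg.lam c hc ha ht
    have := hl c hc ha ht
    have : 0 < size n par c := RTree.size_pos hc
    lia

omit h in
-- The vertex `x` is in neither part, so the lengths drop by one.
theorem nodeWeight_pathItem (hi : PathItem n top tin t p e x) (hap : a ≤ p) (heb : e ≤ b) :
    nodeWeight n top tin a p t + nodeWeight n top tin e b t + 1 ≤ nodeWeight n top tin a b t := by
  have h1 := hi.end_eq
  have h2 : ∑ v ∈ Finset.range n, (if a ≤ tin v ∧ tin v < p ∧ top v = v ∧ v ≠ t then 1 else 0) +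
      ∑ v ∈ Finset.range n, (if e ≤ tin v ∧ tin v < b ∧ top v = v ∧ v ≠ t then 1 else 0) ≤
      ∑ v ∈ Finset.range n, (if a ≤ tin v ∧ tin v < b ∧ top v = v ∧ v ≠ t then 1 else 0) := by
    rw [← Finset.sum_add_distrib]
    refine Finset.sum_le_sum fun v _ => ?_
    by_cases h3 : top v = v ∧ v ≠ t
    · simp only [h3, and_true, ne_eq, not_false_eq_true]
      split_ifs <;> lia
    · have h4 : ∀ q q' : Prop, (q ∧ q' ∧ top v = v ∧ v ≠ t) ↔ False := by tauto
      simp only [h4, if_false]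
      lia
  rw [nodeWeight, nodeWeight, nodeWeight]
  lia

/-- Here the lengths add up without loss, and the segment may even consist of the item alone. The
gain comes from the second summand of `nodeWeight`: the top `c` is counted in the large segment but
not in the segment that has `c` as its own top. -/
theorem nodeWeight_lightItem (hi : LightItem n par top tin t p e c) (hg : Good n par top tin a b t)
    (hap : a ≤ p) (heb : e ≤ b) :
    nodeWeight n top tin a p t + nodeWeight n top tin e b t + nodeWeight n top tin p e c + 1 ≤
      nodeWeight n top tin a b t := by
  have h1 := hi.tin_eq
  have h1' := lightItem_lt hi
  have hct : top c ≠ t := h.lightItem_off hi hi.lt (.refl c)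
  rw [hi.top_eq] at hct
  have h2 : ∑ v ∈ Finset.range n, (if a ≤ tin v ∧ tin v < p ∧ top v = v ∧ v ≠ t then 1 else 0) +
      ∑ v ∈ Finset.range n, (if e ≤ tin v ∧ tin v < b ∧ top v = v ∧ v ≠ t then 1 else 0) +
      ∑ v ∈ Finset.range n, (if p ≤ tin v ∧ tin v < e ∧ top v = v ∧ v ≠ c then 1 else 0) +
      ∑ v ∈ Finset.range n, (if c = v then 1 else 0) ≤
      ∑ v ∈ Finset.range n, (if a ≤ tin v ∧ tin v < b ∧ top v = v ∧ v ≠ t then 1 else 0) := by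
    rw [← Finset.sum_add_distrib, ← Finset.sum_add_distrib, ← Finset.sum_add_distrib]
    refine Finset.sum_le_sum fun v hv => ?_
    rw [Finset.mem_range] at hv
    by_cases h3 : top v = v
    · simp only [h3, true_and]
      by_cases h4 : v = t
      · subst h4
        have h5 : ¬ p ≤ tin v := fun h5 => by
          have := hg.lo
          exact hct (h.numbering_tin.inj h.toRTree hi.lt hv (by lia))
        simp [h5, hct]
      · by_cases h5 : c = v
        · subst h5
          simp only [ne_eq, not_true_eq_false, and_false, if_false, if_true, h4, not_false_eq_true,
            and_true]
          split_ifs <;> lia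
        · simp only [ne_eq, h4, Ne.symm h5, h5, not_false_eq_true, and_true, if_false]
          split_ifs <;> lia
    · have h4 : c ≠ v := fun h4 => h3 (h4 ▸ hi.top_eq)
      simp [h3, h4]
  rw [Finset.sum_ite_eq, if_pos (Finset.mem_range.2 hi.lt)] at h2
  rw [nodeWeight, nodeWeight, nodeWeight, nodeWeight]
  lia

omit h in
theorem nodeWeight_le : nodeWeight n top tin 0 n t ≤ 2 * n := by
  rw [nodeWeight]
  have := Finset.sum_le_card_nsmul (Finset.range n)
    (fun v => if 0 ≤ tin v ∧ tin v < n ∧ top v = v ∧ v ≠ t then 1 else 0) 1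
    fun v _ => by split_ifs <;> lia
  rw [Finset.card_range, smul_eq_mul] at this
  lia

omit h in
theorem segWeight_le (hb : b ≤ n) :
    segWeight n par tin a b t ≤ 2 * ((b - a) * (b - a)) ∧
    (b - a) * (b - a) ≤ segWeight n par tin a b t ∧ segWeight n par tin a b t ≤ 2 * (n * n) := by
  have : (b - a) * (b - a) ≤ n * n := Nat.mul_le_mul (by lia) (by lia)
  rw [segWeight]
  split_ifs <;> lia

omit h in
-- Halving the length divides its square by four. One factor 2 is for the doubling, the other one
-- compensates the factor 2 that only the shorter segment may carry.
theorem segWeight_half {a' b' t' : ℕ} (hb : b ≤ n) (hb' : b' ≤ n)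
    (hh : 2 * (b' - a') ≤ b - a) :
    2 * segWeight n par tin a' b' t' ≤ segWeight n par tin a b t := by
  have h1 := (segWeight_le (par := par) (tin := tin) (t := t') (a := a') hb').1
  have h2 := (segWeight_le (par := par) (tin := tin) (t := t) (a := a) hb).2.1
  have : (2 * (b' - a')) * (2 * (b' - a')) ≤ (b - a) * (b - a) := Nat.mul_le_mul hh hh
  lia

/-- If the large segment is the whole subtree of `t`, then the subtree of the light vertex `c` has
less than half of its length. Otherwise `c` may fill the segment, but the weight of the large
segment carries the factor 2 and that of the complete subtree of `c` does not. -/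
theorem segWeight_light (hi : LightItem n par top tin t p e c) (hap : a ≤ p) (heb : e ≤ b) :
    2 * segWeight n par tin p e c ≤ segWeight n par tin a b t := by
  have h1 := hi.end_eq
  have h2 : segWeight n par tin p e c = (e - p) * (e - p) := by
    rw [segWeight, if_pos ⟨hi.tin_eq.symm, by rw [hi.tin_eq, h1]⟩]
  rw [h2, segWeight]
  split_ifs with h3
  · have h4 := h.light_top hi.lt (by rw [hi.top_eq]; exact hi.pos)
    rw [hi.top_eq] at h4
    have h5 := h.two_mul_size hi.pos hi.lt h4
    have h6 : size n par (par c) ≤ size n par t := RTree.size_le_of_anc hi.anc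
    have : (2 * (e - p)) * (2 * (e - p)) ≤ (b - a) * (b - a) :=
      Nat.mul_le_mul (by lia) (by lia)
    lia
  · have : (e - p) * (e - p) ≤ (b - a) * (b - a) := Nat.mul_le_mul (by lia) (by lia)
    lia

end
end HLD

/-! ## The values that are kept for a segment -/

/-- The real number `r` (or infinity, if `f = 0`) is the minimum of `g` on the set `C`. -/
def IsMin {ι : Type} (f : ℕ) (r : ℝ) (C : ι → Prop) (g : ι → ℝ) : Prop :=
  ∀ z : ℝ, (f = 0 ∨ z ≤ r) ↔ ∀ v, C v → z ≤ g v

namespace IsMin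
variable {ι : Type} {f f' : ℕ} {r r' : ℝ} {C C' : ι → Prop} {g g' : ι → ℝ}

theorem congr (h : IsMin f r C g) (hC : ∀ v, C' v ↔ C v) (hg : ∀ v, C v → g' v = g v) :
    IsMin f r C' g' := by
  intro z
  rw [h z]
  refine forall_congr' fun v => ?_
  rw [hC]
  refine imp_congr_right fun hv => ?_
  rw [hg v hv]

theorem empty (hC : ∀ v, ¬ C v) : IsMin 0 r C g := by
  intro z
  simp [hC]

theorem single (x : ι) : IsMin f (g x) (fun v => v = x ∧ f ≠ 0) g := by
  intro z
  by_cases hf : f = 0 <;> simp [hf]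

theorem add (h : IsMin f r C g) (k : ℝ) : IsMin f (r + k) C (fun v => g v + k) := by
  intro z
  rw [← sub_le_iff_le_add, h (z - k)]
  simp only [sub_le_iff_le_add]

theorem left (h : IsMin f r C g) (h' : IsMin f' r' C' g) (hle : f' = 0 ∨ (f ≠ 0 ∧ r ≤ r')) :
    IsMin f r (fun v => C v ∨ C' v) g := by
  intro z
  simp only [or_imp, forall_and]
  rw [← h z, ← h' z]
  constructor
  · rintro h1
    refine ⟨h1, ?_⟩
    rcases hle with h2 | ⟨h2, h3⟩
    · exact .inl h2
    · exact .inr ((h1.resolve_left h2).trans h3)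
  · exact fun h1 => h1.1

theorem right (h : IsMin f r C g) (h' : IsMin f' r' C' g) (hf' : f' ≠ 0)
    (hle : f = 0 ∨ r' ≤ r) : IsMin 1 r' (fun v => C v ∨ C' v) g := by
  intro z
  simp only [or_imp, forall_and]
  rw [← h z, ← h' z]
  constructor
  · rintro (h1 | h1)
    · exact (one_ne_zero h1).elim
    · refine ⟨?_, .inr h1⟩
      rcases hle with h2 | h2
      · exact .inl h2
      · exact .inr (h1.trans h2)
  · exact fun h1 => .inr (h1.2.resolve_left hf')

end IsMin

/-- The sum of the `y`-values in a segment. -/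
noncomputable def segSum (vat : ℕ → ℕ) (y : ℕ → ℝ) (a b : ℕ) : ℝ := ∑ j ∈ Finset.Ico a b, y (vat j)

theorem segSum_add {vat : ℕ → ℕ} {y : ℕ → ℝ} {a p b : ℕ} (h1 : a ≤ p) (h2 : p ≤ b) :
    segSum vat y a p + segSum vat y p b = segSum vat y a b :=
  Finset.sum_Ico_consecutive _ h1 h2

theorem segSum_self {vat : ℕ → ℕ} {y : ℕ → ℝ} {a : ℕ} : segSum vat y a a = 0 := by simp [segSum]

/-- The values that are kept for a segment: the sum of the `y`-values, the minimum for
the vertices on the heavy path, and the minimum for the other vertices. -/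
structure SegOK (n : ℕ) (par top tin vat : ℕ → ℕ) (base y : ℕ → ℝ) (on : ℕ → ℕ) (a b t : ℕ)
    (sm : ℝ) (pf : ℕ) (pr : ℝ) (qf : ℕ) (qr : ℝ) : Prop where
  sum : sm = segSum vat y a b
  path : IsMin pf pr (fun v => v < n ∧ a ≤ tin v ∧ tin v < b ∧ top v = t ∧ on v ≠ 0)
    (fun v => base v + segSum vat y (tin v) b)
  other : IsMin qf qr (fun v => v < n ∧ a ≤ tin v ∧ tin v < b ∧ top v ≠ t ∧ on v ≠ 0)
    (fun v => base v + segSum vat y (tin v) (tin v + size n par v))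

section
variable {n : ℕ} {par dep hv top tin pos vat ev acc : ℕ → ℕ} {a b t p e c x : ℕ}
  {base y base' y' : ℕ → ℝ} {on on' : ℕ → ℕ} {sm pr qr : ℝ} {pf qf : ℕ}

theorem SegOK.empty : SegOK n par top tin vat base y on a a t 0 0 pr 0 qr where
  sum := segSum_self.symm
  path := .empty fun v hv => by lia
  other := .empty fun v hv => by lia

/-- Changes outside of a segment do not matter. -/
theorem SegOK.frame (hs : SegOK n par top tin vat base y on a b t sm pf pr qf qr)
    (h : HLD n par dep hv top tin pos vat ev acc) (hg : Good n par top tin a b t)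
    (hy : ∀ v < n, a ≤ tin v → tin v < b → y' v = y v)
    (ho : ∀ v < n, a ≤ tin v → tin v < b → on' v = on v) :
    SegOK n par top tin vat base y' on' a b t sm pf pr qf qr := by
  have hb : b ≤ n := hg.hi.trans (h.numbering_tin.add_size_le h.toRTree hg.lt)
  have hsum : ∀ i j, a ≤ i → j ≤ b → segSum vat y' i j = segSum vat y i j := by
    intro i j hi hj
    refine Finset.sum_congr rfl fun l hl => ?_
    rw [Finset.mem_Ico] at hl
    have := h.vat_spec (i := l) (by lia)
    exact hy _ this.1 (by lia) (by lia)
  refine ⟨by rw [hsum a b le_rfl le_rfl, hs.sum], hs.path.congr (fun v => ?_) fun v hv => ?_,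
    hs.other.congr (fun v => ?_) fun v hv => ?_⟩
  · constructor
    · rintro ⟨h1, h2, h3, h4, h5⟩
      exact ⟨h1, h2, h3, h4, ho v h1 h2 h3 ▸ h5⟩
    · rintro ⟨h1, h2, h3, h4, h5⟩
      exact ⟨h1, h2, h3, h4, (ho v h1 h2 h3).symm ▸ h5⟩
  · rw [hsum _ _ hv.2.1 le_rfl]
  · constructor
    · rintro ⟨h1, h2, h3, h4, h5⟩
      exact ⟨h1, h2, h3, h4, ho v h1 h2 h3 ▸ h5⟩
    · rintro ⟨h1, h2, h3, h4, h5⟩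
      exact ⟨h1, h2, h3, h4, (ho v h1 h2 h3).symm ▸ h5⟩
  · rw [hsum _ _ hv.2.1 (h.good_contains hg hv.1 hv.2.1 hv.2.2.1 hv.2.2.2.1)]

/-- The item that separates the two parts of a segment; `e'` is `p` for a single vertex `x`, and
`e` for a subtree. -/
def IsItem (n : ℕ) (par top tin : ℕ → ℕ) (t p e c e' x : ℕ) (y : ℕ → ℝ) (on : ℕ → ℕ) : Prop :=
  (PathItem n top tin t p e x ∧ e' = p) ∨
    (LightItem n par top tin t p e c ∧ e' = e ∧ y x = 0 ∧ on x = 0)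

section pull
variable {e' : ℕ} {smL smR smH prL prR prH qrL qrR qrH : ℝ} {pfL pfR pfH qfL qfR qfH : ℕ}

theorem SegOK.pull_sum (hR : SegOK n par top tin vat base y on e b t smR pfR prR qfR qrR)
    (hH : SegOK n par top tin vat base y on p e' c smH pfH prH qfH qrH)
    (h : HLD n par dep hv top tin pos vat ev acc) (heb : e ≤ b)
    (hi : IsItem n par top tin t p e c e' x y on) :
    y x + smH + smR = segSum vat y p b := by
  rw [hR.sum, hH.sum]
  rcases hi with ⟨hi, rfl⟩ | ⟨hi, rfl, hy, ho⟩
  · have h1 := hi.end_eq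
    have h2 : segSum vat y e' (e' + 1) = y x := by
      rw [segSum, Nat.Ico_succ_singleton, Finset.sum_singleton, ← hi.tin_eq, h.vat_tin x hi.lt]
    rw [segSum_self, ← segSum_add (a := e') (p := e' + 1) (b := b) (by lia) (by lia), h2, h1, add_zero]
  · rw [hy, zero_add, segSum_add (HLD.lightItem_lt hi).le heb]

/-- For all vertices in the left part, the suffix sum is extended by the same amount. -/
theorem SegOK.pull_left (hL : SegOK n par top tin vat base y on a p t smL pfL prL qfL qrL)
    (hpb : p ≤ b) : IsMin pfL (prL + segSum vat y p b)
      (fun v => v < n ∧ a ≤ tin v ∧ tin v < p ∧ top v = t ∧ on v ≠ 0)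
      (fun v => base v + segSum vat y (tin v) b) := by
  refine (hL.path.add (segSum vat y p b)).congr (fun v => Iff.rfl) fun v hv => ?_
  rw [add_assoc, segSum_add hv.2.2.1.le hpb]

theorem IsItem.isMin (hi : IsItem n par top tin t p e c e' x y on) :
    IsMin (on x) (base x + segSum vat y p b) (fun v => v = x ∧ on x ≠ 0)
      (fun v => base v + segSum vat y (tin v) b) := by
  rcases hi with ⟨hi, rfl⟩ | ⟨hi, rfl, hy, ho⟩
  · have := IsMin.single (f := on x) (g := fun v => base v + segSum vat y (tin v) b) x
    simpa only [hi.tin_eq] using this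
  · rw [ho]
    exact .empty fun v hv => hv.2 rfl

/-- The segment of a light item ends where the subtrees of all vertices on its heavy path end, so
its suffix sums are already complete subtree sums. -/
theorem SegOK.pull_top (hH : SegOK n par top tin vat base y on p e' c smH pfH prH qfH qrH)
    (h : HLD n par dep hv top tin pos vat ev acc)
    (hi : IsItem n par top tin t p e c e' x y on) :
    IsMin pfH prH (fun v => v < n ∧ p ≤ tin v ∧ tin v < e' ∧ top v = c ∧ on v ≠ 0)
      (fun v => base v + segSum vat y (tin v) (tin v + size n par v)) := by
  refine hH.path.congr (fun v => Iff.rfl) fun v hv => ?_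
  rcases hi with ⟨hi, rfl⟩ | ⟨hi, rfl, hy, ho⟩
  · lia
  · rw [h.tout_top hv.1, hv.2.2.2.1, hi.tin_eq, hi.end_eq]

/-- The values for a segment are computed from the values for its parts. -/
theorem SegOK.pull {pf qf : ℕ} {pr qr : ℝ}
    (hL : SegOK n par top tin vat base y on a p t smL pfL prL qfL qrL)
    (hR : SegOK n par top tin vat base y on e b t smR pfR prR qfR qrR)
    (hH : SegOK n par top tin vat base y on p e' c smH pfH prH qfH qrH)
    (h : HLD n par dep hv top tin pos vat ev acc) (hap : a ≤ p) (hpe : p < e) (heb : e ≤ b)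
    (hi : IsItem n par top tin t p e c e' x y on)
    (hp : IsMin pf pr (fun v => ((v < n ∧ e ≤ tin v ∧ tin v < b ∧ top v = t ∧ on v ≠ 0) ∨
        (v = x ∧ on x ≠ 0)) ∨ (v < n ∧ a ≤ tin v ∧ tin v < p ∧ top v = t ∧ on v ≠ 0))
      (fun v => base v + segSum vat y (tin v) b))
    (hq : IsMin qf qr (fun v => (((v < n ∧ a ≤ tin v ∧ tin v < p ∧ top v ≠ t ∧ on v ≠ 0) ∨
        (v < n ∧ e ≤ tin v ∧ tin v < b ∧ top v ≠ t ∧ on v ≠ 0)) ∨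
        (v < n ∧ p ≤ tin v ∧ tin v < e' ∧ top v = c ∧ on v ≠ 0)) ∨
        (v < n ∧ p ≤ tin v ∧ tin v < e' ∧ top v ≠ c ∧ on v ≠ 0))
      (fun v => base v + segSum vat y (tin v) (tin v + size n par v))) :
    SegOK n par top tin vat base y on a b t (smL + (y x + smH + smR)) pf pr qf qr := by
  -- The vertices of the middle item: either just `x`, on the path, or a light subtree that avoids
  -- the path.
  have hmid : ∀ v < n, p ≤ tin v → tin v < e → (top v = t ↔ e' = p) ∧ (e' = p → v = x) := by
    intro v hv h1 h2
    rcases hi with ⟨hi, rfl⟩ | ⟨hi, rfl, hy, ho⟩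
    · have h3 := hi.end_eq
      have h4 : v = x := h.numbering_tin.inj h.toRTree hv hi.lt (by have := hi.tin_eq; lia)
      subst h4
      exact ⟨⟨fun _ => rfl, fun _ => hi.top_eq⟩, fun _ => rfl⟩
    · have h3 := h.lightItem_off hi hv ((h.tin_anc hi.lt hv).2
        ⟨by have := hi.tin_eq; lia, by have := hi.tin_eq; have := hi.end_eq; lia⟩)
      exact ⟨⟨fun h4 => (h3 h4).elim, fun h4 => by lia⟩, fun h4 => by lia⟩
  have hx : on x ≠ 0 → x < n ∧ tin x = p ∧ top x = t := by
    intro h1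
    rcases hi with ⟨hi, rfl⟩ | ⟨hi, rfl, hy, ho⟩
    · exact ⟨hi.lt, hi.tin_eq, hi.top_eq⟩
    · exact (h1 ho).elim
  have he' : e' = p ∨ e' = e := by
    rcases hi with ⟨hi, rfl⟩ | ⟨hi, rfl, hy, ho⟩
    · exact .inl rfl
    · exact .inr rfl
  refine ⟨?_, hp.congr (fun v => ?_) fun v _ => rfl, hq.congr (fun v => ?_) fun v _ => rfl⟩
  · rw [hL.sum, hR.pull_sum hH h heb hi, segSum_add hap (by lia)]
  · constructor
    · rintro ⟨h1, h2, h3, h4, h5⟩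
      by_cases h6 : tin v < p
      · exact .inr ⟨h1, h2, h6, h4, h5⟩
      · by_cases h7 : tin v < e
        · have h8 := hmid v h1 (by lia) h7
          have h9 := h8.2 (h8.1.1 h4)
          exact .inl (.inr ⟨h9, h9 ▸ h5⟩)
        · exact .inl (.inl ⟨h1, by lia, h3, h4, h5⟩)
    · rintro ((⟨h1, h2, h3, h4, h5⟩ | ⟨rfl, h5⟩) | ⟨h1, h2, h3, h4, h5⟩)
      · exact ⟨h1, by lia, h3, h4, h5⟩
      · obtain ⟨h6, h7, h8⟩ := hx h5
        exact ⟨h6, by lia, by lia, h8, h5⟩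
      · exact ⟨h1, h2, by lia, h4, h5⟩
  · constructor
    · rintro ⟨h1, h2, h3, h4, h5⟩
      by_cases h6 : tin v < p
      · exact .inl (.inl (.inl ⟨h1, h2, h6, h4, h5⟩))
      · by_cases h7 : tin v < e
        · have h8 := hmid v h1 (by lia) h7
          have h9 : e' = e := he'.resolve_left fun h9 => h4 (h8.1.2 h9)
          by_cases h10 : top v = c
          · exact .inl (.inr ⟨h1, by lia, by lia, h10, h5⟩)
          · exact .inr ⟨h1, by lia, by lia, h10, h5⟩
        · exact .inl (.inl (.inr ⟨h1, by lia, h3, h4, h5⟩))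
    · have hne : ∀ v < n, p ≤ tin v → tin v < e' → top v ≠ t := by
        intro v hv h1 h2 h3
        have h4 := (hmid v hv h1 (by lia)).1.1 h3
        lia
      rintro (((⟨h1, h2, h3, h4, h5⟩ | ⟨h1, h2, h3, h4, h5⟩) | ⟨h1, h2, h3, h4, h5⟩) |
        ⟨h1, h2, h3, h4, h5⟩)
      · exact ⟨h1, h2, by lia, h4, h5⟩
      · exact ⟨h1, by lia, h3, h4, h5⟩
      · exact ⟨h1, by lia, by lia, hne v h1 h2 h3, h5⟩
      · exact ⟨h1, by lia, by lia, hne v h1 h2 h3, h5⟩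

end pull

end

end TwoRespect

namespace TwoRespect

/-! ## The program: building the hierarchy -/

notation "vK" => (7 : ℕ)
notation "vA" => (8 : ℕ)
notation "vB" => (9 : ℕ)
notation "vT" => (10 : ℕ)
notation "vR" => (11 : ℕ)
notation "vC" => (12 : ℕ)
notation "vU" => (13 : ℕ)
notation "vW" => (14 : ℕ)
notation "vH" => (15 : ℕ)
notation "aLO" => (21 : ℕ)
notation "aHI" => (22 : ℕ)
notation "aTP" => (23 : ℕ)
notation "aGP" => (24 : ℕ)
notation "aLC" => (25 : ℕ)
notation "aRC" => (26 : ℕ)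
notation "aHC" => (27 : ℕ)
notation "aIT" => (28 : ℕ)
notation "aND" => (29 : ℕ)

/-- The nodes of the hierarchy: the ends of their segments, the tops of their heavy paths, and
their parents. -/
structure Nodes : Type where
  lo : ℕ → ℕ
  hi : ℕ → ℕ
  tp : ℕ → ℕ
  gp : ℕ → ℕ

/-- The nodes that are stored in the memory. -/
def State.nodes (s : State) : Nodes := ⟨s.warr aLO, s.warr aHI, s.warr aTP, s.warr aGP⟩

/-- The node `r` is the child of the node `j` for the segment from `a` to `b`; it is `0` if this
segment is empty. -/
def Nodes.Child (N : Nodes) (cnt r a b t j : ℕ) : Prop :=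
  (r = 0 ∧ a = b) ∨ (j < r ∧ r < cnt ∧ N.lo r = a ∧ N.hi r = b ∧ N.tp r = t ∧ N.gp r = j)

/-- The nodes are the same up to the index `cnt`. -/
def Nodes.Same (N N' : Nodes) (cnt : ℕ) : Prop :=
  ∀ j < cnt, N'.lo j = N.lo j ∧ N'.hi j = N.hi j ∧ N'.tp j = N.tp j ∧ N'.gp j = N.gp j

/-- The node `r` for the segment from `a` to `b` has been added, unless this segment is empty. -/
def Nodes.Spawned (N N' : Nodes) (cnt cnt' r a b t i : ℕ) : Prop :=
  ((a < b ∧ r = cnt ∧ cnt' = cnt + 1 ∧ N'.lo cnt = a ∧ N'.hi cnt = b ∧ N'.tp cnt = t ∧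
    N'.gp cnt = i) ∨ (b ≤ a ∧ r = 0 ∧ cnt' = cnt)) ∧ N.Same N' cnt

section hier
variable {n : ℕ} {par dep hv top tin pos vat ev acc : ℕ → ℕ}

/-- The node `j` has been split. -/
def Nodes.IsSplit (n : ℕ) (par top tin : ℕ → ℕ) (N : Nodes) (cnt j l r h x : ℕ) : Prop :=
  ∃ p e c e', N.lo j ≤ p ∧ p < e ∧ e ≤ N.hi j ∧
    ((PathItem n top tin (N.tp j) p e x ∧ e' = p) ∨
      (LightItem n par top tin (N.tp j) p e c ∧ e' = e ∧ x = n)) ∧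
    N.Child cnt l (N.lo j) p (N.tp j) j ∧ N.Child cnt r e (N.hi j) (N.tp j) j ∧
    N.Child cnt h p e' c j

/-- The invariant of the construction of the hierarchy: the nodes up to `i` have been split. -/
structure Hier (n : ℕ) (par top tin : ℕ → ℕ) (N : Nodes) (i cnt : ℕ) (lc rc hc it nd : ℕ → ℕ) :
    Prop where
  i_pos : 1 ≤ i
  one_lt : 1 < cnt
  le : i ≤ cnt
  root : N.lo 1 = 0 ∧ N.hi 1 = n ∧ N.tp 1 = 0 ∧ N.gp 1 = 0
  good : ∀ j, 1 ≤ j → j < cnt → Good n par top tin (N.lo j) (N.hi j) (N.tp j)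
  gp_zero : N.gp 0 = 0
  gp_lt : ∀ j, 1 ≤ j → j < cnt → N.gp j < j ∧ N.gp j < i
  weight : ∀ j, 1 ≤ j → j < cnt → N.gp j ≠ 0 →
    2 * segWeight n par tin (N.lo j) (N.hi j) (N.tp j) ≤
      segWeight n par tin (N.lo (N.gp j)) (N.hi (N.gp j)) (N.tp (N.gp j))
  split : ∀ j, 1 ≤ j → j < i → N.IsSplit n par top tin cnt j (lc j) (rc j) (hc j) (it j)
  loc : ∀ u < n, ∃ l, 1 ≤ l ∧ l < cnt ∧ N.lo l ≤ tin u ∧ tin u < N.hi l ∧ (i ≤ l ∨ nd u = l) ∧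
    ∀ j, 1 ≤ j → j < cnt → N.lo j ≤ tin u → tin u < N.hi j → Anc N.gp j l
  pot : i + ∑ j ∈ Finset.Ico i cnt, nodeWeight n top tin (N.lo j) (N.hi j) (N.tp j) ≤ 2 * n + 1

/-- Parents have smaller indices than their children, so a chain of ancestors that starts below
`cnt` never meets a new node. -/
theorem Nodes.Same.anc {N N' : Nodes} {cnt : ℕ} (h : N.Same N' cnt) (h0 : N.gp 0 = 0)
    (hg : ∀ j, 1 ≤ j → j < cnt → N.gp j < j) {j l : ℕ} (hl : l < cnt) (ha : Anc N.gp j l) :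
    Anc N'.gp j l ∧ j ≤ l := by
  obtain ⟨k, rfl⟩ := ha
  suffices H : N'.gp^[k] l = N.gp^[k] l ∧ N.gp^[k] l ≤ l from ⟨⟨k, H.1⟩, H.2⟩
  induction k with
  | zero => simp
  | succ k ih =>
    rw [Function.iterate_succ_apply', Function.iterate_succ_apply', ih.1]
    have h1 := ih.2
    generalize N.gp^[k] l = x at *
    refine ⟨(h x (by lia)).2.2.2, ?_⟩
    rcases Nat.eq_zero_or_pos x with rfl | h2
    · rw [h0]; lia
    · have := hg x h2 (by lia)
      lia

theorem Nodes.Child.mono {N N' : Nodes} {cnt cnt' r a b t j : ℕ} (h : N.Child cnt r a b t j)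
    (hs : N.Same N' cnt) (hc : cnt ≤ cnt') : N'.Child cnt' r a b t j := by
  rcases h with h | ⟨h1, h2, h3, h4, h5, h6⟩
  · exact .inl h
  · have := hs r h2
    exact .inr ⟨h1, by lia, by lia, by lia, by lia, by lia⟩

theorem Nodes.Spawned.child {N N' : Nodes} {cnt cnt' r a b t i : ℕ}
    (h : N.Spawned N' cnt cnt' r a b t i) (hi : i < cnt) (hab : a ≤ b) :
    N'.Child cnt' r a b t i := by
  obtain ⟨h | h, -⟩ := h
  · obtain ⟨h1, rfl, rfl, h2, h3, h4, h5⟩ := h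
    exact .inr ⟨hi, by lia, h2, h3, h4, h5⟩
  · exact .inl ⟨h.2.1, by lia⟩

theorem Nodes.Spawned.sum {N N' : Nodes} {cnt cnt' r a b t i : ℕ}
    (h : N.Spawned N' cnt cnt' r a b t i) :
    ∑ j ∈ Finset.Ico cnt cnt', nodeWeight n top tin (N'.lo j) (N'.hi j) (N'.tp j) ≤
      nodeWeight n top tin a b t := by
  obtain ⟨h | h, -⟩ := h
  · obtain ⟨h1, rfl, rfl, rfl, rfl, rfl, h5⟩ := h
    simp
  · rw [h.2.2]
    simp

theorem Nodes.Same.sum {N N' : Nodes} {cnt c d : ℕ} (h : N.Same N' cnt) (hd : d ≤ cnt) :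
    ∑ j ∈ Finset.Ico c d, nodeWeight n top tin (N'.lo j) (N'.hi j) (N'.tp j) =
    ∑ j ∈ Finset.Ico c d, nodeWeight n top tin (N.lo j) (N.hi j) (N.tp j) := by
  refine Finset.sum_congr rfl fun j hj => ?_
  rw [Finset.mem_Ico] at hj
  obtain ⟨h1, h2, h3, -⟩ := h j (by lia)
  rw [h1, h2, h3]

theorem Nodes.Same.trans {N N' N'' : Nodes} {c c' : ℕ} (h : N.Same N' c) (h' : N'.Same N'' c')
    (hc : c ≤ c') : N.Same N'' c := by
  intro j hj
  have := h j hj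
  have := h' j (by lia)
  lia

/-- The new nodes get `i` as parent, and their segments cover that of `i` disjointly, except for `x`
if the item is a path vertex. So a vertex located at `i` moves to the one new node that contains it,
and `x` stays at `i`. The parts are of at most half length or light, which gives the doubling of
weights, and the item pays for the treatment of `i` in the potential. -/
theorem Hier.step {N N1 N2 N3 : Nodes} {i cnt c1 c2 c3 rL rR rH p e c e' x : ℕ}
    {lc rc hc it nd nd' : ℕ → ℕ}
    (hh : Hier n par top tin N i cnt lc rc hc it nd) (hi : i < cnt)
    (h : HLD n par dep hv top tin pos vat ev acc)
    (hap : N.lo i ≤ p) (hpe : p < e) (heb : e ≤ N.hi i)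
    (hp2 : 2 * (p - N.lo i) ≤ N.hi i - N.lo i) (he2 : 2 * (N.hi i - e) ≤ N.hi i - N.lo i)
    (hitem : (PathItem n top tin (N.tp i) p e x ∧ e' = p ∧ nd' = Function.update nd x i) ∨
      (LightItem n par top tin (N.tp i) p e c ∧ e' = e ∧ x = n ∧ nd' = nd))
    (s1 : N.Spawned N1 cnt c1 rL (N.lo i) p (N.tp i) i)
    (s2 : N1.Spawned N2 c1 c2 rR e (N.hi i) (N.tp i) i)
    (s3 : N2.Spawned N3 c2 c3 rH p e' c i) :
    Hier n par top tin N3 (i + 1) c3 (Function.update lc i rL) (Function.update rc i rR)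
      (Function.update hc i rH) (Function.update it i x) nd' := by
  have hc1 : cnt ≤ c1 := by obtain ⟨h1 | h1, -⟩ := s1 <;> lia
  have hc2 : c1 ≤ c2 := by obtain ⟨h1 | h1, -⟩ := s2 <;> lia
  have hc3 : c2 ≤ c3 := by obtain ⟨h1 | h1, -⟩ := s3 <;> lia
  have hpe' : p ≤ e' ∧ e' ≤ e := by rcases hitem with h1 | h1 <;> lia
  have S12 := s1.2.trans s2.2 hc1
  have S13 := S12.trans s3.2 (hc1.trans hc2)
  have S23 := s2.2.trans s3.2 hc2
  have hgood := hh.good i hh.i_pos hi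
  have hbn : N.hi i ≤ n := hgood.hi.trans (h.numbering_tin.add_size_le h.toRTree hgood.lt)
  have hlam : ∀ c < n, Anc par (N.tp i) c → top c ≠ N.tp i →
      tin c + size n par c ≤ p ∨ e ≤ tin c ∨ (p ≤ tin c ∧ tin c + size n par c ≤ e) := by
    rcases hitem with ⟨h1, -⟩ | ⟨h1, -⟩
    · exact fun c => h.pathItem_lam h1
    · exact fun c => h.lightItem_lam h1
  have kL : N3.Child c3 rL (N.lo i) p (N.tp i) i :=
    (s1.child hi hap).mono S23 (hc2.trans hc3)
  have kR : N3.Child c3 rR e (N.hi i) (N.tp i) i :=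
    (s2.child (by lia) heb).mono s3.2 hc3
  have kH : N3.Child c3 rH p e' c i := s3.child (by lia) hpe'.1
  have hnew : ∀ j, cnt ≤ j → j < c3 → j = rL ∨ j = rR ∨ j = rH := by
    intro j hj hj'
    obtain ⟨h1 | h1, -⟩ := s1 <;> obtain ⟨h2 | h2, -⟩ := s2 <;> obtain ⟨h3 | h3, -⟩ := s3 <;> lia
  have hnewgood : ∀ j, cnt ≤ j → j < c3 → N3.gp j = i ∧
      Good n par top tin (N3.lo j) (N3.hi j) (N3.tp j) ∧
      2 * segWeight n par tin (N3.lo j) (N3.hi j) (N3.tp j) ≤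
        segWeight n par tin (N.lo i) (N.hi i) (N.tp i) := by
    intro j hj hj'
    have hcnt := hh.one_lt
    have kL' : j = rL → N.lo i < p := by obtain ⟨h1 | h1, -⟩ := s1 <;> lia
    have kR' : j = rR → e < N.hi i := by obtain ⟨h1 | h1, -⟩ := s2 <;> lia
    have kH' : j = rH → p < e' := by obtain ⟨h1 | h1, -⟩ := s3 <;> lia
    rcases hnew j hj hj' with h1 | h1 | h1
    · have h2 := kL' h1
      rcases kL with ⟨k1, k2⟩ | ⟨k1, k2, k3, k4, k5, k6⟩
      · lia
      · rw [h1, k3, k4, k5]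
        exact ⟨k6, hgood.left hlam hpe heb h2, HLD.segWeight_half hbn (by lia) (by lia)⟩
    · have h2 := kR' h1
      rcases kR with ⟨k1, k2⟩ | ⟨k1, k2, k3, k4, k5, k6⟩
      · lia
      · rw [h1, k3, k4, k5]
        exact ⟨k6, hgood.right hlam hpe hap h2, HLD.segWeight_half hbn hbn (by lia)⟩
    · have h2 := kH' h1
      rcases kH with ⟨k1, k2⟩ | ⟨k1, k2, k3, k4, k5, k6⟩
      · lia
      · rw [h1, k3, k4, k5]
        rcases hitem with ⟨h3, h4, -⟩ | ⟨h3, h4, -⟩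
        · lia
        · subst h4
          refine ⟨k6, ?_, h.segWeight_light h3 hap heb⟩
          have := h.good_full h3.lt h3.top_eq
          rwa [h3.tin_eq, ← h3.end_eq] at this
  have hgplt : ∀ j, 1 ≤ j → j < cnt → N.gp j < j := fun j h1 h2 => (hh.gp_lt j h1 h2).1
  have h1cnt := hh.one_lt
  have hipos := hh.i_pos
  refine ⟨by lia, by lia, by lia, ?_, fun j h1 h2 => ?_, ?_, fun j h1 h2 => ?_, fun j h1 h2 h3 => ?_,
    fun j h1 h2 => ?_, fun u hu => ?_, ?_⟩
  · have := S13 1 h1cnt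
    have := hh.root
    lia
  · by_cases h3 : j < cnt
    · obtain ⟨e1, e2, e3, -⟩ := S13 j h3
      rw [e1, e2, e3]
      exact hh.good j h1 h3
    · exact (hnewgood j (by lia) h2).2.1
  · rw [(S13 0 (by lia)).2.2.2, hh.gp_zero]
  · by_cases h3 : j < cnt
    · rw [(S13 j h3).2.2.2]
      have := hh.gp_lt j h1 h3
      lia
    · rw [(hnewgood j (by lia) h2).1]
      lia
  · by_cases h4 : j < cnt
    · obtain ⟨e1, e2, e3, e4⟩ := S13 j h4
      rw [e4] at h3
      have h5 := (hh.gp_lt j h1 h4).1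
      obtain ⟨e5, e6, e7, -⟩ := S13 (N.gp j) (by lia)
      rw [e1, e2, e3, e4, e5, e6, e7]
      exact hh.weight j h1 h4 h3
    · have h5 := hnewgood j (by lia) h2
      obtain ⟨e5, e6, e7, -⟩ := S13 i hi
      rw [h5.1, e5, e6, e7]
      exact h5.2.2
  · by_cases h3 : j = i
    · subst h3
      simp only [Function.update_self]
      obtain ⟨e1, e2, e3, -⟩ := S13 j hi
      refine ⟨p, e, c, e', by rw [e1]; exact hap, hpe, by rw [e2]; exact heb, ?_, ?_, ?_, kH⟩
      · rw [e3]
        rcases hitem with h4 | h4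
        · exact .inl ⟨h4.1, h4.2.1⟩
        · exact .inr ⟨h4.1, h4.2.1, h4.2.2.1⟩
      · rw [e1, e3]; exact kL
      · rw [e2, e3]; exact kR
    · simp only [Function.update_of_ne h3]
      obtain ⟨p, e, c, e', f1, f2, f3, f4, f5, f6, f7⟩ := hh.split j h1 (by lia)
      obtain ⟨e1, e2, e3, -⟩ := S13 j (by lia)
      refine ⟨p, e, c, e', ?_⟩
      rw [e1, e2, e3]
      exact ⟨f1, f2, f3, f4, f5.mono S13 (by lia), f6.mono S13 (by lia), f7.mono S13 (by lia)⟩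
  · obtain ⟨l, l1, l2, l3, l4, l5, l6⟩ := hh.loc u hu
    by_cases hl : l = i
    · subst hl
      have hanc : ∀ j, 1 ≤ j → j < cnt → N3.lo j ≤ tin u → tin u < N3.hi j → Anc N3.gp j l := by
        intro j h1 h2 h3 h4
        obtain ⟨e1, e2, -⟩ := S13 j h2
        rw [e1] at h3
        rw [e2] at h4
        exact (S13.anc hh.gp_zero hgplt hi (l6 j h1 h2 h3 h4)).1
      -- If `u` is in the segment of a new node `r` and of no other new node, then `r` is its new
      -- location: the older nodes that contain `u` are ancestors of the node that was split.
      have key : ∀ r a b t, cnt ≤ r → N3.Child c3 r a b t l → a ≤ tin u → tin u < b →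
          (∀ j, cnt ≤ j → j < c3 → N3.lo j ≤ tin u → tin u < N3.hi j → j = r) →
          ∃ l', 1 ≤ l' ∧ l' < c3 ∧ N3.lo l' ≤ tin u ∧ tin u < N3.hi l' ∧ (l + 1 ≤ l' ∨ nd' u = l') ∧
            ∀ j, 1 ≤ j → j < c3 → N3.lo j ≤ tin u → tin u < N3.hi j → Anc N3.gp j l' := by
        intro r a b t hr hk ha hb huniq
        rcases hk with ⟨k1, k2⟩ | ⟨k1, k2, k3, k4, k5, k6⟩
        · lia
        refine ⟨r, by lia, k2, by lia, by lia, .inl (by lia), fun j h1 h2 h3 h4 => ?_⟩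
        by_cases h5 : j < cnt
        · rw [Anc.iff_par, k6]
          exact .inr (hanc j h1 h5 h3 h4)
        · rw [huniq j (by lia) h2 h3 h4]
          exact .refl r
      by_cases q1 : tin u < p
      · refine key rL _ _ _ ?_ kL l3 q1 fun j h1 h2 h3 h4 => ?_
        · obtain ⟨h1 | h1, -⟩ := s1 <;> lia
        · rcases hnew j h1 h2 with h5 | h5 | h5
          · exact h5
          · rcases kR with kk | kk <;> lia
          · rcases kH with kk | kk <;> lia
      · by_cases q2 : tin u < e
        · rcases hitem with ⟨h1, h2, h3⟩ | ⟨h1, h2, -, h3⟩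
          -- The vertex `x` is in none of the new segments, so the node that was split remains its
          -- location.
          · have hux : u = x := h.numbering_tin.inj h.toRTree hu h1.lt (by
              have := h1.tin_eq
              have := h1.end_eq
              lia)
            obtain ⟨e1, e2, -⟩ := S13 l hi
            refine ⟨l, l1, by lia, by lia, by lia, .inr (by rw [h3, hux, Function.update_self]),
              fun j h4 h5 h6 h7 => ?_⟩
            by_cases h8 : j < cnt
            · exact hanc j h4 h8 h6 h7
            · have h9 := h1.end_eq
              rcases hnew j (by lia) h5 with h5 | h5 | h5
              · rcases kL with kk | kk <;> lia
              · rcases kR with kk | kk <;> lia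
              · rcases kH with kk | kk <;> lia
          · refine key rH _ _ _ ?_ kH (by lia) (by lia) fun j h4 h5 h6 h7 => ?_
            · obtain ⟨h4 | h4, -⟩ := s3 <;> lia
            · rcases hnew j h4 h5 with h8 | h8 | h8
              · rcases kL with kk | kk <;> lia
              · rcases kR with kk | kk <;> lia
              · exact h8
        · refine key rR _ _ _ ?_ kR (by lia) l4 fun j h1 h2 h3 h4 => ?_
          · obtain ⟨h1 | h1, -⟩ := s2 <;> lia
          · rcases hnew j h1 h2 with h5 | h5 | h5
            · rcases kL with kk | kk <;> lia
            · exact h5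
            · rcases kH with kk | kk <;> lia
    -- Otherwise `i` would be a proper ancestor of the location of `u`, but only nodes before `i`
    -- have children so far.
    · have hnot : ¬ (N.lo i ≤ tin u ∧ tin u < N.hi i) := by
        rintro ⟨h1, h2⟩
        have h3 := l6 i hh.i_pos hi h1 h2
        have h4 := (S13.anc hh.gp_zero hgplt l2 h3).2
        rcases Anc.iff_par.1 h3 with h5 | h5
        · exact hl h5.symm
        · have h6 := hh.gp_lt l l1 l2
          have h7 := (S13.anc hh.gp_zero hgplt (by lia) h5).2
          lia
      obtain ⟨e1, e2, -⟩ := S13 l l2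
      refine ⟨l, l1, by lia, by lia, by lia, ?_, fun j h1 h2 h3 h4 => ?_⟩
      · rcases l5 with l5 | l5
        · exact .inl (by lia)
        · right
          rcases hitem with ⟨h1, -, h3⟩ | ⟨-, -, -, h3⟩
          · rw [h3, Function.update_of_ne, l5]
            rintro rfl
            have := h1.tin_eq
            lia
          · rw [h3, l5]
      · by_cases h5 : j < cnt
        · obtain ⟨e1, e2, -⟩ := S13 j h5
          rw [e1] at h3
          rw [e2] at h4
          exact (S13.anc hh.gp_zero hgplt l2 (l6 j h1 h5 h3 h4)).1
        · exfalso
          rcases hnew j (by lia) h2 with h6 | h6 | h6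
          · rcases kL with kk | kk <;> lia
          · rcases kR with kk | kk <;> lia
          · rcases kH with kk | kk <;> lia
  · have p0 := hh.pot
    have p1 := s1.sum (n := n) (top := top) (tin := tin)
    have p2 := s2.sum (n := n) (top := top) (tin := tin)
    have p3 := s3.sum (n := n) (top := top) (tin := tin)
    rw [← S23.sum le_rfl] at p1
    rw [← s3.2.sum le_rfl] at p2
    have p4 := S13.sum (n := n) (top := top) (tin := tin) (c := i + 1) le_rfl
    rw [Finset.sum_eq_sum_Ico_succ_bot hi] at p0
    rw [← Finset.sum_Ico_consecutive _ (show i + 1 ≤ cnt by lia) (show cnt ≤ c3 by lia),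
      ← Finset.sum_Ico_consecutive _ hc1 (show c1 ≤ c3 by lia),
      ← Finset.sum_Ico_consecutive _ hc2 hc3, p4]
    have : nodeWeight n top tin (N.lo i) p (N.tp i) + nodeWeight n top tin e (N.hi i) (N.tp i) +
        nodeWeight n top tin p e' c + 1 ≤ nodeWeight n top tin (N.lo i) (N.hi i) (N.tp i) := by
      rcases hitem with ⟨h1, rfl, -⟩ | ⟨h1, rfl, -⟩
      · have h2 := HLD.nodeWeight_pathItem h1 hap heb
        have h3 : nodeWeight n top tin e' e' c = 0 := by
          have : ∀ v, ¬ (e' ≤ tin v ∧ tin v < e' ∧ top v = v ∧ v ≠ c) := fun v => by lia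
          simp [nodeWeight, this]
        lia
      · exact h.nodeWeight_lightItem h1 hgood hap heb
    lia

end hier

end TwoRespect

/-! ### The program that splits the segments. -/

namespace TwoRespect

variable {B K n m : ℕ} {G : WGraph n m} {T : Finset (Fin m)}

/-- Finds the item of the segment of the node `vI` that contains its middle. -/
def findItem : Prog :=
  .setW vX (.get aVAT (.div (.add (.get aLO (.var vI)) (.get aHI (.var vI))) (.lit 2))) ;;
  .setW vC (.var vN) ;;
  .setW vT (.get aTP (.var vI)) ;;
  .loop (.not (.weq (.get aTOP (.var vX)) (.var vT)))
    (.setW vC (.get aTOP (.var vX)) ;; .setW vX (.get aPAR (.var vC)))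

/-- Starting from the vertex in the middle, one climbs from heavy path to heavy path until the path
with top `t` is reached. The last top that was passed is the root of the light item; if there was
none, the middle vertex itself is on the path. In the latter case `vC` still has its initial value
`n`, which is no vertex. -/
theorem run_findItem {D : Decomp G T} {s : State} (hmem : Mem D s) {i mid t a b : ℕ}
    (hI : s.wvar vI = i) (hmid : (s.warr aLO i + s.warr aHI i) / 2 = mid) (ht : s.warr aTP i = t)
    (hnK : 2 * n ≤ K) (hg : Good n D.par D.top D.tin a b t) (h1 : a ≤ mid) (h2 : mid < b) :
    Run B K findItem s (20 * (Nat.log 2 n + 2)) fun s' =>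
      s'.wvar vX < n ∧ D.top (s'.wvar vX) = t ∧
      ((s'.wvar vC = n ∧ D.tin (s'.wvar vX) = mid) ∨
        (s'.wvar vC < n ∧ LightItem n D.par D.top D.tin t (D.tin (s'.wvar vC))
          (D.tin (s'.wvar vC) + size n D.par (s'.wvar vC)) (s'.wvar vC) ∧
          Anc D.par (s'.wvar vC) (D.vat mid))) := by
  have hd := D.hld
  have hbn : b ≤ n := hg.hi.trans (hd.numbering_tin.add_size_le hd.toRTree hg.lt)
  have hv := hd.vat_spec (i := mid) (by lia)
  have hlog : ∀ c, Nat.log 2 (size n D.par c) ≤ Nat.log 2 n :=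
    fun c => Nat.log_mono_right (RTree.size_le c)
  have htv : Anc D.par t (D.vat mid) := hd.good_anc hg hv.1 (by lia) (by lia)
  have htn := hg.lt
  refine (Run.seq' (R := fun s' => s' = s.setW vX (D.vat mid)) (.of_wp' (T := 10) (by decide) ?_)
    ?_).time_mono
    (T₁ := 10 + (2 + (3 + (Nat.log 2 n * 15 + 5 + 1)))) (by lia)
  · simp [Prog.wp, WExpr.eval, hI, hmid, hmem.vat]
    lia
  rintro s1 - - rfl
  refine Run.seq' (R := fun s' => s' = (s.setW vX (D.vat mid)).setW vC n) (.of_wp ?_) ?_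
  · simp [Prog.wp, WExpr.eval, hmem.vn]
    lia
  rintro s2 - - rfl
  refine Run.seq' (R := fun s' => s' = ((s.setW vX (D.vat mid)).setW vC n).setW vT t) (.of_wp ?_) ?_
  · simp [Prog.wp, WExpr.eval, hI, ht]
    lia
  rintro s3 - - rfl
  have hmem3 : Mem D (((s.setW vX (D.vat mid)).setW vC n).setW vT t) := by
    have h1 : Agree findItem s (((s.setW vX (D.vat mid)).setW vC n).setW vT t) := by
      refine ⟨fun i hi => ?_, fun _ _ => rfl, fun _ _ => rfl, fun _ _ => rfl, fun _ => rfl⟩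
      have : i ≠ 3 ∧ i ≠ 12 ∧ i ≠ 10 := by
        refine ⟨?_, ?_, ?_⟩ <;> rintro rfl <;> exact absurd hi (by decide)
      simp [this.1, this.2.1, this.2.2]
    exact hmem.agree h1 rfl
  refine (Run.loop_pot (fun s' => s'.wvar vX < n ∧ Anc D.par t (s'.wvar vX) ∧
      Anc D.par (s'.wvar vX) (D.vat mid) ∧
      ((s'.wvar vC = n ∧ s'.wvar vX = D.vat mid) ∨
        (0 < s'.wvar vC ∧ s'.wvar vC < n ∧ D.top (s'.wvar vC) = s'.wvar vC ∧
          D.par (s'.wvar vC) = s'.wvar vX ∧ Anc D.par (s'.wvar vC) (D.vat mid))))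
    (fun s' => Nat.log 2 n - Nat.log 2 (size n D.par (s'.wvar vX))) 8 ?_ ?_ ?_).time_mono ?_
  · simp
    exact ⟨hv.1, htv, .refl _⟩
  · rintro s' - ha ⟨i1, i2, i3, i4⟩ hb
    have hmem' := hmem3.agree ha rfl
    have eT : s'.wvar vT = t := (ha.w _ rfl).trans (by simp)
    obtain ⟨x, hx⟩ : ∃ x, s'.wvar vX = x := ⟨_, rfl⟩
    simp only [Cond.Holds, WExpr.eval, hmem'.top, eT, hx] at hb i1 i2 i3 ⊢
    -- Since `x` is below `t` but on another path, the top of this other path is strictly below `t`.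
    have hta : Anc D.par t (D.par (D.top x)) ∧ 0 < D.top x := by
      rcases hd.anc_total i1 i2 (hd.anc_top i1) with h3 | h3
      · rcases Anc.iff_par.1 h3 with h4 | h4
        · exact (hb h4.symm).elim
        · refine ⟨h4, ?_⟩
          rcases Nat.eq_zero_or_pos (D.top x) with h5 | h5
          · rw [h5, hd.anc_zero] at h3
            rw [h5, h3] at hb
            exact (hb rfl).elim
          · exact h5
      · have h4 := hd.top_between i1 h3 i2
        rw [hg.top_eq] at h4
        exact (hb h4.symm).elim
    have hlog1 := hd.log_size_climb i1 hta.2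
    have hlog2 := hlog (D.par (D.top x))
    have hpn := hd.lt (D.top x)
    have htx := hd.top_lt i1
    have htt := hd.top_top i1
    have hax := (hd.anc_top i1).trans i3
    refine Run.of_wp' (by decide) ?_
    simp [Prog.wp, WExpr.eval, hx, hmem'.top, hmem'.par]
    exact ⟨by lia, by lia, ⟨hpn, hta.1, (Anc.parent _).trans hax,
      .inr ⟨hta.2, htx, htt, hax⟩⟩, by lia⟩
  · rintro s' - ha ⟨i1, i2, i3, i4⟩ hb
    have hmem' := hmem3.agree ha rfl
    have eT : s'.wvar vT = t := (ha.w _ rfl).trans (by simp)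
    simp only [Cond.Holds, WExpr.eval, hmem'.top, eT, not_not] at hb
    refine ⟨i1, hb, ?_⟩
    rcases i4 with ⟨h3, h4⟩ | ⟨h3, h4, h5, h6, h7⟩
    · exact .inl ⟨h3, by rw [h4, hv.2]⟩
    · exact .inr ⟨h4, ⟨h3, h4, h5, by rw [h6, hb], rfl, rfl, by rw [h6]; exact i2⟩, h7⟩
  · have hc : (Cond.not (.weq (.get aTOP (.var vX)) (.var vT))).cost = 5 := rfl
    rw [hc]
    have : (Nat.log 2 n - Nat.log 2 (size n D.par
      ((((s.setW vX (D.vat mid)).setW vC n).setW vT t).wvar vX))) * (8 + 5 + 1) ≤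
        Nat.log 2 n * 15 := Nat.mul_le_mul (by lia) (by lia)
    lia

/-- Appends the node for the segment from `a` to `b`, unless it is empty, as a child of `vI`. -/
def spawn (slot : ℕ) (a b t : WExpr) : Prog :=
  .setW vA a ;; .setW vB b ;; .setW vT t ;;
  .ite (.wlt (.var vA) (.var vB))
    (.storeW aLO (.var vK) (.var vA) ;; .storeW aHI (.var vK) (.var vB) ;;
     .storeW aTP (.var vK) (.var vT) ;; .storeW aGP (.var vK) (.var vI) ;;
     .setW vR (.var vK) ;; incr vK)
    (.setW vR (.lit 0)) ;;
  .storeW slot (.var vI) (.var vR)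

/-- The bound on `slot` keeps the arrays of children apart from the arrays 21 to 24 that describe
the nodes. -/
theorem wp_spawn {s : State} {slot i cnt a b t : ℕ} {x y z : WExpr} {Q : State → Prop}
    (hs : 25 ≤ slot) (hI : s.wvar vI = i) (hK : s.wvar vK = cnt)
    (hx : x.eval s = a) (hy : y.eval (s.setW vA a) = b)
    (hz : z.eval ((s.setW vA a).setW vB b) = t) (ha : a ≤ K) (hb : b ≤ K) (ht : t ≤ K) (hi : i ≤ K)
    (hc : cnt + 1 ≤ K)
    (hQ : ∀ s' r cnt', s'.wvar vK = cnt' → s.nodes.Spawned s'.nodes cnt cnt' r a b t i →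
      s'.warr slot = Function.update (s.warr slot) i r → Q s') :
    (spawn slot x y z).wp K Q s := by
  have h21 : (21 : ℕ) ≠ slot := by lia
  have h22 : (22 : ℕ) ≠ slot := by lia
  have h23 : (23 : ℕ) ≠ slot := by lia
  have h24 : (24 : ℕ) ≠ slot := by lia
  have g21 : slot ≠ 21 := by lia
  have g22 : slot ≠ 22 := by lia
  have g23 : slot ≠ 23 := by lia
  have g24 : slot ≠ 24 := by lia
  simp [spawn, Prog.wp, hx, hy, hz, ha, hb, ht, incr, Cond.Holds, WExpr.eval, hI, hK, hi,
    show cnt ≤ K by lia, show cnt < K by lia]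
  constructor
  · intro hab
    refine hQ _ cnt (cnt + 1) (by simp) ⟨.inl ?_, fun j hj => ?_⟩ ?_
    · simp [State.nodes, h21, h22, h23, h24, hab]
    · have : j ≠ cnt := by lia
      simp [State.nodes, h21, h22, h23, h24, this]
    · simp [g21, g22, g23, g24]
  · intro hab
    refine hQ _ 0 cnt (by simp [hK]) ⟨.inr ⟨hab, rfl, rfl⟩, fun j hj => ?_⟩ ?_
    · simp [State.nodes, h21, h22, h23, h24]
    · simp

/-- Splits the segment of the node `vI`. -/
def splitNode : Prog :=
  findItem ;;
  .ite (.weq (.var vC) (.var vN))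
    (.setW vU (.get aTIN (.var vX)) ;; .setW vW (.add (.var vU) (.lit 1)) ;; .setW vH (.var vU) ;;
     .storeW aIT (.var vI) (.var vX) ;; .storeW aND (.var vX) (.var vI))
    (.setW vU (.get aTIN (.var vC)) ;;
     .setW vW (.add (.var vU) (.add (.get aSZ (.var vC)) (.lit 1))) ;; .setW vH (.var vW) ;;
     .storeW aIT (.var vI) (.var vN)) ;;
  spawn aLC (.get aLO (.var vI)) (.var vU) (.get aTP (.var vI)) ;;
  spawn aRC (.var vW) (.get aHI (.var vI)) (.get aTP (.var vI)) ;;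
  spawn aHC (.var vU) (.var vH) (.var vC) ;;
  incr vI

/-- Builds the hierarchy of segments. -/
def buildNodes : Prog :=
  .setW vI (.lit 1) ;; .setW vK (.lit 2) ;; .storeW aHI (.lit 1) (.var vN) ;;
  .loop (.wlt (.var vI) (.var vK)) splitNode

theorem run_splitNode {D : Decomp G T} {s : State} (hmem : Mem D s) {i cnt : ℕ}
    (hI : s.wvar vI = i) (hc : s.wvar vK = cnt) (hic : i < cnt) (hnK : 2 * n ≤ K)
    (hcK : cnt + 4 ≤ K)
    (h : Hier n D.par D.top D.tin s.nodes i cnt (s.warr aLC) (s.warr aRC) (s.warr aHC) (s.warr aIT)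
      (s.warr aND)) :
    Run B K splitNode s (20 * (Nat.log 2 n + 2) + 150) fun s' => s'.wvar vI = i + 1 ∧
      Hier n D.par D.top D.tin s'.nodes (i + 1) (s'.wvar vK) (s'.warr aLC) (s'.warr aRC)
        (s'.warr aHC) (s'.warr aIT) (s'.warr aND) := by
  have hd := D.hld
  have hg := h.good i h.i_pos hic
  obtain ⟨a, ha⟩ : ∃ a, s.nodes.lo i = a := ⟨_, rfl⟩
  obtain ⟨b, hb⟩ : ∃ b, s.nodes.hi i = b := ⟨_, rfl⟩
  obtain ⟨t, ht⟩ : ∃ t, s.nodes.tp i = t := ⟨_, rfl⟩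
  rw [ha, hb, ht] at hg
  have hbn : b ≤ n := hg.hi.trans (hd.numbering_tin.add_size_le hd.toRTree hg.lt)
  have hab := hg.ne
  have htn := hg.lt
  have eLO : s.warr aLO i = a := ha
  have eHI : s.warr aHI i = b := hb
  have eTP : s.warr aTP i = t := ht
  refine (Run.seq' (run_findItem hmem hI (by rw [eLO, eHI]) eTP hnK hg (mid := (a + b) / 2)
    (by lia) (by lia)) ?_).time_mono (T₁ := 20 * (Nat.log 2 n + 2) + 150) le_rfl
  rintro s1 - ha1 ⟨hxn, hxt, hcase⟩
  have hmem1 := hmem.agree ha1 rfl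
  have eI : s1.wvar vI = i := (ha1.w _ rfl).trans hI
  have eK : s1.wvar vK = cnt := (ha1.w _ rfl).trans hc
  have eN : s1.nodes = s.nodes := by
    simp only [State.nodes]
    rw [ha1.wa 21 rfl, ha1.wa 22 rfl, ha1.wa 23 rfl, ha1.wa 24 rfl]
  have e25 : s1.warr aLC = s.warr aLC := ha1.wa _ rfl
  have e26 : s1.warr aRC = s.warr aRC := ha1.wa _ rfl
  have e27 : s1.warr aHC = s.warr aHC := ha1.wa _ rfl
  have e28 : s1.warr aIT = s.warr aIT := ha1.wa _ rfl
  have e29 : s1.warr aND = s.warr aND := ha1.wa _ rfl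
  refine (Run.seq' (R := fun s2 => ∃ p e c e' x, s2.wvar vU = p ∧ s2.wvar vW = e ∧ s2.wvar vC = c ∧
    s2.wvar vH = e' ∧ a ≤ p ∧ p ≤ (a + b) / 2 ∧ (a + b) / 2 < e ∧ e ≤ b ∧ c ≤ n ∧ e' ≤ n ∧
    s2.wvar vI = i ∧ s2.warr aIT = Function.update (s.warr aIT) i x ∧
    ((PathItem n D.top D.tin t p e x ∧ e' = p ∧ s2.warr aND = Function.update (s.warr aND) x i) ∨
      (LightItem n D.par D.top D.tin t p e c ∧ e' = e ∧ x = n ∧ s2.warr aND = s.warr aND)))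
    (.of_wp' (T := 40) (by decide) ?_) ?_).time_mono (T₁ := 40 + 110) le_rfl
  · obtain ⟨x, hx⟩ : ∃ x, s1.wvar vX = x := ⟨_, rfl⟩
    obtain ⟨c, hcc⟩ : ∃ x, s1.wvar vC = x := ⟨_, rfl⟩
    rw [hx] at hxn hxt
    rw [hx, hcc] at hcase
    have b1 : ∀ v < n, D.tin v < n := fun v => hd.tin_lt
    have b2 : ∀ v < n, D.tin v + size n D.par v ≤ n :=
      fun v hv => hd.numbering_tin.add_size_le hd.toRTree hv
    simp only [Prog.wp, Cond.Holds, WExpr.eval, hcc, hmem1.vn]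
    constructor
    · rintro rfl
      rcases hcase with ⟨-, h2⟩ | ⟨h1, -⟩
      · simp [hx, eI, hmem1.tin, e28, e29]
        have := b1 x hxn
        exact ⟨by lia, by lia, by lia, by lia, by lia, by lia, by lia, by lia, by lia, by lia, by lia,
          x, rfl, ⟨hxn, hxt, rfl, rfl⟩, rfl⟩
      · lia
    · intro hcn
      rcases hcase with ⟨h1, -⟩ | ⟨h1, h2, h3⟩
      · exact (hcn h1).elim
      · have h4 := hmem1.sz c h1
        have h5 := b2 c h1
        have h6 := hd.vat_spec (i := (a + b) / 2) (by lia)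
        have h7 := (hd.tin_anc h1 h6.1).1 h3
        rw [h6.2] at h7
        -- The middle is in the light subtree, so the whole subtree is inside the segment.
        have h8 := hd.lightItem_subset h2 hg h6.1 h3 (by lia) (by lia)
        simp [hcc, eI, hmem1.tin, hmem1.vn, e28, e29, h4]
        exact ⟨by lia, by lia, by lia, by lia, by lia, by lia, by lia, by lia, by lia, n, rfl,
          .inr ⟨h2, rfl⟩⟩
  rintro s2 - ha2 ⟨p, e, c, e', x, hU, hW, hC, hH, q1, q2, q3, q4, q5, q6, hI2, hit, hitem⟩
  have f25 : s2.warr aLC = s.warr aLC := (ha2.wa _ rfl).trans e25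
  have f26 : s2.warr aRC = s.warr aRC := (ha2.wa _ rfl).trans e26
  have f27 : s2.warr aHC = s.warr aHC := (ha2.wa _ rfl).trans e27
  have fK : s2.wvar vK = cnt := (ha2.w _ rfl).trans eK
  have fN : s2.nodes = s.nodes := by
    rw [← eN]
    simp only [State.nodes]
    rw [ha2.wa 21 rfl, ha2.wa 22 rfl, ha2.wa 23 rfl, ha2.wa 24 rfl]
  have fLO : s2.warr aLO i = a := by rw [← eLO]; exact congrFun (congrArg Nodes.lo fN) i
  have fHI : s2.warr aHI i = b := by rw [← eHI]; exact congrFun (congrArg Nodes.hi fN) i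
  have fTP : s2.warr aTP i = t := by rw [← eTP]; exact congrFun (congrArg Nodes.tp fN) i
  refine (Run.seq' (R := fun s3 => ∃ r c1, s3.wvar vK = c1 ∧ s2.nodes.Spawned s3.nodes cnt c1 r a p t i ∧
    s3.warr aLC = Function.update (s2.warr aLC) i r) (.of_wp' (T := 34) (by decide)
    (wp_spawn (by lia) hI2 fK (a := a) (b := p) (t := t) ?_ ?_ ?_ ?_ ?_ ?_ ?_ ?_ ?_)) ?_).time_mono
    (T₁ := 34 + (34 + (34 + 4))) (by lia)
  · simp [WExpr.eval, hI2, fLO]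
  · simp [WExpr.eval, hU]
  · simp [WExpr.eval, hI2, fTP]
  iterate 5 lia
  · exact fun s' r c1 h1 h2 h3 => ⟨r, c1, h1, h2, h3⟩
  rintro s3 - ha3 ⟨rL, c1, K3, S3, L3⟩
  have hc1 : c1 ≤ cnt + 1 ∧ cnt ≤ c1 := by obtain ⟨h1 | h1, -⟩ := S3 <;> lia
  have gI : s3.wvar vI = i := (ha3.w _ rfl).trans hI2
  have gU : s3.wvar vU = p := (ha3.w _ rfl).trans hU
  have gW : s3.wvar vW = e := (ha3.w _ rfl).trans hW
  have gH : s3.wvar vH = e' := (ha3.w _ rfl).trans hH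
  have gC : s3.wvar vC = c := (ha3.w _ rfl).trans hC
  have gHI : s3.warr aHI i = b := by rw [← fHI]; exact (S3.2 i hic).2.1
  have gTP : s3.warr aTP i = t := by rw [← fTP]; exact (S3.2 i hic).2.2.1
  refine Run.seq' (R := fun s4 => ∃ r c2, s4.wvar vK = c2 ∧ s3.nodes.Spawned s4.nodes c1 c2 r e b t i ∧
    s4.warr aRC = Function.update (s3.warr aRC) i r) (.of_wp' (T := 34) (by decide)
    (wp_spawn (by lia) gI K3 (a := e) (b := b) (t := t) ?_ ?_ ?_ ?_ ?_ ?_ ?_ ?_ ?_)) ?_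
  · simp [WExpr.eval, gW]
  · simp [WExpr.eval, gI, gHI]
  · simp [WExpr.eval, gI, gTP]
  iterate 5 lia
  · exact fun s' r c1 h1 h2 h3 => ⟨r, c1, h1, h2, h3⟩
  rintro s4 - ha4 ⟨rR, c2, K4, S4, L4⟩
  have hc2 : c2 ≤ c1 + 1 ∧ c1 ≤ c2 := by obtain ⟨h1 | h1, -⟩ := S4 <;> lia
  have kI : s4.wvar vI = i := (ha4.w _ rfl).trans gI
  have kU : s4.wvar vU = p := (ha4.w _ rfl).trans gU
  have kH : s4.wvar vH = e' := (ha4.w _ rfl).trans gH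
  have kC : s4.wvar vC = c := (ha4.w _ rfl).trans gC
  refine Run.seq' (R := fun s5 => ∃ r c3, s5.wvar vK = c3 ∧ s4.nodes.Spawned s5.nodes c2 c3 r p e' c i ∧
    s5.warr aHC = Function.update (s4.warr aHC) i r) (.of_wp' (T := 34) (by decide)
    (wp_spawn (by lia) kI K4 (a := p) (b := e') (t := c) ?_ ?_ ?_ ?_ ?_ ?_ ?_ ?_ ?_)) ?_
  · simp [WExpr.eval, kU]
  · simp [WExpr.eval, kH]
  · simp [WExpr.eval, kC]
  iterate 5 lia
  · exact fun s' r c1 h1 h2 h3 => ⟨r, c1, h1, h2, h3⟩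
  rintro s5 - ha5 ⟨rH, c3, K5, S5, L5⟩
  have lI : s5.wvar vI = i := (ha5.w _ rfl).trans kI
  have l25 : s5.warr aLC = Function.update (s.warr aLC) i rL := by
    rw [ha5.wa 25 rfl, ha4.wa 25 rfl, L3, f25]
  have l26 : s5.warr aRC = Function.update (s.warr aRC) i rR := by
    rw [ha5.wa 26 rfl, L4, ha3.wa 26 rfl, f26]
  have l27 : s5.warr aHC = Function.update (s.warr aHC) i rH := by
    rw [L5, ha4.wa 27 rfl, ha3.wa 27 rfl, f27]
  have l28 : s5.warr aIT = Function.update (s.warr aIT) i x := by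
    rw [ha5.wa 28 rfl, ha4.wa 28 rfl, ha3.wa 28 rfl, hit]
  have l29 : s5.warr aND = s2.warr aND := by
    rw [ha5.wa 29 rfl, ha4.wa 29 rfl, ha3.wa 29 rfl]
  rw [fN] at S3
  refine Run.of_wp' (by decide) ?_
  simp only [Prog.wp, incr, WExpr.eval, lI, State.setW_wvar, State.setW_warr, l25, l26, l27, l28, l29,
    K5, if_true]
  refine ⟨by lia, trivial, ?_⟩
  rw [← hb, ← ht] at S4
  refine h.step (p := p) (e := e) (c := c) (e' := e') (x := x) hic hd ?_ ?_ ?_ ?_ ?_ ?_ ?_ S4 S5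
  · rw [ha]; exact q1
  · lia
  · rw [hb]; exact q4
  · rw [ha, hb]; lia
  · rw [ha, hb]; lia
  · rw [ht]; exact hitem
  · rw [ha, ht]; exact S3

/-- Each node that still waits has a non-empty segment, hence weight at least one, and the potential
bounds their number together with `i`. -/
theorem Hier.cnt_le {par top tin : ℕ → ℕ} {N : Nodes} {i cnt : ℕ} {lc rc hc it nd : ℕ → ℕ}
    (h : Hier n par top tin N i cnt lc rc hc it nd) : cnt ≤ 2 * n + 1 := by
  have h1 : ∑ j ∈ Finset.Ico i cnt, 1 ≤
      ∑ j ∈ Finset.Ico i cnt, nodeWeight n top tin (N.lo j) (N.hi j) (N.tp j) := by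
    refine Finset.sum_le_sum fun j hj => ?_
    rw [Finset.mem_Ico] at hj
    have h2 := (h.good j (h.i_pos.trans hj.1) hj.2).ne
    rw [nodeWeight]
    lia
  have := h.pot
  simp at h1
  lia

theorem run_buildNodes {D : Decomp G T} {s : State} (hmem : Mem D s) (hnK : 2 * n + 8 ≤ K)
    (h0 : ∀ a, 21 ≤ a → s.warr a = fun _ => 0) :
    Run B K buildNodes s (20 + 500 * (n * (Nat.log 2 n + 2))) fun s' =>
      Hier n D.par D.top D.tin s'.nodes (s'.wvar vK) (s'.wvar vK) (s'.warr aLC) (s'.warr aRC)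
        (s'.warr aHC) (s'.warr aIT) (s'.warr aND) := by
  have hd := D.hld
  have hn0 := hd.n_pos
  refine (Run.seq' (R := fun s' => s' = s.setW vI 1) (.of_wp ?_) ?_).time_mono
    (T₁ := 2 + (2 + (3 + (2 * n * (20 * (Nat.log 2 n + 2) + 150 + 3 + 1) + 3 + 1)))) (by nlinarith)
  · simp [Prog.wp, WExpr.eval]
    lia
  rintro s1 - ha1 rfl
  refine Run.seq' (R := fun s' => s' = (s.setW vI 1).setW vK 2) (.of_wp ?_) ?_
  · simp [Prog.wp, WExpr.eval]
    lia
  rintro s2 - ha2 rfl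
  refine Run.seq' (R := fun s' => s' = ((s.setW vI 1).setW vK 2).storeW aHI 1 n) (.of_wp ?_) ?_
  · simp [Prog.wp, WExpr.eval, hmem.vn]
    lia
  rintro s3 - ha3 rfl
  have hmem3 := ((hmem.agree ha1 rfl).agree ha2 rfl).agree ha3 rfl
  refine (Run.loop_pot (fun s' => Hier n D.par D.top D.tin s'.nodes (s'.wvar vI) (s'.wvar vK)
      (s'.warr aLC) (s'.warr aRC) (s'.warr aHC) (s'.warr aIT) (s'.warr aND))
    (fun s' => 2 * n + 1 - s'.wvar vI) (20 * (Nat.log 2 n + 2) + 150) ?_ ?_ ?_).time_mono ?_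
  -- The other arrays are still zero, so the node 1 has the segment from 0 to `n`, the root as top
  -- and no parent.
  · have e1 : (((s.setW vI 1).setW vK 2).storeW aHI 1 n).nodes =
        ⟨fun _ => 0, Function.update (fun _ => 0) 1 n, fun _ => 0, fun _ => 0⟩ := by
      simp [State.nodes, h0]
    rw [e1]
    simp only [State.storeW_wvar, State.setW_wvar]
    have h1 : ∀ j, 1 ≤ j → j < 2 → j = 1 := fun j h1 h2 => by lia
    refine ⟨by simp, by simp, by simp, by simp, fun j h2 h3 => ?_, rfl, fun j h2 h3 => ?_,
      fun j h2 h3 h4 => (h4 rfl).elim, fun j h2 h3 => ?_, fun u hu => ⟨1, le_rfl, by simp, by simp,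
      by simpa using hd.tin_lt hu, .inl (by simp), fun j h2 h3 h4 h5 => ?_⟩, ?_⟩
    · obtain rfl := h1 j h2 (by simpa using h3)
      simpa using hd.good_root
    · obtain rfl := h1 j h2 (by simpa using h3)
      simp
    · simp at h3
      lia
    · obtain rfl := h1 j h2 (by simpa using h3)
      exact .refl _
    · have := HLD.nodeWeight_le (n := n) (top := D.top) (tin := D.tin) (t := 0)
      simp
      lia
  · rintro s' - ha h1 hb
    have hmem' := hmem3.agree ha rfl
    have h2 := h1.cnt_le
    have h3 : s'.wvar vI < s'.wvar vK := hb
    refine (run_splitNode hmem' rfl rfl h3 (by lia) ?_ h1).imp ?_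
    · lia
    · rintro s'' - - ⟨h4, h5⟩
      rw [h4]
      exact ⟨h5, by lia⟩
  · rintro s' - ha h1 hb
    have h3 : ¬ s'.wvar vI < s'.wvar vK := hb
    have h4 : s'.wvar vI = s'.wvar vK := by
      have := h1.le
      lia
    rwa [h4] at h1
  · refine Nat.add_le_add_right (Nat.add_le_add_right (Nat.mul_le_mul ?_ le_rfl) _) _
    simp

end TwoRespect

namespace TwoRespect

variable {B K n m : ℕ} {G : WGraph n m} {T : Finset (Fin m)}

/-! ## The program: updates of the hierarchy -/

notation "vF" => (16 : ℕ)
notation "aBF" => (30 : ℕ)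
notation "aPF" => (31 : ℕ)
notation "aOF" => (32 : ℕ)
notation "aY" => (1 : ℕ)
notation "aBASE" => (2 : ℕ)
notation "aSM" => (3 : ℕ)
notation "aPR" => (4 : ℕ)
notation "aOR" => (5 : ℕ)
notation "rS" => (0 : ℕ)
notation "rM" => (1 : ℕ)
notation "rX" => (2 : ℕ)

/-- Replaces the current minimum (in `vF`, `rM`) by the given value if this is smaller. -/
def accMin (f : WExpr) (x : RExpr) : Prog :=
  .ite (.weq f (.lit 0)) .skip
    (.ite (.and (.not (.weq (.var vF) (.lit 0))) (.not (.rlt x (.var rM)))) .skip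
      (.setR rM x ;; .setW vF (.lit 1)))

theorem wp_accMin {ι : Type} {s : State} {f : WExpr} {x : RExpr} {C C' : ι → Prop} {g : ι → ℝ}
    {Q : State → Prop} (hK : 1 ≤ K) (hF : s.wvar vF ≤ K)
    (h : IsMin (s.wvar vF) (s.rvar rM) C g) (h' : IsMin (f.eval s) (x.eval s) C' g)
    (hQ : ∀ f r, f ≤ K → IsMin f r (fun v => C v ∨ C' v) g → Q ((s.setR rM r).setW vF f)) :
    (accMin f x).wp K Q s := by
  have hs : (s.setR rM (s.rvar rM)).setW vF (s.wvar vF) = s := by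
    simp [State.setR, State.setW]
  simp only [accMin, Prog.wp, Cond.Holds, WExpr.eval, RExpr.eval]
  refine ⟨fun h1 => ?_, fun h1 => ⟨fun h2 => ?_, fun h2 => ⟨hK, ?_⟩⟩⟩
  · rw [← hs]
    exact hQ _ _ hF (h.left h' (.inl h1))
  · rw [← hs]
    exact hQ _ _ hF (h.left h' (.inr ⟨h2.1, not_lt.1 h2.2⟩))
  · refine hQ _ _ hK (h.right h' h1 ?_)
    by_cases h3 : s.wvar vF = 0
    · exact .inl h3
    · exact .inr (not_not.1 fun h4 => h2 ⟨h3, fun h5 => h4 h5.le⟩)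

/-- Recomputes the values of the node `vI`. -/
def pull : Prog :=
  .setR rS (.add (.add (.get aY (.get aIT (.var vI))) (.get aSM (.get aHC (.var vI))))
    (.get aSM (.get aRC (.var vI)))) ;;
  .setW vF (.get aPF (.get aRC (.var vI))) ;; .setR rM (.get aPR (.get aRC (.var vI))) ;;
  accMin (.get aBF (.get aIT (.var vI))) (.add (.get aBASE (.get aIT (.var vI))) (.var rS)) ;;
  accMin (.get aPF (.get aLC (.var vI))) (.add (.get aPR (.get aLC (.var vI))) (.var rS)) ;;
  .storeW aPF (.var vI) (.var vF) ;; .storeR aPR (.var vI) (.var rM) ;;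
  .setW vF (.get aOF (.get aLC (.var vI))) ;; .setR rM (.get aOR (.get aLC (.var vI))) ;;
  accMin (.get aOF (.get aRC (.var vI))) (.get aOR (.get aRC (.var vI))) ;;
  accMin (.get aPF (.get aHC (.var vI))) (.get aPR (.get aHC (.var vI))) ;;
  accMin (.get aOF (.get aHC (.var vI))) (.get aOR (.get aHC (.var vI))) ;;
  .storeW aOF (.var vI) (.var vF) ;; .storeR aOR (.var vI) (.var rM) ;;
  .storeR aSM (.var vI) (.add (.get aSM (.get aLC (.var vI))) (.var rS))

/-- The values of the node `j` are correct. -/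
def NodeOK (D : Decomp G T) (s : State) (y : ℕ → ℝ) (on : ℕ → ℕ) (j : ℕ) : Prop :=
  SegOK n D.par D.top D.tin D.vat (s.rarr aBASE) y on (s.warr aLO j) (s.warr aHI j) (s.warr aTP j)
    (s.rarr aSM j) (s.warr aPF j) (s.rarr aPR j) (s.warr aOF j) (s.rarr aOR j)

/-- The memory holds the hierarchy. The node `0` stands for empty segments, and the vertex `n` for
no vertex. -/
structure Built (D : Decomp G T) (s : State) (cnt : ℕ) : Prop where
  hier : Hier n D.par D.top D.tin s.nodes cnt cnt (s.warr aLC) (s.warr aRC) (s.warr aHC)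
    (s.warr aIT) (s.warr aND)
  sm_zero : s.rarr aSM 0 = 0
  pf_zero : s.warr aPF 0 = 0
  of_zero : s.warr aOF 0 = 0
  y_n : s.rarr aY n = 0
  bf_n : s.warr aBF n = 0

/-- The values for two nodes and their locations are the same. -/
def State.SameAt (s s' : State) (j : ℕ) : Prop :=
  s'.rarr aSM j = s.rarr aSM j ∧ s'.warr aPF j = s.warr aPF j ∧ s'.rarr aPR j = s.rarr aPR j ∧
    s'.warr aOF j = s.warr aOF j ∧ s'.rarr aOR j = s.rarr aOR j

/-- The program does not change the shape of the hierarchy, nor the values at the vertices. -/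
def Prog.keepsTree (p : Prog) : Bool :=
  [21, 22, 23, 24, 25, 26, 27, 28, 29, 30].all (fun a => !p.modWA a) && !p.modRA 1 && !p.modRA 2

theorem Agree.tree {p : Prog} {s s' : State} (ha : Agree p s s') (hp : p.keepsTree) :
    (s'.nodes = s.nodes ∧ s'.warr aLC = s.warr aLC ∧ s'.warr aRC = s.warr aRC ∧
      s'.warr aHC = s.warr aHC ∧ s'.warr aIT = s.warr aIT ∧ s'.warr aND = s.warr aND) ∧
    s'.warr aBF = s.warr aBF ∧ s'.rarr aY = s.rarr aY ∧ s'.rarr aBASE = s.rarr aBASE := by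
  simp only [Prog.keepsTree, List.all_cons, List.all_nil, Bool.and_eq_true, Bool.not_eq_true',
    Bool.and_true] at hp
  obtain ⟨⟨⟨a1, a2, a3, a4, a5, a6, a7, a8, a9, a10⟩, r1⟩, r2⟩ := hp
  refine ⟨⟨?_, ha.wa _ a5, ha.wa _ a6, ha.wa _ a7, ha.wa _ a8, ha.wa _ a9⟩, ha.wa _ a10, ha.ra _ r1,
    ha.ra _ r2⟩
  simp only [State.nodes]
  rw [ha.wa _ a1, ha.wa _ a2, ha.wa _ a3, ha.wa _ a4]

theorem Built.agree {D : Decomp G T} {s s' : State} {cnt : ℕ} {p : Prog} (h : Built D s cnt)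
    (ha : Agree p s s') (hp : p.keepsTree) (h0 : s.SameAt s' 0) : Built D s' cnt := by
  obtain ⟨⟨e1, e2, e3, e4, e5, e6⟩, e7, e8, e9⟩ := ha.tree hp
  obtain ⟨z1, z2, z3, z4, z5⟩ := h0
  refine ⟨?_, z1.trans h.sm_zero, z2.trans h.pf_zero, z4.trans h.of_zero, ?_, ?_⟩
  · rw [e1, e2, e3, e4, e5, e6]
    exact h.hier
  · rw [e8, h.y_n]
  · rw [e7, h.bf_n]

theorem NodeOK.agree {D : Decomp G T} {s s' : State} {y : ℕ → ℝ} {on : ℕ → ℕ} {j : ℕ} {p : Prog}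
    (h : NodeOK D s y on j) (ha : Agree p s s') (hp : p.keepsTree) (h0 : s.SameAt s' j) :
    NodeOK D s' y on j := by
  obtain ⟨⟨e1, -⟩, -, -, e9⟩ := ha.tree hp
  obtain ⟨z1, z2, z3, z4, z5⟩ := h0
  have f1 := congrArg (fun N : Nodes => N.lo j) e1
  have f2 := congrArg (fun N : Nodes => N.hi j) e1
  have f3 := congrArg (fun N : Nodes => N.tp j) e1
  simp only [State.nodes] at f1 f2 f3
  rwa [NodeOK, f1, f2, f3, e9, z1, z2, z3, z4, z5]

/-- The node 0 stores the sum 0 and two infinite minima, which is correct for an empty segment. So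
`pull` needs no case distinction for missing children. -/
theorem Built.child {D : Decomp G T} {s : State} {cnt r a b t j : ℕ} {y : ℕ → ℝ} {on : ℕ → ℕ}
    (h : Built D s cnt) (hc : s.nodes.Child cnt r a b t j)
    (hok : j < r → r < cnt → s.nodes.gp r = j → NodeOK D s y on r) :
    SegOK n D.par D.top D.tin D.vat (s.rarr aBASE) y on a b t
      (s.rarr aSM r) (s.warr aPF r) (s.rarr aPR r) (s.warr aOF r) (s.rarr aOR r) := by
  rcases hc with ⟨rfl, rfl⟩ | ⟨h1, h2, rfl, rfl, rfl, h3⟩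
  · rw [h.sm_zero, h.pf_zero, h.of_zero]
    exact .empty
  · exact hok h1 h2 h3

theorem run_pull {D : Decomp G T} {s : State} {cnt i : ℕ} (h : Built D s cnt) (hI : s.wvar vI = i)
    (h1 : 1 ≤ i) (hi : i < cnt) (hK : 1 ≤ K)
    (hok : ∀ j, i < j → j < cnt → s.nodes.gp j = i → NodeOK D s (s.rarr aY) (s.warr aBF) j) :
    Run B K pull s 220 fun s' => NodeOK D s' (s.rarr aY) (s.warr aBF) i ∧
      ∀ j, j ≠ i → s.SameAt s' j := by
  refine Run.bd fun hbd => ?_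
  have hd := D.hld
  obtain ⟨p, e, c, e', hap, hpe, heb, hitem, hl, hr, hh⟩ := h.hier.split i h1 hi
  have hL := h.child hl fun _ => hok _ ‹_›
  have hR := h.child hr fun _ => hok _ ‹_›
  have hH := h.child hh fun _ => hok _ ‹_›
  have nl : s.warr aLC i ≠ i := by rcases hl with hl | hl <;> lia
  have nr : s.warr aRC i ≠ i := by rcases hr with hr | hr <;> lia
  have nh : s.warr aHC i ≠ i := by rcases hh with hh | hh <;> lia
  have hit : IsItem n D.par D.top D.tin (s.nodes.tp i) p e c e' (s.warr aIT i) (s.rarr aY)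
      (s.warr aBF) := by
    rcases hitem with h2 | ⟨h2, h3, h4⟩
    · exact .inl h2
    · exact .inr ⟨h2, h3, by rw [h4, h.y_n], by rw [h4, h.bf_n]⟩
  have hsum := hR.pull_sum hH hd heb hit
  have m1 := hR.path
  have m2 := hit.isMin (base := s.rarr aBASE) (vat := D.vat) (b := s.nodes.hi i)
  have m3 := hL.pull_left (hpe.le.trans heb)
  have m4 := hL.other
  have m5 := hR.other
  have m6 := hH.pull_top hd hit
  have m7 := hH.other
  obtain ⟨l, el⟩ : ∃ l, s.warr aLC i = l := ⟨_, rfl⟩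
  obtain ⟨r, er⟩ : ∃ l, s.warr aRC i = l := ⟨_, rfl⟩
  obtain ⟨q, eq⟩ : ∃ l, s.warr aHC i = l := ⟨_, rfl⟩
  obtain ⟨x, ex⟩ : ∃ l, s.warr aIT i = l := ⟨_, rfl⟩
  rw [el] at hL m3 m4 nl
  rw [er] at hR hsum m1 m5 nr
  rw [eq] at hH hsum m6 m7 nh
  rw [ex] at hit hsum m2
  -- The program computes the sum from `p` on as `rS`; it is what the path vertices of the left part
  -- and of the item need.
  rw [← hsum] at m2 m3
  refine .of_wp' (by decide) ?_
  simp only [pull, Prog.wp, WExpr.eval, RExpr.eval, State.setR_wvar, State.setR_warr, State.setW_rarr,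
    State.setR_rarr, State.setW_warr, hI, er, eq, ex, State.setW_wvar]
  refine ⟨hbd.2 _ _, wp_accMin hK (by simp [hbd.2]) (by simpa [hI, er] using m1)
    (by simpa [WExpr.eval, RExpr.eval, hI, ex] using m2) fun f1 r1 hf1 k1 => ?_⟩
  refine wp_accMin hK (by simpa using hf1) (by simpa using k1)
    (by simpa [WExpr.eval, RExpr.eval, hI, el] using m3) fun f2 r2 hf2 k2 => ?_
  simp only [State.setR_wvar, State.setR_warr, State.setW_rarr,
    State.setR_rarr, State.setW_warr, State.setW_wvar, State.storeR_wvar, State.storeW_wvar,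
    State.storeR_warr, State.storeR_rvar, State.storeR_rarr, State.storeW_rarr, State.storeW_warr,
    State.setW_rvar, State.setR_rvar, State.storeW_rvar, hI]
  refine ⟨by simpa using hf2, by simp [el, hbd.2], wp_accMin hK (by simp [el, hbd.2])
    (by simpa [hI, el] using m4)
    (by simpa [WExpr.eval, RExpr.eval, hI, er] using m5) fun f3 r3 hf3 k3 => ?_⟩
  refine wp_accMin hK (by simpa using hf3) (by simpa using k3)
    (by simpa [WExpr.eval, RExpr.eval, hI, eq, nh] using m6) fun f4 r4 hf4 k4 => ?_
  refine wp_accMin hK (by simpa using hf4) (by simpa using k4)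
    (by simpa [WExpr.eval, RExpr.eval, hI, eq, nh] using m7) fun f5 r5 hf5 k5 => ?_
  refine ⟨by simpa using hf5, ?_, fun j hj => ?_⟩
  · have := hL.pull hR hH hd hap hpe heb hit k2 k5
    simpa [NodeOK, State.nodes, hI, el] using this
  · simp [State.SameAt, hI, hj]

/-- Recomputes the values of the node `vI` and its ancestors. -/
def climb : Prog :=
  .loop (.not (.weq (.var vI) (.lit 0))) (pull ;; .setW vI (.get aGP (.var vI)))

/-- Only ancestors of the current node, including itself, can have wrong values, and recomputing
removes the current node from them. The weight doubles with each step upwards, and it is at most `2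
* (n * n)`, so there are at most `2 * Nat.log 2 n + 3` steps. -/
theorem run_climb {D : Decomp G T} {s : State} {cnt : ℕ} (h : Built D s cnt) (hK : cnt ≤ K)
    (hI : s.wvar vI < cnt)
    (hok : ∀ j, 1 ≤ j → j < cnt →
      NodeOK D s (s.rarr aY) (s.warr aBF) j ∨ Anc s.nodes.gp j (s.wvar vI)) :
    Run B K climb s (500 * (Nat.log 2 n + 2)) fun s' => Built D s' cnt ∧
      ∀ j, 1 ≤ j → j < cnt → NodeOK D s' (s'.rarr aY) (s'.warr aBF) j := by
  have hd := D.hld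
  obtain ⟨N, eN⟩ : ∃ N, s.nodes = N := ⟨_, rfl⟩
  rw [eN] at hok
  have hh := h.hier
  rw [eN] at hh
  have hbn : ∀ j, 1 ≤ j → j < cnt → N.hi j ≤ n := fun j h1 h2 =>
    (hh.good j h1 h2).hi.trans (hd.numbering_tin.add_size_le hd.toRTree (hh.good j h1 h2).lt)
  have hw : ∀ j, 1 ≤ j → j < cnt → 0 < segWeight n D.par D.tin (N.lo j) (N.hi j) (N.tp j) ∧
      Nat.log 2 (segWeight n D.par D.tin (N.lo j) (N.hi j) (N.tp j)) ≤ 2 * Nat.log 2 n + 2 := by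
    intro j h1 h2
    have h3 := HLD.segWeight_le (par := D.par) (tin := D.tin) (t := N.tp j) (a := N.lo j)
      (hbn j h1 h2)
    have h4 := (hh.good j h1 h2).ne
    have h5 : 0 < (N.hi j - N.lo j) * (N.hi j - N.lo j) := Nat.mul_pos (by lia) (by lia)
    refine ⟨by lia, ?_⟩
    have h6 : n < 2 ^ (Nat.log 2 n + 1) := Nat.lt_pow_succ_log_self (by lia) n
    have h7 : n * n < 2 ^ (Nat.log 2 n + 1) * 2 ^ (Nat.log 2 n + 1) := Nat.mul_lt_mul'' h6 h6
    rw [← pow_add] at h7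
    have h8 : Nat.log 2 (segWeight n D.par D.tin (N.lo j) (N.hi j) (N.tp j)) <
        2 * Nat.log 2 n + 2 + 1 := by
      refine Nat.log_lt_of_lt_pow (by lia) ?_
      have h9 : 2 ^ (2 * Nat.log 2 n + 2 + 1) = 2 * 2 ^ (Nat.log 2 n + 1 + (Nat.log 2 n + 1)) := by
        rw [← pow_succ']
        congr 1
        lia
      lia
    lia
  refine (Run.loop_pot (fun s' => Built D s' cnt ∧ s'.wvar vI < cnt ∧ ∀ j, 1 ≤ j → j < cnt →
      NodeOK D s' (s.rarr aY) (s.warr aBF) j ∨ Anc N.gp j (s'.wvar vI))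
    (fun s' => if s'.wvar vI = 0 then 0 else 2 * Nat.log 2 n + 3 - Nat.log 2
      (segWeight n D.par D.tin (N.lo (s'.wvar vI)) (N.hi (s'.wvar vI)) (N.tp (s'.wvar vI)))) 223
      ⟨h, hI, hok⟩ ?_ ?_).time_mono ?_
  · rintro s' - ha ⟨i1, i2, i3⟩ hb
    obtain ⟨i, ei⟩ : ∃ i, s'.wvar vI = i := ⟨_, rfl⟩
    have hi0 : i ≠ 0 := by simpa [Cond.Holds, WExpr.eval, ei] using hb
    rw [ei] at i2 i3
    obtain ⟨⟨e1, -⟩, e7, e8, e9⟩ := ha.tree rfl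
    rw [eN] at e1
    rw [← e8, ← e7] at i3 ⊢
    refine (Run.seq' (run_pull i1 ei (by lia) i2 (by lia) fun j h1 h2 h3 => ?_) ?_).time_mono
      (T₁ := 220 + 3) le_rfl
    · refine (i3 j (by lia) h2).resolve_right fun h4 => ?_
      have h5 := (Nodes.Same.anc (N := N) (N' := N) (fun _ _ => ⟨rfl, rfl, rfl, rfl⟩) hh.gp_zero
        (fun j h1 h2 => (hh.gp_lt j h1 h2).1) i2 h4).2
      lia
    · rintro s2 - ha2 ⟨h1, h2⟩
      have f1 := (ha2.tree rfl).1.1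
      have hI2 : s2.wvar vI = i := (ha2.w _ rfl).trans ei
      have hgp : s2.warr aGP i = N.gp i := by
        rw [← e1]
        exact congrArg (fun N : Nodes => N.gp i) f1
      have hlt := hh.gp_lt i (by lia) i2
      have hb2 := i1.agree ha2 rfl (h2 0 (by lia))
      have ha3 : Agree (.setW vI (.lit 0)) s2 (s2.setW vI (N.gp i)) :=
        ⟨fun j hj => by simp [Prog.modW] at hj; simp [hj], fun _ _ => rfl, fun _ _ => rfl,
          fun _ _ => rfl, fun _ => rfl⟩
      have hsame : ∀ j, s2.SameAt (s2.setW vI (N.gp i)) j := fun j => ⟨rfl, rfl, rfl, rfl, rfl⟩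
      refine .of_wp' (by decide) ?_
      simp only [Prog.wp, WExpr.eval, hI2, hgp]
      refine ⟨by lia, ⟨hb2.agree ha3 rfl (hsame 0), ?_, fun j h3 h4 => ?_⟩, ?_⟩
      · simp
        lia
      · simp only [State.setW_wvar, if_true]
        rcases eq_or_ne j i with rfl | hne
        · exact .inl (h1.agree ha3 rfl (hsame j))
        · rcases i3 j h3 h4 with h5 | h5
          · exact .inl ((h5.agree ha2 rfl (h2 j hne)).agree ha3 rfl (hsame j))
          · exact .inr ((Anc.iff_par.1 h5).resolve_left hne)
      · simp only [State.setW_wvar, if_true, ei, if_neg hi0]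
        have h5 := hw i (by lia) i2
        split_ifs with h6
        · lia
        · have h7 := hh.weight i (by lia) i2 h6
          have h8 := Nat.log_mono_right (b := 2) h7
          rw [mul_comm, Nat.log_mul_base (by lia) (by lia)] at h8
          have h9 := hw (N.gp i) (by lia) (by lia)
          lia
  · rintro s' - ha ⟨i1, i2, i3⟩ hb
    obtain ⟨⟨e1, -⟩, e7, e8, e9⟩ := ha.tree rfl
    have hi0 : s'.wvar vI = 0 := by simpa [Cond.Holds, WExpr.eval] using hb
    rw [e8, e7]
    refine ⟨i1, fun j h1 h2 => (i3 j h1 h2).resolve_right fun h3 => ?_⟩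
    rw [hi0] at h3
    have h5 := (Nodes.Same.anc (N := N) (N' := N) (fun _ _ => ⟨rfl, rfl, rfl, rfl⟩) hh.gp_zero
      (fun j h1 h2 => (hh.gp_lt j h1 h2).1) (show 0 < cnt by have := hh.one_lt; lia) h3).2
    lia
  · have hc : (Cond.not (.weq (.var vI) (.lit 0))).cost = 4 := rfl
    have : (if s.wvar vI = 0 then 0 else 2 * Nat.log 2 n + 3 - Nat.log 2 (segWeight n D.par D.tin
        (N.lo (s.wvar vI)) (N.hi (s.wvar vI)) (N.tp (s.wvar vI)))) ≤ 2 * Nat.log 2 n + 3 := by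
      split_ifs <;> lia
    rw [hc]
    nlinarith

/-- All values in the hierarchy are correct. -/
def Live (D : Decomp G T) (s : State) : Prop :=
  ∃ cnt, Built D s cnt ∧ ∀ j, 1 ≤ j → j < cnt → NodeOK D s (s.rarr aY) (s.warr aBF) j

theorem Live.agree {D : Decomp G T} {s s' : State} {p : Prog} (h : Live D s) (ha : Agree p s s')
    (hp : p.keepsTree)
    (hp' : !p.modWA 31 && !p.modWA 32 && !p.modRA 3 && !p.modRA 4 && !p.modRA 5) : Live D s' := by
  simp only [Bool.and_eq_true, Bool.not_eq_true'] at hp'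
  obtain ⟨⟨⟨⟨p1, p2⟩, p3⟩, p4⟩, p5⟩ := hp'
  obtain ⟨cnt, h1, h2⟩ := h
  have hs : ∀ j, s.SameAt s' j := fun j => ⟨congrFun (ha.ra _ p3) j, congrFun (ha.wa _ p1) j,
    congrFun (ha.ra _ p4) j, congrFun (ha.wa _ p2) j, congrFun (ha.ra _ p5) j⟩
  obtain ⟨-, e7, e8, -⟩ := ha.tree hp
  refine ⟨cnt, h1.agree ha hp (hs 0), fun j h3 h4 => ?_⟩
  rw [e7, e8]
  exact (h2 j h3 h4).agree ha hp (hs j)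

/-- The values at the vertex `v` have changed: recomputes the values of all nodes that contain it. -/
def touch (v : WExpr) : Prog := .setW vI (.get aND v) ;; climb

/-- A state `s` is given that differs from a correct one only in `y` and in the activity of the
vertex `u`. The nodes whose segments do not contain `u` are still correct by `SegOK.frame`, and all
others are ancestors of the node where `u` is located. -/
theorem run_touch {D : Decomp G T} {s s0 : State} {v : WExpr} {u : ℕ} (h : Live D s0)
    (hK : 2 * n + 1 ≤ K) (hv : v.eval s = u) (hu : u < n)
    (hw : s.warr = Function.update s0.warr aBF (s.warr aBF))
    (hr : s.rarr = Function.update s0.rarr aY (s.rarr aY))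
    (hy : ∀ w, w ≠ u → s.rarr aY w = s0.rarr aY w) (ho : ∀ w, w ≠ u → s.warr aBF w = s0.warr aBF w) :
    Run B K (touch v) s ((v.cost + 2) + 500 * (Nat.log 2 n + 2)) (Live D) := by
  obtain ⟨cnt, hb, hok⟩ := h
  have hd := D.hld
  have ew : ∀ a, a ≠ 30 → s.warr a = s0.warr a := fun a ha => by rw [hw]; simp [ha]
  have er : ∀ a, a ≠ 1 → s.rarr a = s0.rarr a := fun a ha => by rw [hr]; simp [ha]
  have eN : s.nodes = s0.nodes := by
    simp only [State.nodes]
    rw [ew 21 (by decide), ew 22 (by decide), ew 23 (by decide), ew 24 (by decide)]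
  have hb' : Built D s cnt := by
    refine ⟨?_, ?_, ?_, ?_, ?_, ?_⟩
    · rw [eN, ew 25 (by decide), ew 26 (by decide), ew 27 (by decide), ew 28 (by decide),
        ew 29 (by decide)]
      exact hb.hier
    · rw [er 3 (by decide), hb.sm_zero]
    · rw [ew 31 (by decide), hb.pf_zero]
    · rw [ew 32 (by decide), hb.of_zero]
    · rw [hy n (by lia), hb.y_n]
    · rw [ho n (by lia), hb.bf_n]
  have hcK : cnt ≤ K := hb'.hier.cnt_le.trans hK
  obtain ⟨l, l1, l2, l3, l4, l5, l6⟩ := hb'.hier.loc u hu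
  have hnd : s.warr aND u = l := l5.resolve_left (by lia)
  have key : ∀ j, 1 ≤ j → j < cnt →
      NodeOK D s (s.rarr aY) (s.warr aBF) j ∨ Anc s.nodes.gp j l := by
    intro j h1 h2
    by_cases h3 : s.nodes.lo j ≤ D.tin u ∧ D.tin u < s.nodes.hi j
    · exact .inr (l6 j h1 h2 h3.1 h3.2)
    · refine .inl ?_
      have h4 := hok j h1 h2
      rw [NodeOK, ← ew 21 (by decide), ← ew 22 (by decide), ← ew 23 (by decide),
        ← er 2 (by decide), ← er 3 (by decide), ← er 4 (by decide), ← er 5 (by decide),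
        ← ew 31 (by decide), ← ew 32 (by decide)] at h4
      refine SegOK.frame h4 hd (hb'.hier.good j h1 h2) (fun w _ g1 g2 => hy w ?_)
        fun w _ g1 g2 => ho w ?_
      · rintro rfl
        exact h3 ⟨g1, g2⟩
      · rintro rfl
        exact h3 ⟨g1, g2⟩
  refine Run.seq' (R := fun s' => s' = s.setW vI l) (.of_wp' (T := v.cost + 2) le_rfl ?_) ?_
  · simp only [Prog.wp, WExpr.eval, hv, hnd, and_true]
    lia
  · rintro s1 - ha rfl
    have hsame : ∀ j, s.SameAt (s.setW vI l) j := fun j => ⟨rfl, rfl, rfl, rfl, rfl⟩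
    refine (run_climb (hb'.agree ha rfl (hsame 0)) hcK (by simpa using l2) fun j h1 h2 => ?_).imp
      fun s' _ _ h => ⟨cnt, h⟩
    simp only [State.setW_wvar, if_true]
    exact (key j h1 h2).imp (fun h => h.agree ha rfl (hsame j)) id

theorem segSum_update {D : Decomp G T} {y : ℕ → ℝ} {u v : ℕ} {x : ℝ} (hu : u < n) (hv : v < n)
    [Decidable (Anc D.par v u)] :
    segSum D.vat (Function.update y u (y u + x)) (D.tin v) (D.tin v + size n D.par v) =
      segSum D.vat y (D.tin v) (D.tin v + size n D.par v) + if Anc D.par v u then x else 0 := by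
  have hd := D.hld
  have hvn := hd.numbering_tin.add_size_le hd.toRTree hv
  have h1 : ∀ j ∈ Finset.Ico (D.tin v) (D.tin v + size n D.par v),
      Function.update y u (y u + x) (D.vat j) = y (D.vat j) + if D.tin u = j then x else 0 := by
    intro j hj
    rw [Finset.mem_Ico] at hj
    have h2 := hd.vat_spec (i := j) (by lia)
    rw [Function.update_apply]
    by_cases h3 : D.tin u = j
    · have h4 : D.vat j = u := by rw [← h3, hd.vat_tin u hu]
      rw [if_pos h4, if_pos h3, h4]
    · rw [if_neg (fun h4 => h3 (by rw [← h4, h2.2])), if_neg h3, add_zero]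
  rw [segSum, Finset.sum_congr rfl h1, Finset.sum_add_distrib, Finset.sum_ite_eq, segSum]
  congr 1
  refine if_congr ?_ rfl rfl
  rw [Finset.mem_Ico, hd.tin_anc hv hu]

/-- The value of the edge above the vertex `v`. -/
noncomputable def Decomp.val (D : Decomp G T) (s : State) (v : ℕ) : ℝ :=
  s.rarr aBASE v + segSum D.vat (s.rarr aY) (D.tin v) (D.tin v + size n D.par v)

/-- Adds the real variable `rX` to the values of the edges above the ancestors of a vertex. -/
def addY (v : WExpr) : Prog :=
  .setW vX v ;; .storeR aY (.var vX) (.add (.get aY (.var vX)) (.var rX)) ;; touch (.var vX)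

open Classical in
theorem run_addY {D : Decomp G T} {s : State} {v : WExpr} {u : ℕ} (h : Live D s)
    (hK : 2 * n + 1 ≤ K) (hv : v.eval s = u) (hu : u < n) :
    Run B K (addY v) s (v.cost + 20 + 500 * (Nat.log 2 n + 2)) fun s' => Live D s' ∧
      ∀ w < n, D.val s' w = D.val s w + if Anc D.par w u then s.rvar rX else 0 := by
  refine (Run.seq' (R := fun s' => s' = s.setW vX u) (.of_wp ?_) ?_).time_mono
    (T₁ := v.cost + 1 + (6 + (3 + 500 * (Nat.log 2 n + 2)))) (by lia)
  · simp only [Prog.wp, hv, and_true]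
    lia
  rintro s1 - - rfl
  refine Run.seq' (R := fun s' => s' = (s.setW vX u).storeR aY u (s.rarr aY u + s.rvar rX))
    (.of_wp ?_) ?_
  · simp [Prog.wp, WExpr.eval, RExpr.eval]
  rintro s2 - - rfl
  refine (run_touch (s0 := s) (u := u) h hK ?_ hu ?_ ?_ ?_ ?_).imp fun s' _ ha hl => ⟨hl, fun w hw => ?_⟩
  · simp [WExpr.eval]
  · simp
  · funext a
    by_cases ha : a = 1 <;> simp [ha]
  · intro w hw
    simp [hw]
  · simp
  · obtain ⟨-, -, e8, e9⟩ := ha.tree rfl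
    rw [Decomp.val, e8, e9]
    have h1 := segSum_update (D := D) (y := s.rarr aY) (x := s.rvar rX) hu hw
    simp [Decomp.val] at h1 ⊢
    rw [h1]
    ring

/-- Reads the minimum of all values. -/
def readRoot : Prog :=
  .setW vF (.get aPF (.lit 1)) ;; .setR rM (.get aPR (.lit 1)) ;;
  accMin (.get aOF (.lit 1)) (.get aOR (.lit 1))

/-- The segment of the node 1 ends at `n`, as do the subtrees of the vertices on the heavy path of
the root, so here suffix sums are subtree sums. -/
theorem run_readRoot {D : Decomp G T} {s : State} (h : Live D s) (hK : 1 ≤ K) :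
    Run B K readRoot s 30 fun s' => IsMin (s'.wvar vF) (s'.rvar rM)
      (fun v => v < n ∧ s.warr aBF v ≠ 0) (D.val s) := by
  refine Run.bd fun hbd => ?_
  obtain ⟨cnt, hb, hok⟩ := h
  have hd := D.hld
  have h1 := hok 1 le_rfl hb.hier.one_lt
  obtain ⟨h2, h3, h4, -⟩ := hb.hier.root
  simp only [State.nodes] at h2 h3 h4
  rw [NodeOK, h2, h3, h4] at h1
  have hout : ∀ v < n, D.top v = 0 → D.tin v + size n D.par v = n := by
    intro v hv h5
    rw [hd.tout_top hv, h5, hd.tin_zero, hd.toRTree.size_root, zero_add]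
  have m1 : IsMin (s.warr aPF 1) (s.rarr aPR 1)
      (fun v => v < n ∧ 0 ≤ D.tin v ∧ D.tin v < n ∧ D.top v = 0 ∧ s.warr aBF v ≠ 0) (D.val s) :=
    h1.path.congr (fun v => Iff.rfl) fun v hv => by rw [Decomp.val, hout v hv.1 hv.2.2.2.1]
  have m2 : IsMin (s.warr aOF 1) (s.rarr aOR 1)
      (fun v => v < n ∧ 0 ≤ D.tin v ∧ D.tin v < n ∧ D.top v ≠ 0 ∧ s.warr aBF v ≠ 0) (D.val s) :=
    h1.other
  refine .of_wp' (by decide) ?_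
  simp only [readRoot, Prog.wp, WExpr.eval, RExpr.eval, State.setW_rarr]
  refine ⟨hbd.2 _ _, wp_accMin hK (by simp [hbd.2]) (by simpa using m1)
    (by simpa [WExpr.eval, RExpr.eval] using m2) fun f r _ hfr => ?_⟩
  refine IsMin.congr (by simpa using hfr) (fun v => ?_) fun _ _ => rfl
  constructor
  · rintro ⟨h5, h6⟩
    have h7 := hd.tin_lt h5
    by_cases h8 : D.top v = 0
    · exact .inl ⟨h5, h7, h8, h6⟩
    · exact .inr ⟨h5, h7, h8, h6⟩
  · rintro (h5 | h5)
    · exact ⟨h5.1, h5.2.2.2⟩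
    · exact ⟨h5.1, h5.2.2.2⟩

end TwoRespect

/-! ### The program: initial values of the hierarchy. -/

namespace TwoRespect

variable {B K n m : ℕ} {G : WGraph n m} {T : Finset (Fin m)}

/-- Initializes the values of all vertices and nodes. -/
def initTree : Prog :=
  .setW vI (.lit 1) ;;
  .loop (.wlt (.var vI) (.var vN))
    (.storeW aBF (.var vI) (.lit 1) ;; .storeR aBASE (.var vI) (.get 0 (.get aPE (.var vI))) ;;
     incr vI) ;;
  .setW vI (.var vK) ;;
  .loop (.wlt (.lit 1) (.var vI)) (decr vI ;; pull)

/-- The set of all vertices other than the root. -/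
def nonRoot (n v : ℕ) : ℕ := if 0 < v ∧ v < n then 1 else 0

/-- Children have larger indices than their parents, so they are finished first when the index
decreases. All `y` are zero, so the values are the base values. The root vertex, which has no edge
above it, stays inactive. -/
theorem run_initTree {D : Decomp G T} {s : State} (hmem : Mem D s)
    (hh : Hier n D.par D.top D.tin s.nodes (s.wvar vK) (s.wvar vK) (s.warr aLC) (s.warr aRC)
      (s.warr aHC) (s.warr aIT) (s.warr aND)) (hnK : 2 * n + 1 ≤ K)
    (hw : ∀ a, 30 ≤ a → s.warr a = fun _ => 0) (hr : ∀ a, 1 ≤ a → s.rarr a = fun _ => 0) :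
    Run B K initTree s (600 * n + 600) fun s' => Live D s' ∧ s'.warr aBF = nonRoot n ∧
      ∀ v, 0 < v → v < n → D.val s' v = G.weightN (D.pe v) := by
  have hd := D.hld
  have hn0 := hd.n_pos
  have hcn := hh.cnt_le
  refine (Run.seq' (R := fun s' => s' = s.setW vI 1) (.of_wp ?_) ?_).time_mono
    (T₁ := 2 + (((n - 1) * (14 + 3 + 1) + 3 + 1) + (2 + ((s.wvar vK - 1) * (224 + 3 + 1) + 3 + 1))))
    ?_
  · simp [Prog.wp, WExpr.eval]
    lia
  · rintro s1 - ha1 rfl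
    refine Run.seq' (R := fun s' => s'.warr aBF = nonRoot n ∧
      ∀ v, 0 < v → v < n → s'.rarr aBASE v = G.weightN (D.pe v)) ?_ ?_
    · refine Run.loop_count (fun j s' => s'.wvar vI = j + 1 ∧ s'.warr aBF = nonRoot (j + 1) ∧
        ∀ v, 0 < v → v < j + 1 → s'.rarr aBASE v = G.weightN (D.pe v)) (n - 1) 14 ?_ ?_ ?_
      · refine ⟨by simp, ?_, fun v h1 h2 => by lia⟩
        simp only [State.setW_warr, hw 30 le_rfl]
        funext v
        simp [nonRoot]
        lia
      · rintro j hj s' - ha ⟨h1, h2, h3⟩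
        have hmem' := (hmem.agree ha1 rfl).agree ha rfl
        refine ⟨?_, Run.of_wp' (by decide) ?_⟩
        · simp [Cond.Holds, WExpr.eval, h1, hmem'.vn]
          lia
        · simp [Prog.wp, incr, WExpr.eval, RExpr.eval, h1, h2, hmem'.pe, hmem'.weight]
          refine ⟨by lia, by lia, ?_, fun v h4 h5 => ?_⟩
          · funext v
            simp only [Function.update_apply, nonRoot]
            split_ifs <;> lia
          · rw [Function.update_apply]
            split_ifs with h6
            · rw [h6]
            · exact h3 v h4 (by lia)
      · rintro s' - ha ⟨h1, h2, h3⟩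
        have hmem' := (hmem.agree ha1 rfl).agree ha rfl
        rw [show n - 1 + 1 = n by lia] at h1 h2 h3
        exact ⟨by simp [Cond.Holds, WExpr.eval, h1, hmem'.vn], h2, h3⟩
    rintro s2 - ha2 ⟨h1, h2⟩
    have eK : s2.wvar vK = s.wvar vK := ha2.w _ rfl
    have eN : s2.nodes = s.nodes := by
      simp only [State.nodes]
      rw [ha2.wa 21 rfl, ha2.wa 22 rfl, ha2.wa 23 rfl, ha2.wa 24 rfl]
      rfl
    obtain ⟨cnt, ec⟩ : ∃ c, s.wvar vK = c := ⟨_, rfl⟩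
    have c1 := hh.one_lt
    rw [ec] at hh hcn c1 eK ⊢
    have eY : s2.rarr aY = fun _ => 0 := (ha2.ra _ rfl).trans (hr 1 le_rfl)
    have hb2 : Built D s2 cnt := by
      refine ⟨?_, ?_, ?_, ?_, ?_, ?_⟩
      · rw [eN, ha2.wa 25 rfl, ha2.wa 26 rfl, ha2.wa 27 rfl, ha2.wa 28 rfl, ha2.wa 29 rfl]
        exact hh
      · rw [ha2.ra 3 rfl, State.setW_rarr, hr 3 (by lia)]
      · rw [ha2.wa 31 rfl, State.setW_warr, hw 31 (by lia)]
      · rw [ha2.wa 32 rfl, State.setW_warr, hw 32 (by lia)]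
      · rw [eY]
      · simp [h1, nonRoot]
    refine Run.seq' (R := fun s' => s' = s2.setW vI cnt) (.of_wp ?_) ?_
    · simp [Prog.wp, WExpr.eval, eK]
      lia
    rintro s3 - ha3 rfl
    have hsame : ∀ j, s2.SameAt (s2.setW vI cnt) j := fun j => ⟨rfl, rfl, rfl, rfl, rfl⟩
    have hb3 := hb2.agree ha3 rfl (hsame 0)
    refine Run.loop_count (fun j s' => s'.wvar vI = cnt - j ∧ Built D s' cnt ∧ ∀ j', cnt - j ≤ j' →
      j' < cnt → NodeOK D s' (s2.rarr aY) (s2.warr aBF) j') (cnt - 1) 224 ?_ ?_ ?_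
    · exact ⟨by simp, hb3, fun j' _ _ => by lia⟩
    · rintro j hj s' - ha ⟨i1, i2, i3⟩
      obtain ⟨-, e7, e8, e9⟩ := ha.tree rfl
      refine ⟨?_, ?_⟩
      · simp [Cond.Holds, WExpr.eval, i1]
        lia
      · refine (Run.seq' (R := fun s4 => s4 = s'.setW vI (cnt - (j + 1))) (.of_wp ?_) ?_).time_mono
          (T₁ := 4 + 220) le_rfl
        · simp only [Prog.wp, decr, WExpr.eval, i1, Nat.sub_sub, and_true]
          lia
        rintro s4 - ha4 rfl
        have hsame' : ∀ j', s'.SameAt (s'.setW vI (cnt - (j + 1))) j' :=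
          fun j => ⟨rfl, rfl, rfl, rfl, rfl⟩
        have hb4 := i2.agree ha4 rfl (hsame' 0)
        refine (run_pull hb4 (i := cnt - (j + 1)) (by simp) (by lia) (by lia) (by lia)
          fun j' h3 h4 _ => ?_).imp fun s5 _ ha5 h => ?_
        · simp only [State.setW_rarr, State.setW_warr, e7, e8]
          exact (i3 j' (by lia) h4).agree ha4 rfl (hsame' j')
        · obtain ⟨h3, h4⟩ := h
          simp only [State.setW_rarr, State.setW_warr, e7, e8] at h3
          refine ⟨(ha5.w _ rfl).trans (by simp), hb4.agree ha5 rfl (h4 0 (by lia)), fun j' h5 h6 => ?_⟩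
          by_cases h7 : j' = cnt - (j + 1)
          · rw [h7]
            exact h3
          · exact ((i3 j' (by lia) h6).agree ha4 rfl (hsame' j')).agree ha5 rfl (h4 j' h7)
    · rintro s' - ha ⟨i1, i2, i3⟩
      obtain ⟨-, e7, e8, e9⟩ := ha.tree rfl
      simp only [State.setW_rarr, State.setW_warr] at e7 e8 e9
      refine ⟨?_, ⟨cnt, i2, fun j h3 h4 => ?_⟩, by rw [e7, h1], fun v h3 h4 => ?_⟩
      · simp [Cond.Holds, WExpr.eval, i1]
        lia
      · rw [e7, e8]
        exact i3 j (by lia) h4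
      · rw [Decomp.val, e8, e9, eY, h2 v h3 h4]
        simp [segSum]
  · have : (s.wvar vK - 1) * (224 + 3 + 1) ≤ 2 * n * 228 := Nat.mul_le_mul (by lia) (by lia)
    lia

/-! ## The calls to the data structure -/

notation "vG" => (17 : ℕ)
notation "vL" => (18 : ℕ)
notation "vZ" => (19 : ℕ)
notation "aON" => (33 : ℕ)
notation "rG" => (3 : ℕ)
notation "rB" => (4 : ℕ)
notation "rA" => (5 : ℕ)

/-- The program does not change the lists of marks. -/
def Prog.keepsMarks (p : Prog) : Bool :=
  [17, 18, 19, 20].all (fun a => !p.modWA a) && !p.modW 6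

theorem Marked.agree {D : Decomp G T} {s s' : State} {k : ℕ} {l : ℕ → List ℕ} {p : Prog}
    (h : Marked D k s l) (ha : Agree p s s') (hp : p.keepsMarks) : Marked D k s' l := by
  simp only [Prog.keepsMarks, List.all_cons, List.all_nil, Bool.and_eq_true, Bool.not_eq_true',
    Bool.and_true] at hp
  obtain ⟨⟨a17, a18, a19, a20⟩, q⟩ := hp
  refine ⟨?_, h.cover, ?_⟩
  · rw [ha.w _ q, ha.wa _ a17, ha.wa _ a18, ha.wa _ a19]
    exact h.marks
  · rw [ha.wa _ a20]
    exact h.lca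

/-- The calls `cs` have been carried out. -/
structure After (D : Decomp G T) (pre : List Symbol) (s : State) (cs : List (Cmd n)) : Prop where
  live : Live D s
  bf : s.warr aBF = nonRoot n
  val : ∀ v, 0 < v → v < n → ∀ e : Fin m, (e : ℕ) = D.pe v →
    Ext.fin (D.val s v + s.rvar rG) = G.updates T G.initialWeights cs e
  out : s.out = pre ++ G.record T G.initialWeights cs

theorem After.agree {D : Decomp G T} {pre : List Symbol} {s s' : State} {cs : List (Cmd n)} {p : Prog}
    (h : After D pre s cs) (ha : Agree p s s') (hp : p.keepsTree)
    (hp' : !p.modWA 31 && !p.modWA 32 && !p.modRA 3 && !p.modRA 4 && !p.modRA 5)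
    (hp'' : !p.modR 3 && !p.emits) : After D pre s' cs := by
  simp only [Bool.and_eq_true, Bool.not_eq_true'] at hp''
  obtain ⟨-, e7, e8, e9⟩ := ha.tree hp
  refine ⟨h.live.agree ha hp hp', e7.trans h.bf, ?_, (ha.o hp''.2).trans h.out⟩
  simp only [Decomp.val, e8, e9, ha.r _ hp''.1]
  exact h.val

theorem record_append (D : Fin m → Ext) (cs cs' : List (Cmd n)) :
    G.record T D (cs ++ cs') = G.record T D cs ++ G.record T (G.updates T D cs) cs' := by
  induction cs generalizing D with
  | nil => simp [WGraph.record, WGraph.updates_nil]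
  | cons c cs ih =>
    rw [WGraph.updates_cons]
    cases c <;> simp [WGraph.record, ih, WGraph.update]

theorem updates_append (D : Fin m → Ext) (cs cs' : List (Cmd n)) :
    G.updates T D (cs ++ cs') = G.updates T (G.updates T D cs) cs' := by
  funext e
  simp [WGraph.updates, add_assoc]

/-- Writes down a call and prepares it. -/
def announce : Prog :=
  .emitW (.var vU) ;; .emitW (.get aSRC (.var vE)) ;; .emitW (.get aDST (.var vE)) ;;
  .emitR .zero ;; .emitR (.var rX) ;;
  .ite (.weq (.var vU) (.lit 0)) .skip
    (.setR rG (.add (.var rG) (.var rX)) ;; .setR rX (.sub .zero (.var rX)))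

/-- Carries out `PathAdd` (if `vU = 0`) or `NonPathAdd` (if `vU = 1`) for the edge `vE` and the real
number `rX`. -/
def apply : Prog :=
  announce ;; addY (.get aSRC (.var vE)) ;; addY (.get aDST (.var vE)) ;;
  .setR rX (.sub (.sub .zero (.var rX)) (.var rX)) ;; addY (.get aLCA (.var vE))

/-- The call that `apply` carries out. -/
noncomputable def WGraph.cmd (G : WGraph n m) (k : Fin m) (u : ℕ) (x : ℝ) : Cmd n :=
  if u = 0 then .pathAdd (G.src k) (G.dst k) (Ext.fin x) else .nonPathAdd (G.src k) (G.dst k) (Ext.fin x)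

/-- Adding `z` at both ends and `- 2 z` at their lowest common ancestor changes the sum below `w` by
`z` if exactly one end is below `w`, that is, if the edge above `w` is on the path. If both ends are
below, the three changes cancel. For `NonPathAdd` the offset `rG` adds `x` to all edges, and `z = -
x` takes it back on the path. -/
theorem run_apply (hT : G.IsSpanningTree T) {D : Decomp G T} {pre : List Symbol} {s : State}
    {cs : List (Cmd n)} {l : ℕ → List ℕ} (hmem : Mem D s) (hmark : Marked D 0 s l)
    (h : After D pre s cs) {k : Fin m} {u : ℕ} {x : ℝ} (hk : k ∉ T) (hE : s.wvar vE = k)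
    (hU : s.wvar vU = u) (hu : u ≤ 1) (hX : s.rvar rX = x) (hK : 2 * n + 1 ≤ K) :
    Run B K apply s (1600 * (Nat.log 2 n + 2)) fun s' => After D pre s' (cs ++ [G.cmd k u x]) := by
  classical
  have hsrc : s.warr aSRC k = G.src k := by rw [hmem.src, WGraph.srcN_fin]
  have hdst : s.warr aDST k = G.dst k := by rw [hmem.dst, WGraph.dstN_fin]
  obtain ⟨q, hq⟩ : ∃ q, s.warr aLCA k = q := ⟨_, rfl⟩
  have hlca := hmark.lca k (Nat.zero_le _) k.2 (by rw [flagN_fin]; simp [hk])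
  rw [hq, WGraph.srcN_fin, WGraph.dstN_fin] at hlca
  obtain ⟨z, hz⟩ : ∃ z, (if u = 0 then x else 0 - x) = z := ⟨_, rfl⟩
  obtain ⟨g, hg⟩ : ∃ g, (if u = 0 then s.rvar rG else s.rvar rG + x) = g := ⟨_, rfl⟩
  refine (Run.seq' (R := fun s1 => s1.rvar rX = z ∧ s1.rvar rG = g ∧ s1.out = s.out ++
      [.inl u, .inl (G.src k : ℕ), .inl (G.dst k : ℕ), .inr 0, .inr x])
    (.of_wp' (T := 40) (by decide) ?_) ?_).time_mono
    (T₁ := 40 + ((2 + 20 + 500 * (Nat.log 2 n + 2)) + ((2 + 20 + 500 * (Nat.log 2 n + 2)) +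
      (6 + (2 + 20 + 500 * (Nat.log 2 n + 2)))))) (by lia)
  · simp [announce, Prog.wp, Cond.Holds, WExpr.eval, RExpr.eval, hE, hU, hX, hsrc, hdst, ← hz, ← hg]
    constructor <;> intro h0 <;> simp [h0]
  rintro s1 - ha1 ⟨x1, g1, o1⟩
  have v1 : ∀ w, D.val s1 w = D.val s w := fun w => by
    rw [Decomp.val, Decomp.val, ha1.ra 1 rfl, ha1.ra 2 rfl]
  refine Run.seq' (run_addY (h.live.agree ha1 rfl rfl) hK (u := G.src k)
    (by simp [WExpr.eval, ha1.w 5 rfl, ha1.wa 0 rfl, hE, hsrc]) (G.src k).2) ?_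
  rintro s2 - ha2 ⟨l2, v2⟩
  refine Run.seq' (run_addY l2 hK (u := G.dst k)
    (by simp [WExpr.eval, ha2.w 5 rfl, ha2.wa 1 rfl, ha1.w 5 rfl, ha1.wa 1 rfl, hE, hdst])
    (G.dst k).2) ?_
  rintro s3 - ha3 ⟨l3, v3⟩
  have x3 : s3.rvar rX = z := (ha3.r 2 rfl).trans ((ha2.r 2 rfl).trans x1)
  refine Run.seq' (R := fun s' => s' = s3.setR rX (0 - z - z)) (.of_wp ?_) ?_
  · simp [Prog.wp, RExpr.eval, x3]
  rintro s4 - ha4 rfl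
  refine (run_addY (l3.agree ha4 rfl rfl) hK (u := q) ?_ hlca.1).imp ?_
  · simp [WExpr.eval, ha3.w 5 rfl, ha3.wa 20 rfl, ha2.w 5 rfl, ha2.wa 20 rfl, ha1.w 5 rfl,
      ha1.wa 20 rfl, hE, hq]
  rintro s5 - ha5 ⟨l5, v5⟩
  refine ⟨l5, ?_, fun w h0 hw e he => ?_, ?_⟩
  · rw [ha5.wa 30 rfl, State.setR_warr, ha3.wa 30 rfl, ha2.wa 30 rfl, ha1.wa 30 rfl, h.bf]
  · have v4 : D.val (s3.setR rX (0 - z - z)) w = D.val s3 w := rfl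
    have hon := D.rooting.onPath_iff hT h0 hw he (G.src k) (G.dst k)
    have hg5 : s5.rvar rG = g := by
      rw [ha5.r 3 rfl, State.setR_rvar, if_neg (by decide), ha3.r 3 rfl, ha2.r 3 rfl, g1]
    rw [v5 w hw, v4, v3 w hw, v2 w hw, v1, hg5, ha2.r 2 rfl, x1, State.setR_rvar, if_pos rfl,
      updates_append, WGraph.updates_cons, WGraph.updates_nil, WGraph.update_eq]
    beta_reduce
    rw [← h.val w h0 hw e he, ← hg, ← hz]
    simp only [hlca.2]
    rw [WGraph.cmd]
    by_cases h1 : u = 0 <;> simp only [h1, if_true, if_false, WGraph.amount, hon] <;>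
      by_cases h2 : Anc D.par w (G.src k) <;> by_cases h3 : Anc D.par w (G.dst k) <;>
      simp only [h2, h3, if_true, if_false, and_self, iff_self, not_true, not_false_eq_true, and_true,
        and_false, iff_false, iff_true, ← Ext.fin_zero, ← Ext.fin_add] <;>
      congr 1 <;> ring
  · rw [ha5.o rfl, State.setR_out, ha3.o rfl, ha2.o rfl, o1, h.out, record_append, List.append_assoc]
    congr 2
    rw [WGraph.cmd]
    by_cases h1 : u = 0
    · simp [WGraph.record, encode, Ext.fin, h1]
    · simp [WGraph.record, encode, Ext.fin, show u = 1 by lia]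

end TwoRespect

/-! ### The program: testing paths, and the first tree edge. -/

namespace TwoRespect

variable {B K n m : ℕ} {G : WGraph n m} {T : Finset (Fin m)}

/-- If the endpoint in the array `a` of the edge `vE` is below the tree edge number `vG`, adds one
to `vR`. -/
def testEnd (a : ℕ) : Prog :=
  .ite (.and (.wlt (.var vG) (.var vN)) (.and
    (.not (.wlt (.get aTIN (.get a (.var vE))) (.get aTIN (.get aEV (.var vG)))))
    (.wlt (.get aTIN (.get a (.var vE)))
      (.add (.get aTIN (.get aEV (.var vG))) (.add (.get aSZ (.get aEV (.var vG))) (.lit 1))))))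
    (incr vR) .skip

/-- Sets `vR` to `1` if the tree edge number `vG` is on the path of the edge `vE`, and else to `0`. -/
def testOn : Prog :=
  .setW vR (.lit 0) ;; testEnd aSRC ;; testEnd aDST ;;
  .ite (.weq (.var vR) (.lit 1)) .skip (.setW vR (.lit 0))

/-- The tree edge number `i` is on the path of the edge `k`. -/
def Decomp.OnAt (D : Decomp G T) (i k : ℕ) : Prop :=
  ¬ (AboveAt n D.par D.ev i (G.srcN k) ↔ AboveAt n D.par D.ev i (G.dstN k))

open Classical in
/-- The indicator of `OnAt`. -/
noncomputable def Decomp.onBit (D : Decomp G T) (i k : ℕ) : ℕ := if D.OnAt i k then 1 else 0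

theorem Decomp.onBit_le (D : Decomp G T) (i k : ℕ) : D.onBit i k ≤ 1 := by
  rw [onBit]
  split_ifs <;> lia

theorem Decomp.onBit_eq (D : Decomp G T) {i j k : ℕ} :
    D.onBit i k = D.onBit j k ↔ (D.OnAt i k ↔ D.OnAt j k) := by
  rw [onBit, onBit]
  split_ifs with h1 h2 h2 <;> simp [h1, h2]

theorem wp_testEnd {D : Decomp G T} {s : State} {Q : State → Prop} {a i c : ℕ} (hn : s.wvar vN = n)
    (htin : s.warr aTIN = D.tin) (hev : s.warr aEV = D.ev)
    (hsz : ∀ v < n, s.warr aSZ v + 1 = size n D.par v) (hG : s.wvar vG = i)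
    (hc : s.warr a (s.wvar vE) = c) (hcn : c < n)
    (h1 : AboveAt n D.par D.ev i c → s.wvar vR + 1 ≤ K ∧ Q (s.setW vR (s.wvar vR + 1)))
    (h0 : ¬ AboveAt n D.par D.ev i c → Q s) : (testEnd a).wp K Q s := by
  have key : (i < n ∧ ¬ D.tin c < D.tin (D.ev i) ∧
      D.tin c < D.tin (D.ev i) + (s.warr aSZ (D.ev i) + 1)) ↔ AboveAt n D.par D.ev i c := by
    rw [AboveAt]
    refine and_congr_right fun hi => ?_
    have h2 := D.hld.ev_spec hi
    rw [D.hld.tin_anc h2.1 hcn, hsz _ h2.1, not_lt]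
  simp only [testEnd, Prog.wp, incr, Cond.Holds, WExpr.eval, hn, htin, hev, hG, hc, key]
  exact ⟨h1, h0⟩

/-- The variable `vR` counts the ends below the tree edge; the edge is on the path if the count is
exactly one. -/
theorem run_testOn {D : Decomp G T} {s : State} {i k : ℕ} (hmem : Mem D s) (hG : s.wvar vG = i)
    (hE : s.wvar vE = k) (hk : k < m) (hK : 2 ≤ K) :
    Run B K testOn s 80 fun s' => s'.wvar vR = D.onBit i k := by
  refine .of_wp' (by decide) ?_
  simp only [testOn, Prog.wp, WExpr.eval]
  have hs : s.warr aSRC (s.wvar vE) = G.srcN k := by rw [hE, hmem.src]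
  have hd : s.warr aDST (s.wvar vE) = G.dstN k := by rw [hE, hmem.dst]
  have hvn := hmem.vn
  refine ⟨by lia, wp_testEnd (D := D) (i := i) (by simpa using hvn) hmem.tin hmem.ev hmem.sz
    (by simpa using hG) (by simpa using hs) (G.srcN_lt hk) (fun h1 => ?_) fun h1 => ?_⟩
  · refine ⟨by simp; lia, wp_testEnd (D := D) (i := i) (by simpa using hvn) hmem.tin hmem.ev hmem.sz
      (by simpa using hG) (by simpa using hd) (G.dstN_lt hk) (fun h2 => ?_) fun h2 => ?_⟩
    · simp [Cond.Holds, WExpr.eval, Decomp.onBit, Decomp.OnAt, h1, h2, hK]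
    · simp [Cond.Holds, WExpr.eval, Decomp.onBit, Decomp.OnAt, h1, h2]
  · refine wp_testEnd (D := D) (i := i) (by simpa using hvn) hmem.tin hmem.ev hmem.sz
      (by simpa using hG) (by simpa using hd) (G.dstN_lt hk) (fun h2 => ?_) fun h2 => ?_
    · simp [Cond.Holds, WExpr.eval, Decomp.onBit, Decomp.OnAt, h1, h2]
      lia
    · simp [Cond.Holds, WExpr.eval, Decomp.onBit, Decomp.OnAt, h1, h2]

/-! ### Lists of calls, by increasing index of the non-tree edge -/

section upto
variable {α : Type}

/-- The part of the list for the edge `k`; it is empty for tree edges. -/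
def extend (T : Finset (Fin m)) (f : Fin m → List α) (k : ℕ) : List α :=
  if hk : k < m then (if (⟨k, hk⟩ : Fin m) ∉ T then f ⟨k, hk⟩ else []) else []

/-- The part of the list for the edges with an index below `c`. -/
def upto (T : Finset (Fin m)) (f : Fin m → List α) (c : ℕ) : List α :=
  (List.range c).flatMap (extend T f)

theorem upto_succ (f : Fin m → List α) (c : ℕ) :
    upto T f (c + 1) = upto T f c ++ extend T f c := by
  simp [upto, List.range_succ]

theorem extend_eq_nil {f : Fin m → List α} {j : ℕ} (h : ∀ k : Fin m, (k : ℕ) = j → k ∉ T → f k = []) :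
    extend T f j = [] := by
  unfold extend
  split_ifs with h1 h2
  · rfl
  · exact h ⟨j, h1⟩ rfl h2
  · rfl

theorem upto_eq {f : Fin m → List α} {c k : ℕ} (hck : c ≤ k)
    (h : ∀ j, c ≤ j → j < k → extend T f j = []) : upto T f k = upto T f c := by
  induction k, hck using Nat.le_induction with
  | base => rfl
  | succ k hk ih => rw [upto_succ, h k hk (Nat.lt_succ_self k), List.append_nil,
      ih fun j h1 h2 => h j h1 (h2.trans (Nat.lt_succ_self k))]

theorem nonTree_flatMap (f : Fin m → List α) : (nonTree T).flatMap f = upto T f m := by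
  rw [upto, ← List.map_coe_finRange_eq_range, List.flatMap_map, nonTree]
  induction List.finRange m with
  | nil => rfl
  | cons a l ih =>
    rw [List.flatMap_cons, ← ih, List.filter_cons]
    by_cases ha : a ∈ T <;> simp [extend, ha]

end upto

/-- The array `aON` says which non-tree edges have the tree edge number `i` on their paths. -/
def OnOK (D : Decomp G T) (s : State) (i : ℕ) : Prop :=
  ∀ k : Fin m, k ∉ T → s.warr aON k = D.onBit i k

/-- Establishes the invariants for the first tree edge. -/
def startAll : Prog :=
  .setW vG (.lit 1) ;; .setW vE (.lit 0) ;;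
  .loop (.wlt (.var vE) (.var vM))
    (.ite (.weq (.get aFLAG (.var vE)) (.lit 1)) .skip
      (testOn ;; .storeW aON (.var vE) (.var vR) ;; .setW vU (.var vR) ;;
       .setR rX (.get 0 (.var vE)) ;; apply) ;;
     incr vE)

/-- The status of an edge also serves as the code of the call: on the path means `NonPathAdd` (code
1), off the path means `PathAdd` (code 0). -/
theorem run_startAll (hT : G.IsSpanningTree T) {D : Decomp G T} {pre : List Symbol} {s : State}
    {l : ℕ → List ℕ} (hmem : Mem D s) (hmark : Marked D 0 s l) (h : After D pre s [])
    (hK : 2 * n + 2 ≤ K) (hmK : m ≤ K) :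
    Run B K startAll s (m * (1800 * (Nat.log 2 n + 2)) + 10) fun s' => s'.wvar vG = 1 ∧
      OnOK D s' 1 ∧ After D pre s' (upto T (fun k => [G.cmd k (D.onBit 1 k) (G.weight k)]) m) := by
  obtain ⟨A, hA⟩ : ∃ A, 1600 * (Nat.log 2 n + 2) = A := ⟨_, rfl⟩
  refine (Run.seq' (R := fun s' => s' = s.setW vG 1) (.of_wp ?_) ?_).time_mono
    (T₁ := 2 + (2 + (m * ((A + 110) + 3 + 1) + 3 + 1))) ?_
  · simp [Prog.wp, WExpr.eval]
    lia
  · rintro s1 - ha1 rfl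
    refine Run.seq' (R := fun s' => s' = (s.setW vG 1).setW vE 0) (.of_wp ?_) ?_
    · simp [Prog.wp, WExpr.eval]
    rintro s2 - ha2 rfl
    refine Run.loop_count (fun j s' => s'.wvar vE = j ∧
      (∀ k : Fin m, k ∉ T → (k : ℕ) < j → s'.warr aON k = D.onBit 1 k) ∧
      After D pre s' (upto T (fun k => [G.cmd k (D.onBit 1 k) (G.weight k)]) j)) m
      (A + 110) ?_ ?_ ?_
    · refine ⟨by simp, fun k _ hk => by lia, ?_⟩
      exact (h.agree ha1 rfl rfl rfl).agree ha2 rfl rfl rfl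
    · rintro j hj s' - ha ⟨i1, i2, i3⟩
      have hmem' := ((hmem.agree ha1 rfl).agree ha2 rfl).agree ha rfl
      have hmark' := ((hmark.agree ha1 rfl).agree ha2 rfl).agree ha rfl
      have hG' : s'.wvar vG = 1 := (ha.w 17 rfl).trans (by simp)
      refine ⟨by simpa [Cond.Holds, WExpr.eval, i1, hmem'.vm] using hj, ?_⟩
      have hfl : s'.warr aFLAG j = 1 ↔ (⟨j, hj⟩ : Fin m) ∈ T := by
        rw [hmem'.flag, flagN, dif_pos hj]
        by_cases h1 : (⟨j, hj⟩ : Fin m) ∈ T <;> simp [h1]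
      refine (Run.seq' (R := fun s3 => (∀ k : Fin m, k ∉ T → (k : ℕ) < j + 1 →
          s3.warr aON k = D.onBit 1 k) ∧
        After D pre s3 (upto T (fun k => [G.cmd k (D.onBit 1 k) (G.weight k)]) (j + 1)))
        (Run.ite (T₁ := 1) (T₂ := 80 + (3 + (2 + (3 + A)))) ?_ ?_)
        ?_).time_mono (T₁ := (4 + max 1 (80 + (3 + (2 + (3 + A)))) + 1) + 4)
        (by lia)
      · intro hb
        have hjT := hfl.1 (by simpa [Cond.Holds, WExpr.eval, i1] using hb)
        refine .skip ⟨fun k hk hkj => i2 k hk ?_, ?_⟩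
        · refine lt_of_le_of_ne (by lia) fun h1 => hk ?_
          rwa [show k = ⟨j, hj⟩ from Fin.ext h1]
        · rw [upto_succ]
          simpa [extend, hj, hjT] using i3
      · intro hb
        have hjT : (⟨j, hj⟩ : Fin m) ∉ T := fun h1 => hb (by simpa [Cond.Holds, WExpr.eval, i1] using hfl.2 h1)
        refine Run.seq' (run_testOn hmem' hG' i1 hj (by lia)) ?_
        rintro s3 - ha3 hR
        have e3 : s3.wvar vE = j := (ha3.w 5 rfl).trans i1
        have o3 : s3.warr aON = s'.warr aON := ha3.wa 33 rfl
        have w3 : s3.rarr 0 = G.weightN := (hmem'.agree ha3 rfl).weight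
        have hbit := D.onBit_le 1 j
        refine Run.seq' (R := fun s4 => s4.warr aON = Function.update (s3.warr aON) j (D.onBit 1 j))
          (.of_wp ?_) ?_
        · simp [Prog.wp, WExpr.eval, hR, e3]
          lia
        rintro s4 - ha4 o4
        refine Run.seq' (R := fun s5 => s5.wvar vU = D.onBit 1 j) (.of_wp ?_) ?_
        · simp [Prog.wp, WExpr.eval, ha4.w 11 rfl, hR]
          lia
        rintro s5 - ha5 u5
        refine Run.seq' (R := fun s6 => s6.rvar rX = G.weight ⟨j, hj⟩) (.of_wp ?_) ?_
        · simp [Prog.wp, WExpr.eval, RExpr.eval, ha5.w 5 rfl, ha4.w 5 rfl, e3, ha5.ra 0 rfl,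
            ha4.ra 0 rfl, w3, WGraph.weightN, hj]
        rintro s6 - ha6 x6
        have hmem6 := (((hmem'.agree ha3 rfl).agree ha4 rfl).agree ha5 rfl).agree ha6 rfl
        have hmark6 := (((hmark'.agree ha3 rfl).agree ha4 rfl).agree ha5 rfl).agree ha6 rfl
        have haf6 := (((i3.agree ha3 rfl rfl rfl).agree ha4 rfl rfl rfl).agree ha5 rfl rfl rfl).agree
          ha6 rfl rfl rfl
        refine (run_apply hT hmem6 hmark6 haf6 (k := ⟨j, hj⟩) hjT
          (by rw [ha6.w 5 rfl, ha5.w 5 rfl, ha4.w 5 rfl, e3]) ((ha6.w 13 rfl).trans u5) hbit x6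
          (by lia)).mono hA.le fun s7 _ ha7 h7 => ⟨fun k hk hkj => ?_, ?_⟩
        · rw [ha7.wa 33 rfl, ha6.wa 33 rfl, ha5.wa 33 rfl, o4, o3, Function.update_apply]
          split_ifs with h1
          · rw [h1]
          · exact i2 k hk (by lia)
        · rw [upto_succ]
          simpa [extend, hj, hjT] using h7
      · rintro s3 - ha3 ⟨h1, h2⟩
        have e3 : s3.wvar vE = j := (ha3.w 5 rfl).trans i1
        refine (Run.of_wp (p := incr vE) (Q := fun s4 => s4 = s3.setW vE (j + 1)) ?_).imp ?_
        · simp [Prog.wp, incr, WExpr.eval, e3]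
          lia
        · rintro s4 - ha4 rfl
          exact ⟨by simp, h1, h2.agree ha4 rfl rfl rfl⟩
    · rintro s' - ha ⟨i1, i2, i3⟩
      have hmem' := ((hmem.agree ha1 rfl).agree ha2 rfl).agree ha rfl
      exact ⟨by simp [Cond.Holds, WExpr.eval, i1, hmem'.vm], (ha.w 17 rfl).trans (by simp),
        fun k hk => i2 k hk k.2, i3⟩
  · have h2 : m * (A + 110 + 3 + 1) ≤ m * (1800 * (Nat.log 2 n + 2)) := Nat.mul_le_mul le_rfl (by lia)
    lia

end TwoRespect

/-! ### The program: restoring the invariants between consecutive tree edges. -/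

namespace TwoRespect

variable {B K n m : ℕ} {G : WGraph n m} {T : Finset (Fin m)}

/-- Restores the invariants for the non-tree edge `vE` after the current tree edge has changed. -/
def flipOne : Prog :=
  testOn ;;
  .ite (.weq (.var vR) (.get aON (.var vE))) .skip
    (.setW vU (.get aON (.var vE)) ;; .setR rX (.sub .zero (.get 0 (.var vE))) ;; apply ;;
     .storeW aON (.var vE) (.var vR) ;;
     .setW vU (.var vR) ;; .setR rX (.get 0 (.var vE)) ;; apply)

/-- The calls for the non-tree edge `k` between the tree edges with the numbers `i` and `i + 1`. -/
noncomputable def Decomp.flip (D : Decomp G T) (i : ℕ) (k : Fin m) : List (Cmd n) :=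
  if D.onBit (i + 1) k = D.onBit i k then []
  else [G.cmd k (D.onBit i k) (0 - G.weight k), G.cmd k (D.onBit (i + 1) k) (G.weight k)]

/-- The array `aON` remembers how the edge was treated last. Comparing it with the present status
makes superfluous and repeated marks harmless. -/
theorem run_flipOne (hT : G.IsSpanningTree T) {D : Decomp G T} {pre : List Symbol} {s : State}
    {cs : List (Cmd n)} {l : ℕ → List ℕ} (hmem : Mem D s) (hmark : Marked D 0 s l)
    (h : After D pre s cs) {i : ℕ} {k : Fin m} (hk : k ∉ T) (hG : s.wvar vG = i + 1)
    (hE : s.wvar vE = k) (hON : s.warr aON k = D.onBit i k) (hK : 2 * n + 2 ≤ K) :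
    Run B K flipOne s (3300 * (Nat.log 2 n + 2)) fun s' => After D pre s' (cs ++ D.flip i k) ∧
      s'.warr aON = Function.update (s.warr aON) k (D.onBit (i + 1) k) := by
  obtain ⟨A, hA⟩ : ∃ A, 1600 * (Nat.log 2 n + 2) = A := ⟨_, rfl⟩
  have hb0 := D.onBit_le i k
  have hb1 := D.onBit_le (i + 1) k
  refine (Run.seq' (run_testOn hmem hG hE k.2 (by lia)) ?_).time_mono
    (T₁ := 80 + (4 + max 1 (3 + (5 + (A + (3 + (2 + (3 + A)))))) + 1)) (by lia)
  rintro s1 - ha1 hR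
  have e1 : s1.wvar vE = k := (ha1.w 5 rfl).trans hE
  have o1 : s1.warr aON = s.warr aON := ha1.wa 33 rfl
  have hmem1 := hmem.agree ha1 rfl
  refine Run.ite (fun hb => .skip ?_) fun hb => ?_
  · simp only [Cond.Holds, WExpr.eval, hR, e1, o1, hON] at hb
    rw [Decomp.flip, if_pos hb, List.append_nil, o1, hb, ← hON, Function.update_eq_self]
    exact ⟨h.agree ha1 rfl rfl rfl, rfl⟩
  · simp only [Cond.Holds, WExpr.eval, hR, e1, o1, hON] at hb
    refine Run.seq' (R := fun s2 => s2.wvar vU = D.onBit i k) (.of_wp ?_) ?_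
    · simp [Prog.wp, WExpr.eval, e1, o1, hON]
      lia
    rintro s2 - ha2 u2
    refine Run.seq' (R := fun s3 => s3.rvar rX = 0 - G.weight k) (.of_wp ?_) ?_
    · simp [Prog.wp, WExpr.eval, RExpr.eval, ha2.w 5 rfl, e1, ha2.ra 0 rfl, hmem1.weight,
        WGraph.weightN_fin]
    rintro s3 - ha3 x3
    have hmem3 := (hmem1.agree ha2 rfl).agree ha3 rfl
    have hmark3 := ((hmark.agree ha1 rfl).agree ha2 rfl).agree ha3 rfl
    have haf3 := ((h.agree ha1 rfl rfl rfl).agree ha2 rfl rfl rfl).agree ha3 rfl rfl rfl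
    have e3 : s3.wvar vE = k := (ha3.w 5 rfl).trans ((ha2.w 5 rfl).trans e1)
    refine Run.seq' ((run_apply hT hmem3 hmark3 haf3 hk e3 ((ha3.w 13 rfl).trans u2) hb0 x3
      (by lia)).time_mono hA.le) ?_
    rintro s4 - ha4 haf4
    have e4 : s4.wvar vE = k := (ha4.w 5 rfl).trans e3
    have R4 : s4.wvar vR = D.onBit (i + 1) k := (ha4.w 11 rfl).trans ((ha3.w 11 rfl).trans
      ((ha2.w 11 rfl).trans hR))
    have o4 : s4.warr aON = s.warr aON := (ha4.wa 33 rfl).trans ((ha3.wa 33 rfl).trans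
      ((ha2.wa 33 rfl).trans o1))
    refine Run.seq' (R := fun s5 => s5.warr aON = Function.update (s.warr aON) k (D.onBit (i + 1) k))
      (.of_wp ?_) ?_
    · simp [Prog.wp, WExpr.eval, e4, R4, o4]
      lia
    rintro s5 - ha5 o5
    refine Run.seq' (R := fun s6 => s6.wvar vU = D.onBit (i + 1) k) (.of_wp ?_) ?_
    · simp [Prog.wp, WExpr.eval, ha5.w 11 rfl, R4]
      lia
    rintro s6 - ha6 u6
    have hmem6 := ((hmem3.agree ha4 rfl).agree ha5 rfl).agree ha6 rfl
    refine Run.seq' (R := fun s3 => s3.rvar rX = G.weight k) (.of_wp ?_) ?_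
    · simp [Prog.wp, WExpr.eval, RExpr.eval, ha6.w 5 rfl, ha5.w 5 rfl, e4, hmem6.weight,
        WGraph.weightN_fin]
    rintro s7 - ha7 x7
    have hmark7 := (((hmark3.agree ha4 rfl).agree ha5 rfl).agree ha6 rfl).agree ha7 rfl
    have haf7 := ((haf4.agree ha5 rfl rfl rfl).agree ha6 rfl rfl rfl).agree ha7 rfl rfl rfl
    refine (run_apply hT (hmem6.agree ha7 rfl) hmark7 haf7 hk
      (by rw [ha7.w 5 rfl, ha6.w 5 rfl, ha5.w 5 rfl, e4]) ((ha7.w 13 rfl).trans u6) hb1 x7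
      (by lia)).mono hA.le fun s8 _ ha8 h8 => ⟨?_, ?_⟩
    · rw [Decomp.flip, if_neg hb]
      simpa using h8
    · rw [ha8.wa 33 rfl, ha7.wa 33 rfl, ha6.wa 33 rfl, o5]

/-- Processes the marks between the tree edges with the numbers `vG - 1` and `vG`. -/
def flips : Prog :=
  .setW vL (.get aHEAD (.sub (.var vG) (.lit 1))) ;;
  .loop (.not (.weq (.var vL) (.lit 0)))
    (.setW vE (.get aMK (.var vL)) ;; flipOne ;; .setW vL (.get aNX (.var vL)))

/-- In the invariant all non-tree edges below `c` have been treated, and every other edge that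
changes its status is still in `rest`. Since the list is sorted, the edges between `c` and the next
mark need no calls, so the calls come out by increasing index. -/
theorem run_flips (hT : G.IsSpanningTree T) {D : Decomp G T} {pre : List Symbol} {s : State}
    {cs : List (Cmd n)} {l : ℕ → List ℕ} (hmem : Mem D s) (hmark : Marked D 0 s l)
    (h : After D pre s cs) {i : ℕ} (hi : i < n) (hG : s.wvar vG = i + 1) (hON : OnOK D s i)
    (hK : 2 * n + 2 ≤ K) :
    Run B K flips s ((l i).length * (3400 * (Nat.log 2 n + 2)) + 15) fun s' =>
      After D pre s' (cs ++ upto T (D.flip i) m) ∧ OnOK D s' (i + 1) := by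
  refine Run.bd fun hbd => ?_
  obtain ⟨A, hA⟩ : ∃ A, 3300 * (Nat.log 2 n + 2) = A := ⟨_, rfl⟩
  -- The status of an edge cannot change without one of its ends changing sides, and such places are
  -- marked.
  have hflip : ∀ k : Fin m, k ∉ T → k.1 ∉ l i → D.onBit (i + 1) k = D.onBit i k := by
    intro k hk hki
    rw [Decomp.onBit_eq]
    have := mt (hmark.cover k (Nat.zero_le _) k.2 (by rw [flagN_fin]; simp [hk]) i hi) hki
    rw [Decomp.OnAt, Decomp.OnAt]
    tauto
  refine (Run.seq' (R := fun s' => s' = s.setW vL (s.warr aHEAD i)) (.of_wp' (T := 5) (by decide) ?_)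
    ?_).time_mono (T₁ := 5 + ((l i).length * ((3 + (A + 3)) + 4 + 1) + 4 + 1)) ?_
  · simp [Prog.wp, WExpr.eval, hG, hbd.2]
  · rintro s1 - ha1 rfl
    refine Run.loop_count (fun j s' => ∃ c rest, IsLinked (s'.warr aNX) (s'.warr aMK) (s'.wvar vQ)
      (s'.wvar vL) rest ∧ rest.length + j = (l i).length ∧ rest.Pairwise (· ≤ ·) ∧
      (∀ e ∈ rest, e < m ∧ flagN T e ≠ 1) ∧
      (∀ k : Fin m, k ∉ T → c ≤ (k : ℕ) → D.onBit (i + 1) k ≠ D.onBit i k → (k : ℕ) ∈ rest) ∧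
      (∀ k : Fin m, k ∉ T → s'.warr aON k = if (k : ℕ) < c then D.onBit (i + 1) k else D.onBit i k) ∧
      c ≤ m ∧ After D pre s' (cs ++ upto T (D.flip i) c)) (l i).length (3 + (A + 3)) ?_ ?_ ?_
    · refine ⟨0, l i, ?_, rfl, hmark.marks.sorted i, fun e he => (hmark.marks.mem i e he).2,
        fun k hk _ hne => ?_, fun k hk => ?_, Nat.zero_le _, ?_⟩
      · simpa using hmark.marks.linked i
      · by_contra h1
        exact hne (hflip k hk h1)
      · simpa using hON k hk
      · simpa [upto] using h.agree ha1 rfl rfl rfl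
    · rintro j hj s' hbd' ha ⟨c, rest, i1, i2, i3, i4, i5, i6, i7, i8⟩
      have hmem' := (hmem.agree ha1 rfl).agree ha rfl
      have hmark' := (hmark.agree ha1 rfl).agree ha rfl
      have hG' : s'.wvar vG = i + 1 := (ha.w 17 rfl).trans (by simpa using hG)
      have hL0 : s'.wvar vL ≠ 0 := by
        intro h1
        rw [h1] at i1
        rw [i1.zero, List.length_nil] at i2
        lia
      refine ⟨by simpa [Cond.Holds, WExpr.eval] using hL0, ?_⟩
      obtain ⟨rest', hrest, -, hlink⟩ := i1.pos hL0
      obtain ⟨p, hp⟩ : ∃ p, s'.wvar vL = p := ⟨_, rfl⟩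
      obtain ⟨k, hk⟩ : ∃ k, s'.warr aMK p = k := ⟨_, rfl⟩
      rw [hp] at hrest hlink
      rw [hk] at hrest
      subst hrest
      have hkm := (i4 k (by simp)).1
      have hkT : (⟨k, hkm⟩ : Fin m) ∉ T := fun h1 => (i4 k (by simp)).2 (by simp [flagN, hkm, h1])
      rw [List.pairwise_cons] at i3
      -- the calls up to `k`
      have key : c ≤ k → upto T (D.flip i) k = upto T (D.flip i) c ∧
          ∀ k' : Fin m, k' ∉ T → c ≤ (k' : ℕ) → (k' : ℕ) < k → D.onBit (i + 1) k' = D.onBit i k' := by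
        intro hck
        have h1 : ∀ k' : Fin m, k' ∉ T → c ≤ (k' : ℕ) → (k' : ℕ) < k →
            D.onBit (i + 1) k' = D.onBit i k' := by
          intro k' hk' h1 h2
          by_contra h3
          rcases List.mem_cons.1 (i5 k' hk' h1 h3) with h4 | h4
          · lia
          · have := i3.1 _ h4
            lia
        refine ⟨upto_eq hck fun j' h2 h3 => extend_eq_nil fun k' hk' hT' => ?_, h1⟩
        rw [Decomp.flip, if_pos (h1 k' hT' (by lia) (by lia))]
      refine Run.seq' (R := fun s2 => s2 = s'.setW vE k) (.of_wp ?_) ?_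
      · simp [Prog.wp, WExpr.eval, hp, hk]
        exact hk ▸ hbd'.2 _ _
      rintro s2 - ha2 rfl
      have hmem2 := hmem'.agree ha2 rfl
      have hmark2 := hmark'.agree ha2 rfl
      have haf2 := i8.agree ha2 rfl rfl rfl
      have hG2 : (s'.setW vE k).wvar vG = i + 1 := by simpa using hG'
      have hlast : ∀ s3 : State, Agree flipOne (s'.setW vE k) s3 →
          ∀ c', (∀ k : Fin m, k ∉ T → s3.warr aON k =
              if (k : ℕ) < c' then D.onBit (i + 1) k else D.onBit i k) → c' ≤ m →
            (∀ k : Fin m, k ∉ T → c' ≤ (k : ℕ) → D.onBit (i + 1) k ≠ D.onBit i k → (k : ℕ) ∈ rest') →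
            After D pre s3 (cs ++ upto T (D.flip i) c') →
          Run B K (.setW vL (.get aNX (.var vL))) s3 3 fun s' => ∃ c rest,
            IsLinked (s'.warr aNX) (s'.warr aMK) (s'.wvar vQ)
            (s'.wvar vL) rest ∧ rest.length + (j + 1) = (l i).length ∧ rest.Pairwise (· ≤ ·) ∧
            (∀ e ∈ rest, e < m ∧ flagN T e ≠ 1) ∧
            (∀ k : Fin m, k ∉ T → c ≤ (k : ℕ) → D.onBit (i + 1) k ≠ D.onBit i k → (k : ℕ) ∈ rest) ∧
            (∀ k : Fin m, k ∉ T → s'.warr aON k =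
              if (k : ℕ) < c then D.onBit (i + 1) k else D.onBit i k) ∧
            c ≤ m ∧ After D pre s' (cs ++ upto T (D.flip i) c) := by
        intro s3 ha3 c' h1 h2 h3 h4
        have n3 : s3.warr aNX = s'.warr aNX := ha3.wa 18 rfl
        have m3 : s3.warr aMK = s'.warr aMK := ha3.wa 19 rfl
        have q3 : s3.wvar vQ = s'.wvar vQ := (ha3.w 6 rfl).trans (by simp)
        have p3 : s3.wvar vL = p := (ha3.w 18 rfl).trans (by simpa using hp)
        refine (Run.of_wp (p := .setW vL (.get aNX (.var vL)))
          (Q := fun s4 => s4 = s3.setW vL (s'.warr aNX p)) ?_).imp ?_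
        · simp [Prog.wp, WExpr.eval, p3, n3, hbd'.2]
        · rintro s4 - ha4 rfl
          refine ⟨c', rest', ?_, ?_, i3.2, fun e he => i4 e (List.mem_cons_of_mem _ he), h3, h1, h2,
            h4.agree ha4 rfl rfl rfl⟩
          · simpa [n3, m3, q3] using hlink
          · rw [List.length_cons] at i2
            lia
      by_cases hck : c ≤ k
      · obtain ⟨hup, hsame⟩ := key hck
        refine Run.seq' ((run_flipOne hT hmem2 hmark2 haf2 (i := i) hkT hG2 (by simp) ?_ hK).time_mono
          hA.le) ?_
        · have := i6 ⟨k, hkm⟩ hkT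
          rw [if_neg (not_lt.2 hck)] at this
          exact this
        rintro s3 - ha3 ⟨h1, h2⟩
        refine hlast s3 ha3 (k + 1) (fun k' hk' => ?_) hkm (fun k' hk' h3 h4 => ?_) ?_
        · rw [h2, Function.update_apply]
          by_cases h3 : (k' : ℕ) = k
          · rw [if_pos h3, if_pos (by lia), h3]
          · rw [if_neg h3, State.setW_warr, i6 k' hk']
            by_cases h4 : (k' : ℕ) < c
            · rw [if_pos h4, if_pos (by lia)]
            · by_cases h5 : (k' : ℕ) < k
              · rw [if_neg h4, if_pos (by lia), hsame k' hk' (by lia) h5]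
              · rw [if_neg h4, if_neg (by lia)]
        · exact (List.mem_cons.1 (i5 k' hk' (by lia) h4)).resolve_left (by lia)
        · rw [upto_succ, hup, ← List.append_assoc]
          rwa [extend, dif_pos hkm, if_pos hkT]
      -- The mark is a repetition: the edge has already been treated, so the test finds nothing to
      -- do.
      · have hON' : s'.warr aON k = D.onBit (i + 1) k := by
          have := i6 ⟨k, hkm⟩ hkT
          rw [if_pos (not_le.1 hck)] at this
          exact this
        refine Run.seq' (R := fun s3 => After D pre s3 (cs ++ upto T (D.flip i) c) ∧
          s3.warr aON = s'.warr aON) (T₁ := A) ?_ ?_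
        · refine Run.time_mono (T₁ := 80 + (4 + max 1 0 + 1)) ?_ (by lia)
          refine Run.seq' (run_testOn hmem2 hG2 (by simp) hkm (by lia)) ?_
          rintro s3 - ha3 hR
          refine Run.ite (fun _ => .skip ⟨haf2.agree ha3 rfl rfl rfl, ha3.wa 33 rfl⟩) fun hb => ?_
          refine (hb ?_).elim
          have e3 : s3.wvar vE = k := (ha3.w 5 rfl).trans (by simp)
          have o3 : s3.warr aON = s'.warr aON := ha3.wa 33 rfl
          simp only [Cond.Holds, WExpr.eval, hR, e3, o3, hON']
        rintro s3 - ha3 ⟨h1, h2⟩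
        refine hlast s3 ha3 c (fun k' hk' => ?_) i7 (fun k' hk' h3 h4 => ?_) h1
        · rw [h2]
          exact i6 k' hk'
        · exact (List.mem_cons.1 (i5 k' hk' h3 h4)).resolve_left (by lia)
    · rintro s' - ha ⟨c, rest, i1, i2, i3, i4, i5, i6, i7, i8⟩
      have hr : rest = [] := List.length_eq_zero_iff.1 (by lia)
      subst hr
      have h0 : s'.wvar vL = 0 := i1
      have hsame : ∀ k : Fin m, k ∉ T → c ≤ (k : ℕ) → D.onBit (i + 1) k = D.onBit i k := by
        intro k hk h1
        by_contra h2
        simpa using i5 k hk h1 h2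
      refine ⟨by simp [Cond.Holds, WExpr.eval, h0], ?_, fun k hk => ?_⟩
      · rw [upto_eq i7 fun j h1 h2 => extend_eq_nil fun k' hk' hT' => ?_]
        · exact i8
        · rw [Decomp.flip, if_pos (hsame k' hT' (by lia))]
      · rw [i6 k hk]
        split_ifs with h1
        · rfl
        · exact (hsame k hk (by lia)).symm
  · have : (l i).length * ((3 + (A + 3)) + 4 + 1) ≤ (l i).length * (3400 * (Nat.log 2 n + 2)) :=
      Nat.mul_le_mul le_rfl (by lia)
    lia

end TwoRespect

namespace TwoRespect

variable {B K n m : ℕ} {G : WGraph n m} {T : Finset (Fin m)}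

/-! ### The queries -/

/-- The edges that do not belong to `C` have infinite weight, and `f ≠ 0` ensures that there is an
edge of finite weight. -/
theorem minWeight_eq {D : Fin m → Ext} {C : ℕ → Prop} {val : ℕ → ℝ} {f : ℕ} {r : ℝ}
    (hT : T.Nonempty) (hf : f ≠ 0) (hmin : IsMin f r C val)
    (h1 : ∀ e ∈ T, (∃ v, C v ∧ D e = Ext.fin (val v)) ∨ ∃ a, D e = Ext.fin a + Ext.inf)
    (h2 : ∀ v, C v → ∃ e ∈ T, D e = Ext.fin (val v)) : minWeight T D = Ext.fin r := by
  obtain ⟨⟨e, he, hmw⟩, hle⟩ := minWeight_spec hT D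
  have hr := (hmin r).1 (.inr le_rfl)
  refine le_antisymm ?_ ?_
  · by_contra hlt
    have key : ∀ z, z > r → ∃ v, C v ∧ val v < z := by
      intro z hz
      by_contra h3
      push Not at h3
      rcases (hmin z).2 h3 with h4 | h4
      · exact hf h4
      · exact hz.not_ge h4
    rcases h1 e he with ⟨v, hv, hDe⟩ | ⟨a, hDe⟩
    · rw [hmw, hDe, Ext.fin_le_fin, not_le] at hlt
      obtain ⟨w, hw, hlt'⟩ := key _ hlt
      obtain ⟨e', he', hDe'⟩ := h2 w hw
      have := hle e' he'
      rw [hmw, hDe, hDe', Ext.fin_le_fin] at this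
      exact this.not_gt hlt'
    · obtain ⟨w, hw, -⟩ := key (r + 1) (by simp)
      obtain ⟨e', he', hDe'⟩ := h2 w hw
      have := hle e' he'
      rw [hmw, hDe, hDe'] at this
      simp [Ext.fin, Ext.inf, ← toLex_add, Prod.Lex.toLex_le_toLex] at this
  · rw [hmw]
    rcases h1 e he with ⟨v, hv, hDe⟩ | ⟨a, hDe⟩
    · rw [hDe, Ext.fin_le_fin]
      exact hr v hv
    · rw [hDe]
      exact Ext.fin_le_fin_add_inf _ _

/-- The answer to a query, as it is found by the program. -/
noncomputable def answer (f : ℕ) (r r' : ℝ) : Ext := if f = 0 then toLex (1, r') else Ext.fin r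

/-- If there is another edge, the minimum over the others is the answer. If not, the answer is
infinity plus the weight of `e`, and this weight is the minimum `r'` over all edges. -/
theorem minWeight_probe (hT : G.IsSpanningTree T) (D : Decomp G T) {val : ℕ → ℝ} {Dw : Fin m → Ext}
    {g r r' : ℝ} {c f f' : ℕ} {e : Fin m}
    (hD : ∀ v, 0 < v → v < n → ∀ e : Fin m, (e : ℕ) = D.pe v → Ext.fin (val v + g) = Dw e)
    (h0 : 0 < c) (hc : c < n) (he : (e : ℕ) = D.pe c)
    (h1 : IsMin f r (fun v => v < n ∧ 0 < v ∧ v ≠ c) val)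
    (h2 : IsMin f' r' (fun v => v < n ∧ 0 < v) val) :
    minWeight T (G.update T Dw (.pathAdd (G.src e) (G.dst e) Ext.inf)) =
      answer f (r + g) (r' + g) := by
  obtain ⟨e', heT, he', -⟩ := D.rooting.pe_spec c h0 hc
  have : e' = e := Fin.ext (he'.trans he.symm)
  subst this
  have hup : ∀ d ∈ T, G.update T Dw (.pathAdd (G.src e') (G.dst e') Ext.inf) d =
      if d = e' then Dw d + Ext.inf else Dw d := by
    intro d hd
    have h3 : G.OnPath T d (G.src e') (G.dst e') ↔ d = e' := D.rooting.on_tree_iff hT hd heT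
    simp only [WGraph.update, h3]
  have hTne : T.Nonempty := ⟨e', heT⟩
  rw [answer]
  split_ifs with hf
  · subst hf
    -- An infinite minimum means that there is no vertex to minimise over: otherwise its value would
    -- be at least as large as every real number.
    have hempty : ∀ v, v < n → 0 < v → v = c := by
      intro v hv hv0
      by_contra h3
      have := (h1 (val v + 1)).1 (.inl rfl) v ⟨hv, hv0, h3⟩
      linarith
    have hr' : r' = val c := by
      refine le_antisymm ?_ ?_
      · exact (h2 r').1 (.inr le_rfl) c ⟨hc, h0⟩
      · rcases (h2 (val c)).2 fun v hv => by rw [hempty v hv.1 hv.2] with h3 | h3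
        · have := (h2 (val c + 1)).1 (.inl h3) c ⟨hc, h0⟩
          linarith
        · exact h3
    obtain ⟨⟨d, hd, hmw⟩, -⟩ := minWeight_spec hTne
      (G.update T Dw (.pathAdd (G.src e') (G.dst e') Ext.inf))
    obtain ⟨v, v0, v1, hv⟩ := D.rooting.pe_surj d hd
    have hdv : d = e' := Fin.ext (by rw [← hv, hempty v v1 v0, he])
    rw [hmw, hup d hd, if_pos hdv, hdv, ← hD c h0 hc e' he, hr']
    simp [Ext.fin, Ext.inf, ← toLex_add]
  · refine minWeight_eq hTne hf (h1.add g) (fun d hd => ?_) fun v hv => ?_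
    · obtain ⟨v, v0, v1, hv⟩ := D.rooting.pe_surj d hd
      rw [hup d hd]
      split_ifs with h3
      · exact .inr ⟨_, by rw [← hD v v0 v1 d hv.symm]⟩
      · refine .inl ⟨v, ⟨v1, v0, ?_⟩, (hD v v0 v1 d hv.symm).symm⟩
        rintro rfl
        exact h3 (Fin.ext (by rw [← hv, he]))
    · obtain ⟨d, hd, hd', -⟩ := D.rooting.pe_spec v hv.2.1 hv.1
      refine ⟨d, hd, ?_⟩
      rw [hup d hd, if_neg, hD v hv.2.1 hv.1 d hd']
      rintro rfl
      exact hv.2.2 (D.rooting.pe_inj v c hv.2.1 hv.1 h0 hc (by rw [← hd', he]))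

theorem minWeight_all (D : Decomp G T) {val : ℕ → ℝ} {Dw : Fin m → Ext} {g r : ℝ} {f : ℕ}
    (hn : 2 ≤ n)
    (hD : ∀ v, 0 < v → v < n → ∀ e : Fin m, (e : ℕ) = D.pe v → Ext.fin (val v + g) = Dw e)
    (h1 : IsMin f r (fun v => v < n ∧ 0 < v) val) : f ≠ 0 ∧ minWeight T Dw = Ext.fin (r + g) := by
  have hf : f ≠ 0 := by
    rintro rfl
    have := (h1 (val 1 + 1)).1 (.inl rfl) 1 ⟨by lia, by lia⟩
    linarith
  obtain ⟨e, he, -⟩ := D.rooting.pe_spec 1 (by lia) (by lia)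
  refine ⟨hf, minWeight_eq ⟨e, he⟩ hf (h1.add g) (fun d hd => ?_) fun v hv => ?_⟩
  · obtain ⟨v, v0, v1, hv⟩ := D.rooting.pe_surj d hd
    exact .inl ⟨v, ⟨v1, v0⟩, (hD v v0 v1 d hv.symm).symm⟩
  · obtain ⟨d, hd, hd', -⟩ := D.rooting.pe_spec v hv.2 hv.1
    exact ⟨d, hd, (hD v hv.2 hv.1 d hd').symm⟩

/-- The variables `vZ` and `rB` hold the minimum of all finite weights in the list. -/
def Best (s : State) (l : List Ext) : Prop :=
  IsMin (s.wvar vZ) (s.rvar rB) (fun c : Ext => c ∈ l ∧ (ofLex c).1 = 0) (fun c => (ofLex c).2)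

/-- Takes the weight `rA`, or infinity if `vA = 0`, into account. -/
def candidate : Prog :=
  .setW vF (.var vZ) ;; .setR rM (.var rB) ;; accMin (.var vA) (.var rA) ;;
  .setW vZ (.var vF) ;; .setR rB (.var rM)

/-- `Best` ignores infinite weights, so the finite part `r'` of an infinite answer is arbitrary
here. -/
theorem wp_candidate {s : State} {l : List Ext} {Q : State → Prop} {r' : ℝ} (hK : 1 ≤ K)
    (hZ : s.wvar vZ ≤ K) (h : Best s l)
    (hQ : ∀ s', Best s' (l ++ [answer (s.wvar vA) (s.rvar rA) r']) → Q s') :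
    candidate.wp K Q s := by
  simp only [candidate, Prog.wp, WExpr.eval, RExpr.eval]
  refine ⟨hZ, wp_accMin (C' := fun c => c = answer (s.wvar vA) (s.rvar rA) r' ∧ (ofLex c).1 = 0) hK
    (by simpa using hZ) (by simpa [Best] using h) ?_ fun f r hf hmin => ⟨by simpa using hf, hQ _ ?_⟩⟩
  · simp only [WExpr.eval, RExpr.eval, State.setR_wvar, State.setW_wvar, State.setR_rvar,
      State.setW_rvar]
    norm_num
    intro z
    rw [answer]
    split_ifs with h0
    · simp [h0]
    · simp [h0, Ext.fin]
  · refine IsMin.congr (by simpa [Best] using hmin) (fun c => ?_) fun _ _ => rfl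
    simp only [List.mem_append, List.mem_singleton]
    tauto

/-- The query for the tree edge number `vG`. -/
def probeEdge : Prog :=
  (.setW vC (.get aEV (.var vG)) ;; .setW vE (.get aPE (.var vC)) ;;
   .emitW (.lit 0) ;; .emitW (.get aSRC (.var vE)) ;; .emitW (.get aDST (.var vE)) ;;
   .emitR .one ;; .emitR .zero ;; .storeW aBF (.var vC) (.lit 0)) ;;
  touch (.var vC) ;; readRoot ;;
  (.setW vA (.var vF) ;; .setR rA (.var rM) ;; .storeW aBF (.var vC) (.lit 1)) ;;
  touch (.var vC) ;; readRoot ;;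
  (.setR rA (.add (.var rA) (.var rG)) ;; .setR rM (.add (.var rM) (.var rG)) ;; .emitW (.lit 2) ;;
  .ite (.weq (.var vA) (.lit 0)) (.emitR .one ;; .emitR (.var rM)) (.emitR .zero ;; .emitR (.var rA)) ;;
  .emitW (.lit 0) ;; .emitW (.get aSRC (.var vE)) ;; .emitW (.get aDST (.var vE)) ;;
  .emitR (.sub .zero .one) ;; .emitR .zero ;;
  .setR rA (.add (.var rA) (.get 0 (.var vE)))) ;;
  candidate

theorem answer_add {f : ℕ} {r r' w : ℝ} :
    answer f r r' + Ext.fin w = answer f (r + w) (r' + w) := by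
  rw [answer, answer]
  split_ifs
  · simp [Ext.fin, ← toLex_add]
  · rw [Ext.fin_add]

/-- Deactivating the vertex below `e` takes `e` out of the minimum, as adding infinity does if there
are other edges. The second reading, after the reactivation, supplies the finite part of the answer
when `e` is the only edge. -/
theorem run_probeEdge (hT : G.IsSpanningTree T) {D : Decomp G T} {pre : List Symbol} {s : State}
    {cs : List (Cmd n)} {l : List Ext} (hmem : Mem D s) (h : After D pre s cs) (hl : Best s l)
    {i : ℕ} {e : Fin m} (h0 : 0 < i) (hi : i < n) (hG : s.wvar vG = i) (he : (e : ℕ) = D.pe (D.ev i))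
    (hK : 2 * n + 1 ≤ K) (hmK : m ≤ K) :
    Run B K probeEdge s (1200 * (Nat.log 2 n + 2)) fun s' =>
      After D pre s' (cs ++ G.probe e) ∧ Best s' (l ++ [minWeight T (G.update T
        (G.updates T G.initialWeights cs) (.pathAdd (G.src e) (G.dst e) Ext.inf)) +
          Ext.fin (G.weight e)]) := by
  have hd := D.hld
  obtain ⟨c, hcv⟩ : ∃ c, D.ev i = c := ⟨_, rfl⟩
  have hc : c < n := hcv ▸ (hd.ev_spec hi).1
  have hc0 : 0 < c := hcv ▸ hd.ev_ne_zero hi h0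
  rw [hcv] at he
  obtain ⟨A, hA⟩ : ∃ A, 500 * (Nat.log 2 n + 2) = A := ⟨_, rfl⟩
  refine (Run.seq' (R := fun s1 => s1.wvar vC = c ∧ s1.wvar vE = e ∧ s1.out = s.out ++ [.inl 0,
      .inl (G.src e : ℕ), .inl (G.dst e : ℕ), .inr 1, .inr 0] ∧
      s1.warr = Function.update s.warr aBF (Function.update (s.warr aBF) c 0))
    (.of_wp' (T := 40) (by decide) ?_) ?_).time_mono
    (T₁ := 40 + ((3 + A) + (30 + (10 + ((3 + A) + (30 + 95)))))) (by lia)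
  · simp [Prog.wp, WExpr.eval, RExpr.eval, hG, hmem.ev, hcv, hmem.pe, ← he, hmem.src, hmem.dst,
      WGraph.srcN_fin, WGraph.dstN_fin]
    refine ⟨by lia, by lia, by simp [State.storeW]⟩
  rintro s1 - ha1 ⟨c1, e1, o1, w1⟩
  have r1 : s1.rarr = s.rarr := funext fun a => ha1.ra a rfl
  refine Run.seq' ((run_touch (s := s1) (s0 := s) (u := c) h.live hK (by simp [WExpr.eval, c1]) hc
    (by rw [w1]; simp) (by rw [r1]; simp) (fun w _ => by rw [r1])
    (fun w hw => by rw [w1]; simp [hw])).time_mono (by rw [← hA]; rfl)) ?_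
  rintro s2 - ha2 l2
  have b2 : s2.warr aBF = Function.update (nonRoot n) c 0 := by
    rw [ha2.wa 30 rfl, w1, Function.update_self, h.bf]
  have v2 : D.val s2 = D.val s := by
    funext w
    rw [Decomp.val, Decomp.val, ha2.ra 1 rfl, ha2.ra 2 rfl, r1]
  refine Run.seq' (run_readRoot l2 (by lia)) ?_
  rintro s3 hbd3 ha3 m3
  obtain ⟨f, hf⟩ : ∃ f, s3.wvar vF = f := ⟨_, rfl⟩
  obtain ⟨r, hr⟩ : ∃ r, s3.rvar rM = r := ⟨_, rfl⟩
  rw [hf, hr, b2, v2] at m3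
  have m3' : IsMin f r (fun v => v < n ∧ 0 < v ∧ v ≠ c) (D.val s) := by
    refine m3.congr (fun v => and_congr_right fun hv => ?_) fun _ _ => rfl
    by_cases h5 : v = c <;> simp [h5, nonRoot, hv]
    lia
  have c3 : s3.wvar vC = c := (ha3.w 12 rfl).trans ((ha2.w 12 rfl).trans c1)
  refine Run.seq' (R := fun s4 => s4.wvar vA = f ∧ s4.rvar rA = r ∧ s4.wvar vC = c ∧
    s4.warr = Function.update s3.warr aBF (nonRoot n)) (.of_wp' (by decide) ?_) ?_
  · have hf3 := hbd3.1 16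
    have b3 : s3.warr aBF = Function.update (nonRoot n) c 0 := (ha3.wa 30 rfl).trans b2
    have h1 : Function.update (nonRoot n) c 1 = nonRoot n := by
      rw [Function.update_eq_self_iff]
      simp [nonRoot, hc, hc0]
    simp [Prog.wp, WExpr.eval, RExpr.eval, hf, hr, c3]
    refine ⟨by lia, by lia, ?_⟩
    simp [State.storeW, b3, h1]
  rintro s4 - ha4 ⟨f4, r4, c4, w4⟩
  have rr4 : s4.rarr = s3.rarr := funext fun a => ha4.ra a rfl
  have l3 : Live D s3 := l2.agree ha3 rfl rfl
  refine Run.seq' ((run_touch (s := s4) (s0 := s3) (u := c) l3 hK (by simp [WExpr.eval, c4]) hc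
    (by rw [w4]; simp) (by rw [rr4]; simp) (fun w _ => by rw [rr4])
    (fun w hw => by rw [w4, ha3.wa 30 rfl, b2]; simp [hw])).time_mono (by rw [← hA]; rfl)) ?_
  rintro s5 - ha5 l5
  have b5 : s5.warr aBF = nonRoot n := by
    rw [ha5.wa 30 rfl, w4, Function.update_self]
  have v5 : D.val s5 = D.val s := by
    rw [← v2]
    funext w
    rw [Decomp.val, Decomp.val, ha5.ra 1 rfl, ha5.ra 2 rfl, rr4, ha3.ra 1 rfl, ha3.ra 2 rfl]
  refine Run.seq' (run_readRoot l5 (by lia)) ?_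
  rintro s6 hbd6 ha6 m6
  obtain ⟨f', hf'⟩ : ∃ f, s6.wvar vF = f := ⟨_, rfl⟩
  obtain ⟨r', hr'⟩ : ∃ r, s6.rvar rM = r := ⟨_, rfl⟩
  rw [hf', hr', b5, v5] at m6
  have m6' : IsMin f' r' (fun v => v < n ∧ 0 < v) (D.val s) := by
    refine m6.congr (fun v => and_congr_right fun hv => ?_) fun _ _ => rfl
    simp [nonRoot, hv]
    lia
  have ans := minWeight_probe hT D (fun v v0 v1 d hd => h.val v v0 v1 d hd) hc0 hc he m3' m6'
  rw [ans, answer_add]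
  have f6 : s6.wvar vA = f := (ha6.w 8 rfl).trans ((ha5.w 8 rfl).trans f4)
  have r6 : s6.rvar rA = r := (ha6.r 5 rfl).trans ((ha5.r 5 rfl).trans r4)
  have g6 : s6.rvar rG = s.rvar rG := by
    rw [ha6.r 3 rfl, ha5.r 3 rfl, ha4.r 3 rfl, ha3.r 3 rfl, ha2.r 3 rfl, ha1.r 3 rfl]
  have e6 : s6.wvar vE = e := by
    rw [ha6.w 5 rfl, ha5.w 5 rfl, ha4.w 5 rfl, ha3.w 5 rfl, ha2.w 5 rfl, e1]
  have hmem6 : Mem D s6 := (((((hmem.agree ha1 rfl).agree ha2 rfl).agree ha3 rfl).agree ha4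
    rfl).agree ha5 rfl).agree ha6 rfl
  have l6 : Live D s6 := l5.agree ha6 rfl rfl
  have b6 : s6.warr aBF = nonRoot n := (ha6.wa 30 rfl).trans b5
  have v6 : D.val s6 = D.val s := by
    rw [← v5]
    funext w
    rw [Decomp.val, Decomp.val, ha6.ra 1 rfl, ha6.ra 2 rfl]
  have o6 : s6.out = s.out ++ [.inl 0, .inl (G.src e : ℕ), .inl (G.dst e : ℕ), .inr 1, .inr 0] := by
    rw [ha6.o rfl, ha5.o rfl, ha4.o rfl, ha3.o rfl, ha2.o rfl, o1]
  have hl6 : Best s6 l := by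
    rw [Best, ha6.w 19 rfl, ha5.w 19 rfl, ha4.w 19 rfl, ha3.w 19 rfl, ha2.w 19 rfl, ha1.w 19 rfl,
      ha6.r 4 rfl, ha5.r 4 rfl, ha4.r 4 rfl, ha3.r 4 rfl, ha2.r 4 rfl, ha1.r 4 rfl]
    exact hl
  refine Run.time_mono (T₁ := 55 + 40) ?_ le_rfl
  refine Run.seq' (R := fun s7 => s7.wvar vA = f ∧ s7.rvar rA = r + s.rvar rG + G.weight e ∧
    s7.out = s6.out ++ ([.inl 2] ++ encode (answer f (r + s.rvar rG) (r' + s.rvar rG)) ++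
      [.inl 0, .inl (G.src e : ℕ), .inl (G.dst e : ℕ), .inr (-1), .inr 0]))
    (.of_wp' (by decide) ?_) ?_
  · simp [Prog.wp, Cond.Holds, WExpr.eval, RExpr.eval, f6, r6, g6, hr', e6, hmem6.src, hmem6.dst,
      hmem6.weight, WGraph.srcN_fin, WGraph.dstN_fin, WGraph.weightN_fin, answer, encode, Ext.fin]
    constructor <;> intro h5 <;> simp [h5]
  rintro s7 hbd7 ha7 ⟨f7, r7, o7⟩
  have hl7 : Best s7 l := by
    rw [Best, ha7.w 19 rfl, ha7.r 4 rfl]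
    exact hl6
  refine (Run.of_wp' (Q := fun s' => Best s' (l ++ [answer (s7.wvar vA) (s7.rvar rA)
    (r' + s.rvar rG + G.weight e)])) (by decide) (wp_candidate (by lia) (hbd7.1 _) hl7
    fun s' h => h)).imp fun s8 _ ha8 h8 => ⟨?_, ?_⟩
  · refine ⟨(l6.agree ha7 rfl rfl).agree ha8 rfl rfl, ?_, fun v v0 v1 d hd => ?_, ?_⟩
    · rw [ha8.wa 30 rfl, ha7.wa 30 rfl, b6]
    · have v8 : D.val s8 v = D.val s v := by
        rw [← v6, Decomp.val, Decomp.val, ha8.ra 1 rfl, ha8.ra 2 rfl, ha7.ra 1 rfl, ha7.ra 2 rfl]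
      rw [v8, ha8.r 3 rfl, ha7.r 3 rfl, g6, h.val v v0 v1 d hd, updates_append, updates_probe]
    · rw [ha8.o rfl, o7, o6, h.out, record_append]
      simp only [WGraph.probe, WGraph.record, ans]
      simp [encode, Ext.inf]
  · rwa [f7, r7] at h8

end TwoRespect

namespace TwoRespect

variable {B K n m : ℕ} {G : WGraph n m} {T : Finset (Fin m)}

/-! ### The heavy-light order -/

/-- The tree edge number `i`. -/
def Decomp.edge (D : Decomp G T) (hm : 0 < m) (i : ℕ) : Fin m :=
  ⟨D.pe (D.ev i) % m, Nat.mod_lt _ hm⟩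

/-- The tree edges in the order in which the program treats them. -/
def Decomp.order (D : Decomp G T) (hm : 0 < m) : List (Fin m) := (List.range' 1 (n - 1)).map (D.edge hm)

theorem Decomp.edge_spec (D : Decomp G T) (hm : 0 < m) {i : ℕ} (h0 : 0 < i) (hi : i < n) :
    D.edge hm i ∈ T ∧ (D.edge hm i : ℕ) = D.pe (D.ev i) ∧
      G.ends (D.edge hm i) = s(⟨D.par (D.ev i), D.rooting.lt _⟩, ⟨D.ev i, (D.hld.ev_spec hi).1⟩) := by
  obtain ⟨k, hk, hkv, hends⟩ := D.rooting.pe_spec _ (D.hld.ev_ne_zero hi h0) (D.hld.ev_spec hi).1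
  have : D.edge hm i = k := by
    refine Fin.ext ?_
    show D.pe (D.ev i) % m = k
    rw [← hkv]
    exact Nat.mod_eq_of_lt k.2
  rw [this]
  refine ⟨hk, hkv, ?_⟩
  rw [WGraph.ends]
  rcases hends with ⟨h1, h2⟩ | ⟨h1, h2⟩
  · rw [Sym2.eq_swap, show G.dst k = ⟨_, _⟩ from Fin.ext h2, show G.src k = ⟨_, _⟩ from Fin.ext h1]
  · rw [show G.dst k = ⟨_, _⟩ from Fin.ext h2, show G.src k = ⟨_, _⟩ from Fin.ext h1]

theorem Decomp.mem_order (D : Decomp G T) (hm : 0 < m) (k : Fin m) : k ∈ D.order hm ↔ k ∈ T := by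
  simp only [order, List.mem_map, List.mem_range'_1]
  constructor
  · rintro ⟨i, hi, rfl⟩
    exact (D.edge_spec hm (by lia) (by lia)).1
  · intro hk
    obtain ⟨v, v0, v1, hv⟩ := D.rooting.pe_surj k hk
    have h1 := D.hld.pos_lt v1
    have h2 := D.hld.ev_pos v v1
    have h3 : 0 < D.pos v := by
      rcases Nat.eq_zero_or_pos (D.pos v) with h4 | h4
      · have h5 := D.hld.ev_pos 0 (by lia)
        rw [D.hld.pos_zero] at h5
        rw [h4, h5] at h2
        lia
      · exact h4
    refine ⟨D.pos v, by lia, Fin.ext ?_⟩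
    rw [(D.edge_spec hm h3 h1).2.1, h2, hv]

theorem Decomp.subtreeSize_eq (D : Decomp G T) (hT : G.IsSpanningTree T) (u : Fin n) :
    G.subtreeSize T ⟨0, D.rooting.n_pos⟩ u = size n D.par u := by
  rw [WGraph.subtreeSize, size]
  refine Finset.card_bij (fun x _ => (x : ℕ)) (fun x hx => ?_) (fun x _ y _ hxy => Fin.ext hxy)
    fun y hy => ?_
  · rw [Finset.mem_filter] at hx
    exact mem_subtree.2 ⟨x.2, (D.rooting.dist_eq_iff hT u x).1 hx.2⟩
  · rw [mem_subtree] at hy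
    refine ⟨⟨y, hy.1⟩, ?_, rfl⟩
    rw [Finset.mem_filter]
    exact ⟨Finset.mem_univ _, (D.rooting.dist_eq_iff hT u ⟨y, hy.1⟩).2 hy.2⟩

/-- In the numbering `pos` a heavy child comes right after its parent, so the edges above a vertex
and above its heavy child are adjacent in the order. This covers both the edges inside a heavy path
and the edge that leads down to its top. -/
theorem Decomp.isHeavyLightOrder (D : Decomp G T) (hT : G.IsSpanningTree T) (hm : 0 < m) :
    G.IsHeavyLightOrder T (D.order hm) := by
  have hd := D.hld
  have hhv : ∀ u < n, D.hv u < n := by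
    intro u hu
    rcases hd.heavy u hu with h1 | h1
    · rw [h1.1]
      exact hd.n_pos
    · exact (mem_children.1 h1.1).1
  refine ⟨?_, D.mem_order hm, ⟨0, D.rooting.n_pos⟩, fun u => ⟨D.hv u, hhv u u.2⟩, fun u v huv => ?_,
    fun p u hpu huh f hf g hg hfe hge => ?_⟩
  · refine List.Nodup.map_on ?_ (List.nodup_range' ..)
    intro i hi j hj hij
    rw [List.mem_range'_1] at hi hj
    have h1 := congrArg Fin.val hij
    rw [(D.edge_spec hm (by lia) (by lia)).2.1, (D.edge_spec hm (by lia) (by lia)).2.1] at h1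
    have e1 := hd.ev_spec (i := i) (by lia)
    have e2 := hd.ev_spec (i := j) (by lia)
    have h2 := D.rooting.pe_inj _ _ (hd.ev_ne_zero (i := i) (by lia) (by lia)) e1.1
      (hd.ev_ne_zero (i := j) (by lia) (by lia)) e2.1 h1
    rw [← e1.2, ← e2.2, h2]
  · rw [D.rooting.isParent_iff] at huv ⊢
    rw [D.subtreeSize_eq hT, D.subtreeSize_eq hT]
    have hv : (v : ℕ) ∈ children n D.par u := mem_children.2 ⟨v.2, huv⟩
    rcases hd.heavy u u.2 with h1 | h1
    · rw [h1.2] at hv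
      simp at hv
    · have h2 := mem_children.1 h1.1
      exact ⟨h2.2, h1.2 v hv⟩
  · rw [D.rooting.isParent_iff] at hpu huh
    have key : ∀ w : Fin n, 0 < (w : ℕ) → ∀ k ∈ T, ∀ q : Fin n, D.par w = q → G.ends k = s(q, w) →
        0 < D.pos w ∧ D.pos w < n ∧ k = D.edge hm (D.pos w) := by
      intro w w0 k hk q hq hke
      have h1 := hd.pos_lt w.2
      have h2 := hd.ev_pos w w.2
      have h3 := hd.numbering_pos.lo w w0 w.2
      have h4 := D.edge_spec hm (i := D.pos w) (by lia) h1
      refine ⟨by lia, h1, hT.2.1 hk h4.1 ?_⟩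
      rw [hke, h4.2.2]
      congr 2
      · exact Fin.ext (show (q : ℕ) = D.par (D.ev (D.pos w)) by rw [h2, hq])
      · exact Fin.ext (show (w : ℕ) = D.ev (D.pos w) from h2.symm)
    obtain ⟨f0, f1, hf'⟩ := key u hpu.1 f hf p hpu.2 hfe
    obtain ⟨g0, g1, hg'⟩ := key _ huh.1 g hg u huh.2 hge
    have hpos : D.pos (D.hv u) = D.pos u + 1 := by
      have h1 : D.par (D.hv u) = u := huh.2
      have h2 := hd.pos_heavy (D.hv u) huh.1 (hhv u u.2) (by rw [h1])
      rwa [h1] at h2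
    simp only at hg' g0 g1
    rw [hpos] at hg' g1
    refine ⟨(List.range' 1 (D.pos u - 1)).map (D.edge hm),
      (List.range' (D.pos u + 2) (n - (D.pos u + 2))).map (D.edge hm), ?_⟩
    have h5 : List.range' 1 (n - 1) = List.range' 1 (D.pos u - 1) ++ ([D.pos u, D.pos u + 1] ++
        List.range' (D.pos u + 2) (n - (D.pos u + 2))) := by
      have h6 : [D.pos u, D.pos u + 1] = List.range' (D.pos u) 2 := rfl
      rw [h6, List.range'_append_1]
      have h7 := List.range'_append_1 (s := 1) (m := D.pos u - 1) (n := 2 + (n - (D.pos u + 2)))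
      rw [show 1 + (D.pos u - 1) = D.pos u by lia] at h7
      rw [h7]
      congr 1
      lia
    rw [order, h5, hf', hg']
    simp

/-! ### The sequence of calls -/

theorem Decomp.onBit_on (D : Decomp G T) (hT : G.IsSpanningTree T) (hm : 0 < m) {i : ℕ} (h0 : 0 < i)
    (hi : i < n) (k : Fin m) : D.OnAt i k ↔ G.On T (D.edge hm i) k := by
  rw [WGraph.On, D.rooting.onPath_iff hT (D.hld.ev_ne_zero hi h0) (D.hld.ev_spec hi).1
    (D.edge_spec hm h0 hi).2.1, OnAt, AboveAt, AboveAt, WGraph.srcN_fin, WGraph.dstN_fin]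
  simp [hi]

/-- The fictitious edge with number `n` is on no path. Thus the last step of the algorithm, which
treats the current edge as off all paths, is one more transition of the usual kind. -/
theorem Decomp.not_onAt (D : Decomp G T) (k : ℕ) : ¬ D.OnAt n k := by
  simp [OnAt, AboveAt]

theorem Decomp.start_eq (D : Decomp G T) (hT : G.IsSpanningTree T) (hm : 0 < m) (hn : 2 ≤ n) :
    G.start T (D.edge hm 1) = upto T (fun k => [G.cmd k (D.onBit 1 k) (G.weight k)]) m := by
  rw [← nonTree_flatMap, WGraph.start, List.map_eq_flatMap]
  congr 1
  funext k
  rw [Decomp.onBit, D.onBit_on hT hm one_pos (by lia)]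
  split_ifs <;> simp [WGraph.cmd, WGraph.addOn, WGraph.addOff]

theorem Decomp.advance_eq (D : Decomp G T) (hT : G.IsSpanningTree T) (hm : 0 < m) {i : ℕ} (h0 : 0 < i)
    (hi : i + 1 < n) :
    G.advance T (D.edge hm i) (D.edge hm (i + 1)) = upto T (D.flip i) m := by
  rw [← nonTree_flatMap, WGraph.advance]
  congr 1
  funext k
  rw [flip, onBit, onBit, D.onBit_on hT hm h0 (by lia), D.onBit_on hT hm (by lia) hi]
  by_cases h1 : G.On T (D.edge hm i) k <;> by_cases h2 : G.On T (D.edge hm (i + 1)) k <;>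
    simp [h1, h2, WGraph.cmd, WGraph.addOn, WGraph.addOff, WGraph.undoOn, WGraph.undoOff]

theorem Decomp.finish_eq (D : Decomp G T) (hT : G.IsSpanningTree T) (hm : 0 < m) {i : ℕ} (h0 : 0 < i)
    (hi : i + 1 = n) :
    G.finish T (D.edge hm i) = upto T (D.flip i) m ++ [.queryMin] := by
  rw [← nonTree_flatMap, WGraph.finish]
  congr 2
  funext k
  rw [flip, onBit, onBit, D.onBit_on hT hm h0 (by lia), hi, if_neg (D.not_onAt k)]
  by_cases h1 : G.On T (D.edge hm i) k <;>
    simp [h1, WGraph.cmd, WGraph.addOn, WGraph.undoOff]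

/-- The calls up to the query for the tree edge number `j + 1`. -/
noncomputable def Decomp.callsTo (D : Decomp G T) (hm : 0 < m) (j : ℕ) : List (Cmd n) :=
  upto T (fun k => [G.cmd k (D.onBit 1 k) (G.weight k)]) m ++
    (List.range' 1 j).flatMap fun i => G.probe (D.edge hm i) ++ upto T (D.flip i) m

theorem Decomp.callsTo_succ (D : Decomp G T) (hm : 0 < m) (j : ℕ) : D.callsTo hm (j + 1) =
    D.callsTo hm j ++ G.probe (D.edge hm (j + 1)) ++ upto T (D.flip (j + 1)) m := by
  rw [callsTo, callsTo, List.range'_1_concat, List.flatMap_append, List.flatMap_singleton, add_comm 1 j]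
  simp only [List.append_assoc]

theorem Decomp.iterate_eq (D : Decomp G T) (hT : G.IsSpanningTree T) (hm : 0 < m) {j k : ℕ}
    (h0 : 0 < j) (hj : j + k + 1 = n) :
    G.iterate T (D.edge hm j) ((List.range' (j + 1) k).map (D.edge hm)) =
      ((List.range' j (k + 1)).flatMap fun i => G.probe (D.edge hm i) ++ upto T (D.flip i) m) ++
        [.queryMin] := by
  induction k generalizing j with
  | zero =>
    simp [WGraph.iterate, D.finish_eq hT hm h0 hj]
  | succ k ih =>
    rw [List.range'_succ, List.map_cons, WGraph.iterate, D.advance_eq hT hm h0 (by lia),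
      ih (by lia) (by lia), List.range'_succ (n := k + 1), List.flatMap_cons]
    simp only [List.append_assoc]

theorem Decomp.calls_eq (D : Decomp G T) (hT : G.IsSpanningTree T) (hm : 0 < m) (hn : 2 ≤ n) :
    G.calls T (D.order hm) = D.callsTo hm (n - 1) ++ [.queryMin] := by
  obtain ⟨k, rfl⟩ : ∃ k, n = k + 2 := ⟨n - 2, by lia⟩
  rw [order, show k + 2 - 1 = k + 1 by lia, List.range'_succ, List.map_cons, WGraph.calls,
    D.start_eq hT hm hn, D.iterate_eq hT hm one_pos (by lia), callsTo, List.append_assoc]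

theorem Decomp.updates_callsTo (D : Decomp G T) (hT : G.IsSpanningTree T) (hm : 0 < m) {j : ℕ}
    (hj : j + 1 < n) : G.updates T G.initialWeights (D.callsTo hm j) =
      fun e => Ext.fin (G.stored T (G.On T (D.edge hm (j + 1))) e) := by
  induction j with
  | zero =>
    rw [callsTo, ← D.start_eq hT hm (by lia)]
    simpa using updates_start (G := G) (T := T) (D.edge hm 1)
  | succ j ih =>
    rw [D.callsTo_succ, updates_append, updates_append, ih (by lia), updates_probe,
      ← D.advance_eq hT hm (by lia) hj, updates_advance]

theorem Decomp.minWeight_callsTo (D : Decomp G T) (hT : G.IsSpanningTree T) (hm : 0 < m)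
    (hn : 2 ≤ n) :
    minWeight T (G.updates T G.initialWeights (D.callsTo hm (n - 1))) = G.lastAnswer T := by
  obtain ⟨k, rfl⟩ : ∃ k, n = k + 2 := ⟨n - 2, by lia⟩
  rw [show k + 2 - 1 = k + 1 by lia, D.callsTo_succ, updates_append, updates_append,
    D.updates_callsTo hT hm (by lia), updates_probe, WGraph.lastAnswer]
  congr 1
  rw [← updates_finish (D.edge hm (k + 1)), D.finish_eq hT hm (by lia) rfl, updates_append,
    WGraph.updates_cons, WGraph.updates_nil, WGraph.update]

theorem Decomp.minWeight_probeAnswer (D : Decomp G T) (hT : G.IsSpanningTree T) (hm : 0 < m) {j : ℕ}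
    (hj : j + 1 < n) : minWeight T (G.update T (G.updates T G.initialWeights (D.callsTo hm j))
      (.pathAdd (G.src (D.edge hm (j + 1))) (G.dst (D.edge hm (j + 1))) Ext.inf)) =
      G.probeAnswer T (D.edge hm (j + 1)) := by
  have := answers_probe (G := G) (T := T) (D.edge hm (j + 1))
  simp only [WGraph.probe, WGraph.answers, List.cons.injEq, and_true] at this
  rw [D.updates_callsTo hT hm hj, this]

/-- The candidates for the first `j` tree edges. -/
noncomputable def Decomp.bestTo (D : Decomp G T) (hm : 0 < m) (j : ℕ) : List Ext :=
  (List.range' 1 j).map fun i => G.probeAnswer T (D.edge hm i) + Ext.fin (G.weight (D.edge hm i))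

theorem Decomp.candidates_eq (D : Decomp G T) (hm : 0 < m) (hn : 2 ≤ n) :
    G.candidates T (D.order hm) = D.bestTo hm (n - 1) ++ [G.lastAnswer T] := by
  have hne : D.order hm ≠ [] := by
    rw [order, Ne, List.map_eq_nil_iff, List.range'_eq_nil_iff]
    lia
  rw [TwoRespect.candidates_eq hne, order, bestTo, List.map_map]
  rfl

/-- The minimum of all candidates is finite by hypothesis, so leaving out the infinite ones does not
change it. -/
theorem Best.eq {s : State} {l : List Ext} {x : ℝ} (h : Best s l)
    (hx : l.minimum = ((Ext.fin x : Ext) : WithTop Ext)) : s.rvar rB = x := by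
  obtain ⟨h1, h2⟩ := List.minimum_eq_coe_iff.1 hx
  have h3 : ∀ z, (∀ c : Ext, c ∈ l ∧ (ofLex c).1 = 0 → z ≤ (ofLex c).2) ↔ z ≤ x := by
    intro z
    constructor
    · exact fun h4 => h4 _ ⟨h1, rfl⟩
    · rintro h4 c ⟨hc, hc0⟩
      have h5 : c = Ext.fin (ofLex c).2 := by
        rw [Ext.fin, ← hc0]
        rfl
      have h6 := h2 c hc
      rw [h5, Ext.fin_le_fin] at h6
      exact h4.trans h6
  have h4 : ∀ z, (s.wvar vZ = 0 ∨ z ≤ s.rvar rB) ↔ z ≤ x := fun z => (h z).trans (h3 z)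
  have h5 : s.wvar vZ ≠ 0 := by
    intro h5
    have := (h4 (x + 1)).1 (.inl h5)
    linarith
  exact le_antisymm ((h4 _).1 (.inr le_rfl)) (((h4 x).2 le_rfl).resolve_left h5)

end TwoRespect

namespace TwoRespect

variable {B K n m : ℕ} {G : WGraph n m} {T : Finset (Fin m)}

/-! ### The whole program -/

/-- Writes down the order of the tree edges. -/
def emitOrder : Prog :=
  .setW vI (.lit 1) ;;
  .loop (.wlt (.var vI) (.var vN)) (.emitW (.get aPE (.get aEV (.var vI))) ;; incr vI)

theorem run_emitOrder {D : Decomp G T} {s : State} (hmem : Mem D s) (hm : 0 < m) (hnK : n + 1 ≤ K) :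
    Run B K emitOrder s (20 * n + 20) fun s' =>
      s'.out = s.out ++ (D.order hm).map fun e : Fin m => .inl (e : ℕ) := by
  refine (Run.seq' (R := fun s' => s' = s.setW vI 1) (.of_wp ?_) ?_).time_mono
    (T₁ := 2 + ((n - 1) * (8 + 3 + 1) + 3 + 1)) (by lia)
  · simp [Prog.wp, WExpr.eval]
    lia
  rintro s1 - ha1 rfl
  refine Run.loop_count (fun j s' => s'.wvar vI = 1 + j ∧ s'.out = s.out ++
    (List.range' 1 j).map fun i => .inl (D.edge hm i : ℕ)) _ _ (by simp) ?_ ?_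
  · rintro j hj s' - ha2 ⟨hI, ho⟩
    have hmem' : Mem D s' := (hmem.agree ha1 rfl).agree ha2 rfl
    refine ⟨by simp [Cond.Holds, WExpr.eval, hI, hmem'.vn]; lia, .of_wp' (by decide) ?_⟩
    simp [Prog.wp, incr, WExpr.eval, hI, hmem'.pe, hmem'.ev, ho, List.range'_1_concat,
      (D.edge_spec hm (i := 1 + j) (by lia) (by lia)).2.1]
    lia
  · rintro s' - ha2 ⟨hI, ho⟩
    have hmem' : Mem D s' := (hmem.agree ha1 rfl).agree ha2 rfl
    refine ⟨by simp [Cond.Holds, WExpr.eval, hI, hmem'.vn]; lia, ?_⟩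
    rw [ho, Decomp.order, List.map_map]
    rfl

/-- Treats all tree edges. -/
def mainLoop : Prog :=
  .loop (.wlt (.var vG) (.var vN)) (probeEdge ;; incr vG ;; flips)

/-- The time for the marks is summed over all lists: their total length is `s.wvar vQ - 1`, because
`vQ` is the first free cell and the cell 0 is not used. -/
theorem run_mainLoop (hT : G.IsSpanningTree T) {D : Decomp G T} {pre : List Symbol} {s : State}
    {l : ℕ → List ℕ} (hmem : Mem D s) (hmark : Marked D 0 s l) (hm : 0 < m) (hG : s.wvar vG = 1)
    (hON : OnOK D s 1) (h : After D pre s (D.callsTo hm 0)) (hl : Best s (D.bestTo hm 0))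
    (hK : 2 * n + 2 ≤ K) (hmK : m ≤ K) :
    Run B K mainLoop s ((n + s.wvar vQ) * (3500 * (Nat.log 2 n + 2)) + 4) fun s' =>
      After D pre s' (D.callsTo hm (n - 1)) ∧ Best s' (D.bestTo hm (n - 1)) := by
  have hn0 := D.rooting.n_pos
  obtain ⟨A, hA⟩ : ∃ A, 1200 * (Nat.log 2 n + 2) = A := ⟨_, rfl⟩
  obtain ⟨A', hA'⟩ : ∃ A', 3400 * (Nat.log 2 n + 2) = A' := ⟨_, rfl⟩
  refine (Run.loop_sum (fun j s' => s'.wvar vG = j + 1 ∧ OnOK D s' (j + 1) ∧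
    After D pre s' (D.callsTo hm j) ∧ Best s' (D.bestTo hm j)) (n - 1)
    (fun j => A + (4 + ((l (j + 1)).length * A' + 15))) ⟨hG, hON, h, hl⟩ ?_ ?_).time_mono ?_
  · rintro j hj s' - ha1 ⟨hG1, hON1, h1, hl1⟩
    have hmem1 : Mem D s' := hmem.agree ha1 rfl
    have hmark1 : Marked D 0 s' l := hmark.agree ha1 rfl
    refine ⟨by simp [Cond.Holds, WExpr.eval, hG1, hmem1.vn]; lia, ?_⟩
    refine Run.seq' ((run_probeEdge hT hmem1 h1 hl1 (Nat.succ_pos j) (by lia) hG1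
      (D.edge_spec hm (Nat.succ_pos j) (by lia)).2.1 (by lia) hmK).time_mono hA.le) ?_
    rintro s2 - ha2 ⟨h2, hl2⟩
    refine Run.seq' (R := fun s3 => s3.wvar vG = j + 1 + 1) (.of_wp' (by decide) ?_) ?_
    · simp [Prog.wp, incr, WExpr.eval, ha2.w 17 rfl, hG1]
      lia
    rintro s3 - ha3 hG3
    refine ((run_flips hT (((hmem1.agree ha2 rfl).agree ha3 rfl))
      ((hmark1.agree ha2 rfl).agree ha3 rfl) (h2.agree ha3 rfl rfl rfl) (i := j + 1) (by lia) hG3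
      ?_ hK).time_mono (by rw [hA'])).imp fun s4 _ ha4 h4 => ⟨?_, h4.2, ?_, ?_⟩
    · intro k hk
      rw [ha3.wa 33 rfl, ha2.wa 33 rfl]
      exact hON1 k hk
    · rw [ha4.w 17 rfl, hG3]
    · rw [D.callsTo_succ]
      exact h4.1
    · rw [D.minWeight_probeAnswer hT hm (by lia)] at hl2
      rw [Best, ha4.w 19 rfl, ha3.w 19 rfl, ha4.r 4 rfl, ha3.r 4 rfl, Decomp.bestTo,
        List.range'_1_concat, List.map_append, List.map_singleton, add_comm 1 j]
      exact hl2
  · rintro s' - ha1 ⟨hG1, -, h1, hl1⟩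
    refine ⟨?_, h1, hl1⟩
    simp [Cond.Holds, WExpr.eval, hG1, (hmem.agree ha1 rfl).vn]
    lia
  · have h1 := hmark.marks.count
    obtain ⟨k, rfl⟩ : ∃ k, n = k + 1 := ⟨n - 1, by lia⟩
    -- The list with number 0 is split off, since only the lists 1 to `n - 1` are processed.
    rw [Finset.sum_range_succ'] at h1
    rw [Nat.add_sub_cancel]
    have h2 : ∑ j ∈ Finset.range k, (l (j + 1)).length ≤ s.wvar vQ := by lia
    simp only [Finset.sum_add_distrib, ← Finset.sum_mul, Finset.sum_const, Finset.card_range,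
      smul_eq_mul, Cond.cost, WExpr.cost]
    have h3 := Nat.mul_le_mul_right A' h2
    rw [← hA'] at h3 ⊢
    rw [← hA]
    nlinarith

/-- The last query and the output of the result. -/
def finishAll : Prog :=
  readRoot ;;
  (.setR rA (.add (.var rM) (.var rG)) ;; .setW vA (.var vF) ;; .emitW (.lit 2) ;; .emitR .zero ;;
    .emitR (.var rA)) ;;
  candidate ;;
  .emitR (.var rB)

theorem run_finishAll {D : Decomp G T} {pre : List Symbol} {s : State} {cs : List (Cmd n)}
    {l : List Ext} (hn : 2 ≤ n) (h : After D pre s cs) (hl : Best s l) (hK : 1 ≤ K) :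
    Run B K finishAll s 100 fun s' =>
      s'.out = pre ++ G.record T G.initialWeights (cs ++ [.queryMin]) ++ [.inr (s'.rvar rB)] ∧
        Best s' (l ++ [minWeight T (G.updates T G.initialWeights cs)]) := by
  refine (Run.seq' (run_readRoot h.live hK) ?_).time_mono (T₁ := 30 + (20 + (40 + 2))) (by lia)
  rintro s1 hbd1 ha1 m1
  obtain ⟨f, hf⟩ : ∃ f, s1.wvar vF = f := ⟨_, rfl⟩
  obtain ⟨r, hr⟩ : ∃ r, s1.rvar rM = r := ⟨_, rfl⟩
  rw [hf, hr, h.bf] at m1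
  obtain ⟨hf0, hmw⟩ := minWeight_all D hn h.val (m1.congr
    (fun v => and_congr_right fun hv => by simp [nonRoot, hv]; lia) fun _ _ => rfl)
  rw [hmw]
  refine Run.seq' (R := fun s2 => s2.wvar vA = f ∧ s2.rvar rA = r + s.rvar rG ∧
    s2.out = s.out ++ [.inl 2, .inr 0, .inr (r + s.rvar rG)]) (.of_wp' (by decide) ?_) ?_
  · have := hbd1.1 16
    simp [Prog.wp, WExpr.eval, RExpr.eval, hf, hr, ha1.r 3 rfl, ha1.o rfl]
    lia
  rintro s2 hbd2 ha2 ⟨f2, r2, o2⟩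
  have hl2 : Best s2 l := by
    rw [Best, ha2.w 19 rfl, ha2.r 4 rfl, ha1.w 19 rfl, ha1.r 4 rfl]
    exact hl
  refine Run.seq' (R := fun s3 => Best s3 (l ++ [answer (s2.wvar vA) (s2.rvar rA) 0]))
    (.of_wp' (by decide) (wp_candidate hK (hbd2.1 _) hl2 fun s' h => h)) ?_
  rintro s3 - ha3 hl3
  rw [f2, r2, answer, if_neg hf0] at hl3
  refine .of_wp' (by decide) ?_
  simp only [Prog.wp, RExpr.eval]
  refine ⟨?_, hl3⟩
  have o3 : s3.out = s2.out := ha3.o rfl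
  rw [State.emit_out, State.emit_rvar, o3, o2, h.out, record_append]
  simp [WGraph.record, hmw, encode, Ext.fin]

/-- The program. -/
def program : Prog :=
  decompose ;; markAll ;; buildNodes ;; initTree ;; emitOrder ;; startAll ;; mainLoop ;; finishAll

theorem markAll_modWA {a : ℕ} (ha : 21 ≤ a) : markAll.modWA a = false := by
  simp [markAll, markPath, pushMark, climbBoth, decr, incr, Prog.modWA]
  lia

theorem buildNodes_modWA {a : ℕ} (ha : 30 ≤ a) : buildNodes.modWA a = false := by
  simp [buildNodes, splitNode, findItem, spawn, incr, Prog.modWA]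
  omega

theorem run_program (hn : 2 ≤ n) (hT : G.IsSpanningTree T) (hm : 0 < m)
    (h1K : 2 * (m + 1) * (m + 1) ≤ K) (h2K : 2 * n + 8 ≤ K)
    (h3K : (4 * m + 4) * (Nat.log 2 n + 2) ≤ K) :
    Run B K program (G.input T)
      ((n + (m + (4 * (Nat.log 2 n + 1) * m))) * (9000 * (Nat.log 2 n + 2))) fun s' =>
      ∃ D : Decomp G T, s'.out = (D.order hm).map (fun e : Fin m => .inl (e : ℕ)) ++
        G.record T G.initialWeights (G.calls T (D.order hm)) ++ [.inr (s'.rvar rB)] ∧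
        Best s' (G.candidates T (D.order hm)) := by
  have hmK : m ≤ K := by nlinarith
  obtain ⟨L, hL⟩ : ∃ L, Nat.log 2 n = L := ⟨_, rfl⟩
  refine (Run.seq' (run_decompose (by lia) hT h1K (by lia)) ?_).time_mono
    (T₁ := (60 * m + 380 * n + 440) + ((10 + 400 * (m * (Nat.log 2 n + 2))) +
      ((20 + 500 * (n * (Nat.log 2 n + 2))) + ((600 * n + 600) + ((20 * n + 20) +
      ((m * (1800 * (Nat.log 2 n + 2)) + 10) +
      (((n + (1 + 4 * (Nat.log 2 n + 1) * m)) * (3500 * (Nat.log 2 n + 2)) + 4) + 100))))))) ?_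
  swap
  · rw [hL]
    have h1 : 2 * (L + 2) ≤ n * (L + 2) := Nat.mul_le_mul_right _ hn
    have h2 : 0 ≤ n * L := Nat.zero_le _
    have h3 : 0 ≤ m * L := Nat.zero_le _
    have h4 : 0 ≤ (L + 1) * m * (L + 2) := Nat.zero_le _
    linarith
  rintro s1 - ha1 ⟨⟨D, hmem1⟩, w1, q1, o1⟩
  refine Run.seq' (run_markAll hmem1 (by lia) h3K w1) ?_
  rintro s2 - ha2 ⟨l, hmark2, hq2⟩
  have hmem2 := hmem1.agree ha2 rfl
  have w2 : ∀ a, 21 ≤ a → s2.warr a = fun _ => 0 := fun a haa => by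
    rw [ha2.wa a (markAll_modWA haa), w1 a (by lia)]
  refine Run.seq' (run_buildNodes hmem2 h2K w2) ?_
  rintro s3 - ha3 h3
  have hmem3 := hmem2.agree ha3 rfl
  refine Run.seq' (run_initTree hmem3 h3 (by lia)
    (fun a haa => by rw [ha3.wa a (buildNodes_modWA haa), w2 a (by lia)])
    (fun a haa => by rw [ha3.ra a rfl, ha2.ra a rfl, q1 a haa])) ?_
  rintro s4 - ha4 ⟨live4, bf4, val4⟩
  have hmem4 := hmem3.agree ha4 rfl
  refine Run.seq' (run_emitOrder hmem4 hm (by lia)) ?_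
  rintro s5 - ha5 o5
  have hmem5 := hmem4.agree ha5 rfl
  have hmark5 := ((hmark2.agree ha3 rfl).agree ha4 rfl).agree ha5 rfl
  have o4 : s4.out = [] := by rw [ha4.o rfl, ha3.o rfl, ha2.o rfl, o1]
  have g5 : s5.rvar rG = 0 := by
    rw [ha5.r 3 rfl, ha4.r 3 rfl, ha3.r 3 rfl, ha2.r 3 rfl, ha1.r 3 rfl]
    rfl
  have z5 : s5.wvar vZ = 0 := by
    rw [ha5.w 19 rfl, ha4.w 19 rfl, ha3.w 19 rfl, ha2.w 19 rfl, ha1.w 19 rfl]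
    rfl
  have h5 : After D ((D.order hm).map fun e : Fin m => .inl (e : ℕ)) s5 [] := by
    refine ⟨live4.agree ha5 rfl rfl, ?_, fun v v0 v1 e he => ?_, ?_⟩
    · rw [ha5.wa 30 rfl, bf4]
    · have : D.val s5 v = D.val s4 v := by
        rw [Decomp.val, Decomp.val, ha5.ra 1 rfl, ha5.ra 2 rfl]
      rw [this, val4 v v0 v1, g5, ← he, WGraph.weightN_fin, add_zero, WGraph.updates_nil]
      rfl
    · rw [o5, o4, WGraph.record]
      simp
  refine Run.seq' (run_startAll hT hmem5 hmark5 h5 (by lia) hmK) ?_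
  rintro s6 - ha6 ⟨hG6, on6, h6⟩
  have hq6 : s6.wvar vQ ≤ 1 + 4 * (Nat.log 2 n + 1) * m := by
    rwa [ha6.w 6 rfl, ha5.w 6 rfl, ha4.w 6 rfl, ha3.w 6 rfl]
  refine Run.seq' ((run_mainLoop hT (hmem5.agree ha6 rfl) (hmark5.agree ha6 rfl) hm hG6 on6
    (by simpa [Decomp.callsTo] using h6) ?_ (by lia) hmK).time_mono ?_) ?_
  · simp [Best, IsMin, Decomp.bestTo, ha6.w 19 rfl, z5]
  · gcongr
  rintro s7 - ha7 ⟨h7, hl7⟩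
  refine (run_finishAll hn h7 hl7 (by lia)).imp fun s8 _ ha8 h8 => ⟨D, ?_, ?_⟩
  · rw [D.calls_eq hT hm hn]
    exact h8.1
  · rw [D.candidates_eq hm hn, ← D.minWeight_callsTo hT hm hn]
    exact h8.2

/-! ### The bounds for the words and the final estimate of the time. -/

theorem input_bd (G : WGraph n m) (T : Finset (Fin m)) (hnK : n ≤ K) (hmK : m ≤ K) :
    (G.input T).Bd K := by
  constructor
  · intro i
    simp only [WGraph.input]
    split_ifs <;> lia
  · intro a k
    simp only [WGraph.input]
    split_ifs <;> lia

/-- Different vertices other than the root have different edges above them. -/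
theorem IsRooting.le_edges {par pe dep : ℕ → ℕ} (h : IsRooting G T par pe dep) : n ≤ m + 1 := by
  by_contra! hlt
  have h1 : ∀ i : Fin (m + 1), pe (i + 1) < m := fun i => by
    obtain ⟨k, -, hk, -⟩ := h.pe_spec (i + 1) (by lia) (by lia)
    exact hk ▸ k.2
  have h2 : Function.Injective fun i : Fin (m + 1) => (⟨pe (i + 1), h1 i⟩ : Fin m) := by
    intro i j hij
    have := h.pe_inj (i + 1) (j + 1) (by lia) (by lia) (by lia) (by lia) (congrArg Fin.val hij)
    exact Fin.ext (by lia)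
  simpa using Fintype.card_le_of_injective _ h2

/-- With `S = n + m`, the words in memory are bounded by a small multiple of `S ^ 2`, hence by `K =
S ^ 4` as `S ≥ 3`. The word bound `S ^ 8` then leaves the factor 64 that the expressions need. -/
theorem exec_program (hn : 2 ≤ n) (hT : G.IsSpanningTree T) :
    ∃ (es : List (Fin m)) (x : ℝ) (t : ℕ) (s : State),
      G.IsHeavyLightOrder T es ∧ G.Returns T es x ∧ IsLeast (G.twoRespectingValues T) x ∧
      Exec ((n + m) ^ 8) program (G.input T) t s ∧ s.out = G.transcript T es x ∧
      t ≤ 300000 * m * Nat.log 2 n ^ 2 := by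
  obtain ⟨par, pe, dep, hroot⟩ := exists_isRooting (by lia) hT
  have hnm := hroot.le_edges
  have hm : 0 < m := by lia
  obtain ⟨S, hS⟩ : ∃ S, n + m = S := ⟨_, rfl⟩
  have hS3 : 3 ≤ S := by lia
  have hlog : Nat.log 2 n < n := Nat.log_lt_self 2 (by lia)
  have hlog1 : 1 ≤ Nat.log 2 n := Nat.log_pos (by lia) hn
  have h9 : 9 ≤ S ^ 2 := by nlinarith
  have h4 : 9 * S ^ 2 ≤ S ^ 4 := by nlinarith
  have hm1 : m + 1 ≤ S := by lia
  have h5 : (m + 1) * (m + 1) ≤ S ^ 2 := by nlinarith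
  have h6 : (m + 1) * (Nat.log 2 n + 2) ≤ S ^ 2 := by
    rw [sq]
    exact Nat.mul_le_mul hm1 (by lia)
  have h7 : S ≤ S ^ 2 := by nlinarith
  have h8 : 64 * S ^ 4 ≤ S ^ 8 := by nlinarith
  obtain ⟨t, s, ht, hexec, -, -, D, hout, hbest⟩ := run_program (K := S ^ 4) (B := S ^ 8) hn hT hm
    (by nlinarith) (by nlinarith) (by nlinarith) (by decide) (by nlinarith) h8
    (input_bd G T (by nlinarith) (by nlinarith))
  obtain ⟨x, hx, hleast⟩ := exists_returns_isLeast hn hT (D.mem_order hm)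
  refine ⟨D.order hm, x, t, s, D.isHeavyLightOrder hT hm, hx, hleast, hS ▸ hexec, ?_, ht.trans ?_⟩
  · rw [hout, WGraph.transcript, hbest.eq hx]
  · generalize Nat.log 2 n = L at *
    -- As `L ≥ 1` and `m ≥ 1`, one has `n ≤ m + 1 ≤ 2 * (L * m)`, `L + 1 ≤ 2 * L` and `L + 2 ≤ 3 *
    -- L`. The resulting constant is `11 * 27000 = 297000`.
    calc (n + (m + 4 * (L + 1) * m)) * (9000 * (L + 2))
        ≤ (2 * (L * m) + (L * m + 4 * (2 * L) * m)) * (9000 * (3 * L)) := by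
          gcongr <;> nlinarith
      _ ≤ 300000 * m * L ^ 2 := by nlinarith [Nat.zero_le (m * L ^ 2)]

end TwoRespect

theorem mainTheorem2 :
    -- correctness: with every heavy-light order, the algorithm returns the minimum value
    (∀ (n m : ℕ), 2 ≤ n → ∀ (G : WGraph n m) (T : Finset (Fin m)), G.IsSpanningTree T →
      ∀ es : List (Fin m), G.IsHeavyLightOrder T es →
        ∃ x : ℝ, G.Returns T es x ∧ IsLeast (G.twoRespectingValues T) x) ∧
    -- running time: one machine program carries out the algorithm within the time bound
    (∃ (P : Prog) (c : ℕ) (C : ℝ), ∀ (n m : ℕ), 2 ≤ n →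
      ∀ (G : WGraph n m) (T : Finset (Fin m)), G.IsSpanningTree T →
        ∃ (es : List (Fin m)) (x : ℝ) (t : ℕ) (s : State),
          G.IsHeavyLightOrder T es ∧ G.Returns T es x ∧ IsLeast (G.twoRespectingValues T) x ∧
          Exec ((n + m) ^ c) P (G.input T) t s ∧ s.out = G.transcript T es x ∧
          (t : ℝ) ≤ C * m * Real.logb 2 n ^ 2) := by
  refine ⟨fun n m hn G T hT es hes => exists_returns_isLeast hn hT hes.2.1,
    program, 8, 300000, fun n m hn G T hT => ?_⟩
  obtain ⟨es, x, t, s, h1, h2, h3, h4, h5, h6⟩ := exec_program hn hT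
  refine ⟨es, x, t, s, h1, h2, h3, h4, h5, ?_⟩
  calc (t : ℝ) ≤ 300000 * m * (Nat.log 2 n : ℝ) ^ 2 := by exact_mod_cast h6
    _ ≤ 300000 * m * Real.logb 2 n ^ 2 := by
      gcongr
      exact_mod_cast Real.natLog_le_logb n 2
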